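/- Let $m\ge 5$ be an integer. For an integer $r\in[0,m-2]$ with $\gcd(r,m-2)=1$ put $P_m^{(r)}(x)=\frac{m-2}{2}x^2-\frac{m-2-2r}{2}x$, and $P_m=P_m^{(1)}$. For positive integers $a_1,\dots,a_n$ and such $r_1,\dots,r_n$, the polynomial $\sum_{i=1}^n a_iP_m^{(r_i)}(x_i)$ is called a generalized shifted $m$-gonal form of rank $n$; when all $r_i=1$ it is a generalized $m$-gonal form, written $\langle a_1,\dots,a_n\rangle_m$ (the order of the coefficients is immaterial). It is primitive if $\gcd(a_1,\dots,a_n)=1$. It represents $N\in\mathbb N_0$ if it takes the value $N$ at some $\mathbf x\in\mathbb Z^n$, and locally represents $N$ if for every prime $p$ it takes the value $N$ at some $\mathbf x\in\mathbb Z_p^n$. It is regular if it represents every $N\in\mathbb N_0$ that it locally represents, and universal if it represents every $N\in\mathbb N_0$. Below, $a_i'$ denotes positive integers, and $n\ge 4$ is the rank. (1) If $m\ge 14$, $m\not\equiv 0\pmod 4$ and $m\equiv 2\pmod 3$, then every primitive regular generalized shifted $m$-gonal form of rank $n\ge4$ is universal. (2) If $m\ge 14$, $m\not\equiv0\pmod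 4$ and $m\not\equiv2\pmod 3$, then every primitive regular generalized $m$-gonal form of rank $n\ge 4$ is universal, or is of the form - $\langle a_1,3a_2',\dots,3a_n'\rangle_m$ with $a_1\in\{1,2\}$, and the set of non-negative integers it represents is $(a_1+3\mathbb N_0)\cup3\mathbb N_0$. (3) If $m\ge 28$, $m\equiv 0\pmod 4$ and $m\equiv 2\pmod 3$, then every primitive regular generalized $m$-gonal form of rank $n\ge4$ is universal, or is of one of the following forms, representing exactly the indicated set of non-negative integers: - $\langle a_1,4a_2',\dots,4a_n'\rangle_m$ with $a_1\in\{1,3\}$, representing $(a_1+4\mathbb N_0)\cup 4\mathbb N_0$; - $\langle 1,3,4a_3',\dots,4a_n'\rangle_m$, representing $\mathbb N_0\setminus(2+4\mathbb N_0)$; - $\langle 1,1,4a_3',\dots,4a_n'\rangle_m$, representing $\mathbb N_0\setminus(3+4\mathbb N_0)$. (4) If $m\ge 28$, $m\equiv0\pmod 4$ and $m\not\equiv 2\pmod 3$, then every primitive regular generalized $m$-gonal form of rank $n\ge 4$ is universal, or is of one of the following forms, representing exactly the indicated set of non-negative integers: - $\langle a_1,3a_2',\dots,3a_n'\rangle_m$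 with $a_1\in\{1,2\}$, representing $(a_1+3\mathbb N_0)\cup 3\mathbb N_0$; - $\langle a_1,4a_2',\dots,4a_n'\rangle_m$ with $a_1\in\{1,3\}$, representing $(a_1+4\mathbb N_0)\cup4\mathbb N_0$; - $\langle 1,3,4a_3',\dots,4a_n'\rangle_m$, representing $\mathbb N_0\setminus(2+4\mathbb N_0)$; - $\langle 1,1,4a_3',\dots,4a_n'\rangle_m$, representing $\mathbb N_0\setminus(3+4\mathbb N_0)$; - $\langle 3,4,12a_3',\dots,12a_n'\rangle_m$, representing all $N\in\mathbb N_0$ with $N\equiv0,3,4,7\pmod{12}$; - $\langle 3,8,12a_3',\dots,12a_n'\rangle_m$, representing all $N\in\mathbb N_0$ with $N\equiv0,3,8,11\pmod{12}$; - $\langle 3,3,4,12a_4',\dots,12a_n'\rangle_m$, representing all $N\in\mathbb N_0$ with $N\equiv0,3,4,6,7,10\pmod{12}$. -/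

import Mathlib

/-- The generalized shifted `m`-gonal number of level `r`,
`P_m^{(r)}(x) = (m-2)/2 * x^2 - (m-2-2r)/2 * x`, evaluated in a field `K`
(used with `K = ℚ` at rational integers and with `K = ℚ_p` at `p`-adic integers). -/
def shiftedPolygonal {K : Type*} [Field K] (m r : ℕ) (x : K) : K :=
  ((m : K) - 2) / 2 * x ^ 2 - ((m : K) - 2 - 2 * (r : K)) / 2 * x

/-- `r` is an admissible level for `m`-gonal numbers: an integer in `[0, m-2]` coprime to `m-2`. -/
def IsLevel (m r : ℕ) : Prop :=
  r + 2 ≤ m ∧ Nat.Coprime r (m - 2)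

/-- The form `a₁ P_m^{(r₁)}(x₁) + ⋯ + aₙ P_m^{(rₙ)}(xₙ)` takes the value `N` at some integer
vector. -/
def Represents {n : ℕ} (m : ℕ) (a r : Fin n → ℕ) (N : ℕ) : Prop :=
  ∃ x : Fin n → ℤ, ∑ i, (a i : ℚ) * shiftedPolygonal m (r i) (x i : ℚ) = (N : ℚ)

/-- The same form takes the value `N` at some vector of `p`-adic integers. -/
def RepresentsOver (p : ℕ) [Fact p.Prime] {n : ℕ} (m : ℕ) (a r : Fin n → ℕ) (N : ℕ) : Prop :=
  ∃ x : Fin n → ℤ_[p],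
    ∑ i, (a i : ℚ_[p]) * shiftedPolygonal m (r i) (x i : ℚ_[p]) = (N : ℚ_[p])

/-- `N` is represented over `ℤ_p` for every prime `p`. -/
def LocallyRepresents {n : ℕ} (m : ℕ) (a r : Fin n → ℕ) (N : ℕ) : Prop :=
  ∀ (p : ℕ) [Fact p.Prime], RepresentsOver p m a r N

/-- A form is regular if it represents every non-negative integer that it represents locally. -/
def IsRegularForm {n : ℕ} (m : ℕ) (a r : Fin n → ℕ) : Prop :=
  ∀ N : ℕ, LocallyRepresents m a r N → Represents m a r N

/-- A form is universal if it represents every non-negative integer. -/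
def IsUniversalForm {n : ℕ} (m : ℕ) (a r : Fin n → ℕ) : Prop :=
  ∀ N : ℕ, Represents m a r N

/-- The coefficients are positive integers whose greatest common divisor is `1`. -/
def IsPrimitiveCoeff {n : ℕ} (a : Fin n → ℕ) : Prop :=
  (∀ i, 0 < a i) ∧ Finset.univ.gcd a = 1

/-- The levels of a generalized `m`-gonal form `⟨a₁, …, aₙ⟩_m`: all equal to `1`. -/
def unitLevel (n : ℕ) : Fin n → ℕ := fun _ => 1

/-- Up to the order of the variables, the coefficients are the entries of `h` followed by
`d * c` for positive integers `c`, i.e. the form is `⟨h₁, …, h_k, d c_{k+1}, …, d c_n⟩_m`. -/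
def HasShape {n : ℕ} (h : List ℕ) (d : ℕ) (a : Fin n → ℕ) : Prop :=
  ∃ c : Multiset ℕ, (∀ x ∈ c, 0 < x) ∧
    (Finset.univ : Finset (Fin n)).val.map a = (h : Multiset ℕ) + c.map (fun x => d * x)

/-- The generalized `m`-gonal form `⟨a₁, …, aₙ⟩_m` has the shape `⟨h, d c⟩_m`, and the
non-negative integers it represents are exactly those in `S`. -/
def IsOfType {n : ℕ} (m : ℕ) (a : Fin n → ℕ) (h : List ℕ) (d : ℕ) (S : Set ℕ) : Prop :=
  HasShape h d a ∧ {N : ℕ | Represents m a (unitLevel n) N} = S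

/-!
A regular form is universal as soon as it is universal over `ℤ_p` for every prime `p`, so the question
is at which primes a regular form can fail to be universal, and what it then represents.

*Local side.* The reflection `x ↦ -x` normalises the levels to `2 r < M`, where `M = m - 2`
(`PForm.Adm`). Completing squares turns representation of `N` over `ℤ_p` into representation of a
linear function of `N` by a diagonal quadratic form, unless every primitive form is universal at `p`
(`p` odd dividing `M`, or `p = 2` and `M` not `2` modulo `4`). Failure at an odd prime therefore means
that at most two coefficients are prime to `p`, forming an anisotropic form modulo `p`
(`Adm.bad_cases`).

*Descent.* Where a form is not universal at `q`, some variables can be confined to the residue class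
modulo `q` on which their completed square vanishes. Substituting and dividing by a power of `q`
gives another form of the same kind, again regular, with the same behaviour at all other primes
(`Descent.regular`, `Descent.univAt_iff`). Repeating this makes the form universal at `q`, because the
sum of the squared exponents of `q` in the coefficients decreases (`Adm.exists_descent_lt`). At `2` a
descent may halve the modulus of single variables, which is why a `PForm` has a modulus for each
variable (`STyp.exists_univAt_two`). In this way any prime can be studied as if it were the only one
at which universality fails; the form then represents every natural number that it represents over
`ℤ_p`.

*Small values.* A polygonal number with modulus `M` and level `r` takes the values `0`, `r`, `M - r`,
and then only larger ones. Since `M` is at least `12`, small numbers are essentially sums of the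
`a i * r i`. If universality fails at `p`, many small numbers are represented over `ℤ_p` by Hensel's
lemma, and there are too few such sums unless the coefficients are very special. This excludes all
`p ≥ 5` (`Adm.univAt_of_five_le`); at `3` it leaves one coefficient prime to `3` and a form that
represents all multiples of `3` (`Adm.one_unit_three`); at `2` it leaves one odd coefficient, `1` or
`3`, or two of them, `1, 3` or `1, 1`, next to multiples of `4` (`STyp.odd_coeffs`, `STyp.of_one_odd`,
`STyp.of_two_odd`, collected in `STyp.twoShape`).

*Types.* The represented classes modulo `3` or `4` can now be read off (`Adm.three_type`,
`STyp.two_type`). If universality fails at both `2` and `3`, one descent at `3` gives a form universal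
at `3` in which a single variable is shifted, with large values. The analysis at `2` allows one such
variable (`AlmostUnshifted`), and going back through the descent gives the types modulo `12`
(`STyp.two_three_type`).
-/

/-! ### Quadratic equations over the `p`-adic integers -/

section Padic

variable {p : ℕ} [Fact p.Prime]

lemma padicInt_dvd_iff_toZMod (x : ℤ_[p]) : (p : ℤ_[p]) ∣ x ↔ PadicInt.toZMod x = 0 := by
  rw [← RingHom.mem_ker, PadicInt.ker_toZMod, PadicInt.maximalIdeal_eq_span_p,
    Ideal.mem_span_singleton]

lemma padicInt_isUnit_iff (x : ℤ_[p]) : IsUnit x ↔ ¬ (p : ℤ_[p]) ∣ x := by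
  rw [← PadicInt.norm_lt_one_iff_dvd, ← PadicInt.not_isUnit_iff, not_not]

lemma padicInt_dvd_intCast (z : ℤ) : (p : ℤ_[p]) ∣ (z : ℤ_[p]) ↔ (p : ℤ) ∣ z := by
  have := PadicInt.pow_p_dvd_int_iff (p := p) 1 z
  simpa using this

lemma padicInt_dvd_natCast (z : ℕ) : (p : ℤ_[p]) ∣ (z : ℤ_[p]) ↔ p ∣ z := by
  have := padicInt_dvd_intCast (p := p) (z : ℤ)
  rw [Int.natCast_dvd_natCast] at this
  simpa using this

lemma padicInt_isUnit_natCast (z : ℕ) : IsUnit (z : ℤ_[p]) ↔ ¬ p ∣ z := by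
  rw [padicInt_isUnit_iff, padicInt_dvd_natCast]

lemma padicInt_isUnit_intCast (z : ℤ) : IsUnit (z : ℤ_[p]) ↔ ¬ (p : ℤ) ∣ z := by
  rw [padicInt_isUnit_iff, padicInt_dvd_intCast]

lemma padicInt_dvd_mul {x y : ℤ_[p]} : (p : ℤ_[p]) ∣ x * y ↔ (p : ℤ_[p]) ∣ x ∨ (p : ℤ_[p]) ∣ y :=
  PadicInt.prime_p.dvd_mul

lemma exists_int_congr (x : ℤ_[p]) (k : ℕ) : ∃ (n : ℕ) (z : ℤ_[p]), x = n + (p : ℤ_[p]) ^ k * z := by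
  have h := PadicInt.appr_spec k x
  rw [Ideal.mem_span_singleton] at h
  obtain ⟨z, hz⟩ := h
  exact ⟨x.appr k, z, by rw [← hz]; ring⟩

/-- Hensel's lemma for a quadratic polynomial that is linear modulo `p`. -/
lemma exists_quadratic_root (α β t : ℤ_[p]) (hα : (p : ℤ_[p]) ∣ α) (hβ : IsUnit β) :
    ∃ x, α * x ^ 2 + β * x = t := by
  obtain ⟨b, hb⟩ := hβ.exists_right_inv
  let F : Polynomial ℤ_[p] :=
    Polynomial.C α * Polynomial.X ^ 2 + Polynomial.C β * Polynomial.X - Polynomial.C t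
  have h1 : F.aeval (b * t) = α * (b * t) ^ 2 := by
    simp [F]
    linear_combination t * hb
  have h2 : F.derivative.aeval (b * t) = α * (2 * (b * t)) + β := by
    simp [F]
    norm_num
  have h3 : ‖F.derivative.aeval (b * t)‖ = 1 := by
    rw [h2, ← PadicInt.isUnit_iff, padicInt_isUnit_iff]
    intro h
    rw [padicInt_isUnit_iff] at hβ
    exact hβ ((dvd_add_right (hα.mul_right _)).1 h)
  have h4 : ‖F.aeval (b * t)‖ < 1 := by
    rw [h1, PadicInt.norm_lt_one_iff_dvd]
    exact hα.mul_right _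
  obtain ⟨z, hz, -⟩ := hensels_lemma (F := F) (a := b * t) (by rw [h3]; simpa using h4)
  refine ⟨z, ?_⟩
  simp [F] at hz
  linear_combination hz

lemma exists_sq_of_dvd_sub (hp : p ≠ 2) {u y₀ : ℤ_[p]} (hy : ¬ (p : ℤ_[p]) ∣ y₀)
    (h : (p : ℤ_[p]) ∣ u - y₀ ^ 2) : ∃ y, y ^ 2 = u := by
  obtain ⟨w, hw⟩ := h
  have h2 : IsUnit ((2 : ℕ) : ℤ_[p]) := by
    rw [padicInt_isUnit_natCast]
    intro h
    exact hp ((Nat.prime_dvd_prime_iff_eq Fact.out Nat.prime_two).1 h)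
  have hβ : IsUnit (2 * y₀) := by
    have := h2.mul ((padicInt_isUnit_iff y₀).2 hy)
    simpa using this
  obtain ⟨x, hx⟩ := exists_quadratic_root (p : ℤ_[p]) (2 * y₀) w dvd_rfl hβ
  exact ⟨y₀ + p * x, by linear_combination (p : ℤ_[p]) * hx - hw⟩

lemma exists_sq_of_eight_dvd {u : ℤ_[2]} (h : (8 : ℤ_[2]) ∣ u - 1) : ∃ y, y ^ 2 = u := by
  obtain ⟨w, hw⟩ := h
  obtain ⟨x, hx⟩ := exists_quadratic_root (p := 2) 2 1 w (by norm_num) isUnit_one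
  exact ⟨1 + 4 * x, by linear_combination 8 * hx - hw⟩

end Padic

/-! ### Diagonal quadratic forms -/

/-- The diagonal quadratic form `∑ i ∈ s, A i * y i ^ 2` over `R` takes the value `t`. -/
def DiagRep {R ι : Type*} [CommRing R] (A : ι → R) (s : Finset ι) (t : R) : Prop :=
  ∃ y : ι → R, ∑ i ∈ s, A i * y i ^ 2 = t

namespace DiagRep

variable {R ι : Type*} [CommRing R] {A B : ι → R} {s s' : Finset ι} {t t' d : R}

lemma zero : DiagRep A s 0 := ⟨0, by simp⟩

lemma of_eq (h : DiagRep A s t) (e : t = t') : DiagRep A s t' := e ▸ h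

lemma single (i : ι) (z : R) : DiagRep A {i} (A i * z ^ 2) := ⟨fun _ => z, by simp⟩

lemma add [DecidableEq ι] (h : DiagRep A s t) (h' : DiagRep A s' t') (hd : Disjoint s s') :
    DiagRep A (s ∪ s') (t + t') := by
  obtain ⟨y, hy⟩ := h
  obtain ⟨y', hy'⟩ := h'
  refine ⟨fun i => if i ∈ s then y i else y' i, ?_⟩
  rw [Finset.sum_union hd, ← hy, ← hy']
  congr 1
  · exact Finset.sum_congr rfl fun i hi => by simp [hi]
  · exact Finset.sum_congr rfl fun i hi => by simp [Finset.disjoint_right.1 hd hi]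

lemma mono [DecidableEq ι] (h : DiagRep A s t) (hs : s ⊆ s') : DiagRep A s' t := by
  have := h.add (DiagRep.zero (A := A) (s := s' \ s)) Finset.disjoint_sdiff
  rwa [Finset.union_sdiff_of_subset hs, add_zero] at this

/-- Multiplying a diagonal form by `d` and its coefficients by squares. -/
lemma scale (h : DiagRep B s t) (hAB : ∀ i ∈ s, ∃ z, A i * z ^ 2 = d * B i) :
    DiagRep A s (d * t) := by
  classical
  obtain ⟨y, hy⟩ := h
  choose! z hz using hAB
  refine ⟨fun i => z i * y i, ?_⟩
  rw [← hy, Finset.mul_sum]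
  exact Finset.sum_congr rfl fun i hi => by linear_combination (y i) ^ 2 * hz i hi

/-- Add one more variable with a prescribed value. -/
lemma cons [DecidableEq ι] {i : ι} (hi : i ∉ s) (z : R) (h : DiagRep A s (t - A i * z ^ 2)) :
    DiagRep A (insert i s) t := by
  have := (DiagRep.single (A := A) i z).add h (by simpa using hi)
  rw [add_sub_cancel] at this
  exact this

lemma pair [DecidableEq ι] {i j : ι} (hij : i ≠ j) (y z : R) (h : A i * y ^ 2 + A j * z ^ 2 = t) :
    DiagRep A {i, j} t :=
  DiagRep.cons (by simpa using hij) y ((DiagRep.single j z).of_eq (by linear_combination h))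

lemma sq_mul (h : DiagRep A s t) (d : R) : DiagRep A s (d ^ 2 * t) :=
  h.scale fun i _ => ⟨d, by ring⟩

end DiagRep

/-! ### Universal diagonal forms over the `p`-adic integers, `p` odd -/

section OddLocal

variable {p : ℕ} [Fact p.Prime] {ι : Type*} [DecidableEq ι] {A : ι → ℤ_[p]}

/-- Every `p`-adic integer is an even power of `p` times a unit or `p` times a unit, or zero. -/
lemma padicInt_eq_sq_mul (t : ℤ_[p]) :
    t = 0 ∨ ∃ d u : ℤ_[p], IsUnit u ∧ (t = d ^ 2 * u ∨ t = d ^ 2 * (p * u)) := by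
  by_cases ht : t = 0
  · exact Or.inl ht
  right
  have h := PadicInt.unitCoeff_spec ht
  set u := PadicInt.unitCoeff ht
  rcases Nat.even_or_odd' t.valuation with ⟨k, hk | hk⟩
  · refine ⟨(p : ℤ_[p]) ^ k, u, u.isUnit, Or.inl ?_⟩
    rw [hk] at h
    rw [h]; ring
  · refine ⟨(p : ℤ_[p]) ^ k, u, u.isUnit, Or.inr ?_⟩
    rw [hk] at h
    rw [h]; ring

lemma exists_sq_mul_of_dvd (hp : p ≠ 2) {a u y₀ : ℤ_[p]} (ha : IsUnit a) (hy : ¬ (p : ℤ_[p]) ∣ y₀)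
    (h : (p : ℤ_[p]) ∣ u - a * y₀ ^ 2) : ∃ y, a * y ^ 2 = u := by
  obtain ⟨b, hb⟩ := ha.exists_right_inv
  obtain ⟨w, hw⟩ := h
  obtain ⟨y, hyy⟩ := exists_sq_of_dvd_sub (u := b * u) hp hy
    ⟨b * w, by linear_combination b * hw + y₀ ^ 2 * hb⟩
  exact ⟨y, by linear_combination a * hyy + u * hb⟩

lemma exists_binary_mod {q : ℕ} [Fact q.Prime] (hq : q ≠ 2) (a b c : ZMod q) (ha : a ≠ 0)
    (hb : b ≠ 0) : ∃ x y, a * x ^ 2 + b * y ^ 2 = c := by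
  obtain ⟨x, y, h⟩ := FiniteField.exists_root_sum_quadratic (R := ZMod q)
    (f := Polynomial.C a * Polynomial.X ^ 2 + Polynomial.C 0 * Polynomial.X + Polynomial.C 0)
    (g := Polynomial.C b * Polynomial.X ^ 2 + Polynomial.C 0 * Polynomial.X + Polynomial.C (-c))
    (Polynomial.degree_quadratic ha) (Polynomial.degree_quadratic hb)
    (by
      rw [ZMod.card]
      exact Nat.odd_iff.1 ((Fact.out : q.Prime).odd_of_ne_two hq))
  refine ⟨x, y, ?_⟩
  simp at h
  linear_combination h

lemma toZMod_surj (x : ZMod p) : ∃ y : ℤ_[p], PadicInt.toZMod y = x :=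
  ⟨(x.val : ℤ_[p]), by simp⟩

/-- A binary form with unit coefficients lifts any solution modulo `p` that is nonzero
modulo `p`. -/
lemma diagRep_pair_of_mod (hp : p ≠ 2) {i j : ι} (hij : i ≠ j) (hi : IsUnit (A i)) {t y z : ℤ_[p]}
    (hy : ¬ (p : ℤ_[p]) ∣ y) (h : (p : ℤ_[p]) ∣ t - (A i * y ^ 2 + A j * z ^ 2)) :
    DiagRep A {i, j} t := by
  obtain ⟨w, hw⟩ := exists_sq_mul_of_dvd (u := t - A j * z ^ 2) hp hi hy (by
    convert h using 1; ring)
  exact DiagRep.pair hij w z (by linear_combination hw)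

lemma diagRep_pair_unit (hp : p ≠ 2) {i j : ι} (hij : i ≠ j) (hi : IsUnit (A i))
    (hj : IsUnit (A j)) {t : ℤ_[p]} (ht : IsUnit t) : DiagRep A {i, j} t := by
  have hne : ∀ {x : ℤ_[p]}, IsUnit x → PadicInt.toZMod x ≠ 0 := fun hx => by
    rw [padicInt_isUnit_iff, padicInt_dvd_iff_toZMod] at hx
    exact hx
  obtain ⟨x, y, h⟩ := exists_binary_mod hp _ _ (PadicInt.toZMod t) (hne hi) (hne hj)
  obtain ⟨x, rfl⟩ := toZMod_surj x
  obtain ⟨y, rfl⟩ := toZMod_surj y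
  have hd : (p : ℤ_[p]) ∣ t - (A i * x ^ 2 + A j * y ^ 2) := by
    rw [padicInt_dvd_iff_toZMod]
    simp [← h]
  by_cases hx : (p : ℤ_[p]) ∣ x
  · have hy : ¬ (p : ℤ_[p]) ∣ y := by
      intro hy
      rw [padicInt_isUnit_iff] at ht
      apply ht
      have h1 : (p : ℤ_[p]) ∣ A i * x ^ 2 + A j * y ^ 2 :=
        dvd_add ((dvd_pow hx two_ne_zero).mul_left _) ((dvd_pow hy two_ne_zero).mul_left _)
      exact (dvd_sub_left h1).1 hd
    rw [Finset.pair_comm]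
    exact diagRep_pair_of_mod hp hij.symm hj hy (by rwa [add_comm] at hd)
  · exact diagRep_pair_of_mod hp hij hi hx hd

/-- Three unit coefficients make a diagonal form universal over `ℤ_p`. -/
lemma diagRep_three_unit (hp : p ≠ 2) {i j l : ι} (hij : i ≠ j) (hil : i ≠ l) (hjl : j ≠ l)
    (hi : IsUnit (A i)) (hj : IsUnit (A j)) (hl : IsUnit (A l)) (t : ℤ_[p]) :
    DiagRep A {l, i, j} t := by
  have hn : l ∉ ({i, j} : Finset ι) := by simp [hil.symm, hjl.symm]
  by_cases ht : IsUnit t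
  · exact DiagRep.cons hn 0 (diagRep_pair_unit hp hij hi hj (by simpa using ht))
  · refine DiagRep.cons hn 1 (diagRep_pair_unit hp hij hi hj ?_)
    rw [padicInt_isUnit_iff] at *
    rw [not_not] at ht
    intro h
    exact hl ((dvd_sub_right ht).1 (by simpa using h))

/-- Two unit coefficients forming an isotropic plane modulo `p` are universal over `ℤ_p`. -/
lemma diagRep_isotropic (hp : p ≠ 2) {i j : ι} (hij : i ≠ j) (hi : IsUnit (A i))
    (hj : IsUnit (A j)) {y z : ℤ_[p]} (hy : ¬ (p : ℤ_[p]) ∣ y)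
    (h : (p : ℤ_[p]) ∣ A i * y ^ 2 + A j * z ^ 2) (t : ℤ_[p]) : DiagRep A {i, j} t := by
  by_cases ht : IsUnit t
  · exact diagRep_pair_unit hp hij hi hj ht
  · rw [padicInt_isUnit_iff, not_not] at ht
    exact diagRep_pair_of_mod hp hij hi hy (dvd_sub ht h)

/-- A form `⟨u₁, u₂, p u₃, p u₄⟩` with units `uᵢ` is universal over `ℤ_p`. -/
lemma diagRep_two_two (hp : p ≠ 2) {i j k l : ι} (hij : i ≠ j) (hkl : k ≠ l)
    (hik : i ≠ k) (hil : i ≠ l) (hjk : j ≠ k) (hjl : j ≠ l)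
    (hi : IsUnit (A i)) (hj : IsUnit (A j)) {u v : ℤ_[p]} (hu : IsUnit u) (hv : IsUnit v)
    (hk : A k = p * u) (hl : A l = p * v) (t : ℤ_[p]) : DiagRep A ({i, j} ∪ {k, l}) t := by
  rcases padicInt_eq_sq_mul t with rfl | ⟨d, w, hw, rfl | rfl⟩
  · exact DiagRep.zero
  · exact (DiagRep.sq_mul (diagRep_pair_unit hp hij hi hj hw) d).mono Finset.subset_union_left
  · refine (DiagRep.sq_mul ?_ d).mono Finset.subset_union_right
    have h1 : DiagRep (fun x => if x = k then u else v) {k, l} w :=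
      diagRep_pair_unit hp hkl (by simpa using hu) (by simpa [hkl.symm] using hv) hw
    refine h1.scale fun x hx => ⟨1, ?_⟩
    rcases Finset.mem_insert.1 hx with rfl | hx
    · simp [hk]
    · rw [Finset.mem_singleton] at hx
      subst hx
      simp [hl, hkl.symm]

end OddLocal

/-! ### Forms with varying moduli -/

/-- A sum `∑ a i * P_{M i + 2}^{(r i)}(x i)` of generalized shifted polygonal numbers in which
the moduli `M i` may depend on the variable. -/
structure PForm (n : ℕ) where
  /-- The coefficients. -/
  a : Fin n → ℕ
  /-- The moduli; a shifted `m`-gonal number has modulus `m - 2`. -/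
  M : Fin n → ℕ
  /-- The levels. -/
  r : Fin n → ℕ

/-- Twice the shifted polygonal number with modulus `M` and level `r`; the factor `2` gives integral
coefficients. -/
def polyDbl {R : Type*} [CommRing R] (M r : ℕ) (x : R) : R := M * (x * (x - 1)) + 2 * r * x

/-- The shifted polygonal number with modulus `M` and level `r` at an integer. -/
def polyVal (M r : ℕ) (x : ℤ) : ℤ := M * (x * (x - 1) / 2) + r * x

lemma polyDbl_eq_two_mul (M r : ℕ) (x : ℤ) : polyDbl M r x = 2 * polyVal M r x := by
  have h : 2 * (x * (x - 1) / 2) = x * (x - 1) := by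
    apply Int.mul_ediv_cancel'
    rcases Int.even_or_odd x with ⟨k, hk⟩ | ⟨k, hk⟩
    · exact ⟨k * (x - 1), by rw [hk]; ring⟩
    · exact ⟨x * k, by rw [hk]; ring⟩
  unfold polyDbl polyVal
  linear_combination -(M : ℤ) * h

@[simp] lemma polyVal_zero (M r : ℕ) : polyVal M r 0 = 0 := by simp [polyVal]

@[simp] lemma polyVal_one (M r : ℕ) : polyVal M r 1 = r := by simp [polyVal]

lemma polyVal_ge {M r : ℕ} (hr : 0 < r) (hM : 2 * r < M) {x : ℤ} (h0 : x ≠ 0) (h1 : x ≠ 1) :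
    (M : ℤ) - r ≤ polyVal M r x := by
  have h := polyDbl_eq_two_mul M r x
  unfold polyDbl at h
  rcases lt_or_gt_of_ne h0 with hx | hx
  · have h2 : (2 : ℤ) ≤ x * (x - 1) := by nlinarith
    nlinarith [mul_le_mul_of_nonneg_left h2 (by positivity : (0 : ℤ) ≤ M),
      mul_nonneg (by omega : 0 ≤ -x - 1) (by positivity : (0 : ℤ) ≤ (M : ℤ)),
      mul_nonneg (by omega : 0 ≤ -x - 1) (by omega : (0 : ℤ) ≤ (M : ℤ) - 2 * r),
      mul_nonneg (mul_nonneg (by omega : 0 ≤ -x - 1) (by omega : 0 ≤ -x))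
        (by positivity : (0 : ℤ) ≤ (M : ℤ))]
  · have h2 : 2 ≤ x := by omega
    nlinarith [mul_nonneg (mul_nonneg (by omega : 0 ≤ x - 2) (by omega : 0 ≤ x + 1))
      (by positivity : (0 : ℤ) ≤ (M : ℤ)), mul_nonneg (by omega : 0 ≤ x)
        (by positivity : (0 : ℤ) ≤ (r : ℤ))]

/-- Away from the four smallest arguments a shifted polygonal number is at least `3M - 2r`. -/
lemma polyVal_ge_far {M r : ℕ} (hr : 0 < r) (hM : 2 * r < M) {x : ℤ} (h0 : x ≠ 0) (h1 : x ≠ 1)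
    (h2 : x ≠ -1) (h3 : x ≠ 2) : 3 * (M : ℤ) - 2 * r ≤ polyVal M r x := by
  have h := polyDbl_eq_two_mul M r x
  unfold polyDbl at h
  rcases lt_or_gt_of_ne h0 with hx | hx
  · have hx2 : x ≤ -2 := by omega
    nlinarith [mul_nonneg (mul_nonneg (by omega : 0 ≤ -x - 2) (by omega : 0 ≤ -x))
        (by positivity : (0 : ℤ) ≤ (M : ℤ)),
      mul_nonneg (by omega : 0 ≤ -x - 2) (by omega : (0 : ℤ) ≤ (M : ℤ) - 2 * r)]
  · have hx2 : 3 ≤ x := by omega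
    nlinarith [mul_nonneg (mul_nonneg (by omega : 0 ≤ x - 3) (by omega : 0 ≤ x + 2))
      (by positivity : (0 : ℤ) ≤ (M : ℤ)), mul_nonneg (by omega : 0 ≤ x)
        (by positivity : (0 : ℤ) ≤ (r : ℤ))]

lemma polyVal_neg_one (M r : ℕ) : polyVal M r (-1) = M - r := by
  simp [polyVal]; ring

lemma polyVal_two (M r : ℕ) : polyVal M r 2 = M + 2 * r := by
  simp [polyVal]; ring

lemma polyVal_nonneg {M r : ℕ} (hr : 0 < r) (hM : 2 * r < M) (x : ℤ) : 0 ≤ polyVal M r x := by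
  by_cases h0 : x = 0
  · simp [h0]
  by_cases h1 : x = 1
  · simp [h1]
  · have := polyVal_ge hr hM h0 h1
    omega

namespace PForm

variable {n : ℕ}

/-- Twice the value of the form. -/
def dbl {R : Type*} [CommRing R] (F : PForm n) (x : Fin n → R) : R :=
  ∑ i, (F.a i : R) * polyDbl (F.M i) (F.r i) (x i)

/-- The value of the form at an integer vector. -/
def val (F : PForm n) (x : Fin n → ℤ) : ℤ := ∑ i, (F.a i : ℤ) * polyVal (F.M i) (F.r i) (x i)

lemma dbl_eq_two_mul (F : PForm n) (x : Fin n → ℤ) : F.dbl x = 2 * F.val x := by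
  simp only [dbl, val, Finset.mul_sum, polyDbl_eq_two_mul]
  exact Finset.sum_congr rfl fun i _ => by ring

/-- The form takes the value `N` at some integer vector. -/
def RepInt (F : PForm n) (N : ℕ) : Prop := ∃ x : Fin n → ℤ, F.val x = N

/-- The form takes the value `t` at some vector of `p`-adic integers. -/
def RepAt (p : ℕ) [Fact p.Prime] (F : PForm n) (t : ℤ_[p]) : Prop :=
  ∃ x : Fin n → ℤ_[p], F.dbl x = 2 * t

/-- The form takes every value in `ℤ_p`. -/
def UnivAt (p : ℕ) [Fact p.Prime] (F : PForm n) : Prop := ∀ t, F.RepAt p t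

/-- The form takes every value in `ℕ` that it takes over all `ℤ_p`. -/
def Regular (F : PForm n) : Prop :=
  ∀ N : ℕ, (∀ (p : ℕ) [Fact p.Prime], F.RepAt p N) → F.RepInt N

/-- The forms considered: positive primitive coefficients, levels normalised by the symmetry
`x ↦ -x`, and moduli equal to `D` or `D / 2` that are not too small. -/
structure Adm (D : ℕ) (F : PForm n) : Prop where
  pos : ∀ i, 0 < F.a i
  lev_pos : ∀ i, 0 < F.r i
  lev_lt : ∀ i, 2 * F.r i < F.M i
  cop : ∀ i, Nat.Coprime (F.r i) (F.M i)
  big : ∀ i, 12 ≤ F.M i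
  modulus : ∀ i, F.M i = D ∨ 2 * F.M i = D
  prim : ∀ ℓ : ℕ, ℓ.Prime → ∃ i, ¬ ℓ ∣ F.a i

/-- The coefficients after completing squares with a common denominator. -/
def wa (D : ℕ) (F : PForm n) (i : Fin n) : ℕ := F.a i * (D / F.M i)

/-- The linear coefficient `M - 2r`: the shifted polygonal number with modulus `M` and level `r`
is `((2Mx - c)^2 - c^2) / (8M)`. -/
def cc (F : PForm n) (i : Fin n) : ℤ := F.M i - 2 * F.r i

/-- The constant in `∑ wa i * (2 M i x i - c i)^2 = 8 D N + disc`. -/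
def disc (D : ℕ) (F : PForm n) : ℤ := ∑ i, (F.wa D i : ℤ) * F.cc i ^ 2

variable {D : ℕ} {F : PForm n}

lemma Adm.wt_cases (hF : F.Adm D) (i : Fin n) :
    (F.M i = D ∧ D / F.M i = 1) ∨ (2 * F.M i = D ∧ D / F.M i = 2) := by
  have hb := hF.big i
  rcases hF.modulus i with h | h
  · exact Or.inl ⟨h, by rw [h]; exact Nat.div_self (by omega)⟩
  · refine Or.inr ⟨h, ?_⟩
    rw [← h]
    exact Nat.mul_div_cancel _ (by omega)

lemma Adm.mul_wt (hF : F.Adm D) (i : Fin n) : F.M i * (D / F.M i) = D := by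
  rcases hF.wt_cases i with ⟨h, h'⟩ | ⟨h, h'⟩ <;> rw [h'] <;> omega

lemma Adm.dvd_wa (hF : F.Adm D) {p : ℕ} (hp : p.Prime) (h2 : p ≠ 2) (i : Fin n) :
    p ∣ F.wa D i ↔ p ∣ F.a i := by
  unfold wa
  rcases hF.wt_cases i with ⟨-, h'⟩ | ⟨-, h'⟩ <;> rw [h']
  · simp
  · rw [hp.dvd_mul]
    have : ¬ p ∣ 2 := fun h => h2 ((Nat.prime_dvd_prime_iff_eq hp Nat.prime_two).1 h)
    simp [this]

lemma Adm.not_dvd_M (hF : F.Adm D) {p : ℕ} (hD : ¬ p ∣ D) (i : Fin n) : ¬ p ∣ F.M i :=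
  fun h => hD (by rw [← hF.mul_wt i]; exact h.mul_right _)

lemma Adm.complete_square (hF : F.Adm D) {R : Type*} [CommRing R] (x : Fin n → R) :
    ∑ i, (F.wa D i : R) * (2 * F.M i * x i - F.cc i) ^ 2 = 4 * D * F.dbl x + F.disc D := by
  unfold disc dbl
  rw [Finset.mul_sum, Int.cast_sum, ← Finset.sum_add_distrib]
  refine Finset.sum_congr rfl fun i _ => ?_
  have h : (F.M i : R) * ((D / F.M i : ℕ) : R) = D := by exact_mod_cast congrArg _ (hF.mul_wt i)
  simp only [wa, cc, polyDbl]
  generalize D / F.M i = w at h ⊢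
  push_cast
  linear_combination (4 * (F.a i : R) * (F.M i * (x i * (x i - 1)) + 2 * F.r i * x i)) * h

lemma Adm.complete_square_int (hF : F.Adm D) {x : Fin n → ℤ} {N : ℤ} (h : F.val x = N) :
    ∑ i, (F.wa D i : ℤ) * (2 * F.M i * x i - F.cc i) ^ 2 = 8 * D * N + F.disc D := by
  have := hF.complete_square x
  rw [dbl_eq_two_mul, h] at this
  rw [Int.cast_id] at this
  simp only [Int.cast_id] at this
  rw [this]; ring

lemma not_dvd_two_mul {p : ℕ} (hp : p.Prime) (h2 : p ≠ 2) {k : ℕ} (hk : ¬ p ∣ k) : ¬ p ∣ 2 * k := by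
  rw [hp.dvd_mul, not_or]
  exact ⟨fun h => h2 ((Nat.prime_dvd_prime_iff_eq hp Nat.prime_two).1 h), hk⟩

/-- At odd primes not dividing `D`, representation by the form reduces to representation by the
diagonal quadratic form with coefficients `wa`. -/
lemma Adm.repAt_of_diagRep (hF : F.Adm D) {p : ℕ} [Fact p.Prime] (h2 : p ≠ 2) (hD : ¬ p ∣ D)
    {t : ℤ_[p]}
    (h : DiagRep (fun i => (F.wa D i : ℤ_[p])) Finset.univ (8 * D * t + F.disc D)) :
    F.RepAt p t := by
  have hp : p.Prime := Fact.out
  obtain ⟨y, hy⟩ := h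
  have hu : ∀ i, ∃ b : ℤ_[p], ((2 * F.M i : ℕ) : ℤ_[p]) * b = 1 := fun i =>
    ((padicInt_isUnit_natCast _).2 (not_dvd_two_mul hp h2 (hF.not_dvd_M hD i))).exists_right_inv
  choose b hb using hu
  refine ⟨fun i => b i * (y i + F.cc i), ?_⟩
  have h1 := hF.complete_square fun i => b i * (y i + F.cc i)
  have h3 : ∑ i, (F.wa D i : ℤ_[p]) * (2 * F.M i * (b i * (y i + F.cc i)) - F.cc i) ^ 2
      = ∑ i, (F.wa D i : ℤ_[p]) * y i ^ 2 := by
    refine Finset.sum_congr rfl fun i _ => ?_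
    have hbi := hb i
    push_cast at hbi
    rw [show 2 * (F.M i : ℤ_[p]) * (b i * (y i + F.cc i)) - F.cc i = y i by
      linear_combination (y i + F.cc i) * hbi]
  rw [h3, hy] at h1
  have h4 : IsUnit ((2 * (2 * D) : ℕ) : ℤ_[p]) :=
    (padicInt_isUnit_natCast _).2 (not_dvd_two_mul hp h2 (not_dvd_two_mul hp h2 hD))
  apply h4.mul_left_cancel
  push_cast
  linear_combination -h1

end PForm

/-! ### Descents -/

namespace PForm

variable {n : ℕ}

/-- A descent at the prime `q` from `F` to `F'`: the substitution `x = u x' + s` turns `F` into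
`d F' + o`, where `d` and the `u i` are powers of `q` up to sign, and every integer vector at which
`F` takes a value congruent to `o` modulo `d` arises from the substitution. -/
structure Descent (q : ℕ) (F F' : PForm n) where
  /-- The dilations. -/
  u : Fin n → ℤ
  /-- The translations. -/
  s : Fin n → ℤ
  /-- The factor divided out. -/
  d : ℕ
  /-- The offset. -/
  o : ℕ
  u_pow : ∀ i, ∃ j, (u i).natAbs = q ^ j
  d_pow : ∃ j, d = q ^ j
  sq : ∀ i, (F.a i : ℤ) * F.M i * u i ^ 2 = d * (F'.a i * F'.M i)
  lin : ∀ i, (F.a i : ℤ) * (u i * (F.M i * (2 * s i - 1) + 2 * F.r i)) =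
    d * (F'.a i * (2 * F'.r i - F'.M i))
  val_s : F.val s = o
  forced : ∀ (x : Fin n → ℤ) (N : ℕ), F.val x = d * N + o → ∀ i, u i ∣ x i - s i

namespace Descent

variable {q : ℕ} {F F' : PForm n}

lemma dbl_comp (δ : Descent q F F') {R : Type*} [CommRing R] (x : Fin n → R) :
    F.dbl (fun i => δ.u i * x i + δ.s i) = δ.d * F'.dbl x + 2 * δ.o := by
  have h0 : F.dbl (fun i => (δ.s i : R)) = 2 * δ.o := by
    have h := F.dbl_eq_two_mul δ.s
    rw [δ.val_s] at h
    have h' := congrArg (Int.cast : ℤ → R) h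
    simpa [dbl, polyDbl] using h'
  rw [← h0]
  unfold dbl
  rw [Finset.mul_sum, ← Finset.sum_add_distrib]
  refine Finset.sum_congr rfl fun i _ => ?_
  have h1 := congrArg (Int.cast : ℤ → R) (δ.sq i)
  have h2 := congrArg (Int.cast : ℤ → R) (δ.lin i)
  push_cast at h1 h2
  unfold polyDbl
  linear_combination x i ^ 2 * h1 + x i * h2

lemma pow_isUnit {p : ℕ} [Fact p.Prime] (hq : q.Prime) (hpq : p ≠ q) (j : ℕ) :
    IsUnit ((q ^ j : ℕ) : ℤ_[p]) := by
  rw [padicInt_isUnit_natCast]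
  intro h
  exact hpq ((Nat.prime_dvd_prime_iff_eq Fact.out hq).1 ((Fact.out : p.Prime).dvd_of_dvd_pow h))

lemma u_isUnit (δ : Descent q F F') {p : ℕ} [Fact p.Prime] (hq : q.Prime) (hpq : p ≠ q)
    (i : Fin n) : IsUnit (δ.u i : ℤ_[p]) := by
  obtain ⟨j, hj⟩ := δ.u_pow i
  have := pow_isUnit (p := p) hq hpq j
  rw [← hj, padicInt_isUnit_natCast] at this
  rw [padicInt_isUnit_intCast]
  rwa [Int.natCast_dvd]

lemma d_isUnit (δ : Descent q F F') {p : ℕ} [Fact p.Prime] (hq : q.Prime) (hpq : p ≠ q) :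
    IsUnit (δ.d : ℤ_[p]) := by
  obtain ⟨j, hj⟩ := δ.d_pow
  rw [hj]
  exact pow_isUnit hq hpq j

lemma d_pos (δ : Descent q F F') (hq : q.Prime) : 0 < δ.d := by
  obtain ⟨j, hj⟩ := δ.d_pow
  rw [hj]
  exact pow_pos hq.pos j

lemma repAt_of (δ : Descent q F F') {p : ℕ} [Fact p.Prime] {t : ℤ_[p]} (h : F'.RepAt p t) :
    F.RepAt p (δ.d * t + δ.o) := by
  obtain ⟨x, hx⟩ := h
  refine ⟨_, (δ.dbl_comp x).trans ?_⟩
  rw [hx]; ring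

lemma repAt_iff (δ : Descent q F F') (hq : q.Prime) {p : ℕ} [Fact p.Prime] (hpq : p ≠ q)
    {t : ℤ_[p]} : F.RepAt p (δ.d * t + δ.o) ↔ F'.RepAt p t := by
  refine ⟨fun ⟨x, hx⟩ => ?_, δ.repAt_of⟩
  choose b hb using fun i => (δ.u_isUnit (p := p) hq hpq i).exists_right_inv
  refine ⟨fun i => b i * (x i - δ.s i), ?_⟩
  have h1 := δ.dbl_comp fun i => b i * (x i - δ.s i)
  have h2 : (fun i => (δ.u i : ℤ_[p]) * (b i * (x i - δ.s i)) + δ.s i) = x := by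
    funext i
    linear_combination (x i - δ.s i) * hb i
  rw [h2, hx] at h1
  apply (δ.d_isUnit (p := p) hq hpq).mul_left_cancel
  linear_combination -h1

lemma univAt_iff (δ : Descent q F F') (hq : q.Prime) {p : ℕ} [Fact p.Prime] (hpq : p ≠ q) :
    F.UnivAt p ↔ F'.UnivAt p := by
  refine ⟨fun h t => (δ.repAt_iff hq hpq).1 (h _), fun h t => ?_⟩
  obtain ⟨b, hb⟩ := (δ.d_isUnit (p := p) hq hpq).exists_right_inv
  have := (δ.repAt_iff hq hpq).2 (h (b * (t - δ.o)))
  rwa [show (δ.d : ℤ_[p]) * (b * (t - δ.o)) + δ.o = t by linear_combination (t - δ.o) * hb] at this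

lemma val_comp (δ : Descent q F F') (x : Fin n → ℤ) :
    F.val (fun i => δ.u i * x i + δ.s i) = δ.d * F'.val x + δ.o := by
  have h := δ.dbl_comp x
  simp only [Int.cast_id] at h
  rw [dbl_eq_two_mul, dbl_eq_two_mul] at h
  linarith

/-- Descents preserve regularity. -/
lemma regular (δ : Descent q F F') (hq : q.Prime) (hF : F.Regular) : F'.Regular := by
  intro N hN
  obtain ⟨x, hx⟩ := hF (δ.d * N + δ.o) fun p _ => by
    have := δ.repAt_of (hN p)
    exact_mod_cast this
  push_cast at hx
  choose y hy using δ.forced x N hx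
  refine ⟨y, ?_⟩
  have h1 : x = fun i => δ.u i * y i + δ.s i := by
    funext i
    linarith [hy i]
  have h2 := δ.val_comp y
  rw [← h1, hx] at h2
  have h3 : (δ.d : ℤ) ≠ 0 := by exact_mod_cast (δ.d_pos hq).ne'
  exact mul_left_cancel₀ h3 (by linarith)

end Descent

/-! ### Primes at which every form is universal -/

variable {D : ℕ} {F : PForm n}

/-- A sum supported on one variable. -/
lemma dbl_single (F : PForm n) {R : Type*} [CommRing R] (i : Fin n) (x : R) :
    F.dbl (Pi.single i x) = F.a i * polyDbl (F.M i) (F.r i) x := by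
  unfold dbl
  rw [Finset.sum_eq_single i]
  · simp
  · intro j _ hj
    simp [hj, polyDbl]
  · simp

/-- At an odd prime dividing `D` a primitive form is universal. -/
lemma Adm.univAt_of_dvd (hF : F.Adm D) {p : ℕ} [Fact p.Prime] (h2 : p ≠ 2) (hD : p ∣ D) :
    F.UnivAt p := by
  intro t
  have hp : p.Prime := Fact.out
  obtain ⟨i, hi⟩ := hF.prim p hp
  have hM : p ∣ F.M i := by
    rcases hF.modulus i with h | h
    · rwa [h]
    · rw [← h] at hD
      by_contra hn
      exact not_dvd_two_mul hp h2 hn hD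
  have hr : ¬ p ∣ 2 * F.r i := not_dvd_two_mul hp h2 fun h =>
    hp.one_lt.ne' (Nat.eq_one_of_dvd_coprimes (hF.cop i) h hM)
  obtain ⟨b, hb⟩ := ((padicInt_isUnit_natCast (p := p) _).2 hi).exists_right_inv
  obtain ⟨x, hx⟩ := exists_quadratic_root (p := p) (F.M i) (2 * F.r i - F.M i) (b * (2 * t))
    ((padicInt_dvd_natCast _).2 hM) (by
      rw [padicInt_isUnit_iff]
      intro h
      have := (dvd_sub_left ((padicInt_dvd_natCast _).2 hM)).1 h
      rw [← Nat.cast_ofNat (R := ℤ_[p]), ← Nat.cast_mul, padicInt_dvd_natCast] at this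
      exact hr this)
  refine ⟨Pi.single i x, ?_⟩
  rw [dbl_single]
  unfold polyDbl
  linear_combination (F.a i : ℤ_[p]) * hx + 2 * t * hb

/-- Over `ℤ_2`, a variable whose modulus is not `2` modulo `4` takes all values. -/
lemma exists_polyDbl_two {M r : ℕ} (hr : Nat.Coprime r M) (hM : M % 4 ≠ 2) (t : ℤ_[2]) :
    ∃ x, polyDbl M r x = 2 * t := by
  rcases Nat.even_or_odd M with hE | hO
  · have hr2 : ¬ 2 ∣ r := fun h => by
      have := Nat.dvd_gcd h hE.two_dvd
      rw [hr] at this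
      omega
    obtain ⟨k, hk⟩ : ∃ k, M = 4 * k := ⟨M / 4, by obtain ⟨j, hj⟩ := hE; omega⟩
    obtain ⟨x, hx⟩ := exists_quadratic_root (p := 2) (2 * k) (r - 2 * k) t
      ⟨k, by push_cast; ring⟩ (by
        rw [padicInt_isUnit_iff]
        intro h
        rw [dvd_sub_left (show ((2 : ℕ) : ℤ_[2]) ∣ 2 * (k : ℤ_[2]) from ⟨k, by push_cast; ring⟩),
          padicInt_dvd_natCast] at h
        exact hr2 h)
    refine ⟨x, ?_⟩
    unfold polyDbl
    rw [hk]
    push_cast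
    linear_combination 2 * hx
  · obtain ⟨x, hx⟩ := exists_quadratic_root (p := 2) (2 * M) (2 * r - M) t
      ⟨M, by push_cast; ring⟩ (by
        rw [padicInt_isUnit_iff]
        intro h
        rw [dvd_sub_right (show ((2 : ℕ) : ℤ_[2]) ∣ 2 * (r : ℤ_[2]) from ⟨r, by push_cast; ring⟩),
          padicInt_dvd_natCast] at h
        obtain ⟨j, hj⟩ := hO
        omega)
    refine ⟨2 * x, ?_⟩
    unfold polyDbl
    linear_combination 2 * hx

lemma univAt_two_of_odd {i : Fin n} (hi : ¬ 2 ∣ F.a i) (hr : Nat.Coprime (F.r i) (F.M i))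
    (hM : F.M i % 4 ≠ 2) : F.UnivAt 2 := by
  intro t
  obtain ⟨b, hb⟩ := ((padicInt_isUnit_natCast (p := 2) _).2 hi).exists_right_inv
  obtain ⟨x, hx⟩ := exists_polyDbl_two hr hM (b * t)
  refine ⟨Pi.single i x, ?_⟩
  rw [dbl_single, hx]
  linear_combination 2 * t * hb

end PForm

/-! ### Descent at odd primes -/

/-- The vertex of a shifted polygonal number modulo `q`: restricting to the residue class on which
the completed square is divisible by `q` gives `q ^ 2` times a shifted polygonal number with the
same modulus, up to a constant. -/
lemma exists_level {M r q : ℕ} (hq : Odd q) (hqM : Nat.Coprime q M) (hM : 3 ≤ M)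
    (hr : Nat.Coprime r M) :
    ∃ (u s : ℤ) (r' : ℕ), (u = q ∨ u = -q) ∧ 0 < r' ∧ 2 * r' < M ∧ Nat.Coprime r' M ∧
      u * (M * (2 * s - 1) + 2 * r) = q ^ 2 * (2 * r' - M) := by
  obtain ⟨α, β, hab⟩ := Nat.isCoprime_iff_coprime.2 hqM
  obtain ⟨j, hj⟩ := hq
  have hM0 : (0 : ℤ) < M := by omega
  -- `ρ` is the solution of `q ρ ≡ r` modulo `M`; the new level is whichever of `ρ` and `M - ρ` is
  -- below `M / 2`.
  set ρ : ℤ := (α * r) % M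
  set t : ℤ := -β * r - q * (α * r / M)
  have ht : q * ρ - r = M * t := by
    have : ρ = α * r - M * (α * r / M) := by
      have := Int.emod_add_mul_ediv (α * r) M
      linarith
    rw [this]
    simp only [t]
    linear_combination (r : ℤ) * hab
  have hρ0 : 0 ≤ ρ := Int.emod_nonneg _ hM0.ne'
  have hρM : ρ < M := Int.emod_lt_of_pos _ hM0
  have hcop : IsCoprime ρ (M : ℤ) := by
    have h := Nat.isCoprime_iff_coprime.2 hr
    rw [show (r : ℤ) = ρ * q + M * (-t) by linear_combination -ht] at h
    exact (IsCoprime.of_add_mul_left_left h).of_mul_left_left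
  have hq' : (q : ℤ) = 2 * j + 1 := by exact_mod_cast hj
  obtain ⟨ρ', hρ'⟩ := Int.eq_ofNat_of_zero_le hρ0
  rw [hρ'] at hcop hρM ht
  have hc : Nat.Coprime ρ' M := Nat.isCoprime_iff_coprime.1 hcop
  have hpos : 0 < ρ' := by
    rcases Nat.eq_zero_or_pos ρ' with h | h
    · rw [h, Nat.coprime_zero_left] at hc; omega
    · exact h
  have hne : 2 * ρ' ≠ M := fun h => by
    rw [← h] at hc
    have := Nat.Coprime.eq_one_of_dvd hc ⟨2, by ring⟩
    omega
  have hs : (M : ℤ) * (2 * (t - j) - 1) + 2 * r = q * (2 * ρ' - M) := by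
    linear_combination -2 * ht + (M : ℤ) * hq'
  rcases lt_or_gt_of_ne hne with h | h
  · exact ⟨q, t - j, ρ', Or.inl rfl, hpos, h, hc, by rw [hs]; ring⟩
  · refine ⟨-q, t - j, M - ρ', Or.inr rfl, by omega, by omega, ?_, ?_⟩
    · exact (Nat.coprime_self_sub_left (by omega)).2 hc
    · rw [hs, Nat.cast_sub (by omega)]; ring

namespace PForm

variable {n : ℕ} {D : ℕ} {F : PForm n}

lemma Adm.val_nonneg (hF : F.Adm D) (x : Fin n → ℤ) : 0 ≤ F.val x :=
  Finset.sum_nonneg fun i _ => mul_nonneg (by positivity)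
    (polyVal_nonneg (hF.lev_pos i) (hF.lev_lt i) _)

/-- If the coefficients not divisible by `q` form an anisotropic form modulo `q`, there is a descent
at `q`: the variables with these coefficients are restricted to their vertex class modulo `q`, which
multiplies the coefficients by `q ^ 2`, and then `q`, or if possible `q ^ 2`, is divided out. -/
lemma Adm.exists_descent (hF : F.Adm D) {q : ℕ} (hq : q.Prime) (h2 : q ≠ 2) (hD : ¬ q ∣ D)
    (hforce : ∀ y : Fin n → ℤ, (q : ℤ) ∣ ∑ i, (F.wa D i : ℤ) * y i ^ 2 →
      ∀ i, ¬ q ∣ F.a i → (q : ℤ) ∣ y i) :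
    ∃ (F' : PForm n) (δ : Descent q F F'), F'.Adm D ∧ F'.M = F.M ∧
      (δ.d = if ∀ i, q ∣ F.a i → q ^ 2 ∣ F.a i then q ^ 2 else q) ∧
      (∀ i, q ∣ F.a i → δ.d * F'.a i = F.a i ∧ F'.r i = F.r i) ∧
      (∀ i, ¬ q ∣ F.a i → δ.d * F'.a i = q ^ 2 * F.a i ∧
        (δ.u i = q ∨ δ.u i = -q) ∧
        δ.u i * (F.M i * (2 * δ.s i - 1) + 2 * F.r i) = q ^ 2 * (2 * F'.r i - F.M i)) := by
  classical
  have hodd : Odd q := hq.odd_of_ne_two h2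
  have hM : ∀ i, Nat.Coprime q (F.M i) := fun i =>
    (Nat.Prime.coprime_iff_not_dvd hq).2 (hF.not_dvd_M hD i)
  choose u s r' hu hr0 hrM hrc hlin using fun i =>
    exists_level hodd (hM i) (by have := hF.big i; omega) (hF.cop i)
  set d : ℕ := if ∀ i, q ∣ F.a i → q ^ 2 ∣ F.a i then q ^ 2 else q with hd
  have hdq : d ∣ q ^ 2 := by
    rw [hd]; split_ifs
    · exact dvd_rfl
    · exact dvd_pow_self _ two_ne_zero
  have hqd : q ∣ d := by
    rw [hd]; split_ifs
    · exact dvd_pow_self _ two_ne_zero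
    · exact dvd_rfl
  have hda : ∀ i, q ∣ F.a i → d ∣ F.a i := by
    intro i hi
    rw [hd]; split_ifs with h
    · exact h i hi
    · exact hi
  have hd0 : 0 < d := Nat.pos_of_dvd_of_pos hdq (pow_pos hq.pos 2)
  let F' : PForm n :=
    { a := fun i => if q ∣ F.a i then F.a i / d else q ^ 2 / d * F.a i
      M := F.M
      r := fun i => if q ∣ F.a i then F.r i else r' i }
  have ha1 : ∀ i, q ∣ F.a i → d * F'.a i = F.a i := fun i hi => by
    simp only [F', hi, if_true]
    exact Nat.mul_div_cancel' (hda i hi)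
  have ha2 : ∀ i, ¬ q ∣ F.a i → d * F'.a i = q ^ 2 * F.a i := fun i hi => by
    simp only [F', hi, if_false]
    rw [← mul_assoc, Nat.mul_div_cancel' hdq]
  let s' : Fin n → ℤ := fun i => if q ∣ F.a i then 0 else s i
  have hys : ∀ i, ¬ q ∣ F.a i → (q : ℤ) ∣ 2 * F.M i * s i - F.cc i := by
    intro i hi
    have h := hlin i
    have hq0 : (q : ℤ) ≠ 0 := by exact_mod_cast hq.ne_zero
    unfold cc
    rcases hu i with h' | h' <;> rw [h'] at h
    · refine ⟨2 * r' i - F.M i, mul_left_cancel₀ hq0 ?_⟩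
      linear_combination h
    · refine ⟨-(2 * r' i - F.M i), mul_left_cancel₀ hq0 ?_⟩
      linear_combination -h
  let δ : Descent q F F' :=
    { u := fun i => if q ∣ F.a i then 1 else u i
      s := s'
      d := d
      o := (F.val s').toNat
      u_pow := fun i => by
        split_ifs with h
        · exact ⟨0, by simp⟩
        · rcases hu i with h' | h' <;> exact ⟨1, by simp [h']⟩
      d_pow := by
        rw [hd]; split_ifs
        · exact ⟨2, rfl⟩
        · exact ⟨1, (pow_one q).symm⟩
      sq := fun i => by
        by_cases hi : q ∣ F.a i
        · have h : (d : ℤ) * F'.a i = F.a i := by exact_mod_cast ha1 i hi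
          simp only [hi, if_true]
          linear_combination -(F.M i : ℤ) * h
        · have h : (d : ℤ) * F'.a i = q ^ 2 * F.a i := by exact_mod_cast ha2 i hi
          have hu2 : u i ^ 2 = (q : ℤ) ^ 2 := by rcases hu i with h' | h' <;> rw [h'] <;> ring
          simp only [hi, if_false]
          rw [hu2]
          linear_combination -(F.M i : ℤ) * h
      lin := fun i => by
        by_cases hi : q ∣ F.a i
        · have h : (d : ℤ) * F'.a i = F.a i := by exact_mod_cast ha1 i hi
          have hr' : F'.r i = F.r i := by simp [F', hi]
          have hs' : s' i = 0 := by simp [s', hi]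
          have hM' : F'.M i = F.M i := rfl
          rw [hr', hs', hM']
          simp only [hi, if_true]
          rw [← mul_assoc (d : ℤ), h]
          ring
        · have h : (d : ℤ) * F'.a i = q ^ 2 * F.a i := by exact_mod_cast ha2 i hi
          have hr' : F'.r i = r' i := by simp [F', hi]
          have hs' : s' i = s i := by simp [s', hi]
          have hM' : F'.M i = F.M i := rfl
          rw [hr', hs', hM']
          simp only [hi, if_false]
          rw [← mul_assoc (d : ℤ), h]
          linear_combination (F.a i : ℤ) * hlin i
      val_s := (Int.toNat_of_nonneg (hF.val_nonneg s')).symm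
      forced := fun x N hx i => by
        by_cases hi : q ∣ F.a i
        · simp [hi]
        -- Both `x` and the vertex `s'` have completed squares summing to `0` modulo `q`, so
        -- anisotropy puts both in the vertex class.
        have h1 := hF.complete_square_int hx
        have h2' := hF.complete_square_int (x := s') rfl
        have h3 : (q : ℤ) ∣ ∑ i, (F.wa D i : ℤ) * (2 * F.M i * s' i - F.cc i) ^ 2 := by
          refine Finset.dvd_sum fun j _ => ?_
          by_cases hj : q ∣ F.a j
          · refine Dvd.dvd.mul_right ?_ _
            exact_mod_cast (hF.dvd_wa hq h2 j).2 hj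
          · refine Dvd.dvd.mul_left ?_ _
            refine dvd_pow ?_ two_ne_zero
            simp only [s', hj, if_false]
            exact hys j hj
        have h4 : (q : ℤ) ∣ ∑ i, (F.wa D i : ℤ) * (2 * F.M i * x i - F.cc i) ^ 2 := by
          rw [h1]
          have h5 : (q : ℤ) ∣ 8 * D * (d * N) := by
            have : (q : ℤ) ∣ d := by exact_mod_cast hqd
            exact Dvd.dvd.mul_left (this.mul_right _) _
          have := dvd_add h5 h3
          rw [h2'] at this
          rw [Int.toNat_of_nonneg (hF.val_nonneg s')]
          rw [mul_add, add_assoc]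
          exact this
        have h5 := hforce _ h4 i hi
        have h6 := dvd_sub h5 (hys i hi)
        have h7 : (q : ℤ) ∣ ((2 * F.M i : ℕ) : ℤ) * (x i - s i) := by
          push_cast
          rw [show (2 * F.M i : ℤ) * (x i - s i) =
            2 * F.M i * x i - F.cc i - (2 * F.M i * s i - F.cc i) by ring]
          exact h6
        have h8 : (q : ℤ) ∣ x i - s i := by
          rcases (Nat.prime_iff_prime_int.1 hq).dvd_mul.1 h7 with h | h
          · exact absurd (Int.natCast_dvd_natCast.1 h) (not_dvd_two_mul hq h2 (hF.not_dvd_M hD i))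
          · exact h
        simp only [hi, if_false, s']
        rcases hu i with h' | h' <;> rw [h']
        · exact h8
        · exact (neg_dvd).2 h8 }
  refine ⟨F', δ, ?_, rfl, rfl, fun i hi => ⟨ha1 i hi, by simp [F', hi]⟩,
    fun i hi => ⟨ha2 i hi, ?_, ?_⟩⟩
  · refine ⟨fun i => ?_, fun i => ?_, fun i => ?_, fun i => ?_, hF.big, hF.modulus, ?_⟩
    · by_cases hi : q ∣ F.a i
      · have := ha1 i hi
        have := hF.pos i
        exact Nat.pos_of_ne_zero fun h => by simp [h] at *; omega
      · have h := ha2 i hi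
        have h' := mul_pos (pow_pos hq.pos 2) (hF.pos i)
        exact Nat.pos_of_ne_zero fun h0 => by rw [h0] at h; omega
    · by_cases hi : q ∣ F.a i <;> simp only [F', hi, if_true, if_false]
      exacts [hF.lev_pos i, hr0 i]
    · by_cases hi : q ∣ F.a i <;> simp only [F', hi, if_true, if_false]
      exacts [hF.lev_lt i, hrM i]
    · by_cases hi : q ∣ F.a i <;> simp only [F', hi, if_true, if_false]
      exacts [hF.cop i, hrc i]
    · intro ℓ hℓ
      by_cases hlq : ℓ = q
      · subst hlq
        by_cases hall : ∀ i, ℓ ∣ F.a i → ℓ ^ 2 ∣ F.a i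
        · obtain ⟨i, hi⟩ := hF.prim ℓ hℓ
          refine ⟨i, fun h => hi ?_⟩
          have h3 := ha2 i hi
          rw [hd, if_pos hall] at h3
          rwa [Nat.eq_of_mul_eq_mul_left (pow_pos hℓ.pos 2) h3] at h
        · have hdl : d = ℓ := by rw [hd, if_neg hall]
          push Not at hall
          obtain ⟨i, hi, hi2⟩ := hall
          refine ⟨i, fun h => hi2 ?_⟩
          rw [← ha1 i hi, hdl, sq]
          exact Nat.mul_dvd_mul_left _ h
      · obtain ⟨i, hi⟩ := hF.prim ℓ hℓ
        refine ⟨i, fun h => hi ?_⟩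
        by_cases hqi : q ∣ F.a i
        · rw [← ha1 i hqi]
          exact h.mul_left _
        · have h3 : ℓ ∣ q ^ 2 * F.a i := by
            rw [← ha2 i hqi]
            exact h.mul_left _
          rcases hℓ.dvd_mul.1 h3 with h4 | h4
          · exact absurd ((Nat.prime_dvd_prime_iff_eq hℓ hq).1 (hℓ.dvd_of_dvd_pow h4)) hlq
          · exact h4
  · simp only [δ, hi, if_false]
    exact hu i
  · simp only [δ, F', s', hi, if_false]
    exact hlin i

end PForm

/-! ### Odd primes at which a form is not universal -/

namespace PForm

variable {n : ℕ} {D : ℕ} {F : PForm n}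

lemma Adm.univAt_of_diagRep (hF : F.Adm D) {p : ℕ} [Fact p.Prime] (h2 : p ≠ 2) (hD : ¬ p ∣ D)
    {s : Finset (Fin n)} (h : ∀ t, DiagRep (fun i => (F.wa D i : ℤ_[p])) s t) : F.UnivAt p :=
  fun _ => hF.repAt_of_diagRep h2 hD ((h _).mono (Finset.subset_univ _))

lemma Adm.isUnit_wa (hF : F.Adm D) {p : ℕ} [Fact p.Prime] (h2 : p ≠ 2) {i : Fin n}
    (hi : ¬ p ∣ F.a i) : IsUnit (F.wa D i : ℤ_[p]) := by
  rw [padicInt_isUnit_natCast, hF.dvd_wa Fact.out h2]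
  exact hi

/-- A coefficient of exact order one at `p`, after completing squares. -/
lemma Adm.wa_eq_mul_unit (hF : F.Adm D) {p : ℕ} [Fact p.Prime] (h2 : p ≠ 2) {i : Fin n}
    (h1 : p ∣ F.a i) (hi : ¬ p ^ 2 ∣ F.a i) :
    ∃ u : ℤ_[p], IsUnit u ∧ (F.wa D i : ℤ_[p]) = p * u := by
  have hp : p.Prime := Fact.out
  obtain ⟨b, hb⟩ := h1
  refine ⟨((b * (D / F.M i) : ℕ) : ℤ_[p]), ?_, ?_⟩
  · rw [padicInt_isUnit_natCast, hp.dvd_mul, not_or]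
    constructor
    · intro h
      apply hi
      rw [hb, sq]
      exact Nat.mul_dvd_mul_left _ h
    · have h3 : ¬ p ∣ 2 := fun h => h2 ((Nat.prime_dvd_prime_iff_eq hp Nat.prime_two).1 h)
      rcases hF.wt_cases i with ⟨-, h'⟩ | ⟨-, h'⟩ <;> rw [h']
      · exact hp.one_lt.ne' ∘ Nat.dvd_one.1
      · exact h3
  · unfold wa
    rw [hb]
    push_cast
    ring

/-- At an odd prime `p` not dividing `D` where the form is not universal, the coefficients not
divisible by `p` form an anisotropic form modulo `p` in one or two variables, and in the latter case
there are no two coefficients of exact order one. -/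
lemma Adm.bad_cases (hF : F.Adm D) {p : ℕ} [Fact p.Prime] (h2 : p ≠ 2) (hD : ¬ p ∣ D)
    (hbad : ¬ F.UnivAt p) :
    (∃ i, ¬ p ∣ F.a i ∧ ∀ j, j ≠ i → p ∣ F.a j) ∨
    (∃ i j, i ≠ j ∧ ¬ p ∣ F.a i ∧ ¬ p ∣ F.a j ∧ (∀ k, k ≠ i → k ≠ j → p ∣ F.a k) ∧
      (∀ y z : ℤ, (p : ℤ) ∣ F.wa D i * y ^ 2 + F.wa D j * z ^ 2 → (p : ℤ) ∣ y ∧ (p : ℤ) ∣ z) ∧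
      (∀ k l, k ≠ l → p ∣ F.a k → p ∣ F.a l → p ^ 2 ∣ F.a k ∨ p ^ 2 ∣ F.a l)) := by
  classical
  have hp : p.Prime := Fact.out
  have hpi : Prime (p : ℤ) := Nat.prime_iff_prime_int.1 hp
  obtain ⟨i, hi⟩ := hF.prim p hp
  by_cases h1 : ∀ j, j ≠ i → p ∣ F.a j
  · exact Or.inl ⟨i, hi, h1⟩
  right
  push Not at h1
  obtain ⟨j, hji, hj⟩ := h1
  have key : ∀ i j, i ≠ j → ¬ p ∣ F.a i → ¬ p ∣ F.a j → ∀ y z : ℤ,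
      (p : ℤ) ∣ F.wa D i * y ^ 2 + F.wa D j * z ^ 2 → (p : ℤ) ∣ y := by
    intro i j hij hi hj y z h
    by_contra hy
    apply hbad
    refine hF.univAt_of_diagRep h2 hD (s := {i, j}) fun t =>
      diagRep_isotropic (y := (y : ℤ_[p])) (z := (z : ℤ_[p])) h2 hij (hF.isUnit_wa h2 hi)
        (hF.isUnit_wa h2 hj) (by rwa [padicInt_dvd_intCast]) ?_ t
    have := (padicInt_dvd_intCast (p := p) _).2 h
    push_cast at this
    exact this
  refine ⟨i, j, hji.symm, hi, hj, fun k hki hkj => ?_, fun y z h => ⟨key i j hji.symm hi hj y z h,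
    key j i hji hj hi z y (by rwa [add_comm])⟩, fun k l hkl hk hl => ?_⟩
  · by_contra hk
    exact hbad (hF.univAt_of_diagRep h2 hD fun t => diagRep_three_unit h2 hji.symm hki.symm hkj.symm
      (hF.isUnit_wa h2 hi) (hF.isUnit_wa h2 hj) (hF.isUnit_wa h2 hk) t)
  · by_contra hcon
    rw [not_or] at hcon
    obtain ⟨u, hu, huk⟩ := hF.wa_eq_mul_unit h2 hk hcon.1
    obtain ⟨v, hv, hvl⟩ := hF.wa_eq_mul_unit h2 hl hcon.2
    have hne : ∀ {x y}, ¬ p ∣ F.a x → p ∣ F.a y → x ≠ y := fun hx hy h => hx (h ▸ hy)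
    exact hbad (hF.univAt_of_diagRep h2 hD fun t => diagRep_two_two h2 hji.symm hkl
      (hne hi hk) (hne hi hl) (hne hj hk) (hne hj hl) (hF.isUnit_wa h2 hi) (hF.isUnit_wa h2 hj)
      hu hv huk hvl t)

/-- The hypothesis of `Adm.exists_descent` holds wherever the form is not universal. -/
lemma Adm.vertex_of_bad (hF : F.Adm D) {p : ℕ} [Fact p.Prime] (h2 : p ≠ 2) (hD : ¬ p ∣ D)
    (hbad : ¬ F.UnivAt p) (y : Fin n → ℤ) (h : (p : ℤ) ∣ ∑ i, (F.wa D i : ℤ) * y i ^ 2) (i : Fin n)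
    (hi : ¬ p ∣ F.a i) : (p : ℤ) ∣ y i := by
  classical
  have hp : p.Prime := Fact.out
  have hpi : Prime (p : ℤ) := Nat.prime_iff_prime_int.1 hp
  have hwa : ∀ j, p ∣ F.a j → (p : ℤ) ∣ F.wa D j * y j ^ 2 := fun j hj =>
    Dvd.dvd.mul_right (by exact_mod_cast (hF.dvd_wa hp h2 j).2 hj) _
  rcases hF.bad_cases h2 hD hbad with ⟨i₀, h0, hrest⟩ | ⟨i₀, j₀, hij, h0, h1, hrest, han, -⟩
  · have hii : i = i₀ := by
      by_contra hne
      exact hi (hrest i hne)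
    subst hii
    rw [← Finset.add_sum_erase _ _ (Finset.mem_univ i)] at h
    have h3 := (dvd_add_left (Finset.dvd_sum fun j hj => hwa j
      (hrest j (Finset.ne_of_mem_erase hj)))).1 h
    rcases hpi.dvd_mul.1 h3 with h4 | h4
    · exact absurd ((hF.dvd_wa hp h2 i).1 (by exact_mod_cast h4)) hi
    · exact hpi.dvd_of_dvd_pow h4
  · rw [← Finset.add_sum_erase _ _ (Finset.mem_univ i₀),
      ← Finset.add_sum_erase _ _ (Finset.mem_erase.2 ⟨hij.symm, Finset.mem_univ j₀⟩), ← add_assoc] at h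
    have h3 := (dvd_add_left (Finset.dvd_sum fun j hj => hwa j (hrest j
      (Finset.ne_of_mem_erase (Finset.mem_of_mem_erase hj)) (Finset.ne_of_mem_erase hj)))).1 h
    have h4 := han _ _ h3
    by_cases hi0 : i = i₀
    · rw [hi0]; exact h4.1
    · by_cases hj0 : i = j₀
      · rw [hj0]; exact h4.2
      · exact absurd (hrest i hi0 hj0) hi

/-- A measure of non-universality at `q`: the sum of the squared exponents of `q` in the
coefficients. -/
def ordSq (q : ℕ) (F : PForm n) : ℕ := ∑ i, (padicValNat q (F.a i)) ^ 2

lemma Descent.pow_dvd_iff {q : ℕ} {F F' : PForm n} (δ : Descent q F F') (hq : q.Prime)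
    (hM : F'.M = F.M) (hM0 : ∀ i, 0 < F.M i) {p : ℕ} (hp : p.Prime) (hpq : p ≠ q) (k : ℕ)
    (i : Fin n) : p ^ k ∣ F'.a i ↔ p ^ k ∣ F.a i := by
  have h1 := δ.sq i
  rw [hM] at h1
  have h2 : (F.a i : ℤ) * δ.u i ^ 2 = δ.d * F'.a i := by
    have : (F.M i : ℤ) ≠ 0 := by exact_mod_cast (hM0 i).ne'
    apply mul_right_cancel₀ this
    linear_combination h1
  have h3 : F.a i * (δ.u i).natAbs ^ 2 = δ.d * F'.a i := by
    zify
    rw [sq_abs]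
    exact h2
  obtain ⟨j, hj⟩ := δ.u_pow i
  obtain ⟨l, hl⟩ := δ.d_pow
  have hc : ∀ e, Nat.Coprime (p ^ k) (q ^ e) := fun e =>
    Nat.Coprime.pow _ _ ((Nat.coprime_primes hp hq).2 hpq)
  rw [hj, hl, ← pow_mul] at h3
  rw [← (hc l).dvd_mul_left, ← h3, (hc _).dvd_mul_right]

/-- Descent at a prime where the form is not universal decreases `ordSq`: positive exponents drop,
while the exponents `0`, of which there are at most two, become at most `1`. With two exponents `0`
the gain comes from the exponents at least `2`, all others but one being of this kind. -/
lemma Adm.exists_descent_lt (hF : F.Adm D) (hn : 4 ≤ n) {q : ℕ} [Fact q.Prime] (h2 : q ≠ 2)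
    (hD : ¬ q ∣ D) (hbad : ¬ F.UnivAt q) :
    ∃ (F' : PForm n) (_ : Descent q F F'), F'.Adm D ∧ F'.M = F.M ∧ F'.ordSq q < F.ordSq q := by
  classical
  have hq : q.Prime := Fact.out
  obtain ⟨F', δ, hF', hM, hd, hdiv, hndiv⟩ :=
    hF.exists_descent hq h2 hD (hF.vertex_of_bad h2 hD hbad)
  refine ⟨F', δ, hF', hM, ?_⟩
  have hv0 : ∀ i, q ∣ F.a i → 1 ≤ padicValNat q (F.a i) := fun i hi =>
    one_le_padicValNat_of_dvd (hF.pos i).ne' hi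
  have hvn : ∀ i, ¬ q ∣ F.a i → padicValNat q (F.a i) = 0 := fun i hi =>
    padicValNat.eq_zero_of_not_dvd hi
  have hv2 : ∀ i, q ^ 2 ∣ F.a i → 2 ≤ padicValNat q (F.a i) := fun i hi =>
    (padicValNat_dvd_iff_le (hF.pos i).ne').1 hi
  have hdpos := δ.d_pos hq
  have hval1 : ∀ i, q ∣ F.a i →
      padicValNat q δ.d + padicValNat q (F'.a i) = padicValNat q (F.a i) := fun i hi => by
    rw [← (hdiv i hi).1, padicValNat.mul hdpos.ne' (hF'.pos i).ne']
  have hval2 : ∀ i, ¬ q ∣ F.a i → padicValNat q δ.d + padicValNat q (F'.a i) = 2 := fun i hi => by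
    rw [← padicValNat.mul hdpos.ne' (hF'.pos i).ne', (hndiv i hi).1,
      padicValNat.mul (pow_ne_zero 2 hq.ne_zero) (hF.pos i).ne', hvn i hi, padicValNat.prime_pow]
  have hd12 : 1 ≤ padicValNat q δ.d := by
    rw [hd]; split_ifs
    · rw [padicValNat.prime_pow]; omega
    · rw [padicValNat.self hq.one_lt]
  -- The decrease of `ordSq` contributed by the coefficient `i`.
  let h : Fin n → ℤ := fun i => (padicValNat q (F.a i) : ℤ) ^ 2 - (padicValNat q (F'.a i) : ℤ) ^ 2
  have hh1 : ∀ i, q ∣ F.a i → 1 ≤ h i := fun i hi => by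
    have e1 := hval1 i hi
    have e2 : padicValNat q (F'.a i) + 1 ≤ padicValNat q (F.a i) := by omega
    simp only [h]
    generalize padicValNat q (F'.a i) = v at e2 ⊢
    generalize padicValNat q (F.a i) = w at e2 ⊢
    zify at e2
    nlinarith [Int.natCast_nonneg v]
  have hh2 : ∀ i, q ^ 2 ∣ F.a i → 3 ≤ h i := fun i hi => by
    have e0 := hv2 i hi
    have e1 := hval1 i ((dvd_pow_self q two_ne_zero).trans hi)
    have e2 : padicValNat q (F'.a i) + 1 ≤ padicValNat q (F.a i) := by omega
    simp only [h]
    generalize padicValNat q (F'.a i) = v at e2 ⊢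
    generalize padicValNat q (F.a i) = w at e0 e2 ⊢
    zify at e2 e0
    nlinarith [Int.natCast_nonneg v]
  have hh3 : ∀ i, ¬ q ∣ F.a i → -1 ≤ h i := fun i hi => by
    have e1 := hval2 i hi
    have e2 : padicValNat q (F'.a i) ≤ 1 := by omega
    simp only [h, hvn i hi]
    generalize padicValNat q (F'.a i) = v at e2 ⊢
    zify at e2
    push_cast
    nlinarith [Int.natCast_nonneg v]
  have hlt : ∀ f g : Fin n → ℕ, 0 < ∑ i, ((f i : ℤ) ^ 2 - (g i : ℤ) ^ 2) →
      ∑ i, g i ^ 2 < ∑ i, f i ^ 2 := fun f g hs => by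
    rw [Finset.sum_sub_distrib] at hs
    zify
    linarith
  have hgoal : 0 < ∑ i, h i → F'.ordSq q < F.ordSq q := fun hs => hlt _ _ hs
  apply hgoal
  rcases hF.bad_cases h2 hD hbad with ⟨i₀, h0, hrest⟩ | ⟨i₀, j₀, hij, h0, h1, hrest, -, hone⟩
  · rw [← Finset.add_sum_erase _ _ (Finset.mem_univ i₀)]
    have e1 : ∑ _i ∈ Finset.univ.erase i₀, (1 : ℤ) ≤ ∑ i ∈ Finset.univ.erase i₀, h i :=
      Finset.sum_le_sum fun i hi => hh1 i (hrest i (Finset.ne_of_mem_erase hi))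
    simp only [Finset.sum_const, Finset.card_erase_of_mem (Finset.mem_univ i₀), Finset.card_univ,
      Fintype.card_fin, nsmul_eq_mul, mul_one] at e1
    have := hh3 i₀ h0
    push_cast [show 1 ≤ n by omega] at e1
    have : (4 : ℤ) ≤ n := by exact_mod_cast hn
    linarith
  · set S := (Finset.univ.erase i₀).erase j₀ with hS
    have hmem : j₀ ∈ Finset.univ.erase i₀ := Finset.mem_erase.2 ⟨hij.symm, Finset.mem_univ _⟩
    rw [← Finset.add_sum_erase _ _ (Finset.mem_univ i₀), ← Finset.add_sum_erase _ _ hmem, ← hS]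
    have hSc : S.card = n - 2 := by
      rw [hS, Finset.card_erase_of_mem hmem, Finset.card_erase_of_mem (Finset.mem_univ _)]
      simp; omega
    have hSd : ∀ i ∈ S, q ∣ F.a i := fun i hi =>
      hrest i (Finset.ne_of_mem_erase (Finset.mem_of_mem_erase hi)) (Finset.ne_of_mem_erase hi)
    obtain ⟨k, hk, l, hl, hkl⟩ := Finset.one_lt_card.1 (by omega : 1 < S.card)
    obtain ⟨m, hm, hm2⟩ : ∃ m ∈ S, q ^ 2 ∣ F.a m := by
      rcases hone k l hkl (hSd k hk) (hSd l hl) with h' | h'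
      exacts [⟨k, hk, h'⟩, ⟨l, hl, h'⟩]
    rw [← Finset.add_sum_erase _ _ hm]
    have e1 : ∑ _i ∈ S.erase m, (1 : ℤ) ≤ ∑ i ∈ S.erase m, h i :=
      Finset.sum_le_sum fun i hi => hh1 i (hSd i (Finset.mem_of_mem_erase hi))
    simp only [Finset.sum_const, Finset.card_erase_of_mem hm, hSc, nsmul_eq_mul, mul_one] at e1
    have e2 := hh3 i₀ h0
    have e3 := hh3 j₀ h1
    have e4 := hh2 m hm2
    have e5 : (1 : ℤ) ≤ ((n - 2 - 1 : ℕ) : ℤ) := by omega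
    linarith

/-- Repeated descent at `q` reaches a form universal at `q`. -/
lemma Adm.exists_univAt (hn : 4 ≤ n) {q : ℕ} [Fact q.Prime] (h2 : q ≠ 2) {F : PForm n}
    (hF : F.Adm D) (hreg : F.Regular) :
    ∃ F' : PForm n, F'.Adm D ∧ F'.Regular ∧ F'.M = F.M ∧ F'.UnivAt q ∧
      (∀ (p : ℕ) [Fact p.Prime], p ≠ q → (F.UnivAt p ↔ F'.UnivAt p)) ∧
      (∀ p : ℕ, p.Prime → p ≠ q → ∀ k i, p ^ k ∣ F'.a i ↔ p ^ k ∣ F.a i) := by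
  have hq : q.Prime := Fact.out
  induction h : F.ordSq q using Nat.strong_induction_on generalizing F with
  | _ N ih =>
    subst h
    by_cases hu : F.UnivAt q
    · exact ⟨F, hF, hreg, rfl, hu, fun p _ _ => Iff.rfl, fun p _ _ k i => Iff.rfl⟩
    · have hD : ¬ q ∣ D := fun hD => hu (hF.univAt_of_dvd h2 hD)
      obtain ⟨G, δ, hG, hM, hlt⟩ := hF.exists_descent_lt hn h2 hD hu
      obtain ⟨F', h1, h2', h3, h4, h5, h6⟩ := ih _ hlt hG (δ.regular hq hreg) rfl
      refine ⟨F', h1, h2', h3.trans hM, h4, fun p _ hp => (δ.univAt_iff hq hp).trans (h5 p hp),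
        fun p hp hpq k i => (h6 p hp hpq k i).trans ?_⟩
      exact δ.pow_dvd_iff hq hM (fun i => by have := hF.big i; omega) hp hpq k i

/-- Repeated descent at a finite set of odd primes. -/
lemma Adm.exists_univAt_finset (hn : 4 ≤ n) (S : Finset ℕ) (hS : ∀ q ∈ S, q.Prime ∧ q ≠ 2)
    (hF : F.Adm D) (hreg : F.Regular) :
    ∃ F' : PForm n, F'.Adm D ∧ F'.Regular ∧ F'.M = F.M ∧
      (∀ (p : ℕ) [Fact p.Prime], p ∈ S → F'.UnivAt p) ∧
      (∀ (p : ℕ) [Fact p.Prime], p ∉ S → (F.UnivAt p ↔ F'.UnivAt p)) ∧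
      (∀ p : ℕ, p.Prime → p ∉ S → ∀ k i, p ^ k ∣ F'.a i ↔ p ^ k ∣ F.a i) := by
  classical
  induction S using Finset.induction_on with
  | empty =>
    exact ⟨F, hF, hreg, rfl, fun p _ hp => absurd hp (Finset.notMem_empty p), fun p _ _ => Iff.rfl,
      fun p _ _ k i => Iff.rfl⟩
  | insert q S hqS ih =>
    obtain ⟨G, hG, hGr, hM, h1, h2, h3⟩ := ih fun p hp => hS p (Finset.mem_insert_of_mem hp)
    have hq := hS q (Finset.mem_insert_self q S)
    have : Fact q.Prime := ⟨hq.1⟩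
    obtain ⟨F', hF', hr', hM', k1, k2, k3⟩ := hG.exists_univAt hn hq.2 hGr
    refine ⟨F', hF', hr', hM'.trans hM, fun p _ hp => ?_, fun p _ hp => ?_, fun p hp hpS k i => ?_⟩
    · by_cases hpq : p = q
      · subst hpq; exact k1
      · exact (k2 p hpq).1 (h1 p ((Finset.mem_insert.1 hp).resolve_left hpq))
    · rw [Finset.mem_insert, not_or] at hp
      exact (h2 p hp.2).trans (k2 p hp.1)
    · rw [Finset.mem_insert, not_or] at hpS
      exact (k3 p hp hpS.1 k i).trans (h3 p hp hpS.2 k i)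

/-- An odd prime dividing no coefficient is harmless. -/
lemma Adm.univAt_of_not_dvd (hF : F.Adm D) (hn : 4 ≤ n) {p : ℕ} [Fact p.Prime] (h2 : p ≠ 2)
    (h : ¬ p ∣ ∏ i, F.a i) : F.UnivAt p := by
  by_cases hD : p ∣ D
  · exact hF.univAt_of_dvd h2 hD
  have hi : ∀ i, ¬ p ∣ F.a i := fun i hi => h (hi.trans (Finset.dvd_prod_of_mem _ (Finset.mem_univ i)))
  by_contra hbad
  rcases hF.bad_cases h2 hD hbad with ⟨i, -, hr⟩ | ⟨i, j, -, -, -, hr, -⟩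
  · let x : Fin n := ⟨0, by omega⟩
    let y : Fin n := ⟨1, by omega⟩
    have hxy : x ≠ y := by simp [x, y]
    by_cases hx : x = i
    · exact hi y (hr y fun h => hxy (hx.trans h.symm))
    · exact hi x (hr x hx)
  · obtain ⟨k, hk⟩ : ∃ k, k ∉ ({i, j} : Finset (Fin n)) := by
      by_contra hcon
      push Not at hcon
      have := Finset.card_le_card (fun k _ => hcon k : (Finset.univ : Finset (Fin n)) ⊆ {i, j})
      have h3 := Finset.card_le_two (a := i) (b := j)
      simp at this
      omega
    simp only [Finset.mem_insert, Finset.mem_singleton, not_or] at hk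
    exact hi k (hr k hk.1 hk.2)

/-- Descent to a form universal at all odd primes outside a given set. -/
lemma Adm.exists_univAt_outside (hn : 4 ≤ n) (T : Set ℕ) (hF : F.Adm D) (hreg : F.Regular) :
    ∃ F' : PForm n, F'.Adm D ∧ F'.Regular ∧ F'.M = F.M ∧
      (∀ (p : ℕ) [Fact p.Prime], p ≠ 2 → p ∉ T → F'.UnivAt p) ∧
      (∀ (p : ℕ) [Fact p.Prime], p = 2 ∨ p ∈ T → (F.UnivAt p ↔ F'.UnivAt p)) ∧
      (∀ p : ℕ, p.Prime → p = 2 ∨ p ∈ T → ∀ k i, p ^ k ∣ F'.a i ↔ p ^ k ∣ F.a i) := by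
  classical
  obtain ⟨F', h1, h2, h3, h4, h5, h6⟩ := hF.exists_univAt_finset hn
    ((∏ i, F.a i).primeFactors.filter fun p => p ≠ 2 ∧ p ∉ T)
    (fun q hq => by
      simp only [Finset.mem_filter] at hq
      exact ⟨Nat.prime_of_mem_primeFactors hq.1, hq.2.1⟩) hreg
  refine ⟨F', h1, h2, h3, fun p _ hp2 hpT => ?_, fun p _ hp => h5 p ?_,
    fun p hp hp' => h6 p hp ?_⟩
  · by_cases hp : p ∣ ∏ i, F.a i
    · refine h4 p ?_
      simp only [Finset.mem_filter, Nat.mem_primeFactors]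
      exact ⟨⟨Fact.out, hp, Finset.prod_ne_zero_iff.2 fun i _ => (hF.pos i).ne'⟩, hp2, hpT⟩
    · refine (h5 p ?_).1 (hF.univAt_of_not_dvd hn hp2 hp)
      simp only [Finset.mem_filter, Nat.mem_primeFactors]
      exact fun h => hp h.1.2.1
  · simp only [Finset.mem_filter]; tauto
  · simp only [Finset.mem_filter]; tauto

end PForm

/-! ### Local and global values with few nonzero terms -/

namespace PForm

variable {n : ℕ} {D : ℕ} {F : PForm n}

/-- The term of the form belonging to the variable `i`. -/
def tm (F : PForm n) (i : Fin n) (z : ℤ) : ℤ := F.a i * polyVal (F.M i) (F.r i) z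

lemma val_eq_sum (F : PForm n) (x : Fin n → ℤ) : F.val x = ∑ i, F.tm i (x i) := rfl

@[simp] lemma tm_zero (F : PForm n) (i : Fin n) : F.tm i 0 = 0 := by simp [tm]

lemma tm_one (F : PForm n) (i : Fin n) : F.tm i 1 = (F.a i * F.r i : ℕ) := by simp [tm]

lemma Adm.tm_nonneg (hF : F.Adm D) (i : Fin n) (z : ℤ) : 0 ≤ F.tm i z :=
  mul_nonneg (by positivity) (polyVal_nonneg (hF.lev_pos i) (hF.lev_lt i) _)

lemma val_single [DecidableEq (Fin n)] (F : PForm n) (i : Fin n) (z : ℤ) :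
    F.val (Pi.single i z) = F.tm i z := by
  rw [val_eq_sum, Finset.sum_eq_single i]
  · simp
  · intro j _ hj
    simp [hj]
  · simp

lemma dvd_tm {d : ℕ} {i : Fin n} (h : d ∣ F.a i) (z : ℤ) : (d : ℤ) ∣ F.tm i z :=
  Dvd.dvd.mul_right (by exact_mod_cast h) _

lemma Adm.lev_gap (hF : F.Adm D) (i : Fin n) : F.r i + 7 ≤ F.M i := by
  have := hF.big i
  have := hF.lev_lt i
  omega

/-- A term not exceeding `13` is `0`, the value at `1`, or the value at `-1` with coefficient
`1`. -/
lemma Adm.tm_cases (hF : F.Adm D) (i : Fin n) {z : ℤ} (h : F.tm i z ≤ 13) :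
    F.tm i z = 0 ∨ F.tm i z = (F.a i * F.r i : ℕ) ∨
      (F.a i = 1 ∧ F.a i * F.r i = F.r i ∧ F.tm i z = (F.M i : ℤ) - F.r i) := by
  by_cases h0 : z = 0
  · simp [h0]
  by_cases h1 : z = 1
  · rw [h1, tm_one]; simp
  right; right
  have hb := hF.big i
  have hl := hF.lev_lt i
  have hr := hF.lev_pos i
  have hge := polyVal_ge hr hl h0 h1
  have ha := hF.pos i
  have h1a : F.a i = 1 := by
    by_contra hne
    have h2 : 2 ≤ (F.a i : ℤ) := by omega
    have h7 : 7 ≤ polyVal (F.M i) (F.r i) z := by omega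
    unfold tm at h
    nlinarith [mul_le_mul h2 h7 (by norm_num) (by positivity)]
  refine ⟨h1a, by simp [h1a], ?_⟩
  unfold tm at h ⊢
  rw [h1a] at h ⊢
  simp only [Nat.cast_one, one_mul] at h ⊢
  by_cases h2 : z = -1
  · rw [h2, polyVal_neg_one]
  by_cases h3 : z = 2
  · rw [h3, polyVal_two] at h
    omega
  · have := polyVal_ge_far hr hl h0 h1 h2 h3
    omega

/-- A term less than `7` is `0` or the value at `1`. -/
lemma Adm.tm_cases_lt (hF : F.Adm D) (i : Fin n) {z : ℤ} (h : F.tm i z < 7) :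
    F.tm i z = 0 ∨ F.tm i z = (F.a i * F.r i : ℕ) := by
  have := hF.lev_gap i
  rcases hF.tm_cases i (h.le.trans (by norm_num)) with h' | h' | ⟨-, -, h'⟩
  · exact Or.inl h'
  · exact Or.inr h'
  · omega

lemma Adm.eight_mul_tm (i : Fin n) (z : ℤ) :
    8 * (F.M i : ℤ) * F.tm i z = F.a i * ((2 * F.M i * z - F.cc i) ^ 2 - F.cc i ^ 2) := by
  have h := polyDbl_eq_two_mul (F.M i) (F.r i) z
  unfold tm cc
  unfold polyDbl at h
  linear_combination (-4 * (F.M i : ℤ) * F.a i) * h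

/-- The residue class modulo `p` on which the completed square of a variable vanishes. -/
lemma Adm.exists_vertex (hF : F.Adm D) {p : ℕ} (hp : p.Prime) (h2 : p ≠ 2) (hD : ¬ p ∣ D)
    (i : Fin n) : ∃ z : ℤ, (p : ℤ) ∣ 2 * F.M i * z - F.cc i := by
  have h : Nat.Coprime p (2 * F.M i) :=
    (Nat.Prime.coprime_iff_not_dvd hp).2 (not_dvd_two_mul hp h2 (hF.not_dvd_M hD i))
  obtain ⟨u, v, huv⟩ := Nat.isCoprime_iff_coprime.2 h
  push_cast at huv
  exact ⟨v * F.cc i, -u * F.cc i, by linear_combination F.cc i * huv⟩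

/-- Modulo `p`, a term with unit coefficient takes equal values only at arguments symmetric about the
vertex. -/
lemma Adm.not_dvd_tm_sub (hF : F.Adm D) {p : ℕ} (hp : p.Prime) (h2 : p ≠ 2) (hD : ¬ p ∣ D)
    {i : Fin n} (hi : ¬ p ∣ F.a i) {z j k : ℤ} (hz : (p : ℤ) ∣ 2 * F.M i * z - F.cc i)
    (hjk : ¬ (p : ℤ) ∣ j - k) (hjk' : ¬ (p : ℤ) ∣ j + k) :
    ¬ (p : ℤ) ∣ F.tm i (z + j) - F.tm i (z + k) := by
  intro h
  have hpi : Prime (p : ℤ) := Nat.prime_iff_prime_int.1 hp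
  have h2M : ¬ (p : ℤ) ∣ 2 * F.M i := by
    have := not_dvd_two_mul hp h2 (hF.not_dvd_M hD i)
    exact_mod_cast this
  have hai : ¬ (p : ℤ) ∣ F.a i := by exact_mod_cast hi
  have h3 : (p : ℤ) ∣ (F.a i * (2 * F.M i)) * ((j - k) * (2 * F.M i * (j + k))) := by
    have e : ((F.a i : ℤ) * (2 * F.M i)) * ((j - k) * (2 * F.M i * (j + k))) =
        8 * F.M i * (F.tm i (z + j) - F.tm i (z + k))
        - (F.a i * (2 * F.M i) * (j - k) * 2) * (2 * F.M i * z - F.cc i) := by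
      rw [mul_sub, Adm.eight_mul_tm, Adm.eight_mul_tm]
      ring
    rw [e]
    exact dvd_sub (h.mul_left _) (hz.mul_left _)
  rcases hpi.dvd_mul.1 h3 with h3 | h3
  · rcases hpi.dvd_mul.1 h3 with h3 | h3
    exacts [hai h3, h2M h3]
  · rcases hpi.dvd_mul.1 h3 with h3 | h3
    · exact hjk h3
    · rcases hpi.dvd_mul.1 h3 with h3 | h3
      exacts [h2M h3, hjk' h3]

/-- A value modulo `p` taken off the vertex of some unit variable is taken over `ℤ_p`. -/
lemma Adm.repAt_of_congr (hF : F.Adm D) {p : ℕ} [Fact p.Prime] (h2 : p ≠ 2) (hD : ¬ p ∣ D)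
    {i : Fin n} (hi : ¬ p ∣ F.a i) {x : Fin n → ℤ} {N : ℤ} (hN : (p : ℤ) ∣ N - F.val x)
    (hx : ¬ (p : ℤ) ∣ 2 * F.M i * x i - F.cc i) : F.RepAt p N := by
  classical
  apply hF.repAt_of_diagRep h2 hD
  set y : Fin n → ℤ := fun j => 2 * F.M j * x j - F.cc j with hy
  have hsum : ∑ j, (F.wa D j : ℤ) * y j ^ 2 = 8 * D * F.val x + F.disc D :=
    hF.complete_square_int rfl
  rw [← Finset.add_sum_erase _ _ (Finset.mem_univ i)] at hsum
  set R := ∑ j ∈ Finset.univ.erase i, (F.wa D j : ℤ) * y j ^ 2 with hR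
  obtain ⟨w, hw⟩ := hN
  obtain ⟨z, hz⟩ := exists_sq_mul_of_dvd (a := (F.wa D i : ℤ_[p]))
    (u := ((8 * D * N + F.disc D - R : ℤ) : ℤ_[p])) (y₀ := (y i : ℤ_[p])) h2 (hF.isUnit_wa h2 hi)
    (by rwa [padicInt_dvd_intCast]) (by
      have : (p : ℤ) ∣ 8 * D * N + F.disc D - R - F.wa D i * y i ^ 2 :=
        ⟨8 * D * w, by linear_combination 8 * D * hw - hsum⟩
      have := (padicInt_dvd_intCast (p := p) _).2 this
      push_cast at this ⊢
      exact this)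
  have hrest : DiagRep (fun i => (F.wa D i : ℤ_[p])) (Finset.univ.erase i) ((R : ℤ) : ℤ_[p]) :=
    ⟨fun j => (y j : ℤ_[p]), by rw [hR]; push_cast; rfl⟩
  have h3 := DiagRep.cons (A := fun i => (F.wa D i : ℤ_[p])) (t := 8 * D * (N : ℤ_[p]) + F.disc D)
    (Finset.notMem_erase i _) z (hrest.of_eq (by
      rw [hz]; push_cast; ring))
  rwa [Finset.insert_erase (Finset.mem_univ i)] at h3

/-- Two coefficients of exact order one represent all numbers of exact order one. -/
lemma Adm.diagRep_of_exact (hF : F.Adm D) {p : ℕ} [Fact p.Prime] (h2 : p ≠ 2)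
    {k l : Fin n} (hkl : k ≠ l) (hk : p ∣ F.a k) (hk' : ¬ p ^ 2 ∣ F.a k) (hl : p ∣ F.a l)
    (hl' : ¬ p ^ 2 ∣ F.a l) {t : ℤ_[p]} (ht : IsUnit t) :
    DiagRep (fun i => (F.wa D i : ℤ_[p])) {k, l} (p * t) := by
  obtain ⟨u, hu, huk⟩ := hF.wa_eq_mul_unit h2 hk hk'
  obtain ⟨v, hv, hvl⟩ := hF.wa_eq_mul_unit h2 hl hl'
  have h := diagRep_pair_unit (A := fun i => if i = k then u else v) h2 hkl (by simpa using hu)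
    (by simpa [hkl.symm] using hv) ht
  refine h.scale fun i hi => ⟨1, ?_⟩
  rw [Finset.mem_insert, Finset.mem_singleton] at hi
  rcases hi with rfl | rfl
  · simp [huk]
  · simp [hvl, hkl.symm]

lemma Adm.repAt_of_exact (hF : F.Adm D) {p : ℕ} [Fact p.Prime] (h2 : p ≠ 2) (hD : ¬ p ∣ D)
    {k l : Fin n} (hkl : k ≠ l) (hk : p ∣ F.a k) (hk' : ¬ p ^ 2 ∣ F.a k) (hl : p ∣ F.a l)
    (hl' : ¬ p ^ 2 ∣ F.a l) {N : ℤ} (h1 : (p : ℤ) ∣ 8 * D * N + F.disc D)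
    (h3 : ¬ (p : ℤ) ^ 2 ∣ 8 * D * N + F.disc D) : F.RepAt p N := by
  obtain ⟨t, ht⟩ := h1
  have htu : IsUnit (t : ℤ_[p]) := by
    rw [padicInt_isUnit_intCast]
    rintro ⟨s, rfl⟩
    exact h3 ⟨s, by rw [ht]; ring⟩
  refine hF.repAt_of_diagRep h2 hD (((hF.diagRep_of_exact h2 hkl hk hk' hl hl' htu).mono
    (Finset.subset_univ _)).of_eq ?_)
  have := congrArg (Int.cast : ℤ → ℤ_[p]) ht
  push_cast at this
  exact this.symm

/-- Among `v` and `v + p` in the vertex class, one gives a discriminant of exact order one. -/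
lemma exists_exact_disc {p : ℕ} (hp : p.Prime) (h2 : p ≠ 2) (hD : ¬ p ∣ D) {v : ℤ}
    (h : (p : ℤ) ∣ 8 * D * v + F.disc D) :
    ∃ N : ℤ, (N = v ∨ N = v + p) ∧ (p : ℤ) ∣ 8 * D * N + F.disc D ∧
      ¬ (p : ℤ) ^ 2 ∣ 8 * D * N + F.disc D := by
  by_cases h1 : (p : ℤ) ^ 2 ∣ 8 * D * v + F.disc D
  · refine ⟨v + p, Or.inr rfl, ?_, fun h3 => ?_⟩
    · rw [show 8 * (D : ℤ) * (v + p) + F.disc D = (8 * D * v + F.disc D) + 8 * D * p by ring]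
      exact dvd_add h (dvd_mul_left _ _)
    · have h4 : (p : ℤ) ^ 2 ∣ p * (2 * (2 * (2 * D))) := by
        rw [show (p : ℤ) * (2 * (2 * (2 * D))) =
          (8 * D * (v + p) + F.disc D) - (8 * D * v + F.disc D) by ring]
        exact dvd_sub h3 h1
      rw [sq] at h4
      have h5 := (mul_dvd_mul_iff_left (by exact_mod_cast hp.ne_zero : (p : ℤ) ≠ 0)).1 h4
      have h6 : p ∣ 2 * (2 * (2 * D)) := by exact_mod_cast h5
      exact not_dvd_two_mul hp h2 (not_dvd_two_mul hp h2 (not_dvd_two_mul hp h2 hD)) h6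
  · exact ⟨v, Or.inl rfl, h, h1⟩

/-- If coefficients divisible by `q` represent `q`, then one of them is `q` with level `1`. -/
lemma Adm.exists_eq_of_sum (hF : F.Adm D) {q : ℕ} (hq : 0 < q) {s : Finset (Fin n)}
    (hs : ∀ i ∈ s, q ∣ F.a i) {x : Fin n → ℤ} (hx : ∑ i ∈ s, F.tm i (x i) = q) :
    ∃ k ∈ s, F.a k = q ∧ F.r k = 1 := by
  obtain ⟨k, hk, hk0⟩ : ∃ k ∈ s, F.tm k (x k) ≠ 0 := by
    by_contra hcon
    push Not at hcon
    rw [Finset.sum_eq_zero hcon] at hx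
    omega
  have hle : F.tm k (x k) ≤ q := by
    rw [← hx]
    exact Finset.single_le_sum (f := fun i => F.tm i (x i)) (fun i _ => hF.tm_nonneg i _) hk
  have h0 := hF.tm_nonneg k (x k)
  obtain ⟨b, hb⟩ := hs k hk
  have hb0 : 0 < b := Nat.pos_of_ne_zero fun h => by have := hF.pos k; simp [hb, h] at this
  have hP0 := polyVal_nonneg (hF.lev_pos k) (hF.lev_lt k) (x k)
  have hbP : (b : ℤ) * polyVal (F.M k) (F.r k) (x k) = 1 := by
    have h1 : F.tm k (x k) = q * (b * polyVal (F.M k) (F.r k) (x k)) := by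
      unfold tm; rw [hb]; push_cast; ring
    rw [h1] at hle hk0
    have h2 : (b : ℤ) * polyVal (F.M k) (F.r k) (x k) ≠ 0 := right_ne_zero_of_mul hk0
    have h3 : 0 ≤ (b : ℤ) * polyVal (F.M k) (F.r k) (x k) := by positivity
    have h4 : (0 : ℤ) < q := by exact_mod_cast hq
    by_contra h5
    have h6 : 2 ≤ (b : ℤ) * polyVal (F.M k) (F.r k) (x k) := by omega
    nlinarith
  have hb1 : b = 1 := by
    exact_mod_cast Int.eq_one_of_mul_eq_one_right (by positivity) hbP
  have hP1 : polyVal (F.M k) (F.r k) (x k) = 1 := by rw [hb1] at hbP; simpa using hbP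
  refine ⟨k, hk, by rw [hb, hb1, mul_one], ?_⟩
  have := hF.lev_gap k
  by_cases hx0 : x k = 0
  · rw [hx0] at hP1; simp at hP1
  by_cases hx1 : x k = 1
  · rw [hx1] at hP1; simpa using hP1
  have := polyVal_ge (hF.lev_pos k) (hF.lev_lt k) hx0 hx1
  omega

/-- If coefficients divisible by `q` represent `q` and `2 q`, then two of them are `q` or `2 q`,
the first one with level `1`. -/
lemma Adm.exists_pair_of_sum (hF : F.Adm D) {q : ℕ} (hq : 0 < q) {s : Finset (Fin n)}
    (hs : ∀ i ∈ s, q ∣ F.a i) {x x' : Fin n → ℤ} (hx : ∑ i ∈ s, F.tm i (x i) = q)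
    (hx' : ∑ i ∈ s, F.tm i (x' i) = 2 * q) :
    ∃ k ∈ s, ∃ l ∈ s, k ≠ l ∧ F.a k = q ∧ F.r k = 1 ∧ (F.a l = q ∨ F.a l = 2 * q) ∧
      F.a l * F.r l ≤ 2 * q := by
  obtain ⟨k, hk, hka, hkr⟩ := hF.exists_eq_of_sum hq hs hx
  obtain ⟨l, hl, hl0, hlk⟩ : ∃ l ∈ s, F.tm l (x' l) ≠ 0 ∧ l ≠ k := by
    by_contra hcon
    push Not at hcon
    have hsum : ∑ i ∈ s, F.tm i (x' i) = F.tm k (x' k) := by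
      apply Finset.sum_eq_single_of_mem k hk
      intro j hj hjk
      by_contra h0
      exact hjk (hcon j hj h0)
    rw [hsum] at hx'
    unfold tm at hx'
    rw [hka, hkr, mul_comm] at hx'
    have hP := mul_right_cancel₀ (by exact_mod_cast hq.ne' : (q : ℤ) ≠ 0) hx'
    have h1 := hF.lev_gap k
    have h2 := hF.lev_lt k
    rw [hkr] at h1 h2
    by_cases hx0 : x' k = 0
    · rw [hx0] at hP; simp at hP
    by_cases hx1 : x' k = 1
    · rw [hx1] at hP; simp at hP
    have := polyVal_ge one_pos h2 hx0 hx1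
    omega
  have hle : F.tm l (x' l) ≤ 2 * q := by
    rw [← hx']
    exact Finset.single_le_sum (f := fun i => F.tm i (x' i)) (fun i _ => hF.tm_nonneg i _) hl
  obtain ⟨b, hb⟩ := hs l hl
  have hb0 : 0 < b := Nat.pos_of_ne_zero fun h => by have := hF.pos l; simp [hb, h] at this
  have hq' : (0 : ℤ) < q := by exact_mod_cast hq
  have hP1 : 1 ≤ polyVal (F.M l) (F.r l) (x' l) := by
    have := polyVal_nonneg (hF.lev_pos l) (hF.lev_lt l) (x' l)
    have h0 : polyVal (F.M l) (F.r l) (x' l) ≠ 0 := right_ne_zero_of_mul hl0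
    omega
  have hPr : (F.r l : ℤ) ≤ polyVal (F.M l) (F.r l) (x' l) := by
    by_cases hx0 : x' l = 0
    · rw [hx0] at hP1; simp at hP1
    by_cases hx1 : x' l = 1
    · rw [hx1]; simp
    have := polyVal_ge (hF.lev_pos l) (hF.lev_lt l) hx0 hx1
    have := hF.lev_lt l
    omega
  have hbP : (b : ℤ) * polyVal (F.M l) (F.r l) (x' l) ≤ 2 := by
    unfold tm at hle
    rw [hb] at hle
    push_cast at hle
    nlinarith
  have hb2 : b ≤ 2 := by
    have : (b : ℤ) ≤ 2 := by nlinarith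
    exact_mod_cast this
  refine ⟨k, hk, l, hl, hlk.symm, hka, hkr, ?_, ?_⟩
  · interval_cases b
    · left; rw [hb, mul_one]
    · right; rw [hb, mul_comm]
  · have h1 : ((F.a l * F.r l : ℕ) : ℤ) ≤ F.tm l (x' l) := by
      unfold tm; push_cast
      exact mul_le_mul_of_nonneg_left hPr (by positivity)
    have := h1.trans hle
    exact_mod_cast this

lemma exact_of_eq {q b : ℕ} (hq : 3 ≤ q) (hb : b = q ∨ b = 2 * q) : q ∣ b ∧ ¬ q ^ 2 ∣ b := by
  rcases hb with rfl | rfl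
  · exact ⟨dvd_rfl, fun h => by
      have := Nat.le_of_dvd (by omega) h
      nlinarith⟩
  · exact ⟨dvd_mul_left _ _, fun h => by
      have := Nat.le_of_dvd (by omega) h
      nlinarith⟩

end PForm

/-! ### Universality at primes at least five -/

instance fact_prime_five : Fact (Nat.Prime 5) := ⟨by norm_num⟩

namespace PForm

variable {n : ℕ} {D : ℕ} {F : PForm n}

lemma Adm.not_dvd_off_vertex (hF : F.Adm D) {p : ℕ} (hp : p.Prime) (h2 : p ≠ 2) (hD : ¬ p ∣ D)
    {i : Fin n} {z j : ℤ} (hz : (p : ℤ) ∣ 2 * F.M i * z - F.cc i) (hj : ¬ (p : ℤ) ∣ j) :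
    ¬ (p : ℤ) ∣ 2 * F.M i * (z + j) - F.cc i := by
  intro h
  have h2M : ¬ (p : ℤ) ∣ 2 * F.M i := by
    have := not_dvd_two_mul hp h2 (hF.not_dvd_M hD i)
    exact_mod_cast this
  have h3 : (p : ℤ) ∣ 2 * F.M i * j := by
    rw [show 2 * (F.M i : ℤ) * j = (2 * F.M i * (z + j) - F.cc i) - (2 * F.M i * z - F.cc i) by ring]
    exact dvd_sub h hz
  rcases (Nat.prime_iff_prime_int.1 hp).dvd_mul.1 h3 with h3 | h3
  exacts [h2M h3, hj h3]

lemma val_split_one (F : PForm n) [DecidableEq (Fin n)] (i : Fin n) (x : Fin n → ℤ) :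
    F.val x = F.tm i (x i) + ∑ j ∈ Finset.univ.erase i, F.tm j (x j) :=
  (Finset.add_sum_erase _ _ (Finset.mem_univ i)).symm

lemma val_split_two (F : PForm n) [DecidableEq (Fin n)] {i j : Fin n} (hij : i ≠ j)
    (x : Fin n → ℤ) :
    F.val x = F.tm i (x i) + F.tm j (x j) +
      ∑ k ∈ (Finset.univ.erase i).erase j, F.tm k (x k) := by
  rw [val_split_one F i, ← Finset.add_sum_erase _ _ (Finset.mem_erase.2
    ⟨hij.symm, Finset.mem_univ _⟩), add_assoc]

/-- In a vertex of every unit variable the discriminant is divisible by `p`. -/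
lemma Adm.dvd_disc_of_vertex (hF : F.Adm D) {p : ℕ} (hp : p.Prime) (h2 : p ≠ 2)
    {x : Fin n → ℤ} (hx : ∀ i, ¬ p ∣ F.a i → (p : ℤ) ∣ 2 * F.M i * x i - F.cc i) {v : ℤ}
    (hv : (p : ℤ) ∣ v - F.val x) : (p : ℤ) ∣ 8 * D * v + F.disc D := by
  have h := hF.complete_square_int (x := x) rfl
  rw [show 8 * (D : ℤ) * v + F.disc D =
    8 * D * (v - F.val x) + (8 * D * F.val x + F.disc D) by ring, ← h]
  refine dvd_add (hv.mul_left _) (Finset.dvd_sum fun i _ => ?_)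
  by_cases hi : p ∣ F.a i
  · exact Dvd.dvd.mul_right (by exact_mod_cast (hF.dvd_wa hp h2 i).2 hi) _
  · exact ((hx i hi).pow two_ne_zero).mul_left _

/-- The arguments at which a term is at most `2 q`. -/
lemma Adm.abs_le_of_tm_lt (hF : F.Adm D) {i : Fin n} {y : ℤ} {q : ℕ} (h : F.tm i y ≤ 2 * q) :
    y ∈ Finset.Icc (-((4 * q / 13 : ℕ) : ℤ)) ((4 * q / 13 : ℕ) + 1) := by
  have ha : (1 : ℤ) ≤ F.a i := by exact_mod_cast hF.pos i
  have hP0 := polyVal_nonneg (hF.lev_pos i) (hF.lev_lt i) y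
  have hP : polyVal (F.M i) (F.r i) y ≤ 2 * q := by
    unfold tm at h
    nlinarith
  have hd := polyDbl_eq_two_mul (F.M i) (F.r i) y
  unfold polyDbl at hd
  have hM : (12 : ℤ) ≤ F.M i := by exact_mod_cast hF.big i
  have hr : (0 : ℤ) < F.r i := by exact_mod_cast hF.lev_pos i
  have hrM : 2 * (F.r i : ℤ) < F.M i := by exact_mod_cast hF.lev_lt i
  have hu : 4 * (q : ℤ) < 13 * ((4 * q / 13 : ℕ) + 1) := by omega
  generalize ((4 * q / 13 : ℕ) : ℤ) = u at hu ⊢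
  generalize (F.M i : ℤ) = M at *
  generalize (F.r i : ℤ) = r at *
  rw [Finset.mem_Icc]
  constructor
  · by_contra hlt
    push Not at hlt
    by_cases hy : y < 0
    · have h1 : 1 ≤ -y := by omega
      have h3 : 12 * (-y) + 1 ≤ M * (-y) + (M - 2 * r) := by nlinarith
      have h4 : 13 * (-y) ≤ (-y) * (M * (-y) + (M - 2 * r)) := by nlinarith
      nlinarith
    · nlinarith
  · by_contra hlt
    push Not at hlt
    by_cases hy : 1 < y
    · have h3 : 12 * (y - 1) + 12 ≤ M * y := by nlinarith
      have h4 : 13 * (y - 1) ≤ (y - 1) * (M * y) := by nlinarith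
      nlinarith
    · nlinarith

/-- With a single unit coefficient, a value modulo `p` off the vertex is the residue of a value of
the unit term. -/
lemma Adm.exists_of_one_unit [DecidableEq (Fin n)] (hF : F.Adm D) {p : ℕ} [Fact p.Prime]
    (h2 : p ≠ 2) (hD : ¬ p ∣ D) (hglob : ∀ N : ℕ, F.RepAt p N → F.RepInt N) {i : Fin n}
    (hi : ¬ p ∣ F.a i) (hr : ∀ j, j ≠ i → p ∣ F.a j) {N z : ℤ} (hN0 : 0 ≤ N)
    (hN : (p : ℤ) ∣ N - F.tm i z) (hz : ¬ (p : ℤ) ∣ 2 * F.M i * z - F.cc i) :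
    ∃ x : Fin n → ℤ, F.tm i (x i) + ∑ j ∈ Finset.univ.erase i, F.tm j (x j) = N ∧
      0 ≤ ∑ j ∈ Finset.univ.erase i, F.tm j (x j) ∧
      (p : ℤ) ∣ ∑ j ∈ Finset.univ.erase i, F.tm j (x j) := by
  lift N to ℕ using hN0
  obtain ⟨x, hx⟩ := hglob N (by
    have := hF.repAt_of_congr h2 hD hi (x := Pi.single i z) (N := N)
      (by rwa [val_single]) (by simpa using hz)
    simpa using this)
  refine ⟨x, by rw [← val_split_one, hx], Finset.sum_nonneg fun j _ => hF.tm_nonneg j _,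
    Finset.dvd_sum fun j hj => dvd_tm (hr j (Finset.ne_of_mem_erase hj)) _⟩

/-- With a single unit coefficient, the unit term would have to take the `(p - 1) / 2` least
non-negative residues of its values off the vertex. It is quadratic with a large leading coefficient
and takes too few values below `p`. -/
lemma Adm.false_of_one_unit_seven_le (hF : F.Adm D) {p : ℕ} [Fact p.Prime]
    (h7 : 7 ≤ p) (hD : ¬ p ∣ D) (hglob : ∀ N : ℕ, F.RepAt p N → F.RepInt N) {i : Fin n}
    (hi : ¬ p ∣ F.a i) (hr : ∀ j, j ≠ i → p ∣ F.a j) : False := by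
  classical
  have hp : p.Prime := Fact.out
  have h2 : p ≠ 2 := by omega
  obtain ⟨q, hq⟩ := hp.odd_of_ne_two h2
  have hq4 : q ≠ 4 := by
    rintro rfl
    rw [hq] at hp
    norm_num at hp
  obtain ⟨z, hz⟩ := hF.exists_vertex hp h2 hD i
  have hnd : ∀ j : ℤ, 0 < j → j < p → ¬ (p : ℤ) ∣ j := fun j h0 h1 h => by
    have := Int.le_of_dvd h0 h
    omega
  have hp0 : (0 : ℤ) < p := by exact_mod_cast hp.pos
  have key : ∀ j ∈ Finset.Icc (1 : ℤ) q, ∃ y : ℤ, F.tm i y = F.tm i (z + j) % p := fun j hj => by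
    rw [Finset.mem_Icc] at hj
    have hmod := Int.emod_lt_of_pos (F.tm i (z + j)) hp0
    obtain ⟨x, h1, h3, R, h4⟩ := hF.exists_of_one_unit h2 hD hglob hi hr
      (N := F.tm i (z + j) % p) (z := z + j) (Int.emod_nonneg _ hp0.ne')
      (by rw [← Int.emod_add_mul_ediv (F.tm i (z + j)) p]; simp)
      (hF.not_dvd_off_vertex hp h2 hD hz (hnd j (by omega) (by omega)))
    rw [h4] at h1 h3
    have h5 := hF.tm_nonneg i (x i)
    have hR : R = 0 := by
      have h6 : (p : ℤ) * R < p := by linarith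
      have h7 : R < 1 := by nlinarith
      have h8 : 0 ≤ R := by nlinarith
      omega
    exact ⟨x i, by rw [hR] at h1; linarith⟩
  choose! y hy using key
  have hmaps : Set.MapsTo y (Finset.Icc (1 : ℤ) q)
      (Finset.Icc (-((4 * q / 13 : ℕ) : ℤ)) ((4 * q / 13 : ℕ) + 1)) := fun j hj => by
    apply hF.abs_le_of_tm_lt (i := i)
    rw [hy j hj]
    have := Int.emod_lt_of_pos (F.tm i (z + j)) hp0
    omega
  have hinj : Set.InjOn y (Finset.Icc (1 : ℤ) q) := fun j hj k hk hjk => by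
    by_contra hne
    have e : F.tm i (z + j) % p = F.tm i (z + k) % p := by rw [← hy j hj, ← hy k hk, hjk]
    rw [Finset.coe_Icc, Set.mem_Icc] at hj hk
    have hd : (p : ℤ) ∣ F.tm i (z + j) - F.tm i (z + k) := Int.ModEq.dvd (Eq.symm e)
    refine hF.not_dvd_tm_sub hp h2 hD hi hz (fun h => ?_) (hnd _ (by omega) (by omega)) hd
    rcases lt_or_gt_of_ne hne with hlt | hlt
    · exact hnd (k - j) (by omega) (by omega) (by rw [← neg_sub]; exact h.neg_right)
    · exact hnd _ (by omega) (by omega) h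
  have hcard := Finset.card_le_card_of_injOn y hmaps hinj
  simp only [Int.card_Icc] at hcard
  obtain rfl | rfl | h6 : q = 3 ∨ q = 5 ∨ 6 ≤ q := by omega
  all_goals omega

/-- With two unit coefficients forming an anisotropic form, every class except that of the vertex
is represented. -/
lemma Adm.exists_of_two_units [DecidableEq (Fin n)] (hF : F.Adm D) {p : ℕ} [Fact p.Prime]
    (h2 : p ≠ 2) (hD : ¬ p ∣ D) (hglob : ∀ N : ℕ, F.RepAt p N → F.RepInt N) {i j : Fin n}
    (hij : i ≠ j) (hi : ¬ p ∣ F.a i) (hj : ¬ p ∣ F.a j)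
    (hr : ∀ k, k ≠ i → k ≠ j → p ∣ F.a k) {N : ℤ} (hN0 : 0 ≤ N)
    (hN : ¬ (p : ℤ) ∣ 8 * D * N + F.disc D) :
    ∃ x : Fin n → ℤ, F.tm i (x i) + F.tm j (x j) +
        ∑ k ∈ (Finset.univ.erase i).erase j, F.tm k (x k) = N ∧
      0 ≤ ∑ k ∈ (Finset.univ.erase i).erase j, F.tm k (x k) ∧
      (p : ℤ) ∣ ∑ k ∈ (Finset.univ.erase i).erase j, F.tm k (x k) := by
  lift N to ℕ using hN0
  obtain ⟨x, hx⟩ := hglob N (by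
    apply hF.repAt_of_diagRep h2 hD
    refine DiagRep.mono (diagRep_pair_unit h2 hij (hF.isUnit_wa h2 hi) (hF.isUnit_wa h2 hj) ?_)
      (Finset.subset_univ _)
    rw [← padicInt_isUnit_intCast] at hN
    push_cast at hN
    exact hN)
  refine ⟨x, by rw [← val_split_two F hij, hx], Finset.sum_nonneg fun j _ => hF.tm_nonneg j _,
    Finset.dvd_sum fun k hk => dvd_tm (hr k (Finset.ne_of_mem_erase (Finset.mem_of_mem_erase hk))
      (Finset.ne_of_mem_erase hk)) _⟩

/-- The residue class modulo `p` of the numbers represented at the vertex. -/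
lemma exists_class {p : ℕ} (hp : p.Prime) (h2 : p ≠ 2) (hD : ¬ p ∣ D) :
    ∃ v : ℤ, 0 ≤ v ∧ v < p ∧ ∀ N : ℤ, (p : ℤ) ∣ 8 * D * N + F.disc D ↔ (p : ℤ) ∣ N - v := by
  have hpi : Prime (p : ℤ) := Nat.prime_iff_prime_int.1 hp
  have h8 : ¬ p ∣ 2 * (2 * (2 * D)) :=
    not_dvd_two_mul hp h2 (not_dvd_two_mul hp h2 (not_dvd_two_mul hp h2 hD))
  obtain ⟨u, w, huw⟩ := Nat.isCoprime_iff_coprime.2 ((Nat.Prime.coprime_iff_not_dvd hp).2 h8)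
  push_cast at huw
  have hp0 : (0 : ℤ) < p := by exact_mod_cast hp.pos
  refine ⟨(-w * F.disc D) % p, Int.emod_nonneg _ hp0.ne', Int.emod_lt_of_pos _ hp0, fun N => ?_⟩
  have h3 : (p : ℤ) ∣ -w * F.disc D - (-w * F.disc D) % p := Int.dvd_self_sub_emod
  have h4 : (p : ℤ) ∣ 8 * D * N + F.disc D ↔ (p : ℤ) ∣ N - (-w * F.disc D) := by
    have e : 8 * D * N + F.disc D = 2 * (2 * (2 * (D : ℤ))) * (N - (-w * F.disc D))
        + p * (u * F.disc D) := by
      linear_combination -F.disc D * huw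
    rw [e, dvd_add_left (dvd_mul_right _ _), hpi.dvd_mul]
    constructor
    · rintro (h | h)
      · exact absurd (by exact_mod_cast h) h8
      · exact h
    · exact Or.inr
  rw [h4, show N - (-w * F.disc D) % p =
    (N - (-w * F.disc D)) + (-w * F.disc D - (-w * F.disc D) % p) by ring, dvd_add_left h3]

/-- With two unit coefficients, all numbers below `7` except one are sums of the values at `1` of the
two unit terms, which leaves at most five numbers. -/
lemma Adm.false_of_two_units_seven_le (hF : F.Adm D) {p : ℕ} [Fact p.Prime]
    (h7 : 7 ≤ p) (hD : ¬ p ∣ D) (hglob : ∀ N : ℕ, F.RepAt p N → F.RepInt N) {i j : Fin n}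
    (hij : i ≠ j) (hi : ¬ p ∣ F.a i) (hj : ¬ p ∣ F.a j)
    (hr : ∀ k, k ≠ i → k ≠ j → p ∣ F.a k) : False := by
  classical
  have hp : p.Prime := Fact.out
  have h2 : p ≠ 2 := by omega
  obtain ⟨v, hv0, hvp, hv⟩ := exists_class (F := F) hp h2 hD
  have hsub : Finset.Icc (0 : ℤ) 6 ⊆ {v, 0, ((F.a i * F.r i : ℕ) : ℤ), ((F.a j * F.r j : ℕ) : ℤ),
      ((F.a i * F.r i : ℕ) : ℤ) + (F.a j * F.r j : ℕ)} := by
    intro N hN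
    rw [Finset.mem_Icc] at hN
    simp only [Finset.mem_insert, Finset.mem_singleton]
    by_cases hNv : N = v
    · exact Or.inl hNv
    right
    have hnd : ¬ (p : ℤ) ∣ 8 * D * N + F.disc D := fun h => by
      obtain ⟨c, hc⟩ := (hv N).1 h
      have : c < 1 := by nlinarith
      have : -1 < c := by nlinarith
      have : c = 0 := by omega
      rw [this] at hc
      omega
    obtain ⟨x, h1, h3, R, h4⟩ := hF.exists_of_two_units h2 hD hglob hij hi hj hr hN.1 hnd
    rw [h4] at h1 h3
    have h5 := hF.tm_nonneg i (x i)
    have h6 := hF.tm_nonneg j (x j)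
    have hR : R = 0 := by
      have h6 : (p : ℤ) * R < p := by omega
      have h7 : R < 1 := by nlinarith
      have h8 : 0 ≤ R := by nlinarith
      omega
    rw [hR] at h1
    have h8 := hF.tm_cases_lt i (z := x i) (by omega)
    have h9 := hF.tm_cases_lt j (z := x j) (by omega)
    omega
  have h3 := (Finset.card_le_card hsub).trans Finset.card_le_five
  simp at h3

lemma Adm.lev_of_twelve (hF : F.Adm D) (i : Fin n) (h : F.M i = 12) : F.r i = 1 ∨ F.r i = 5 := by
  have h1 := hF.lev_pos i
  have h2 := hF.lev_lt i
  have h3 : F.r i < 6 := by omega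
  have hcop := hF.cop i
  rw [h] at hcop
  interval_cases F.r i
  · exact Or.inl rfl
  · exact absurd hcop (by decide)
  · exact absurd hcop (by decide)
  · exact absurd hcop (by decide)
  · exact Or.inr rfl

lemma Adm.tm_cases_of_le_three (hF : F.Adm D) (i : Fin n) {z : ℤ} (h : F.tm i z ≤ 13)
    (h3 : F.a i * F.r i ≤ 3) : F.tm i z = 0 ∨ F.tm i z = (F.a i * F.r i : ℕ) ∨
      (F.tm i z = 10 ∧ F.a i = 1 ∧ F.M i = 13 ∧ F.r i = 3 ∧ F.a i * F.r i = 3) ∨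
      (11 ≤ F.tm i z ∧ F.tm i z = (F.M i : ℤ) - F.r i ∧ F.a i * F.r i = F.r i) := by
  have h12 := hF.lev_of_twelve i
  have hb := hF.big i
  rcases hF.tm_cases i h with h' | h' | ⟨h1, h2, h'⟩ <;> omega

/-- For `p = 5` the small values leave a few possibilities. In these the numbers `5` and `10` (or
`13`) provide two further coefficients of exact order one at `5`, so that some `N` in the vertex
class is represented over `ℤ_5`; but the class contains no small value of the form. -/
lemma Adm.false_of_one_unit_five (hF : F.Adm D) (hD : ¬ 5 ∣ D)
    (hglob : ∀ N : ℕ, F.RepAt 5 N → F.RepInt N) {i : Fin n}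
    (hi : ¬ 5 ∣ F.a i) (hr : ∀ j, j ≠ i → 5 ∣ F.a j) : False := by
  classical
  have hp : Nat.Prime 5 := by norm_num
  obtain ⟨z, hz⟩ := hF.exists_vertex hp (by norm_num) hD i
  have hz' := fun j => hF.not_dvd_off_vertex (j := j) hp (by norm_num) hD hz
  have hne := fun j k => hF.not_dvd_tm_sub (j := j) (k := k) hp (by norm_num) hD hi hz
  have key := fun N y => hF.exists_of_one_unit (N := N) (z := y) (by norm_num) hD hglob hi hr
  have hlev := hF.lev_gap i
  have hlt := hF.lev_lt i
  have hbig := hF.big i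
  have hcop := hF.cop i
  have hne10 := hne 1 0 (by norm_num) (by norm_num)
  have hne20 := hne 2 0 (by norm_num) (by norm_num)
  have hne12 := hne 1 2 (by norm_num) (by norm_num)
  have hz1 := hz' 1 (by norm_num)
  have hz2 := hz' 2 (by norm_num)
  rw [add_zero] at hne10 hne20
  have hT : ((5 : ℕ) : ℤ) ∣ 8 * D * (F.tm i z % 5) + F.disc D := by
    refine hF.dvd_disc_of_vertex hp (by norm_num) (x := Pi.single i z) (fun j hj => ?_) ?_
    · have : j = i := by
        by_contra h
        exact hj (hr j h)
      subst this
      simpa using hz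
    · rw [val_single]; omega
  generalize hT0 : F.tm i z = t₀ at *
  generalize hT1 : F.tm i (z + 1) = t₁ at *
  generalize hT2 : F.tm i (z + 2) = t₂ at *
  obtain ⟨x₁, e1, f1, g1⟩ := key (t₁ % 5) (z + 1) (by omega) (by rw [hT1]; omega) hz1
  obtain ⟨x₂, e2, f2, g2⟩ := key (t₂ % 5) (z + 2) (by omega) (by rw [hT2]; omega) hz2
  have c1 := hF.tm_cases_lt i (z := x₁ i) (by omega)
  have c2 := hF.tm_cases_lt i (z := x₂ i) (by omega)
  have n1 := hF.tm_nonneg i (x₁ i)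
  have n2 := hF.tm_nonneg i (x₂ i)
  -- the two classes off the vertex are `0` and the value at `1`
  have hα : (t₁ % 5 = 0 ∧ t₂ % 5 = (F.a i * F.r i : ℕ)) ∨
      (t₂ % 5 = 0 ∧ t₁ % 5 = (F.a i * F.r i : ℕ)) := by omega
  have key' : ∀ N : ℤ, 0 ≤ N → (N % 5 = 0 ∨ N % 5 = (F.a i * F.r i : ℕ)) →
      ∃ x : Fin n → ℤ, F.tm i (x i) + ∑ j ∈ Finset.univ.erase i, F.tm j (x j) = N ∧
      0 ≤ ∑ j ∈ Finset.univ.erase i, F.tm j (x j) ∧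
      ((5 : ℕ) : ℤ) ∣ ∑ j ∈ Finset.univ.erase i, F.tm j (x j) := by
    intro N h0 hN
    have : N % 5 = t₁ % 5 ∨ N % 5 = t₂ % 5 := by omega
    rcases this with h | h
    · exact key N (z + 1) h0 (by rw [hT1]; omega) hz1
    · exact key N (z + 2) h0 (by rw [hT2]; omega) hz2
  have hα5 : F.a i * F.r i < 5 := by omega
  have hv : t₀ % 5 ≠ 0 ∧ t₀ % 5 ≠ (F.a i * F.r i : ℕ) := by omega
  have hv5 : 0 ≤ t₀ % 5 ∧ t₀ % 5 < 5 := by omega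
  have hα0 : F.a i * F.r i ≠ 0 := (Nat.mul_pos (hF.pos i) (hF.lev_pos i)).ne'
  generalize t₀ % 5 = v at *
  clear hα key c1 c2 n1 n2 e1 e2 f1 f2 g1 g2 hne10 hne20 hne12 hz1 hz2 hT1 hT2 hz hz' hne hi
  have hαr : F.a i = 1 → F.a i * F.r i = F.r i := fun h => by rw [h, one_mul]
  have h12 := hF.lev_of_twelve i
  have h14 : F.M i = 14 → F.r i ≠ 4 := fun h h' => by
    have := hF.cop i
    rw [h, h'] at this
    revert this
    decide
  obtain ⟨x₅, e5, f5, g5⟩ := key' 5 (by norm_num) (by omega)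
  have hs5 : ∑ j ∈ Finset.univ.erase i, F.tm j (x₅ j) = (5 : ℕ) := by
    have n5 := hF.tm_nonneg i (x₅ i)
    have c5 := hF.tm_cases_lt i (z := x₅ i) (by omega)
    omega
  obtain ⟨x₆, hs10⟩ : ∃ x : Fin n → ℤ, ∑ j ∈ Finset.univ.erase i, F.tm j (x j) = 2 * (5 : ℕ) := by
    obtain ⟨x, e, f, g⟩ := key' 10 (by norm_num) (by omega)
    have n5 := hF.tm_nonneg i (x i)
    have c5 := hF.tm_cases i (z := x i) (by omega)
    -- With modulus `13` and level `3` the value at `-1` is `10`, and `13` is used instead.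
    by_cases hM : F.a i = 1 ∧ F.M i = 13 ∧ F.r i = 3
    · have hα3 : F.a i * F.r i = 3 := by rw [hM.1, hM.2.2]
      clear e f g n5 c5
      obtain ⟨x, e, f, g⟩ := key' 13 (by norm_num) (by omega)
      have n5 := hF.tm_nonneg i (x i)
      have c5 := hF.tm_cases i (z := x i) (by omega)
      exact ⟨x, by rcases c5 with c5 | c5 | c5 <;> omega⟩
    · exact ⟨x, by rcases c5 with c5 | c5 | c5 <;> omega⟩
  obtain ⟨k, hk, l, hl, hkl, hka, -, hla, -⟩ := hF.exists_pair_of_sum (by norm_num)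
    (fun j hj => hr j (Finset.ne_of_mem_erase hj)) hs5 hs10
  have hk5 := exact_of_eq (by norm_num) (Or.inl hka : F.a k = 5 ∨ F.a k = 2 * 5)
  have hl5 := exact_of_eq (by norm_num) hla
  -- A number in the vertex class that is represented over `ℤ_5` but not over `ℤ`.
  obtain ⟨N, hN, hN1, hN2⟩ := exists_exact_disc hp (by norm_num) hD hT
  have hN0 : 0 ≤ N := by omega
  lift N to ℕ using hN0
  obtain ⟨x, hx⟩ := hglob N (by
    have := hF.repAt_of_exact (by norm_num) hD hkl hk5.1 hk5.2 hl5.1 hl5.2 hN1 hN2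
    simpa using this)
  rw [val_split_one F i] at hx
  have f : 0 ≤ ∑ j ∈ Finset.univ.erase i, F.tm j (x j) :=
    Finset.sum_nonneg fun j _ => hF.tm_nonneg j _
  have g : ((5 : ℕ) : ℤ) ∣ ∑ j ∈ Finset.univ.erase i, F.tm j (x j) :=
    Finset.dvd_sum fun j hj => dvd_tm (hr j (Finset.ne_of_mem_erase hj)) _
  have n5 := hF.tm_nonneg i (x i)
  have c5 := hF.tm_cases i (z := x i) (by omega)
  clear key' hs5 hs10 e5 hN1 hN2
  rcases c5 with c5 | c5 | c5 <;> omega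

/-- The analogue of `Adm.false_of_one_unit_five` for two unit coefficients. -/
lemma Adm.false_of_two_units_five (hF : F.Adm D) (hD : ¬ 5 ∣ D)
    (hglob : ∀ N : ℕ, F.RepAt 5 N → F.RepInt N) {i j : Fin n}
    (hij : i ≠ j) (hi : ¬ 5 ∣ F.a i) (hj : ¬ 5 ∣ F.a j)
    (hr : ∀ k, k ≠ i → k ≠ j → 5 ∣ F.a k) : False := by
  classical
  have hp : Nat.Prime 5 := by norm_num
  obtain ⟨v, hv0, hv5, hv⟩ := exists_class (F := F) hp (by norm_num) hD
  have key : ∀ N : ℤ, 0 ≤ N → ¬ N % 5 = v →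
    ∃ x : Fin n → ℤ, F.tm i (x i) + F.tm j (x j) +
        ∑ k ∈ (Finset.univ.erase i).erase j, F.tm k (x k) = N ∧
      0 ≤ ∑ k ∈ (Finset.univ.erase i).erase j, F.tm k (x k) ∧
      ((5 : ℕ) : ℤ) ∣ ∑ k ∈ (Finset.univ.erase i).erase j, F.tm k (x k) := fun N h0 h1 =>
    hF.exists_of_two_units (by norm_num) hD hglob hij hi hj hr h0 (by rw [hv]; push_cast; omega)
  have hα : F.a i * F.r i ≠ 0 := (Nat.mul_pos (hF.pos i) (hF.lev_pos i)).ne'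
  have hβ : F.a j * F.r j ≠ 0 := (Nat.mul_pos (hF.pos j) (hF.lev_pos j)).ne'
  have key5 : ∀ N : ℤ, 0 ≤ N → N < 5 → N ≠ v → N = 0 ∨ N = (F.a i * F.r i : ℕ) ∨
      N = (F.a j * F.r j : ℕ) ∨ N = ((F.a i * F.r i : ℕ) : ℤ) + (F.a j * F.r j : ℕ) := by
    intro N h0 h5 hNv
    obtain ⟨x, e, f, g⟩ := key N h0 (by omega)
    have n1 := hF.tm_nonneg i (x i)
    have n2 := hF.tm_nonneg j (x j)
    have c1 := hF.tm_cases_lt i (z := x i) (by omega)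
    have c2 := hF.tm_cases_lt j (z := x j) (by omega)
    omega
  -- `0`, the two values at `1` and their sum cover all numbers below `5` except `v`.
  have hcases : (v = 4 ∧ (F.a i * F.r i = 1 ∧ F.a j * F.r j = 2 ∨
        F.a i * F.r i = 2 ∧ F.a j * F.r j = 1)) ∨
      (v = 2 ∧ (F.a i * F.r i = 1 ∧ F.a j * F.r j = 3 ∨
        F.a i * F.r i = 3 ∧ F.a j * F.r j = 1)) := by
    have k0 := key5 0
    have k1 := key5 1
    have k2 := key5 2
    have k3 := key5 3
    have k4 := key5 4
    generalize F.a i * F.r i = α at *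
    generalize F.a j * F.r j = β at *
    clear key key5 hv
    have hα5 : α < 5 := by omega
    have hβ5 : β < 5 := by omega
    interval_cases α <;> interval_cases β <;> omega
  have hα3 : F.a i * F.r i ≤ 3 := by omega
  have hβ3 : F.a j * F.r j ≤ 3 := by omega
  have hlev := hF.lev_gap i
  have hbig := hF.big i
  have hlevj := hF.lev_gap j
  have hbigj := hF.big j
  have hMi := hF.modulus i
  have hMj := hF.modulus j
  obtain ⟨x₅, e5, f5, g5⟩ := key 5 (by norm_num) (by omega)
  have hs5 : ∑ k ∈ (Finset.univ.erase i).erase j, F.tm k (x₅ k) = (5 : ℕ) := by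
    have n1 := hF.tm_nonneg i (x₅ i)
    have n2 := hF.tm_nonneg j (x₅ j)
    have c1 := hF.tm_cases_lt i (z := x₅ i) (by omega)
    have c2 := hF.tm_cases_lt j (z := x₅ j) (by omega)
    omega
  obtain ⟨x₆, hs10⟩ : ∃ x : Fin n → ℤ,
      ∑ k ∈ (Finset.univ.erase i).erase j, F.tm k (x k) = 2 * (5 : ℕ) := by
    clear key5 e5 f5 g5 hs5
    -- With modulus `13` and level `3` the value at `-1` is `10`, and `13` is used instead.
    by_cases hM : v = 2 ∧ (F.M i = 13 ∨ F.M j = 13)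
    · obtain ⟨x, e, f, g⟩ := key 13 (by norm_num) (by omega)
      have n1 := hF.tm_nonneg i (x i)
      have n2 := hF.tm_nonneg j (x j)
      have c1 := hF.tm_cases_of_le_three i (z := x i) (by omega) hα3
      have c2 := hF.tm_cases_of_le_three j (z := x j) (by omega) hβ3
      refine ⟨x, ?_⟩
      clear key hv hi hj
      generalize ∑ k ∈ (Finset.univ.erase i).erase j, F.tm k (x k) = S at *
      rcases c1 with c1 | c1 | c1 | c1 <;> rcases c2 with c2 | c2 | c2 | c2 <;> omega
    · obtain ⟨x, e, f, g⟩ := key 10 (by norm_num) (by omega)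
      have n1 := hF.tm_nonneg i (x i)
      have n2 := hF.tm_nonneg j (x j)
      have c1 := hF.tm_cases_of_le_three i (z := x i) (by omega) hα3
      have c2 := hF.tm_cases_of_le_three j (z := x j) (by omega) hβ3
      refine ⟨x, ?_⟩
      clear key hv hi hj
      generalize ∑ k ∈ (Finset.univ.erase i).erase j, F.tm k (x k) = S at *
      rcases c1 with c1 | c1 | c1 | c1 <;> rcases c2 with c2 | c2 | c2 | c2 <;> omega
  have hr' : ∀ k ∈ (Finset.univ.erase i).erase j, 5 ∣ F.a k := fun k hk =>
    hr k (Finset.ne_of_mem_erase (Finset.mem_of_mem_erase hk)) (Finset.ne_of_mem_erase hk)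
  obtain ⟨k, hk, l, hl, hkl, hka, -, hla, -⟩ := hF.exists_pair_of_sum (by norm_num) hr' hs5 hs10
  have hk5 := exact_of_eq (by norm_num) (Or.inl hka : F.a k = 5 ∨ F.a k = 2 * 5)
  have hl5 := exact_of_eq (by norm_num) hla
  -- A number in the vertex class that is represented over `ℤ_5` but not over `ℤ`.
  obtain ⟨N, hN, hN1, hN2⟩ := exists_exact_disc hp (by norm_num) hD ((hv v).2 (by simp))
  have hN0 : 0 ≤ N := by omega
  lift N to ℕ using hN0
  obtain ⟨x, hx⟩ := hglob N (by
    have := hF.repAt_of_exact (by norm_num) hD hkl hk5.1 hk5.2 hl5.1 hl5.2 hN1 hN2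
    simpa using this)
  rw [val_split_two F hij] at hx
  have f : 0 ≤ ∑ k ∈ (Finset.univ.erase i).erase j, F.tm k (x k) :=
    Finset.sum_nonneg fun j _ => hF.tm_nonneg j _
  have g : ((5 : ℕ) : ℤ) ∣ ∑ k ∈ (Finset.univ.erase i).erase j, F.tm k (x k) :=
    Finset.dvd_sum fun k hk => dvd_tm (hr' k hk) _
  have n1 := hF.tm_nonneg i (x i)
  have n2 := hF.tm_nonneg j (x j)
  have c1 := hF.tm_cases_of_le_three i (z := x i) (by omega) hα3
  have c2 := hF.tm_cases_of_le_three j (z := x j) (by omega) hβ3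
  clear key key5 hv hi hj e5 hs5 hs10 hN1 hN2
  generalize ∑ k ∈ (Finset.univ.erase i).erase j, F.tm k (x k) = S at *
  rcases c1 with c1 | c1 | c1 | c1 <;> rcases c2 with c2 | c2 | c2 | c2 <;> omega

/-- A regular form universal at `2` is universal at all primes at least `5`: otherwise it misses
one of the first few integers that it should represent. -/
theorem Adm.univAt_of_five_le (hF : F.Adm D) (hn : 4 ≤ n) (hreg : F.Regular) (hu : F.UnivAt 2)
    {p : ℕ} [Fact p.Prime] (h5 : 5 ≤ p) : F.UnivAt p := by
  have hp : p.Prime := Fact.out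
  obtain ⟨G, hG, hGr, -, hGu, hGT, -⟩ := hF.exists_univAt_outside hn {p} hreg
  rw [hGT p (Or.inr rfl)]
  by_contra hbad
  have h2 : p ≠ 2 := by omega
  have hD : ¬ p ∣ D := fun hD => hbad (hG.univAt_of_dvd h2 hD)
  have hglob : ∀ N : ℕ, G.RepAt p N → G.RepInt N := fun N hN => hGr N fun q _ => by
    by_cases hq2 : q = 2
    · subst hq2
      exact (hGT 2 (Or.inl rfl)).1 hu _
    · by_cases hqp : q = p
      · subst hqp
        exact hN
      · exact hGu q hq2 hqp _
  have h57 : p = 5 ∨ 7 ≤ p := by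
    have : p ≠ 6 := by rintro rfl; revert hp; decide
    omega
  rcases h57 with rfl | h7
  · rcases hG.bad_cases h2 hD hbad with ⟨i, hi, hr⟩ | ⟨i, j, hij, hi, hj, hr, -, -⟩
    · exact hG.false_of_one_unit_five hD hglob hi hr
    · exact hG.false_of_two_units_five hD hglob hij hi hj hr
  · rcases hG.bad_cases h2 hD hbad with ⟨i, hi, hr⟩ | ⟨i, j, hij, hi, hj, hr, -, -⟩
    · exact hG.false_of_one_unit_seven_le h7 hD hglob hi hr
    · exact hG.false_of_two_units_seven_le h7 hD hglob hij hi hj hr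

end PForm

/-! ### Diagonal forms over the `2`-adic integers -/

section TwoAdic

variable {ι : Type*} {a : ι → ℕ} {s : Finset ι} {n : ℤ}

/-- The diagonal form with natural coefficients `a i`, `i ∈ s`, represents the integer `n` over
`ℤ_2`. -/
def TwoRep (a : ι → ℕ) (s : Finset ι) (n : ℤ) : Prop :=
  DiagRep (fun i => (a i : ℤ_[2])) s (n : ℤ_[2])

namespace TwoRep

lemma mono [DecidableEq ι] {s' : Finset ι} (h : TwoRep a s n) (hs : s ⊆ s') : TwoRep a s' n := DiagRep.mono h hs

lemma cons [DecidableEq ι] {i : ι} (hi : i ∉ s) (z : ℤ) (h : TwoRep a s (n - a i * z ^ 2)) :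
    TwoRep a (insert i s) n :=
  DiagRep.cons hi (z : ℤ_[2]) (DiagRep.of_eq h (by push_cast; rfl))

lemma cons_one [DecidableEq ι] {i : ι} (hi : i ∉ s) (h : TwoRep a s (n - a i)) : TwoRep a (insert i s) n :=
  h.elim fun y hy => cons hi 1 ⟨y, by rw [hy]; push_cast; ring⟩

lemma four_mul (h : TwoRep a s n) : TwoRep a s (4 * n) :=
  DiagRep.of_eq (DiagRep.sq_mul h 2) (by push_cast; ring)

lemma of_four_dvd (h4 : 4 ∣ n) (h : TwoRep a s (n / 4)) : TwoRep a s n := by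
  have := h.four_mul
  rwa [Int.mul_ediv_cancel' h4] at this

/-- Multiplying a represented number by a square unit. -/
lemma of_unit_sq {m : ℤ} {t : ℤ_[2]} (h : DiagRep (fun i => (a i : ℤ_[2])) s (m : ℤ_[2])) {w : ℤ_[2]}
    (ht : t = m * (1 + 8 * w)) : DiagRep (fun i => (a i : ℤ_[2])) s t := by
  obtain ⟨y, hy⟩ := exists_sq_of_eight_dvd (u := 1 + 8 * w) ⟨w, by ring⟩
  exact (h.sq_mul y).of_eq (by rw [hy, ht]; ring)

lemma isUnit_of_odd {m : ℤ} (h : m % 2 = 1) : IsUnit (m : ℤ_[2]) := by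
  rw [padicInt_isUnit_intCast]
  push_cast
  omega

/-- Integers with the same odd part modulo `8` and the same power of `2` are represented
simultaneously. -/
lemma congr {m : ℤ} (j : ℕ) (hm : m % 2 = 1) (h : TwoRep a s (2 ^ j * m))
    (hn : 2 ^ (j + 3) ∣ n - 2 ^ j * m) : TwoRep a s n := by
  obtain ⟨z, hz⟩ := hn
  obtain ⟨b, hb⟩ := (isUnit_of_odd hm).exists_right_inv
  have hz' := congrArg (Int.cast : ℤ → ℤ_[2]) hz
  push_cast at hz'
  exact of_unit_sq (w := b * z) h (by
    push_cast
    linear_combination hz' - 8 * 2 ^ j * z * hb)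

lemma congr_odd {m : ℤ} (hm : m % 2 = 1) (h : TwoRep a s m) (hn : n % 8 = m % 8) :
    TwoRep a s n :=
  congr 0 hm (by simpa using h) (by norm_num; omega)

lemma self (i : ι) : TwoRep a {i} (a i) := by
  have := DiagRep.single (A := fun i => (a i : ℤ_[2])) i 1
  exact this.of_eq (by simp)

lemma single_odd {i : ι} (hi : a i % 2 = 1) (hn : n % 8 = a i % 8) : TwoRep a {i} n :=
  congr_odd (by omega) (self i) hn

lemma single_two {i : ι} (hi : a i % 4 = 2) (hn : n % 16 = a i % 16) : TwoRep a {i} n := by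
  have h := self (a := a) i
  have e : (a i : ℤ) = 2 ^ 1 * (a i / 2 : ℤ) := by omega
  rw [e] at h
  exact congr 1 (by omega) h (by norm_num; omega)

/-- Two odd coefficients represent all odd numbers congruent to one of them modulo `4`. -/
lemma pair_odd [DecidableEq ι] {i j : ι} (hij : i ≠ j) (hi : a i % 2 = 1) (hj : a j % 2 = 1)
    (hn : n % 4 = a i % 4) : TwoRep a {i, j} n := by
  by_cases h8 : n % 8 = a i % 8
  · exact (single_odd hi h8).mono (by simp)
  · rw [Finset.pair_comm]
    exact cons (by simpa using hij.symm) 2 (single_odd hi (by omega))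

lemma pair_sum [DecidableEq ι] {i j : ι} (hij : i ≠ j) (hi : a i % 2 = 1)
    (hn : n % 8 = (a i + a j) % 8) : TwoRep a {i, j} n := by
  rw [Finset.pair_comm]
  exact cons_one (by simpa using hij.symm) (single_odd hi (by omega))

lemma pair_odd_all [DecidableEq ι] {i j : ι} (hij : i ≠ j) (hi : a i % 2 = 1)
    (hs : (a i + a j) % 4 = 0) (hn : n % 2 = 1) : TwoRep a {i, j} n := by
  by_cases h : n % 4 = a i % 4
  · exact pair_odd hij hi (by omega) h
  · rw [Finset.pair_comm]
    exact pair_odd hij.symm (by omega) hi (by omega)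

/-- A diagonal form representing all integers not divisible by `4` is universal. -/
lemma univ (h : ∀ n : ℤ, ¬ 4 ∣ n → TwoRep a s n) (t : ℤ_[2]) :
    DiagRep (fun i => (a i : ℤ_[2])) s t := by
  have key : ∀ u : ℤ_[2], IsUnit u → ∀ j : ℕ, j ≤ 1 →
      DiagRep (fun i => (a i : ℤ_[2])) s (2 ^ j * u) := by
    intro u hu j hj
    obtain ⟨m, z, hz⟩ := exists_int_congr u 3
    have hm : ((m : ℤ) % 2) = 1 := by
      rw [padicInt_isUnit_iff] at hu
      by_contra hne
      apply hu
      have h2 : (2 : ℕ) ∣ m := by omega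
      rw [hz]
      exact dvd_add ((padicInt_dvd_natCast m).2 h2) (Dvd.dvd.mul_right (dvd_pow_self _ (by norm_num)) _)
    obtain ⟨b, hb⟩ := (isUnit_of_odd hm).exists_right_inv
    have h0 : TwoRep a s (2 ^ j * m) := h _ (by
      interval_cases j
      · simp; omega
      · simp; omega)
    refine of_unit_sq (w := b * z) h0 ?_
    rw [hz]
    push_cast
    push_cast at hb
    linear_combination -8 * 2 ^ j * z * hb
  rcases padicInt_eq_sq_mul t with rfl | ⟨d, u, hu, rfl | rfl⟩
  · exact DiagRep.zero
  · exact ((key u hu 0 (by norm_num)).of_eq (by simp)).sq_mul d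
  · exact ((key u hu 1 (by norm_num)).of_eq (by simp)).sq_mul d

section Triple

variable [DecidableEq ι] {i j l : ι}

lemma triple_of_sum (hij : i ≠ j) (hil : i ≠ l) (hjl : j ≠ l) (hi : a i % 2 = 1)
    (hl : a l % 2 = 1) (hs : (a i + a j) % 4 = 0) : TwoRep a {l, i, j} n := by
  have hl' : l ∉ ({i, j} : Finset ι) := by simp [hil.symm, hjl.symm]
  by_cases h : n % 2 = 1
  · exact (pair_odd_all hij hi hs h).mono (Finset.subset_insert _ _)
  · exact cons_one hl' (pair_odd_all hij hi hs (by omega))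

/-- Three odd coefficients congruent modulo `4` represent every number not divisible by `4` and
outside one odd class modulo `8`. -/
lemma triple_of_congr (hij : i ≠ j) (hil : i ≠ l) (hjl : j ≠ l) (hi : a i % 2 = 1)
    (hj : a j % 4 = a i % 4) (hl : a l % 4 = a i % 4) (hn : ¬ 4 ∣ n)
    (hn' : n % 8 ≠ (a i + a j + a l + 4) % 8) : TwoRep a {l, i, j} n := by
  have hl' : l ∉ ({i, j} : Finset ι) := by simp [hil.symm, hjl.symm]
  by_cases h : n % 4 = a i % 4
  · exact (pair_odd hij hi (by omega) h).mono (Finset.subset_insert _ _)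
  by_cases h2 : n % 2 = 1
  · have e : (n - (a i + a j + a l)) % 4 = 0 := by clear hn'; omega
    have e' : (n - (a i + a j + a l)) % 8 = 0 := by clear hn hj hl hi h h2; omega
    exact cons_one hl' (pair_sum hij hi (by clear hn' hn hj hl hi h h2 e; omega))
  · by_cases h8 : n % 8 = (a i + a j) % 8
    · exact (pair_sum hij hi h8).mono (Finset.subset_insert _ _)
    · exact cons hl' 2 (pair_sum hij hi (by omega))

lemma quadruple {d : ι} (hij : i ≠ j) (hil : i ≠ l) (hjl : j ≠ l) (hid : i ≠ d) (hjd : j ≠ d)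
    (hld : l ≠ d) (hi : a i % 2 = 1) (hj : a j % 2 = 1) (hl : a l % 2 = 1) (hd : a d % 8 ≠ 0)
    (hn : ¬ 4 ∣ n) : TwoRep a {d, l, i, j} n := by
  have hd' : d ∉ ({l, i, j} : Finset ι) := by simp [hid.symm, hjd.symm, hld.symm]
  have hlij : ({l, i, j} : Finset ι) ⊆ {d, l, i, j} := Finset.subset_insert _ _
  by_cases h1 : (a i + a j) % 4 = 0
  · exact (triple_of_sum hij hil hjl hi hl h1).mono hlij
  by_cases h2 : (a i + a l) % 4 = 0
  · refine (triple_of_sum hil hij hjl.symm hi hj h2).mono ?_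
    intro x; simp; tauto
  by_cases hn' : n % 8 ≠ (a i + a j + a l + 4) % 8
  · exact (triple_of_congr hij hil hjl hi (by omega) (by omega) hn hn').mono hlij
  by_cases h3 : (a i + a d) % 4 = 0
  · refine (triple_of_sum hid hij hjd.symm hi hj h3).mono ?_
    intro x; simp; tauto
  exact cons_one hd' (triple_of_congr hij hil hjl hi (by omega) (by omega) (by omega) (by omega))

/-- Three odd coefficients congruent modulo `4` and one coefficient of exact order three represent
all even numbers. -/
lemma quadruple_even {d : ι} (hij : i ≠ j) (hil : i ≠ l) (hjl : j ≠ l) (hid : i ≠ d) (hjd : j ≠ d)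
    (hld : l ≠ d) (hi : a i % 2 = 1) (hj : a j % 4 = a i % 4) (hl : a l % 4 = a i % 4)
    (hd : a d % 16 = 8) (hn : n % 2 = 0) : TwoRep a {d, l, i, j} n := by
  have hd' : d ∉ ({l, i, j} : Finset ι) := by simp [hid.symm, hjd.symm, hld.symm]
  have hlij : ({l, i, j} : Finset ι) ⊆ {d, l, i, j} := Finset.subset_insert _ _
  induction h : n.natAbs using Nat.strong_induction_on generalizing n with
  | _ N ih =>
    subst h
    by_cases h0 : n = 0
    · subst h0
      exact DiagRep.of_eq DiagRep.zero (by simp)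
    by_cases h4 : 4 ∣ n
    · by_cases h2 : n / 4 % 2 = 0
      · exact of_four_dvd h4 (ih _ (by omega) h2 rfl)
      by_cases h8 : n / 4 % 8 ≠ (a i + a j + a l + 4) % 8
      · exact of_four_dvd h4 ((triple_of_congr hij hil hjl hi hj hl (by omega) h8).mono hlij)
      · refine cons_one hd' (of_four_dvd (by omega) ?_)
        exact (pair_odd hij hi (by omega) (by omega)).mono (Finset.subset_insert _ _)
    · exact (triple_of_congr hij hil hjl hi hj hl h4 (by omega)).mono hlij

/-- Two odd coefficients and one congruent to `2` modulo `4` represent everything outside two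
classes modulo `8`. -/
lemma triple_two (hij : i ≠ j) (hil : i ≠ l) (hjl : j ≠ l) (hi : a i % 2 = 1)
    (hj : a j % 2 = 1) (hl : a l % 4 = 2) (hn : n % 8 ≠ 0)
    (hn' : n % 8 ≠ (if a i % 4 = a j % 4 then a i + a j + 4 else a l : ℕ) % 8) :
    TwoRep a {l, i, j} n := by
  have hl' : l ∉ ({i, j} : Finset ι) := by simp [hil.symm, hjl.symm]
  have hodd : ∀ m : ℤ, m % 2 = 1 → TwoRep a {l, i, j} m := by
    intro m hm
    by_cases h : m % 4 = a i % 4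
    · exact (pair_odd hij hi (by omega) h).mono (Finset.subset_insert _ _)
    · exact cons_one hl' (pair_odd hij hi hj (by omega))
  by_cases h1 : n % 2 = 1
  · exact hodd n h1
  by_cases h4 : 4 ∣ n
  · exact of_four_dvd h4 (hodd _ (by omega))
  split_ifs at hn' with h
  · exact (pair_sum hij hi (by omega)).mono (Finset.subset_insert _ _)
  · have e1 : n % 8 ≠ a l % 8 := by exact_mod_cast hn'
    have e2 : (a i + a j) % 4 = 0 := by clear hn' hn e1; omega
    have e3 : (n - a l) % 8 = 4 := by clear e2 h hi hj hn' hn; omega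
    exact cons_one hl' (of_four_dvd (by clear hn' e1 e2 h; omega)
      (pair_odd_all hij hi e2 (by clear hn' e1 e2 h; omega)))

lemma quadruple_two {d : ι} (hij : i ≠ j) (hil : i ≠ l) (hjl : j ≠ l) (hid : i ≠ d) (hjd : j ≠ d)
    (hld : l ≠ d) (hi : a i % 2 = 1) (hj : a j % 2 = 1) (hl : a l % 4 = 2) (hd2 : a d % 2 = 0)
    (hd : a d % 16 ≠ 0) (hn : ¬ 4 ∣ n) : TwoRep a {d, l, i, j} n := by
  have hd' : d ∉ ({l, i, j} : Finset ι) := by simp [hid.symm, hjd.symm, hld.symm]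
  have hl' : l ∉ ({i, j} : Finset ι) := by simp [hil.symm, hjl.symm]
  have hlij : ({l, i, j} : Finset ι) ⊆ {d, l, i, j} := Finset.subset_insert _ _
  have hdl : ({d, i, j} : Finset ι) ⊆ {d, l, i, j} := by intro x; simp; tauto
  have tri := fun m => triple_two (n := m) hij hil hjl hi hj hl
  by_cases h : a i % 4 = a j % 4
  · simp only [h, if_true] at tri
    by_cases hn' : n % 8 ≠ (a i + a j + 4 : ℕ) % 8
    · exact (tri n (by omega) hn').mono hlij
    -- a coefficient in the missing class
    have key : ∀ x : ι, x ∉ ({i, j} : Finset ι) → a x % 8 = (a i + a j + 4) % 8 →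
        TwoRep a (insert x {i, j}) n := by
      intro x hx hax
      have hsum : ∀ m : ℤ, m % 16 = 8 → m / 4 % 8 = (a i + a j) % 8 → TwoRep a {i, j} m :=
        fun m hm hm' => of_four_dvd (by omega) (pair_sum hij hi (by omega))
      have e1 : n % 8 = a x % 8 := by clear hi hj h hn; omega
      have e2 : a x % 4 = 2 := by clear hn' e1 hn; omega
      have e3 : (a i + a j) % 4 = 2 := by clear hn' e1 hn; omega
      clear hn' hax hl hd hd2 hj h
      by_cases h16 : n % 16 = a x % 16
      · exact (single_two e2 h16).mono (by simp)
      by_cases h32 : (n - a x) / 4 % 8 = (a i + a j) % 8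
      · exact cons_one hx (hsum _ (by omega) h32)
      · have e4 : (n - a x) / 4 % 4 = 2 := by omega
        have e5 : (n - a x * 3 ^ 2) / 4 = (n - a x) / 4 - 2 * a x := by omega
        exact cons hx 3 (hsum _ (by omega) (by rw [e5]; omega))
    by_cases hl8 : a l % 8 = (a i + a j + 4) % 8
    · exact (key l hl' hl8).mono hlij
    by_cases hd8 : a d % 8 = (a i + a j + 4) % 8
    · exact (key d (by simp [hid.symm, hjd.symm]) hd8).mono hdl
    by_cases hd4 : a d % 8 ≠ 0
    · exact cons_one hd' (tri _ (by omega) (by omega))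
    -- the two residual classes modulo `16` differ by the coefficient of exact order three
    have hodd : ∀ m : ℤ, (m - a l) % 4 = 0 → (m - a l) / 4 % 4 = a i % 4 → TwoRep a {l, i, j} m :=
      fun m hm hm' => cons_one hl' (of_four_dvd (by omega) (pair_odd hij hi hj (by omega)))
    by_cases h4 : (n - a l) / 4 % 4 = a i % 4
    · exact (hodd n (by omega) h4).mono hlij
    · have e1 : (n - a l) / 4 % 2 = 1 := by omega
      have e2 : (n - a d - a l) / 4 = (n - a l) / 4 - a d / 4 := by clear h4 e1 h; omega
      have e3 : a d / 4 % 4 = 2 := by omega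
      exact cons_one hd' (hodd _ (by clear h4 e1 e2 e3 h; omega)
        (by rw [e2]; clear e2 hn hn' hl8 hd8 hl hd2 hd hd4 h; omega))
  · simp only [h, if_false] at tri
    by_cases hn' : n % 8 ≠ (a l : ℕ) % 8
    · exact (tri n (by omega) hn').mono hlij
    by_cases h8 : (a i + a j) % 8 = 0
    · exact (cons_one hl' (pair_sum hij hi (by omega))).mono hlij
    have hsq : ∀ m : ℤ, m % 16 = a l % 16 → TwoRep a {l, i, j} m := fun m hm =>
      (single_two hl hm).mono (by simp)
    by_cases h16 : n % 16 = a l % 16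
    · exact (hsq n h16).mono hlij
    by_cases hd8 : a d % 8 = a l % 8
    · have e1 : a d % 4 = 2 := by clear hn' hn h16 h8 h hi hj; omega
      have e2 : n % 8 = a l % 8 := by clear h16 h8 h hi hj; omega
      exact cons hd' 2 (hsq _ (by clear hn' hd8 hd hd2 hn h8 h hi hj; omega))
    by_cases hd0 : a d % 8 = 0
    · exact cons_one hd' (hsq _ (by omega))
    · exact cons_one hd' (tri _ (by omega) (by omega))

end Triple

end TwoRep

end TwoAdic

/-! ### Non-universality at `2`: the odd coefficients -/

namespace PForm

variable {n : ℕ}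

/-- A form all of whose moduli are `2 k` with `k` odd, so that universality at `2` may fail. -/
structure STyp (k : ℕ) (F : PForm n) : Prop where
  adm : F.Adm (2 * k)
  M_eq : ∀ i, F.M i = 2 * k
  odd : k % 2 = 1
  big : 13 ≤ k

/-- Half the linear coefficient: with modulus `2 k` the polygonal number is
`((k x - ee)^2 - ee^2) / k`. -/
def ee (k : ℕ) (F : PForm n) (i : Fin n) : ℤ := ((k : ℤ) - F.r i) / 2

/-- The constant in `∑ a i * (k x i - ee i)^2 = k N + twoDisc`. -/
def twoDisc (k : ℕ) (F : PForm n) : ℤ := ∑ i, (F.a i : ℤ) * F.ee k i ^ 2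

variable {k : ℕ} {F : PForm n}

lemma STyp.r_odd (hF : F.STyp k) (i : Fin n) : F.r i % 2 = 1 := by
  have h := hF.adm.cop i
  rw [hF.M_eq i] at h
  have h2 : Nat.Coprime (F.r i) 2 := Nat.Coprime.coprime_mul_right_right h
  rcases Nat.mod_two_eq_zero_or_one (F.r i) with h0 | h1
  · have := Nat.dvd_gcd (Nat.dvd_of_mod_eq_zero h0) dvd_rfl
    rw [h2] at this
    omega
  · exact h1

lemma STyp.two_mul_ee (hF : F.STyp k) (i : Fin n) : 2 * F.ee k i = k - F.r i := by
  have := hF.r_odd i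
  have := hF.odd
  unfold ee
  omega

lemma STyp.r_lt (hF : F.STyp k) (i : Fin n) : F.r i < k := by
  have := hF.adm.lev_lt i
  rw [hF.M_eq] at this
  omega

lemma STyp.complete_square (hF : F.STyp k) {R : Type*} [CommRing R] (x : Fin n → R) :
    2 * ∑ i, (F.a i : R) * (k * x i - F.ee k i) ^ 2 = k * F.dbl x + 2 * F.twoDisc k := by
  unfold twoDisc dbl
  rw [Finset.mul_sum, Finset.mul_sum, Int.cast_sum, Finset.mul_sum, ← Finset.sum_add_distrib]
  refine Finset.sum_congr rfl fun i _ => ?_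
  have h := congrArg (Int.cast : ℤ → R) (hF.two_mul_ee i)
  unfold polyDbl
  rw [hF.M_eq i]
  push_cast at h ⊢
  linear_combination (-2 * (F.a i : R) * k * x i) * h

lemma STyp.complete_square_int (hF : F.STyp k) (x : Fin n → ℤ) :
    ∑ i, (F.a i : ℤ) * (k * x i - F.ee k i) ^ 2 = k * F.val x + F.twoDisc k := by
  have h := hF.complete_square x
  rw [dbl_eq_two_mul] at h
  simp only [Int.cast_id] at h
  linarith

/-- Representation over `ℤ_2` reduces to representation by the diagonal form with the same
coefficients. -/
lemma STyp.repAt_of_diagRep (hF : F.STyp k) {t : ℤ_[2]}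
    (h : DiagRep (fun i => (F.a i : ℤ_[2])) Finset.univ (k * t + F.twoDisc k)) : F.RepAt 2 t := by
  obtain ⟨y, hy⟩ := h
  have hk := hF.odd
  obtain ⟨b, hb⟩ := ((padicInt_isUnit_natCast (p := 2) k).2 (by omega)).exists_right_inv
  refine ⟨fun i => b * (y i + F.ee k i), ?_⟩
  have h1 := hF.complete_square fun i => b * (y i + F.ee k i)
  have h3 : ∑ i, (F.a i : ℤ_[2]) * (k * (b * (y i + F.ee k i)) - F.ee k i) ^ 2
      = ∑ i, (F.a i : ℤ_[2]) * y i ^ 2 := by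
    refine Finset.sum_congr rfl fun i _ => ?_
    rw [show (k : ℤ_[2]) * (b * (y i + F.ee k i)) - F.ee k i = y i by
      linear_combination (y i + F.ee k i) * hb]
  rw [h3, hy] at h1
  apply ((padicInt_isUnit_natCast (p := 2) k).2 (by omega)).mul_left_cancel
  linear_combination -h1

lemma STyp.repAt_of_twoRep (hF : F.STyp k) {N : ℤ} {s : Finset (Fin n)}
    (h : TwoRep F.a s (k * N + F.twoDisc k)) : F.RepAt 2 N :=
  hF.repAt_of_diagRep ((h.mono (Finset.subset_univ _)).of_eq (by push_cast; ring))

lemma STyp.univAt_of_twoRep (hF : F.STyp k) {s : Finset (Fin n)}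
    (h : ∀ m : ℤ, ¬ 4 ∣ m → TwoRep F.a s m) : F.UnivAt 2 := fun _ =>
  hF.repAt_of_diagRep ((TwoRep.univ h _).mono (Finset.subset_univ _))

/-- Terms up to `13` come from the arguments `0` and `1`. -/
lemma STyp.tm_cases (hF : F.STyp k) (i : Fin n) {z : ℤ} (h : F.tm i z ≤ 13) :
    F.tm i z = 0 ∨ F.tm i z = (F.a i * F.r i : ℕ) := by
  rcases hF.adm.tm_cases i h with h' | h' | ⟨-, -, h'⟩
  · exact Or.inl h'
  · exact Or.inr h'
  · have := hF.M_eq i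
    have := hF.r_lt i
    have := hF.big
    omega

/-- The numbers with a given target `k N + E` form one residue class modulo `8`. -/
lemma exists_class_two (hk : k % 2 = 1) (E t : ℤ) :
    ∃ v : ℤ, 0 ≤ v ∧ v < 8 ∧ ∀ N : ℤ, (k * N + E) % 8 = t % 8 → N % 8 = v := by
  have h8 : ((k : ℤ) * k) % 8 = 1 := by
    have : (k : ℤ) % 8 = 1 ∨ (k : ℤ) % 8 = 3 ∨ (k : ℤ) % 8 = 5 ∨ (k : ℤ) % 8 = 7 := by omega
    rcases this with h | h | h | h <;> rw [Int.mul_emod, h] <;> norm_num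
  refine ⟨(k * (t - E)) % 8, Int.emod_nonneg _ (by norm_num), Int.emod_lt_of_pos _ (by norm_num),
    fun N hN => ?_⟩
  have h1 : (8 : ℤ) ∣ t - (k * N + E) := Int.ModEq.dvd hN
  have h2 : (8 : ℤ) ∣ k * k - 1 := by omega
  have h3 : (8 : ℤ) ∣ k * (t - E) - N := by
    rw [show k * (t - E) - N = k * (t - (k * N + E)) + (k * k - 1) * N by ring]
    exact dvd_add (h1.mul_left _) (h2.mul_right _)
  omega

lemma list_toFinset_subset_card {s : Finset ℤ} {l : List ℤ} (h : ∀ x ∈ s, x ∈ l) :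
    s.card ≤ l.length :=
  (Finset.card_le_card fun x hx => List.mem_toFinset.2 (h x hx)).trans (List.toFinset_card_le l)

lemma val_split_three (F : PForm n) [DecidableEq (Fin n)] {i j l : Fin n} (hij : i ≠ j)
    (hil : i ≠ l) (hjl : j ≠ l) (x : Fin n → ℤ) :
    F.val x = F.tm i (x i) + F.tm j (x j) + F.tm l (x l) +
      ∑ m ∈ ((Finset.univ.erase i).erase j).erase l, F.tm m (x m) := by
  rw [val_split_two F hij, ← Finset.add_sum_erase _ _ (Finset.mem_erase.2 ⟨hjl.symm,
    Finset.mem_erase.2 ⟨hil.symm, Finset.mem_univ _⟩⟩)]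
  ring

/-- A value up to `13` of a form with all but three coefficients divisible by `d` is a sum of values
at `1` up to a multiple of `d`. -/
lemma STyp.small_values (hF : F.STyp k) {i j l : Fin n} (hij : i ≠ j)
    (hil : i ≠ l) (hjl : j ≠ l) {d : ℕ} (hr : ∀ m, m ≠ i → m ≠ j → m ≠ l → d ∣ F.a m)
    {N : ℕ} (hN : N ≤ 13) (hd : N < d) (h : F.RepInt N) :
    (N : ℤ) ∈ [(0 : ℤ), ((F.a i * F.r i : ℕ) : ℤ), ((F.a j * F.r j : ℕ) : ℤ),
      ((F.a l * F.r l : ℕ) : ℤ), ((F.a i * F.r i : ℕ) : ℤ) + (F.a j * F.r j : ℕ),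
      ((F.a i * F.r i : ℕ) : ℤ) + (F.a l * F.r l : ℕ),
      ((F.a j * F.r j : ℕ) : ℤ) + (F.a l * F.r l : ℕ),
      ((F.a i * F.r i : ℕ) : ℤ) + (F.a j * F.r j : ℕ) + (F.a l * F.r l : ℕ)] := by
  classical
  obtain ⟨x, hx⟩ := h
  rw [val_split_three F hij hil hjl] at hx
  have f : 0 ≤ ∑ m ∈ ((Finset.univ.erase i).erase j).erase l, F.tm m (x m) :=
    Finset.sum_nonneg fun m _ => hF.adm.tm_nonneg m _
  have g : (d : ℤ) ∣ ∑ m ∈ ((Finset.univ.erase i).erase j).erase l, F.tm m (x m) :=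
    Finset.dvd_sum fun m hm => dvd_tm (by
      simp only [Finset.mem_erase] at hm
      exact hr m hm.2.2.1 hm.2.1 hm.1) _
  have n1 := hF.adm.tm_nonneg i (x i)
  have n2 := hF.adm.tm_nonneg j (x j)
  have n3 := hF.adm.tm_nonneg l (x l)
  have h0 : ∑ m ∈ ((Finset.univ.erase i).erase j).erase l, F.tm m (x m) = 0 :=
    Int.eq_zero_of_dvd_of_nonneg_of_lt f (by omega) g
  rw [h0] at hx
  simp only [List.mem_cons, List.not_mem_nil, or_false]
  rcases hF.tm_cases i (z := x i) (by omega) with c1 | c1 <;>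
    rcases hF.tm_cases j (z := x j) (by omega) with c2 | c2 <;>
    rcases hF.tm_cases l (z := x l) (by omega) with c3 | c3 <;>
    rw [c1, c2, c3] at hx <;> clear c1 c2 c3 n1 n2 n3 f g h0 <;> omega

lemma STyp.odd_mul_r (hF : F.STyp k) {i : Fin n} (hi : F.a i % 2 = 1) :
    (F.a i * F.r i) % 2 = 1 := by
  rw [Nat.mul_mod, hi, hF.r_odd i]

/-- Three odd coefficients force universality at `2`. Otherwise they agree modulo `4` and all others
are divisible by `8`, so that the small values are sums of distinct values at `1` of three terms;
these are too few. -/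
lemma STyp.univAt_of_three_odd (hF : F.STyp k) (hglob : ∀ N : ℕ, F.RepAt 2 N → F.RepInt N)
    {i j l : Fin n} (hij : i ≠ j) (hil : i ≠ l) (hjl : j ≠ l) (hi : F.a i % 2 = 1)
    (hj : F.a j % 2 = 1) (hl : F.a l % 2 = 1) : F.UnivAt 2 := by
  by_contra hbad
  have h8 : ∀ m, m ≠ i → m ≠ j → m ≠ l → F.a m % 8 = 0 := fun m hmi hmj hml => by
    by_contra h
    exact hbad (hF.univAt_of_twoRep fun t ht =>
      TwoRep.quadruple hij hil hjl hmi.symm hmj.symm hml.symm hi hj hl h ht)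
  have hij4 : F.a j % 4 = F.a i % 4 := by
    by_contra h
    exact hbad (hF.univAt_of_twoRep fun t _ => TwoRep.triple_of_sum hij hil hjl hi hl (by omega))
  have hil4 : F.a l % 4 = F.a i % 4 := by
    by_contra h
    exact hbad (hF.univAt_of_twoRep fun t _ =>
      TwoRep.triple_of_sum hil hij hjl.symm hi hj (by omega))
  have hα := hF.odd_mul_r hi
  have hβ := hF.odd_mul_r hj
  have hγ := hF.odd_mul_r hl
  obtain ⟨v, hv0, hv8, hv⟩ := exists_class_two hF.odd (F.twoDisc k)
    ((F.a i + F.a j + F.a l + 4 : ℕ) : ℤ)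
  have hodd : ∀ N : ℕ, (k * (N : ℤ) + F.twoDisc k) % 2 = 1 → (N : ℤ) % 8 ≠ v → F.RepInt N :=
    fun N h1 h2 => hglob N (by
      have := hF.repAt_of_twoRep (N := N) (TwoRep.triple_of_congr hij hil hjl hi hij4 hil4
        (by omega) fun h => h2 (hv N (by push_cast; exact h)))
      simpa using this)
  have hpar : ∀ N : ℕ, (k * (N : ℤ) + F.twoDisc k) % 2 = (N + F.twoDisc k) % 2 := fun N => by
    have : (k : ℤ) % 2 = 1 := by have := hF.odd; omega
    rw [Int.add_emod, Int.mul_emod, this]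
    omega
  by_cases hd : ∃ d, d ≠ i ∧ d ≠ j ∧ d ≠ l ∧ F.a d % 16 ≠ 0
  · obtain ⟨d, hdi, hdj, hdl, hd⟩ := hd
    have hd8 := h8 d hdi hdj hdl
    have heven : ∀ N : ℕ, (N + F.twoDisc k) % 2 = 0 → F.RepInt N := fun N h1 => hglob N (by
      have := hF.repAt_of_twoRep (N := N) (TwoRep.quadruple_even hij hil hjl hdi.symm hdj.symm
        hdl.symm hi hij4 hil4 (by omega) (by rw [hpar]; exact h1))
      simpa using this)
    have hs := fun N (hN : N ≤ 7) (h : F.RepInt N) => hF.small_values hij hil hjl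
      (fun m hmi hmj hml => Nat.dvd_of_mod_eq_zero (h8 m hmi hmj hml)) (by omega)
      (by omega : N < 8) h
    simp only [List.mem_cons, List.not_mem_nil, or_false] at hs
    generalize F.a i * F.r i = α at *
    generalize F.a j * F.r j = β at *
    generalize F.a l * F.r l = γ at *
    rcases Int.emod_two_eq_zero_or_one (F.twoDisc k) with h | h
    · have h2 := hs 2 (by norm_num) (heven 2 (by omega))
      have h4 := hs 4 (by norm_num) (heven 4 (by omega))
      have h6 := hs 6 (by norm_num) (heven 6 (by omega))
      clear hs heven hodd hpar hv hglob hd8 hd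
      omega
    · have h1 := hs 1 (by norm_num) (heven 1 (by omega))
      have h3 := hs 3 (by norm_num) (heven 3 (by omega))
      have h5 := hs 5 (by norm_num) (heven 5 (by omega))
      have h7 := hs 7 (by norm_num) (heven 7 (by omega))
      clear hs heven hodd hpar hv hglob hd8 hd
      omega
  · push Not at hd
    have hs := fun N (hN : N ≤ 13) (h : F.RepInt N) => hF.small_values hij hil hjl
      (fun m hmi hmj hml => Nat.dvd_of_mod_eq_zero (hd m hmi hmj hml)) (by omega)
      (by omega : N < 16) h
    simp only [List.mem_cons, List.not_mem_nil, or_false] at hs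
    generalize F.a i * F.r i = α at *
    generalize F.a j * F.r j = β at *
    generalize F.a l * F.r l = γ at *
    -- Of the seven numbers of one parity up to `13`, at most two lie in the excluded class and at
    -- most four are sums of distinct values at `1`.
    rcases Int.emod_two_eq_zero_or_one (F.twoDisc k) with h | h
    · have := list_toFinset_subset_card (s := {1, 3, 5, 7, 9, 11, 13})
        (l := [v, v + 8, (α : ℤ), β, γ, α + β + γ]) (fun N hN => by
          have hN' : 0 ≤ N ∧ N ≤ 13 ∧ N % 2 = 1 := by
            simp only [Finset.mem_insert, Finset.mem_singleton] at hN; omega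
          clear hN
          obtain ⟨h0, h13, h2⟩ := hN'
          lift N to ℕ using h0
          by_cases hNv : (N : ℤ) % 8 = v
          · simp only [List.mem_cons, List.not_mem_nil, or_false]; omega
          · have := hs N (by omega) (hodd N (by rw [hpar]; omega) hNv)
            clear hs hodd hpar hv hglob
            simp only [List.mem_cons, List.not_mem_nil, or_false]; omega)
      revert this
      simp
    · have := list_toFinset_subset_card (s := {0, 2, 4, 6, 8, 10, 12})
        (l := [v, v + 8, (0 : ℤ), α + β, α + γ, β + γ]) (fun N hN => by
          have hN' : 0 ≤ N ∧ N ≤ 13 ∧ N % 2 = 0 := by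
            simp only [Finset.mem_insert, Finset.mem_singleton] at hN; omega
          clear hN
          obtain ⟨h0, h13, h2⟩ := hN'
          lift N to ℕ using h0
          by_cases hNv : (N : ℤ) % 8 = v
          · simp only [List.mem_cons, List.not_mem_nil, or_false]; omega
          · have := hs N (by omega) (hodd N (by rw [hpar]; omega) hNv)
            clear hs hodd hpar hv hglob
            simp only [List.mem_cons, List.not_mem_nil, or_false]; omega)
      revert this
      simp

/-- Two odd coefficients and one congruent to `2` modulo `4` force universality at `2`. Otherwise all
others are divisible by `16`, all classes modulo `8` except two are represented, and at least ten of
the numbers up to `13` are among the eight sums of values at `1` of three terms. -/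
lemma STyp.univAt_of_two_odd (hF : F.STyp k) (hglob : ∀ N : ℕ, F.RepAt 2 N → F.RepInt N)
    {i j l : Fin n} (hij : i ≠ j) (hil : i ≠ l) (hjl : j ≠ l) (hi : F.a i % 2 = 1)
    (hj : F.a j % 2 = 1) (hl : F.a l % 4 = 2) : F.UnivAt 2 := by
  by_contra hbad
  have h16 : ∀ m, m ≠ i → m ≠ j → m ≠ l → F.a m % 16 = 0 := fun m hmi hmj hml => by
    by_contra h
    by_cases h2 : F.a m % 2 = 0
    · exact hbad (hF.univAt_of_twoRep fun t ht =>
        TwoRep.quadruple_two hij hil hjl hmi.symm hmj.symm hml.symm hi hj hl h2 h ht)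
    · exact hbad (hF.univAt_of_three_odd hglob hij hmi.symm hmj.symm hi hj (by omega))
  obtain ⟨v, hv0, hv8, hv⟩ := exists_class_two hF.odd (F.twoDisc k)
    ((if F.a i % 4 = F.a j % 4 then F.a i + F.a j + 4 else F.a l : ℕ) : ℤ)
  obtain ⟨w, hw0, hw8, hw⟩ := exists_class_two hF.odd (F.twoDisc k) 0
  have hrep : ∀ N : ℕ, (N : ℤ) % 8 ≠ v → (N : ℤ) % 8 ≠ w → F.RepInt N :=
    fun N h1 h2 => hglob N (by
      have := hF.repAt_of_twoRep (N := N) (TwoRep.triple_two hij hil hjl hi hj hl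
        (fun h => h2 (hw N (by simpa using h))) (fun h => h1 (hv N h)))
      simpa using this)
  have hs := fun N (hN : N ≤ 13) (h : F.RepInt N) => hF.small_values hij hil hjl
    (fun m hmi hmj hml => Nat.dvd_of_mod_eq_zero (h16 m hmi hmj hml)) (by omega)
    (by omega : N < 16) h
  generalize F.a i * F.r i = α at *
  generalize F.a j * F.r j = β at *
  generalize F.a l * F.r l = γ at *
  have := list_toFinset_subset_card (s := Finset.Icc (0 : ℤ) 13)
    (l := [v, v + 8, w, w + 8] ++ [0, (α : ℤ), β, γ, α + β, α + γ, β + γ, α + β + γ]) (fun N hN => by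
      rw [Finset.mem_Icc] at hN
      obtain ⟨h0, h13⟩ := hN
      lift N to ℕ using h0
      rw [List.mem_append]
      by_cases hNv : (N : ℤ) % 8 = v
      · left; simp only [List.mem_cons, List.not_mem_nil, or_false]; omega
      by_cases hNw : (N : ℤ) % 8 = w
      · left; simp only [List.mem_cons, List.not_mem_nil, or_false]; omega
      · exact Or.inr (hs N (by omega) (hrep N hNv hNw)))
  revert this
  simp

/-- A regular form that is not universal at `2` has one odd coefficient, or two of them and all
others divisible by `4`. -/
theorem STyp.odd_coeffs (hF : F.STyp k) (hn : 4 ≤ n) (hreg : F.Regular) (hbad : ¬ F.UnivAt 2) :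
    (∃ i, F.a i % 2 = 1 ∧ ∀ j, j ≠ i → F.a j % 2 = 0) ∨
    (∃ i j, i ≠ j ∧ F.a i % 2 = 1 ∧ F.a j % 2 = 1 ∧ ∀ l, l ≠ i → l ≠ j → F.a l % 4 = 0) := by
  obtain ⟨G, hG, hGr, hGM, hGu, hGT, hGdvd⟩ := hF.adm.exists_univAt_outside hn ∅ hreg
  have hGS : G.STyp k := ⟨hG, fun i => by rw [hGM]; exact hF.M_eq i, hF.odd, hF.big⟩
  have hGbad : ¬ G.UnivAt 2 := fun h => hbad ((hGT 2 (Or.inl rfl)).2 h)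
  have hglob : ∀ N : ℕ, G.RepAt 2 N → G.RepInt N := fun N hN => hGr N fun q _ => by
    by_cases hq2 : q = 2
    · subst hq2; exact hN
    · exact hGu q hq2 (by simp) _
  have hd : ∀ e i, 2 ^ e ∣ F.a i ↔ 2 ^ e ∣ G.a i := fun e i =>
    (hGdvd 2 Nat.prime_two (Or.inl rfl) e i).symm
  have hd2 : ∀ i, F.a i % 2 = G.a i % 2 := fun i => by have := hd 1 i; omega
  have hd4 : ∀ i, F.a i % 4 = 0 ↔ G.a i % 4 = 0 := fun i => by have := hd 2 i; omega
  simp only [hd2, hd4]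
  obtain ⟨i, hi⟩ := hG.prim 2 Nat.prime_two
  by_contra hcon
  rw [not_or] at hcon
  obtain ⟨hc1, hc2⟩ := hcon
  push Not at hc1 hc2
  obtain ⟨j, hji, hj⟩ := hc1 i (by omega)
  obtain ⟨l, hli, hlj, hl⟩ := hc2 i j hji.symm (by omega) (by omega)
  by_cases h2 : G.a l % 2 = 1
  · exact hGbad (hGS.univAt_of_three_odd hglob hji.symm hli.symm hlj.symm (by omega) (by omega) h2)
  · exact hGbad (hGS.univAt_of_two_odd hglob hji.symm hli.symm hlj.symm (by omega) (by omega)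
      (by omega))

end PForm

/-! ### Descents at `2` -/

namespace PForm

variable {n k : ℕ} {F : PForm n}

lemma STyp.ee_pos (hF : F.STyp k) (i : Fin n) : 0 < F.ee k i := by
  have := hF.r_lt i
  have := hF.two_mul_ee i
  omega

lemma STyp.ee_lt (hF : F.STyp k) (i : Fin n) : 2 * F.ee k i < k := by
  have := hF.adm.lev_pos i
  have := hF.two_mul_ee i
  omega

lemma STyp.coprime_of_mul (hF : F.STyp k) (i : Fin n) {c d : ℤ} {r' : ℕ}
    (h : c * r' + d * k = F.r i) : Nat.Coprime r' k := by
  have h1 := hF.adm.cop i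
  rw [hF.M_eq i] at h1
  obtain ⟨u, v, huv⟩ := Nat.isCoprime_iff_coprime.2 (Nat.Coprime.coprime_mul_left_right h1)
  exact Nat.isCoprime_iff_coprime.1 ⟨u * c, u * d + v, by rw [← huv, ← h]; ring⟩

/-- The level after passing to the arguments with `k x - ee` even; the modulus is unchanged. -/
lemma STyp.exists_level_even (hF : F.STyp k) (i : Fin n) :
    ∃ (u s : ℤ) (r' : ℕ), (u = 2 ∨ u = -2) ∧ (k * s - F.ee k i) % 2 = 0 ∧ 0 < r' ∧
      2 * r' < 2 * k ∧ Nat.Coprime r' (2 * k) ∧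
      u * ((2 * k : ℕ) * (2 * s - 1) + 2 * F.r i) = 4 * (2 * r' - (2 * k : ℕ)) := by
  have h1 := hF.ee_pos i
  have h2 := hF.ee_lt i
  have h3 := hF.two_mul_ee i
  have hk := hF.odd
  rcases Int.emod_two_eq_zero_or_one (F.ee k i) with he | he
  · refine ⟨2, 0, (k - F.ee k i).toNat, Or.inl rfl, by omega, by omega, by omega, ?_, ?_⟩
    · refine Nat.Coprime.mul_right ?_ (hF.coprime_of_mul i (c := 2) (d := -1) ?_)
      · exact Nat.Coprime.symm (Nat.coprime_two_left.2 (Nat.odd_iff.2 (by omega)))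
      · rw [Int.toNat_of_nonneg (by omega)]; linarith
    · rw [Int.toNat_of_nonneg (by omega)]; push_cast; linarith
  · refine ⟨-2, 1, (F.ee k i).toNat, Or.inr rfl, by omega, by omega, by omega, ?_, ?_⟩
    · refine Nat.Coprime.mul_right ?_ (hF.coprime_of_mul i (c := -2) (d := 1) ?_)
      · exact Nat.Coprime.symm (Nat.coprime_two_left.2 (Nat.odd_iff.2 (by omega)))
      · rw [Int.toNat_of_nonneg (by omega)]; linarith
    · rw [Int.toNat_of_nonneg (by omega)]; push_cast; linarith

/-- The level after passing to the arguments with `k x - ee` odd; the modulus is halved. -/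
lemma STyp.exists_level_odd (hF : F.STyp k) (i : Fin n) :
    ∃ (u s : ℤ) (r' : ℕ), (u = 2 ∨ u = -2) ∧ (k * s - F.ee k i) % 2 = 1 ∧ 0 < r' ∧
      2 * r' < k ∧ Nat.Coprime r' k ∧
      u * ((2 * k : ℕ) * (2 * s - 1) + 2 * F.r i) = 8 * (2 * r' - k) := by
  have h1 := hF.ee_pos i
  have h2 := hF.ee_lt i
  have h3 := hF.two_mul_ee i
  have hk := hF.odd
  rcases Int.emod_two_eq_zero_or_one (F.ee k i) with he | he
  · obtain ⟨f, hf⟩ : ∃ f, F.ee k i = 2 * f := ⟨F.ee k i / 2, by omega⟩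
    refine ⟨-2, 1, f.toNat, Or.inr rfl, by omega, by omega, by omega,
      hF.coprime_of_mul i (c := -4) (d := 1) ?_, ?_⟩
    · rw [Int.toNat_of_nonneg (by omega)]; linarith
    · rw [Int.toNat_of_nonneg (by omega)]; push_cast; linarith
  · obtain ⟨f, hf⟩ : ∃ f, k - F.ee k i = 2 * f := ⟨(k - F.ee k i) / 2, by omega⟩
    refine ⟨2, 0, f.toNat, Or.inl rfl, by omega, by omega, by omega,
      hF.coprime_of_mul i (c := 4) (d := -1) ?_, ?_⟩
    · rw [Int.toNat_of_nonneg (by omega)]; linarith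
    · rw [Int.toNat_of_nonneg (by omega)]; push_cast; linarith

/-- The descent at `2` that restricts the variables in `S` to `k x - ee` even and those in `O` to
`k x - ee` odd, and divides by `d`. -/
lemma STyp.exists_descent (hF : F.STyp k) (S O : Finset (Fin n)) (hSO : Disjoint S O) {e : ℕ}
    (a' : Fin n → ℕ) (hS : ∀ i ∈ S, 2 ^ e * a' i = 4 * F.a i)
    (hO : ∀ i ∈ O, 2 ^ e * a' i = 8 * F.a i) (hr : ∀ i, i ∉ S → i ∉ O → 2 ^ e * a' i = F.a i)
    (hodd : ∃ i, a' i % 2 = 1)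
    (hforce : ∀ y y₀ : Fin n → ℤ, (∀ i ∈ S, y₀ i % 2 = 0) → (∀ i ∈ O, y₀ i % 2 = 1) →
      2 ^ e ∣ ∑ i, (F.a i : ℤ) * (y i ^ 2 - y₀ i ^ 2) →
      (∀ i ∈ S, y i % 2 = 0) ∧ (∀ i ∈ O, y i % 2 = 1)) :
    ∃ (F' : PForm n) (_ : Descent 2 F F'), F'.Adm (2 * k) ∧ F'.a = a' ∧
      (∀ i, i ∉ O → F'.M i = 2 * k) ∧ (∀ i ∈ O, F'.M i = k) := by
  classical
  -- In `S` the modulus is kept and the coefficient gains a factor `4`; in `O` the modulus is halved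
  -- and the coefficient gains a factor `8`.
  choose uE sE rE hE1 hE2 hE3 hE4 hE5 hE6 using hF.exists_level_even
  choose uO sO rO hO1 hO2 hO3 hO4 hO5 hO6 using hF.exists_level_odd
  have hdis : ∀ i ∈ O, i ∉ S := fun i hi hi' => Finset.disjoint_left.1 hSO hi' hi
  let u : Fin n → ℤ := fun i => if i ∈ O then uO i else if i ∈ S then uE i else 1
  let s : Fin n → ℤ := fun i => if i ∈ O then sO i else if i ∈ S then sE i else 0
  let F' : PForm n := ⟨a', fun i => if i ∈ O then k else 2 * k,
    fun i => if i ∈ O then rO i else if i ∈ S then rE i else F.r i⟩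
  have hpos : ∀ i, 0 < a' i := fun i => by
    have := hF.adm.pos i
    by_contra h
    have h0 : a' i = 0 := by omega
    by_cases hiO : i ∈ O
    · have := hO i hiO; rw [h0] at this; omega
    by_cases hiS : i ∈ S
    · have := hS i hiS; rw [h0] at this; omega
    · have := hr i hiS hiO; rw [h0] at this; omega
  have hcast : ∀ i c, 2 ^ e * a' i = c * F.a i → (2 : ℤ) ^ e * a' i = c * F.a i :=
    fun i c h => by exact_mod_cast h
  let δ : Descent 2 F F' :=
    { u := u
      s := s
      d := 2 ^ e
      o := (F.val s).toNat
      u_pow := fun i => by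
        simp only [u]
        split_ifs
        · exact ⟨1, by rcases hO1 i with h | h <;> rw [h] <;> rfl⟩
        · exact ⟨1, by rcases hE1 i with h | h <;> rw [h] <;> rfl⟩
        · exact ⟨0, rfl⟩
      d_pow := ⟨e, rfl⟩
      sq := fun i => by
        simp only [u, F', hF.M_eq]
        have h4 : ∀ w : ℤ, w = 2 ∨ w = -2 → w ^ 2 = 4 := by rintro w (rfl | rfl) <;> norm_num
        by_cases hiO : i ∈ O
        · have := hcast i 8 (hO i hiO)
          simp only [hiO, if_true, h4 _ (hO1 i)]
          push_cast at this ⊢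
          linear_combination (-(k : ℤ)) * this
        by_cases hiS : i ∈ S
        · have := hcast i 4 (hS i hiS)
          simp only [hiO, hiS, if_true, if_false, h4 _ (hE1 i)]
          push_cast at this ⊢
          linear_combination (-(2 * k : ℤ)) * this
        · have := hr i hiS hiO
          simp only [hiO, hiS, if_false]
          have : (2 : ℤ) ^ e * a' i = F.a i := by exact_mod_cast this
          push_cast
          linear_combination (-(2 * k : ℤ)) * this
      lin := fun i => by
        simp only [u, s, F', hF.M_eq]
        by_cases hiO : i ∈ O
        · have := hcast i 8 (hO i hiO)
          simp only [hiO, if_true, hO6 i]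
          push_cast at this ⊢
          linear_combination (-(2 * (rO i : ℤ) - k)) * this
        by_cases hiS : i ∈ S
        · have := hcast i 4 (hS i hiS)
          simp only [hiO, hiS, if_true, if_false, hE6 i]
          push_cast at this ⊢
          linear_combination (-(2 * (rE i : ℤ) - 2 * k)) * this
        · have := hr i hiS hiO
          simp only [hiO, hiS, if_false]
          have : (2 : ℤ) ^ e * a' i = F.a i := by exact_mod_cast this
          push_cast
          linear_combination (-(2 * (F.r i : ℤ) - 2 * k)) * this
      val_s := (Int.toNat_of_nonneg (hF.adm.val_nonneg s)).symm
      forced := fun x N hx i => by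
        rw [Int.toNat_of_nonneg (hF.adm.val_nonneg s)] at hx
        have h1 := hF.complete_square_int x
        have h2 := hF.complete_square_int s
        have h3 := hforce (fun i => k * x i - F.ee k i) (fun i => k * s i - F.ee k i)
          (fun i hi => by
            have hiO : i ∉ O := Finset.disjoint_left.1 hSO hi
            simp only [s, hiO, hi, if_true, if_false]
            exact hE2 i)
          (fun i hi => by
            simp only [s, hi, if_true]
            exact hO2 i)
          ⟨k * N, by
            simp only [mul_sub, Finset.sum_sub_distrib] at h1 h2 ⊢
            rw [h1, h2, hx]
            push_cast
            ring⟩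
        have hk : (k : ℤ) % 2 = 1 := by have := hF.odd; omega
        have hpar : ∀ z w : ℤ, (k * z - F.ee k i) % 2 = (k * w - F.ee k i) % 2 → 2 ∣ z - w := by
          intro z w h
          have h4 : (2 : ℤ) ∣ k * (z - w) := by
            rw [show (k : ℤ) * (z - w) = (k * z - F.ee k i) - (k * w - F.ee k i) by ring]
            omega
          exact (Int.prime_two.dvd_mul.1 h4).resolve_left (by omega)
        simp only [u, s]
        split_ifs with hiO hiS
        · have h5 := hpar (x i) (sO i) (by rw [h3.2 i hiO, hO2 i])
          rcases hO1 i with h | h <;> rw [h]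
          · exact h5
          · exact (neg_dvd).2 h5
        · have h5 := hpar (x i) (sE i) (by rw [h3.1 i hiS, hE2 i])
          rcases hE1 i with h | h <;> rw [h]
          · exact h5
          · exact (neg_dvd).2 h5
        · exact one_dvd _ }
  have hbig := hF.big
  refine ⟨F', δ, ⟨hpos, ?_, ?_, ?_, ?_, ?_, ?_⟩, rfl, fun i hi => if_neg hi, fun i hi => if_pos hi⟩
  · intro i
    simp only [F']
    split_ifs
    exacts [hO3 i, hE3 i, hF.adm.lev_pos i]
  · intro i
    simp only [F']
    split_ifs
    · exact hO4 i
    · exact hE4 i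
    · have := hF.adm.lev_lt i
      rwa [hF.M_eq] at this
  · intro i
    simp only [F']
    split_ifs
    · exact hO5 i
    · exact hE5 i
    · have := hF.adm.cop i
      rwa [hF.M_eq] at this
  · intro i
    simp only [F']
    split_ifs <;> omega
  · intro i
    simp only [F']
    split_ifs <;> omega
  · intro ℓ hℓ
    by_cases h2 : ℓ = 2
    · subst h2
      obtain ⟨i, hi⟩ := hodd
      exact ⟨i, by simp only [F']; omega⟩
    · obtain ⟨i, hi⟩ := hF.adm.prim ℓ hℓ
      refine ⟨i, fun h => hi ?_⟩
      have hc : ∀ j, Nat.Coprime ℓ (2 ^ j) := fun j =>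
        Nat.Coprime.pow_right _ ((Nat.coprime_primes hℓ Nat.prime_two).2 h2)
      have h' : ℓ ∣ 2 ^ e * a' i := Dvd.dvd.mul_left h _
      by_cases hiO : i ∈ O
      · rw [hO i hiO] at h'
        exact (hc 3).dvd_of_dvd_mul_left h'
      by_cases hiS : i ∈ S
      · rw [hS i hiS] at h'
        exact (hc 2).dvd_of_dvd_mul_left h'
      · rwa [hr i hiS hiO] at h'

lemma Descent.dvd_iff {q D : ℕ} {F F' : PForm n} (δ : Descent q F F') (hq : q.Prime)
    (hF : F.Adm D) (hF' : F'.Adm D) {p : ℕ} (hp : p.Prime) (hpq : p ≠ q) (hD : ¬ p ∣ D)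
    (i : Fin n) : p ∣ F'.a i ↔ p ∣ F.a i := by
  have h3 : F.a i * F.M i * (δ.u i).natAbs ^ 2 = δ.d * (F'.a i * F'.M i) := by
    zify
    rw [sq_abs]
    exact δ.sq i
  obtain ⟨j, hj⟩ := δ.u_pow i
  obtain ⟨l, hl⟩ := δ.d_pow
  have hc : ∀ e, Nat.Coprime p (q ^ e) := fun e =>
    Nat.Coprime.pow_right _ ((Nat.coprime_primes hp hq).2 hpq)
  have hM := (Nat.Prime.coprime_iff_not_dvd hp).2 (hF.not_dvd_M hD i)
  have hM' := (Nat.Prime.coprime_iff_not_dvd hp).2 (hF'.not_dvd_M hD i)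
  rw [hj, hl, ← pow_mul] at h3
  rw [← hM'.dvd_mul_right, ← (hc l).dvd_mul_left, ← h3, (hc _).dvd_mul_right, hM.dvd_mul_right]

lemma Adm.wa_mul {D : ℕ} (hF : F.Adm D) (i : Fin n) : F.wa D i * F.M i = F.a i * D := by
  rw [wa, mul_assoc, mul_comm (D / F.M i), hF.mul_wt]

/-- The diagonal form represents every `p`-adic integer divisible by `p`. -/
def RepMul (p : ℕ) [Fact p.Prime] (D : ℕ) (F : PForm n) : Prop :=
  ∀ t : ℤ_[p], DiagRep (fun i => (F.wa D i : ℤ_[p])) Finset.univ (p * t)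

lemma Descent.repMul {q D : ℕ} {F F' : PForm n} (δ : Descent q F F') (hq : q.Prime)
    (hF : F.Adm D) (hF' : F'.Adm D) {p : ℕ} [Fact p.Prime] (hpq : p ≠ q) (hD : ¬ p ∣ D)
    (h : F'.RepMul p D) : F.RepMul p D := by
  intro t
  obtain ⟨b, hb⟩ := (δ.d_isUnit (p := p) hq hpq).exists_right_inv
  have h1 := (h (b * t)).scale (A := fun i => (F.wa D i : ℤ_[p])) (d := (δ.d : ℤ_[p])) fun i _ => by
    obtain ⟨m, hm⟩ :=
      ((padicInt_isUnit_natCast (p := p) _).2 (hF'.not_dvd_M hD i)).exists_right_inv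
    refine ⟨F.M i * δ.u i * m, ?_⟩
    have e1 : (F.wa D i : ℤ_[p]) * F.M i = F.a i * D := by exact_mod_cast hF.wa_mul i
    have e2 : (F'.wa D i : ℤ_[p]) * F'.M i = F'.a i * D := by exact_mod_cast hF'.wa_mul i
    have e3 := congrArg (Int.cast : ℤ → ℤ_[p]) (δ.sq i)
    push_cast at e3
    linear_combination (F.M i * δ.u i ^ 2 * m ^ 2) * e1 + D * m ^ 2 * e3
      - δ.d * m ^ 2 * F'.M i * e2 + δ.d * F'.wa D i * (F'.M i * m + 1) * hm
  refine h1.of_eq ?_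
  linear_combination (p * t) * hb

/-- A variable of modulus `k` and another variable make a form universal at `2` as soon as the form
takes both parities off the first one. -/
lemma univAt_two_of_parity {i : Fin n} (hM : F.M i % 2 = 1) {c : ℕ} (hc : c % 2 = 1)
    (ha : F.a i = 2 * c) {j : Fin n} (hij : j ≠ i) (hj : F.a j % 2 = 1) (hr : F.r j % 2 = 1) :
    F.UnivAt 2 := by
  classical
  have key : ∀ t : ℤ_[2], ∃ z : ℤ_[2], F.a i * polyDbl (F.M i) (F.r i) z = 2 * (2 * t) := by
    intro t
    obtain ⟨b, hb⟩ := ((padicInt_isUnit_natCast (p := 2) c).2 (by omega)).exists_right_inv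
    obtain ⟨f, hf⟩ : ∃ f, F.M i = 2 * f + 1 := ⟨F.M i / 2, by omega⟩
    -- substitute `z = 2 w`, after which the quadratic coefficient is even
    obtain ⟨w, hw⟩ := exists_quadratic_root (p := 2) (2 * F.M i) (2 * F.r i - F.M i) (b * t)
      (by push_cast; exact dvd_mul_right _ _) (by
        have := (padicInt_isUnit_intCast (p := 2) (2 * F.r i - F.M i)).2 (by push_cast; omega)
        push_cast at this
        exact this)
    refine ⟨2 * w, ?_⟩
    rw [ha]
    unfold polyDbl
    push_cast
    linear_combination 4 * (c : ℤ_[2]) * hw + 4 * t * hb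
  intro t
  -- the parity of `t` is adjusted by the variable `j`
  obtain ⟨ε, t', ht⟩ : ∃ (ε : ℤ_[2]) (t' : ℤ_[2]),
      2 * t - F.a j * polyDbl (F.M j) (F.r j) ε = 2 * (2 * t') := by
    obtain ⟨m, z, hz⟩ := exists_int_congr t 1
    rcases Nat.mod_two_eq_zero_or_one m with h | h
    · refine ⟨0, (m / 2 : ℕ) + z, ?_⟩
      have : (m : ℤ_[2]) = 2 * (m / 2 : ℕ) := by
        exact_mod_cast congrArg (Nat.cast : ℕ → ℤ_[2]) (by omega : m = 2 * (m / 2))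
      unfold polyDbl
      rw [hz]
      push_cast at this ⊢
      linear_combination 2 * this
    · have h1 : (F.a j * F.r j) % 2 = 1 := by rw [Nat.mul_mod, hj, hr]
      obtain ⟨q, hq⟩ : ∃ q : ℤ, (m : ℤ) - (F.a j * F.r j : ℕ) = 2 * q :=
        ⟨((m : ℤ) - (F.a j * F.r j : ℕ)) / 2, by omega⟩
      refine ⟨1, q + z, ?_⟩
      have := congrArg (Int.cast : ℤ → ℤ_[2]) hq
      unfold polyDbl
      rw [hz]
      push_cast at this ⊢
      linear_combination 2 * this
  obtain ⟨z, hz⟩ := key t'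
  refine ⟨Function.update (Pi.single j ε) i z, ?_⟩
  unfold dbl
  rw [← Finset.add_sum_erase _ _ (Finset.mem_univ i), Finset.sum_eq_single_of_mem j
    (Finset.mem_erase.2 ⟨hij, Finset.mem_univ _⟩)]
  · rw [Function.update_self, Function.update_of_ne hij, Pi.single_eq_same, hz]
    linear_combination -ht
  · intro l hl hlj
    rw [Function.update_of_ne (Finset.ne_of_mem_erase hl), Pi.single_eq_of_ne hlj]
    simp [polyDbl]

/-- Two variables with modulus `13`, coefficients `1` and `3`, the first of level `6`. In this
configuration alone the small values do not decide universality at `3`; it does not arise from forms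
with modulus at least `26`. -/
def Exceptional (F : PForm n) : Prop :=
  ∃ i j, F.M i = 13 ∧ F.M j = 13 ∧ F.a i = 1 ∧ F.a j = 3 ∧ F.r i = 6

/-- `F'` is a form universal at `2`, obtained from `F` by descents at `2`, with the same local
behaviour at odd primes. -/
structure TwoReduction (k : ℕ) (F F' : PForm n) : Prop where
  adm : F'.Adm (2 * k)
  regular : F'.Regular
  univ_two : F'.UnivAt 2
  not_exceptional : ¬ F'.Exceptional
  univ_iff : ∀ (p : ℕ) [Fact p.Prime], p ≠ 2 → (F.UnivAt p ↔ F'.UnivAt p)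
  dvd_iff : ∀ (p : ℕ) [Fact p.Prime], p ≠ 2 → ¬ p ∣ 2 * k → ∀ i, p ∣ F'.a i ↔ p ∣ F.a i
  repMul : ∀ (p : ℕ) [Fact p.Prime], p ≠ 2 → ¬ p ∣ 2 * k →
    F'.RepMul p (2 * k) → F.RepMul p (2 * k)

/-- Descent at `2` to a form universal at `2`. With one odd coefficient its variable is kept even,
which decreases `ordSq`; with two odd coefficients one step that halves the modulus of one or both of
the variables reaches a universal form. -/
theorem STyp.exists_univAt_two (hn : 4 ≤ n) (hF : F.STyp k) (hreg : F.Regular) :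
    ∃ F' : PForm n, F.TwoReduction k F' := by
  classical
  have hlt : ∀ f g : Fin n → ℕ, 0 < ∑ i, ((f i : ℤ) ^ 2 - (g i : ℤ) ^ 2) →
      ∑ i, g i ^ 2 < ∑ i, f i ^ 2 := fun f g hs => by
    rw [Finset.sum_sub_distrib] at hs
    zify
    linarith
  induction h : F.ordSq 2 using Nat.strong_induction_on generalizing F with
  | _ N ih =>
  subst h
  have hk2 := hF.odd
  by_cases hu : F.UnivAt 2
  · refine ⟨F, hF.adm, hreg, hu, ?_, fun p _ _ => Iff.rfl, fun p _ _ _ i => Iff.rfl,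
      fun p _ _ _ => id⟩
    rintro ⟨i, -, hi, -⟩
    rw [hF.M_eq] at hi
    omega
  -- what a descent ending in a universal form provides
  have fin : ∀ (F' : PForm n) (_ : Descent 2 F F'), F'.Adm (2 * k) → F'.UnivAt 2 →
      ¬ F'.Exceptional → ∃ F' : PForm n, F.TwoReduction k F' :=
    fun F' δ h1 h2 h3 => ⟨F', h1, δ.regular Nat.prime_two hreg, h2, h3,
      fun p _ hp => δ.univAt_iff Nat.prime_two hp, fun p _ hp hD i =>
      δ.dvd_iff Nat.prime_two hF.adm h1 Fact.out hp hD i, fun p _ hp hD =>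
        δ.repMul Nat.prime_two hF.adm h1 hp hD⟩
  have hsqm : ∀ z : ℤ, z % 2 = 0 ∧ z ^ 2 % 4 = 0 ∨ z % 2 = 1 ∧ z ^ 2 % 4 = 1 := fun z => by
    rcases Int.even_or_odd' z with ⟨c, rfl | rfl⟩
    · left; refine ⟨by omega, ?_⟩; rw [show (2 * c) ^ 2 = 4 * c ^ 2 by ring]; omega
    · right; refine ⟨by omega, ?_⟩
      rw [show (2 * c + 1) ^ 2 = 4 * (c ^ 2 + c) + 1 by ring]; omega
  rcases hF.odd_coeffs hn hreg hu with ⟨i, hi, hr⟩ | ⟨i, j, hij, hi, hj, hr⟩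
  · -- one odd coefficient
    have hforce : ∀ e : ℕ, 1 ≤ e → ∀ y y₀ : Fin n → ℤ, (∀ l ∈ ({i} : Finset (Fin n)), y₀ l % 2 = 0) →
        (∀ l ∈ (∅ : Finset (Fin n)), y₀ l % 2 = 1) →
        2 ^ e ∣ ∑ l, (F.a l : ℤ) * (y l ^ 2 - y₀ l ^ 2) →
        (∀ l ∈ ({i} : Finset (Fin n)), y l % 2 = 0) ∧
        (∀ l ∈ (∅ : Finset (Fin n)), y l % 2 = 1) := by
      intro e he y y₀ h0 _ hd
      refine ⟨fun l hl => ?_, fun l hl => absurd hl (Finset.notMem_empty l)⟩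
      rw [Finset.mem_singleton] at hl
      subst hl
      rw [← Finset.add_sum_erase _ _ (Finset.mem_univ l)] at hd
      have h2 : (2 : ℤ) ∣ ∑ m ∈ Finset.univ.erase l, (F.a m : ℤ) * (y m ^ 2 - y₀ m ^ 2) :=
        Finset.dvd_sum fun m hm => Dvd.dvd.mul_right (by
          have := hr m (Finset.ne_of_mem_erase hm); omega) _
      have h3 := (dvd_add_left h2).1 ((dvd_pow_self (2 : ℤ) (by omega)).trans hd)
      have h4 := (Int.prime_two.dvd_mul.1 h3).resolve_left (by omega)
      have h5 := h0 l (by simp)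
      rcases hsqm (y l) with h | h <;> rcases hsqm (y₀ l) with h' | h' <;> omega
    have step : ∀ F' : PForm n, Descent 2 F F' → F'.Adm (2 * k) → (∀ l, F'.M l = 2 * k) →
        F'.ordSq 2 < F.ordSq 2 → ∃ F' : PForm n, F.TwoReduction k F' := fun F' δ hA hM hlt => by
      obtain ⟨G, hG⟩ := ih _ hlt ⟨hA, hM, hF.odd, hF.big⟩ (δ.regular Nat.prime_two hreg) rfl
      exact ⟨G, hG.adm, hG.regular, hG.univ_two, hG.not_exceptional,
        fun p _ hp => (δ.univAt_iff Nat.prime_two hp).trans (hG.univ_iff p hp),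
        fun p _ hp hD l => (hG.dvd_iff p hp hD l).trans
          (δ.dvd_iff Nat.prime_two hF.adm hA Fact.out hp hD l),
        fun p _ hp hD h => δ.repMul Nat.prime_two hF.adm hA hp hD (hG.repMul p hp hD h)⟩
    have hvi : padicValNat 2 (F.a i) = 0 := padicValNat.eq_zero_of_not_dvd (by omega)
    by_cases h4 : ∃ l, l ≠ i ∧ F.a l % 4 ≠ 0
    · obtain ⟨l, hli, hl⟩ := h4
      obtain ⟨F', δ, hA, ha, hM, -⟩ := hF.exists_descent {i} ∅ (by simp) (e := 1)
        (fun m => if m = i then 2 * F.a i else F.a m / 2)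
        (fun m hm => by rw [Finset.mem_singleton] at hm; subst hm; simp; ring)
        (fun m hm => absurd hm (Finset.notMem_empty m))
        (fun m hm _ => by
          rw [Finset.mem_singleton] at hm
          have := hr m hm
          simp only [hm, if_false]
          omega)
        ⟨l, by have := hr l hli; simp only [hli, if_false]; omega⟩ (hforce 1 le_rfl)
      refine step F' δ hA (fun m => hM m (by simp)) (hlt _ _ ?_)
      have e0 : padicValNat 2 (F'.a i) = 1 := by
        have : F'.a i = 2 * F.a i := by rw [ha]; simp
        rw [this, padicValNat.mul (by norm_num) (hF.adm.pos i).ne', hvi]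
        simp
      have e1 : ∀ m ∈ Finset.univ.erase i, (1 : ℤ) ≤
          (padicValNat 2 (F.a m) : ℤ) ^ 2 - (padicValNat 2 (F'.a m) : ℤ) ^ 2 := fun m hm => by
        have hmi := Finset.ne_of_mem_erase hm
        have : F.a m = 2 * F'.a m := by
          rw [ha]; have := hr m hmi; simp only [hmi, if_false]; omega
        rw [this, padicValNat.mul (by norm_num) (hA.pos m).ne', padicValNat.self (by norm_num)]
        generalize padicValNat 2 (F'.a m) = v
        push_cast
        nlinarith [Int.natCast_nonneg v]
      rw [← Finset.add_sum_erase _ _ (Finset.mem_univ i), e0, hvi]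
      have := Finset.sum_le_sum e1
      simp only [Finset.sum_const, Finset.card_erase_of_mem (Finset.mem_univ i), Finset.card_univ,
        Fintype.card_fin, nsmul_eq_mul, mul_one] at this
      push_cast [show 1 ≤ n by omega] at this ⊢
      have : (4 : ℤ) ≤ n := by exact_mod_cast hn
      linarith
    · push Not at h4
      obtain ⟨F', δ, hA, ha, hM, -⟩ := hF.exists_descent {i} ∅ (by simp) (e := 2)
        (fun m => if m = i then F.a i else F.a m / 4)
        (fun m hm => by rw [Finset.mem_singleton] at hm; subst hm; simp)
        (fun m hm => absurd hm (Finset.notMem_empty m))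
        (fun m hm _ => by
          rw [Finset.mem_singleton] at hm
          have := h4 m hm
          simp only [hm, if_false]
          omega)
        ⟨i, by simpa using hi⟩ (hforce 2 (by norm_num))
      refine step F' δ hA (fun m => hM m (by simp)) (hlt _ _ ?_)
      have e0 : padicValNat 2 (F'.a i) = 0 := by
        have : F'.a i = F.a i := by rw [ha]; simp
        rw [this, hvi]
      have e1 : ∀ m ∈ Finset.univ.erase i, (1 : ℤ) ≤
          (padicValNat 2 (F.a m) : ℤ) ^ 2 - (padicValNat 2 (F'.a m) : ℤ) ^ 2 := fun m hm => by
        have hmi := Finset.ne_of_mem_erase hm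
        have : F.a m = 2 ^ 2 * F'.a m := by
          rw [ha]; have := h4 m hmi; simp only [hmi, if_false]; omega
        rw [this, padicValNat.mul (by norm_num) (hA.pos m).ne', padicValNat.prime_pow]
        generalize padicValNat 2 (F'.a m) = v
        push_cast
        nlinarith [Int.natCast_nonneg v]
      rw [← Finset.add_sum_erase _ _ (Finset.mem_univ i), e0, hvi]
      have := Finset.sum_le_sum e1
      simp only [Finset.sum_const, Finset.card_erase_of_mem (Finset.mem_univ i), Finset.card_univ,
        Fintype.card_fin, nsmul_eq_mul, mul_one] at this
      push_cast [show 1 ≤ n by omega] at this ⊢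
      have : (4 : ℤ) ≤ n := by exact_mod_cast hn
      linarith
  · -- two odd coefficients
    have hpair : ∀ y y₀ : Fin n → ℤ, 4 ∣ ∑ l, (F.a l : ℤ) * (y l ^ 2 - y₀ l ^ 2) →
        (4 : ℤ) ∣ F.a i * (y i ^ 2 - y₀ i ^ 2) + F.a j * (y j ^ 2 - y₀ j ^ 2) := by
      intro y y₀ hd
      rw [← Finset.add_sum_erase _ _ (Finset.mem_univ i), ← Finset.add_sum_erase _ _
        (Finset.mem_erase.2 ⟨hij.symm, Finset.mem_univ _⟩), ← add_assoc] at hd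
      refine (dvd_add_left (Finset.dvd_sum fun m hm => Dvd.dvd.mul_right ?_ _)).1 hd
      have := hr m (Finset.ne_of_mem_erase (Finset.mem_of_mem_erase hm)) (Finset.ne_of_mem_erase hm)
      omega
    have hmul : ∀ (b : ℕ) (z : ℤ), b % 2 = 1 → (z % 4 = 0 ∧ (b * z) % 4 = 0) ∨
        (z % 4 = 1 ∧ (b * z) % 4 = b % 4) ∨ z % 4 = 2 ∨ (z % 4 = 3 ∧ (b * z) % 4 = (- b : ℤ) % 4) := by
      intro b z hb
      have : (b : ℤ) % 4 = 1 ∨ (b : ℤ) % 4 = 3 := by omega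
      have hz : z % 4 = 0 ∨ z % 4 = 1 ∨ z % 4 = 2 ∨ z % 4 = 3 := by omega
      rcases this with h | h <;> rcases hz with h' | h' | h' | h' <;>
        simp [Int.mul_emod, h, h'] <;> omega
    -- The two squares have different parities if the coefficients add up to `0` modulo `4`, and are
    -- both odd otherwise.
    by_cases hs : (F.a i + F.a j) % 4 = 0
    · obtain ⟨F', δ, hA, ha, hM, hM'⟩ := hF.exists_descent {j} {i} (by simpa using hij.symm) (e := 2)
        (fun m => if m = i then 2 * F.a i else if m = j then F.a j else F.a m / 4)
        (fun m hm => by rw [Finset.mem_singleton] at hm; subst hm; simp [hij.symm])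
        (fun m hm => by rw [Finset.mem_singleton] at hm; subst hm; simp; ring)
        (fun m hm hm' => by
          rw [Finset.mem_singleton] at hm hm'
          have := hr m hm' hm
          simp only [hm, hm', if_false]
          omega)
        ⟨j, by simpa [hij.symm] using hj⟩
        (fun y y₀ h0 h1 hd => by
          have h2 := hpair y y₀ (by simpa using hd)
          simp only [Finset.mem_singleton, forall_eq] at h0 h1 ⊢
          have m1 := hmul (F.a i) (y i ^ 2 - y₀ i ^ 2) hi
          have m2 := hmul (F.a j) (y j ^ 2 - y₀ j ^ 2) hj
          rcases hsqm (y i) with h | h <;> rcases hsqm (y₀ i) with h' | h' <;>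
            rcases hsqm (y j) with g | g <;> rcases hsqm (y₀ j) with g' | g' <;> omega)
      have hMi := hM' i (by simp)
      have hMj := hM j (by simpa using hij.symm)
      refine fin F' δ hA (univAt_two_of_parity (i := i) (by omega) hi (by rw [ha]; simp)
        hij.symm (by rw [ha]; simp [hij.symm, hj]) ?_) ?_
      · have hS : F'.M j = 2 * k := hMj
        have hc := hA.cop j
        rw [hS] at hc
        by_contra h0
        have := Nat.dvd_gcd (show 2 ∣ F'.r j by omega) (dvd_mul_right 2 k)
        rw [hc] at this
        omega
      · rintro ⟨x, y, hx, hy, hx1, hy3⟩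
        have hxi : x = i := by
          by_contra h
          have := hM x (by simpa using h)
          omega
        rw [hxi, ha] at hx1
        simp only [if_true] at hx1
        omega
    · have hforce : ∀ e : ℕ, 2 ≤ e → ∀ y y₀ : Fin n → ℤ,
          (∀ l ∈ (∅ : Finset (Fin n)), y₀ l % 2 = 0) →
          (∀ l ∈ ({i, j} : Finset (Fin n)), y₀ l % 2 = 1) →
          2 ^ e ∣ ∑ l, (F.a l : ℤ) * (y l ^ 2 - y₀ l ^ 2) →
          (∀ l ∈ (∅ : Finset (Fin n)), y l % 2 = 0) ∧
          (∀ l ∈ ({i, j} : Finset (Fin n)), y l % 2 = 1) := by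
        intro e he y y₀ _ h1 hd
        have h2 := hpair y y₀ (by
          refine dvd_trans ?_ hd
          exact_mod_cast pow_dvd_pow (2 : ℕ) he)
        have h1i := h1 i (by simp)
        have h1j := h1 j (by simp)
        have m1 := hmul (F.a i) (y i ^ 2 - y₀ i ^ 2) hi
        have m2 := hmul (F.a j) (y j ^ 2 - y₀ j ^ 2) hj
        have : y i % 2 = 1 ∧ y j % 2 = 1 := by
          rcases hsqm (y i) with h | h <;> rcases hsqm (y₀ i) with h' | h' <;>
            rcases hsqm (y j) with g | g <;> rcases hsqm (y₀ j) with g' | g' <;> omega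
        refine ⟨fun l hl => absurd hl (Finset.notMem_empty l), fun l hl => ?_⟩
        rw [Finset.mem_insert, Finset.mem_singleton] at hl
        rcases hl with rfl | rfl
        exacts [this.1, this.2]
      have hmem : ∀ {m}, m ∉ ({i, j} : Finset (Fin n)) → m ≠ i ∧ m ≠ j := fun hm => by
        simpa using hm
      by_cases h8 : ∃ l, l ≠ i ∧ l ≠ j ∧ F.a l % 8 ≠ 0
      · obtain ⟨l, hli, hlj, hl⟩ := h8
        have hl4 := hr l hli hlj
        obtain ⟨F', δ, hA, ha, hM, hM'⟩ := hF.exists_descent ∅ {i, j} (by simp) (e := 2)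
          (fun m => if m = i ∨ m = j then 2 * F.a m else F.a m / 4)
          (fun m hm => absurd hm (Finset.notMem_empty m))
          (fun m hm => by
            rw [Finset.mem_insert, Finset.mem_singleton] at hm
            simp only [hm, if_true]; ring)
          (fun m _ hm => by
            have := hr m (hmem hm).1 (hmem hm).2
            simp only [hmem hm, or_self, if_false]
            omega)
          ⟨l, by simp only [hli, hlj, or_self, if_false]; omega⟩ (hforce 2 le_rfl)
        have hMi := hM' i (by simp)
        have hMl := hM l (by simp [hli, hlj])
        refine fin F' δ hA (univAt_two_of_parity (i := i) (by omega) hi (by rw [ha]; simp)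
          hli (by rw [ha]; simp only [hli, hlj, or_self, if_false]; omega) ?_) ?_
        · have hc := hA.cop l
          rw [hMl] at hc
          by_contra h0
          have := Nat.dvd_gcd (show 2 ∣ F'.r l by omega) (dvd_mul_right 2 k)
          rw [hc] at this
          omega
        · rintro ⟨x, y, hx, hy, hx1, hy3⟩
          have hxi : x ∈ ({i, j} : Finset (Fin n)) := by
            by_contra h
            have := hM x h
            omega
          rw [Finset.mem_insert, Finset.mem_singleton] at hxi
          rw [ha] at hx1
          simp only [hxi, if_true] at hx1
          omega
      · push Not at h8
        obtain ⟨F', δ, hA, ha, hM, hM'⟩ := hF.exists_descent ∅ {i, j} (by simp) (e := 3)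
          (fun m => if m = i ∨ m = j then F.a m else F.a m / 8)
          (fun m hm => absurd hm (Finset.notMem_empty m))
          (fun m hm => by
            rw [Finset.mem_insert, Finset.mem_singleton] at hm
            simp only [hm, if_true]; norm_num)
          (fun m _ hm => by
            have := h8 m (hmem hm).1 (hmem hm).2
            simp only [hmem hm, or_self, if_false]
            omega)
          ⟨i, by simpa using hi⟩ (hforce 3 (by norm_num))
        have hMi := hM' i (by simp)
        refine fin F' δ hA (univAt_two_of_odd (i := i) (by rw [ha]; simp; omega)
          (hA.cop i) (by omega)) ?_
        rintro ⟨x, y, hx, hy, hx1, hy3⟩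
        have hxi : ∀ x, F'.M x = 13 → F.a x % 4 = F.a i % 4 ∧ F'.a x = F.a x := fun x hx => by
          have hxm : x ∈ ({i, j} : Finset (Fin n)) := by
            by_contra h
            have := hM x h
            omega
          rw [Finset.mem_insert, Finset.mem_singleton] at hxm
          refine ⟨?_, by rw [ha]; simp only [hxm, if_true]⟩
          rcases hxm with rfl | rfl <;> omega
        have h1 := hxi x hx
        have h2 := hxi y hy
        omega

end PForm

/-! ### Universality at `3` -/

instance fact_prime_three' : Fact (Nat.Prime 3) := ⟨Nat.prime_three⟩

namespace PForm

variable {n : ℕ} {D : ℕ} {F : PForm n}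

lemma Adm.eq_zero_of_tm (hF : F.Adm D) {i : Fin n} {z : ℤ} (h : F.tm i z = 0) : z = 0 := by
  by_contra h0
  have h1 := hF.lev_pos i
  have h2 := hF.lev_lt i
  have h3 : (0 : ℤ) < F.a i := by exact_mod_cast hF.pos i
  have hP : 0 < polyVal (F.M i) (F.r i) z := by
    by_cases hz : z = 1
    · rw [hz]; simpa using h1
    · have := polyVal_ge h1 h2 h0 hz
      omega
  exact (mul_pos h3 hP).ne' h

lemma Adm.tm_ge (hF : F.Adm D) {i : Fin n} {z : ℤ} (h0 : z ≠ 0) (h1 : z ≠ 1) :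
    (F.M i : ℤ) - F.r i ≤ F.tm i z := by
  have h2 := polyVal_ge (hF.lev_pos i) (hF.lev_lt i) h0 h1
  have h3 := polyVal_nonneg (hF.lev_pos i) (hF.lev_lt i) z
  have h4 : (1 : ℤ) ≤ F.a i := by exact_mod_cast hF.pos i
  unfold tm
  nlinarith

lemma tm_le_val (hF : F.Adm D) (x : Fin n → ℤ) (i : Fin n) : F.tm i (x i) ≤ F.val x :=
  Finset.single_le_sum (f := fun i => F.tm i (x i)) (fun i _ => hF.tm_nonneg i _) (Finset.mem_univ i)

lemma Adm.vertex_forced (hF : F.Adm D) {p : ℕ} [Fact p.Prime] (h2 : p ≠ 2) (hD : ¬ p ∣ D)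
    (hbad : ¬ F.UnivAt p) {x : Fin n → ℤ} {N : ℤ} (hx : F.val x = N)
    (hN : (p : ℤ) ∣ 8 * D * N + F.disc D) {i : Fin n} (hi : ¬ p ∣ F.a i) :
    (p : ℤ) ∣ 2 * F.M i * x i - F.cc i := by
  refine hF.vertex_of_bad h2 hD hbad (fun i => 2 * F.M i * x i - F.cc i) ?_ i hi
  rw [hF.complete_square_int hx]
  exact hN

lemma Adm.mod_three (hF : F.Adm D) (hD : ¬ 3 ∣ D) (i : Fin n) : F.M i % 3 = 1 ∨ F.M i % 3 = 2 := by
  have := hF.not_dvd_M hD i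
  omega

/-- The residue modulo `3` of the vertex, according to the level. -/
lemma Adm.vertex_mod_three (hF : F.Adm D) (hD : ¬ 3 ∣ D) {i : Fin n} {z : ℤ}
    (hz : ((3 : ℕ) : ℤ) ∣ 2 * F.M i * z - F.cc i) :
    (F.cc i % 3 = 0 → z % 3 = 0) ∧ (F.cc i % 3 ≠ 0 → F.r i % 3 ≠ 0 → z % 3 = 1) ∧
      (F.r i % 3 = 0 → z % 3 = 2) := by
  have hM := hF.mod_three hD i
  obtain ⟨q, hq⟩ : ∃ q : ℤ, (F.M i : ℤ) = 3 * q + 1 ∨ (F.M i : ℤ) = 3 * q + 2 := by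
    rcases hM with h | h
    · exact ⟨F.M i / 3, by omega⟩
    · exact ⟨F.M i / 3, by omega⟩
  have hcc : F.cc i = F.M i - 2 * F.r i := rfl
  rcases hq with h | h <;> rw [h] at hz
  · have : ((3 : ℕ) : ℤ) ∣ 2 * z - F.cc i := by
      rw [show 2 * z - F.cc i = (2 * (3 * q + 1) * z - F.cc i) - 3 * (2 * q * z) by ring]
      exact dvd_sub hz (by push_cast; exact dvd_mul_right _ _)
    refine ⟨fun _ => by omega, fun _ _ => by omega, fun _ => by omega⟩
  · have : ((3 : ℕ) : ℤ) ∣ 4 * z - F.cc i := by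
      rw [show 4 * z - F.cc i = (2 * (3 * q + 2) * z - F.cc i) - 3 * (2 * q * z) by ring]
      exact dvd_sub hz (by push_cast; exact dvd_mul_right _ _)
    refine ⟨fun _ => by omega, fun _ _ => by omega, fun _ => by omega⟩

lemma Adm.wa_cases (hF : F.Adm D) (i : Fin n) : F.wa D i = F.a i ∨ F.wa D i = 2 * F.a i := by
  unfold wa
  rcases hF.wt_cases i with ⟨-, h⟩ | ⟨-, h⟩ <;> rw [h]
  · left; ring
  · right; ring

/-- If only one coefficient has exact order one at `3` and the vertex of a unit variable has residue
`2`, a small number in the vertex class is represented over `ℤ_3`; only one level permits this. -/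
lemma Adm.of_vertex_two (hF : F.Adm D) (hD : ¬ 3 ∣ D)
    (hglob : ∀ N : ℕ, F.RepAt 3 N → F.RepInt N) (hbad : ¬ F.UnivAt 3) {i k : Fin n}
    (hi : ¬ 3 ∣ F.a i) (hri : F.r i % 3 = 0) (hk : 3 ∣ F.a k) (hk9 : ¬ 9 ∣ F.a k)
    (hother : ∀ m, m ≠ k → 3 ∣ F.a m → 9 ∣ F.a m) :
    F.a i = 1 ∧ F.M i = 13 ∧ F.r i = 6 ∧ ¬ 3 ∣ F.cc k ∧
      (∀ j, j ≠ i → ¬ 3 ∣ F.a j → F.r j % 3 ≠ 0) ∧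
      ∃ N : ℤ, N % 3 ≠ 0 ∧ ((3 : ℕ) : ℤ) ∣ 8 * D * N + F.disc D := by
  classical
  have h32 : (3 : ℕ) ≠ 2 := by norm_num
  obtain ⟨v, hv0, hv3, hv⟩ := exists_class (F := F) Nat.prime_three h32 hD
  have hTv := (hv v).2 (by simp)
  have hwk := hF.wa_cases k
  -- The target of `N` agrees with the coefficient `k` modulo `9`, hence is a square multiple of it.
  obtain ⟨N, hN0, hN8, hNT, hN9⟩ : ∃ N : ℤ, 0 ≤ N ∧ N ≤ 8 ∧ ((3 : ℕ) : ℤ) ∣ 8 * D * N + F.disc D ∧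
      9 ∣ 8 * D * N + F.disc D - F.wa D k := by
    have : ∃ s : ℤ, (s = 0 ∨ s = 3 ∨ s = 6) ∧ 9 ∣ 8 * D * (v + s) + F.disc D - F.wa D k := by
      obtain ⟨t, ht⟩ := hTv
      obtain ⟨u, hu⟩ : ∃ u : ℤ, (F.wa D k : ℤ) = 3 * u := ⟨F.wa D k / 3, by omega⟩
      obtain ⟨q, hq⟩ : ∃ q : ℤ, (D : ℤ) = 3 * q + 1 ∨ (D : ℤ) = 3 * q + 2 := ⟨D / 3, by omega⟩
      have e : ∀ s, 8 * (D : ℤ) * (v + s) + F.disc D - F.wa D k = 3 * (t - u) + 8 * D * s := by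
        intro s; push_cast at ht; linear_combination ht - hu
      simp only [e]
      have : (t - u) % 3 = 0 ∨ (t - u) % 3 = 1 ∨ (t - u) % 3 = 2 := by omega
      clear ht hk hk9 hwk
      rcases hq with hq | hq <;> rcases this with h | h | h
      · exact ⟨0, by simp, by omega⟩
      · exact ⟨3, by simp, by omega⟩
      · exact ⟨6, by simp, by omega⟩
      · exact ⟨0, by simp, by omega⟩
      · exact ⟨6, by simp, by omega⟩
      · exact ⟨3, by simp, by omega⟩
    obtain ⟨s, hs, h9⟩ := this
    exact ⟨v + s, by omega, by omega, (hv _).2 (by push_cast; omega), h9⟩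
  have hrep : F.RepAt 3 N := by
    apply hF.repAt_of_diagRep h32 hD
    obtain ⟨u, hu, huk⟩ := hF.wa_eq_mul_unit (p := 3) h32 hk (by simpa using hk9)
    obtain ⟨w, hw⟩ := hN9
    obtain ⟨z, hz⟩ := exists_sq_mul_of_dvd (p := 3) (a := u) (u := u + 3 * w) (y₀ := 1) h32 hu
      (by
        rw [← padicInt_isUnit_iff]
        exact isUnit_one) ⟨w, by push_cast; ring⟩
    refine DiagRep.mono (s := {k}) ((DiagRep.single k z).of_eq ?_) (Finset.subset_univ _)
    have hw' := congrArg (Int.cast : ℤ → ℤ_[3]) hw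
    push_cast at hw' huk
    rw [huk] at hw' ⊢
    linear_combination 3 * hz - hw'
  lift N to ℕ using hN0
  obtain ⟨x, hx⟩ := hglob N (by simpa using hrep)
  have hvert : ∀ j, ¬ 3 ∣ F.a j → ((3 : ℕ) : ℤ) ∣ 2 * F.M j * x j - F.cc j := fun j hj =>
    hF.vertex_forced h32 hD hbad hx hNT hj
  have hge : ∀ j, ¬ 3 ∣ F.a j → F.r j % 3 = 0 → x j % 3 = 2 ∧ (F.M j : ℤ) - F.r j ≤ F.tm j (x j) :=
    fun j hj hrj => by
      have := (hF.vertex_mod_three hD (hvert j hj)).2.2 hrj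
      exact ⟨this, hF.tm_ge (by omega) (by omega)⟩
  obtain ⟨hxi, hgei⟩ := hge i hi hri
  have hlei := tm_le_val hF x i
  have hgap := hF.lev_gap i
  have hbig := hF.big i
  have hlt := hF.lev_lt i
  rw [hx] at hlei
  -- The unit variable is off `0` and `1`, so its term is at least `M - r ≥ 7`; since `N ≤ 8` and
  -- `r` is a multiple of `3` below `M / 2`, this determines everything.
  have htm : F.a i = 1 ∧ F.tm i (x i) = (F.M i : ℤ) - F.r i := by
    rcases hF.tm_cases i (z := x i) (by omega) with h | h | ⟨h, -, h'⟩
    · omega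
    · have h0 : F.tm i (x i) = F.a i * polyVal (F.M i) (F.r i) (x i) := rfl
      have h1 := polyVal_ge (hF.lev_pos i) hlt (by omega : x i ≠ 0) (by omega)
      rw [h0] at h
      push_cast at h
      have := mul_left_cancel₀ (by exact_mod_cast (hF.pos i).ne' : (F.a i : ℤ) ≠ 0) h
      omega
    · exact ⟨h, h'⟩
  have h14 : F.M i = 14 → F.r i ≠ 6 := fun h h' => by
    have := hF.cop i
    rw [h, h'] at this
    revert this
    decide
  have hM : F.M i = 13 ∧ F.r i = 6 := by omega
  have hrest : ∀ j, j ≠ i → F.tm j (x j) ≤ 1 := fun j hj => by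
    rw [val_split_one F i] at hx
    have : F.tm j (x j) ≤ _ := Finset.single_le_sum (f := fun j => F.tm j (x j))
      (fun j _ => hF.tm_nonneg j _) (Finset.mem_erase.2 ⟨hj, Finset.mem_univ j⟩)
    omega
  have hki : k ≠ i := fun h => hi (h ▸ hk)
  have hxk : x k = 0 := by
    apply hF.eq_zero_of_tm (i := k)
    have h1 := hF.tm_nonneg k (x k)
    have h2 := hrest k hki
    have h3 := dvd_tm hk (x k)
    omega
  refine ⟨htm.1, hM.1, hM.2, fun hc => ?_, fun j hji hj hrj => ?_, N, by omega, hNT⟩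
  · have h1 := hF.complete_square_int hx
    have h2 : (9 : ℤ) ∣ ∑ j, (F.wa D j : ℤ) * (2 * F.M j * x j - F.cc j) ^ 2 := by
      refine Finset.dvd_sum fun j _ => ?_
      by_cases hj : 3 ∣ F.a j
      · by_cases hjk : j = k
        · subst hjk
          rw [hxk]
          obtain ⟨c, hc⟩ := hc
          exact ⟨F.wa D j * c ^ 2, by rw [hc]; ring⟩
        · have := hother j hjk hj
          have h4 := hF.wa_cases j
          exact Dvd.dvd.mul_right (by omega) _
      · obtain ⟨c, hc⟩ := hvert j hj
        exact ⟨F.wa D j * c ^ 2, by rw [hc]; push_cast; ring⟩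
    rw [h1] at h2
    omega
  · have h1 := (hge j hj hrj).2
    have h2 := hF.lev_gap j
    have := hrest j hji
    omega

/-- Three coefficients of exact order one, or one of exact order two next to two of exact order one
and a unit, represent all multiples of `3`. -/
lemma Adm.repMul_of (hF : F.Adm D) {p : ℕ} [Fact p.Prime] (h2 : p ≠ 2) {i k l m : Fin n}
    (hi : ¬ p ∣ F.a i) (hkl : k ≠ l) (hk : p ∣ F.a k) (hk' : ¬ p ^ 2 ∣ F.a k)
    (hl : p ∣ F.a l) (hl' : ¬ p ^ 2 ∣ F.a l) (hm : p ∣ F.a m) (hmk : m ≠ k) (hml : m ≠ l)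
    (hm' : ¬ p ^ 3 ∣ F.a m) : F.RepMul p D := by
  classical
  intro t
  by_cases h : p ^ 2 ∣ F.a m
  · have hpair : ∀ u : ℤ_[p], IsUnit u →
        DiagRep (fun i => (F.wa D i : ℤ_[p])) {i, m} (p * (p * u)) := by
      intro u hu
      obtain ⟨b, hb⟩ := h
      have hp : p.Prime := Fact.out
      have hu' : IsUnit ((b * (D / F.M m) : ℕ) : ℤ_[p]) := by
        rw [padicInt_isUnit_natCast, hp.dvd_mul, not_or]
        constructor
        · intro h
          apply hm'
          rw [hb, pow_succ]
          exact Nat.mul_dvd_mul_left _ h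
        · have h3 : ¬ p ∣ 2 := fun h => h2 ((Nat.prime_dvd_prime_iff_eq hp Nat.prime_two).1 h)
          rcases hF.wt_cases m with ⟨-, h'⟩ | ⟨-, h'⟩ <;> rw [h']
          · exact hp.one_lt.ne' ∘ Nat.dvd_one.1
          · exact h3
      have him : i ≠ m := fun h => hi (h ▸ hm)
      have h0 := diagRep_pair_unit
        (A := fun j => if j = i then (F.wa D i : ℤ_[p]) else ((b * (D / F.M m) : ℕ) : ℤ_[p])) h2 him
        (by simpa using hF.isUnit_wa h2 hi) (by simpa [him.symm] using hu') hu
      refine (h0.scale (A := fun i => (F.wa D i : ℤ_[p])) (d := (p : ℤ_[p]) * p) fun j hj => ?_).of_eq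
        (by ring)
      rw [Finset.mem_insert, Finset.mem_singleton] at hj
      rcases hj with rfl | rfl
      · exact ⟨p, by simp; ring⟩
      · refine ⟨1, ?_⟩
        simp only [him.symm, if_false]
        unfold wa
        rw [hb]
        push_cast
        ring
    rcases padicInt_eq_sq_mul t with rfl | ⟨d, u, hu, rfl | rfl⟩
    · rw [mul_zero]; exact DiagRep.zero
    · exact ((((hF.diagRep_of_exact h2 hkl hk hk' hl hl' hu).sq_mul d).mono
        (Finset.subset_univ _)).of_eq (by ring))
    · exact ((((hpair u hu).sq_mul d).mono (Finset.subset_univ _)).of_eq (by ring))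
  · choose! u hu huw using fun j (hj : p ∣ F.a j ∧ ¬ p ^ 2 ∣ F.a j) =>
      hF.wa_eq_mul_unit h2 hj.1 hj.2
    have h0 := diagRep_three_unit (A := u) h2 hkl hmk.symm hml.symm (hu k ⟨hk, hk'⟩)
      (hu l ⟨hl, hl'⟩) (hu m ⟨hm, h⟩) t
    refine (h0.scale (A := fun i => (F.wa D i : ℤ_[p])) fun j hj => ⟨1, ?_⟩).mono
      (Finset.subset_univ _)
    simp only [Finset.mem_insert, Finset.mem_singleton] at hj
    rw [one_pow, mul_one]
    rcases hj with rfl | rfl | rfl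
    exacts [huw _ ⟨hm, h⟩, huw _ ⟨hk, hk'⟩, huw _ ⟨hl, hl'⟩]

/-- With one unit coefficient, all multiples of `3` are represented over `ℤ_3`. The numbers `3` and
`6`, possibly shifted, provide two coefficients of exact order one; if there were no third one of
order at most two, the form would take no value between the sums of these two and `27`, although it
takes such values locally. -/
lemma Adm.repMul_three (hF : F.Adm D) (hD : ¬ 3 ∣ D)
    (hglob : ∀ N : ℕ, F.RepAt 3 N → F.RepInt N) (hbad : ¬ F.UnivAt 3) (hexc : ¬ F.Exceptional)
    {i : Fin n} (hi : ¬ 3 ∣ F.a i) (hr : ∀ j, j ≠ i → 3 ∣ F.a j) : F.RepMul 3 D := by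
  classical
  have h32 : (3 : ℕ) ≠ 2 := by norm_num
  have hM := hF.mod_three hD i
  have hcc : F.cc i = F.M i - 2 * F.r i := rfl
  have hgap := hF.lev_gap i
  have hbig := hF.big i
  have hlt := hF.lev_lt i
  have hα : F.r i % 3 ≠ 0 → (F.a i * F.r i) % 3 ≠ 0 := fun h h' => by
    rcases (Nat.Prime.dvd_mul Nat.prime_three).1 (Nat.dvd_of_mod_eq_zero h') with h1 | h1
    · exact hi h1
    · omega
  have hs : ∀ j ∈ Finset.univ.erase i, 3 ∣ F.a j := fun j hj => hr j (Finset.ne_of_mem_erase hj)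
  have key := fun N z => hF.exists_of_one_unit (p := 3) (N := N) (z := z) h32 hD hglob hi hr
  -- off the vertex the class of `0` is represented
  have key0 : F.cc i % 3 ≠ 0 → ∀ N : ℤ, 0 ≤ N → N % 3 = 0 → _ := fun hc N h0 hN =>
    key N 0 h0 (by rw [tm_zero]; push_cast; omega) (by push_cast; omega)
  -- If `3` divides the level, the vertex class contains neither `0` nor `1`, and the values at the
  -- vertex are large.
  by_cases hr3 : F.r i % 3 = 0
  · exfalso
    have hα3 : (F.a i * F.r i) % 3 = 0 := by rw [Nat.mul_mod, hr3]; simp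
    obtain ⟨x₃, e3, f3, g3⟩ := key0 (by omega) 3 (by norm_num) (by norm_num)
    have n3 := hF.tm_nonneg i (x₃ i)
    have c3 := hF.tm_cases_lt i (z := x₃ i) (by omega)
    by_cases hno : ∀ j, j ≠ i → 9 ∣ F.a j
    · obtain ⟨x₆, e6, f6, g6⟩ := key0 (by omega) 6 (by norm_num) (by norm_num)
      have n6 := hF.tm_nonneg i (x₆ i)
      have c6 := hF.tm_cases_lt i (z := x₆ i) (by omega)
      have h9 : ∀ x : Fin n → ℤ, ((9 : ℕ) : ℤ) ∣ ∑ j ∈ Finset.univ.erase i, F.tm j (x j) := fun x =>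
        Finset.dvd_sum fun j hj => dvd_tm (hno j (Finset.ne_of_mem_erase hj)) _
      have h93 := h9 x₃
      have h96 := h9 x₆
      omega
    push Not at hno
    obtain ⟨k, hki, hk9⟩ := hno
    have hk := hr k hki
    by_cases htwo : ∀ m, m ≠ k → 3 ∣ F.a m → 9 ∣ F.a m
    · obtain ⟨h1, h2, h3, h4, -, -⟩ := hF.of_vertex_two hD hglob hbad hi hr3 hk hk9 htwo
      obtain ⟨j, hj, hja, hjr⟩ := hF.exists_eq_of_sum (q := 3) (by norm_num) hs (x := x₃) (by
        rw [h1, h3] at c3; push_cast; omega)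
      have hjk : j = k := by
        by_contra hne
        have := htwo j hne (hr j (Finset.ne_of_mem_erase hj))
        omega
      subst hjk
      have hcj : F.cc j = F.M j - 2 * F.r j := rfl
      have hMi := hF.modulus i
      have hMj := hF.modulus j
      have := hF.big j
      exact hexc ⟨i, j, h2, by omega, h1, hja, h3⟩
    · push Not at htwo
      obtain ⟨l, hlk, hl, hl9⟩ := htwo
      obtain ⟨v, hv0, hv3, hv⟩ := exists_class (F := F) Nat.prime_three h32 hD
      obtain ⟨N, hN, hN1, hN2⟩ :=
        exists_exact_disc Nat.prime_three h32 hD ((hv v).2 (by simp))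
      have hN0 : 0 ≤ N := by omega
      lift N to ℕ using hN0
      obtain ⟨x, hx⟩ := hglob N (by
        have := hF.repAt_of_exact (p := 3) h32 hD hlk.symm hk (by simpa using hk9) hl
          (by simpa using hl9) hN1 hN2
        simpa using this)
      have h1 := (hF.vertex_mod_three hD (hF.vertex_forced h32 hD hbad hx hN1 hi)).2.2 hr3
      have h2 := hF.tm_ge (i := i) (z := x i) (by omega) (by omega)
      have h3 := tm_le_val hF x i
      omega
  · -- the multiples `3` and `6` are represented by the other coefficients
    have hα' := hα hr3
    obtain ⟨hx, hx'⟩ : (∃ x : Fin n → ℤ, ∑ j ∈ Finset.univ.erase i, F.tm j (x j) = (3 : ℕ)) ∧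
        (∃ x : Fin n → ℤ, ∑ j ∈ Finset.univ.erase i, F.tm j (x j) = 2 * (3 : ℕ)) := by
      by_cases hc : F.cc i % 3 = 0
      · have key1 : ∀ N : ℤ, 0 ≤ N → N % 3 = (F.a i * F.r i : ℕ) % 3 → _ := fun N h0 hN =>
          key N 1 h0 (by rw [tm_one]; omega) (by push_cast; omega)
        obtain ⟨x, e, f, g⟩ := key1 ((F.a i * F.r i : ℕ) % 3) (by omega) (by omega)
        have c := hF.tm_cases_lt i (z := x i) (by omega)
        have h3 : F.a i * F.r i < 3 := by have := hF.tm_nonneg i (x i); omega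
        have hr2 : F.r i ≤ 2 := by
          have := Nat.le_mul_of_pos_left (F.r i) (hF.pos i)
          omega
        obtain ⟨x₃, e3, f3, g3⟩ := key1 ((F.a i * F.r i : ℕ) + 3) (by omega) (by omega)
        obtain ⟨x₆, e6, f6, g6⟩ := key1 ((F.a i * F.r i : ℕ) + 6) (by omega) (by omega)
        have n3 := hF.tm_nonneg i (x₃ i)
        have c3 := hF.tm_cases i (z := x₃ i) (by omega)
        have n6 := hF.tm_nonneg i (x₆ i)
        have c6 := hF.tm_cases i (z := x₆ i) (by omega)
        exact ⟨⟨x₃, by omega⟩, ⟨x₆, by omega⟩⟩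
      · obtain ⟨x₃, e3, f3, g3⟩ := key0 hc 3 (by norm_num) (by norm_num)
        obtain ⟨x₆, e6, f6, g6⟩ := key0 hc 6 (by norm_num) (by norm_num)
        have n3 := hF.tm_nonneg i (x₃ i)
        have c3 := hF.tm_cases_lt i (z := x₃ i) (by omega)
        have n6 := hF.tm_nonneg i (x₆ i)
        have c6 := hF.tm_cases_lt i (z := x₆ i) (by omega)
        exact ⟨⟨x₃, by omega⟩, ⟨x₆, by omega⟩⟩
    obtain ⟨x₃, hx₃⟩ := hx
    obtain ⟨x₆, hx₆⟩ := hx'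
    obtain ⟨k, hk, l, hl, hkl, hka, hkr, hla, hlr⟩ := hF.exists_pair_of_sum (by norm_num) hs hx₃ hx₆
    have hk3 := exact_of_eq (by norm_num) (Or.inl hka : F.a k = 3 ∨ F.a k = 2 * 3)
    have hl3 := exact_of_eq (by norm_num) hla
    by_contra hmul
    have h27 : ∀ m, m ≠ i → m ≠ k → m ≠ l → 27 ∣ F.a m := fun m hmi hmk hml => by
      by_contra h
      exact hmul (hF.repMul_of h32 hi hkl hk3.1 hk3.2 hl3.1 hl3.2 (hr m hmi) hmk hml
        (by simpa using h))
    -- a number in the vertex class just above the sums of the two small coefficients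
    obtain ⟨z, hz01, hzv, hz⟩ : ∃ z : ℤ, (z = 0 ∨ z = 1) ∧
        ((3 : ℕ) : ℤ) ∣ 2 * F.M i * z - F.cc i ∧
        ∀ w : ℤ, ((3 : ℕ) : ℤ) ∣ 2 * F.M i * w - F.cc i → w % 3 = z := by
      by_cases hc : F.cc i % 3 = 0
      · exact ⟨0, by simp, by push_cast; omega, fun w hw => (hF.vertex_mod_three hD hw).1 hc⟩
      · have hz1 : (F.M i + 2 * F.r i) % 3 = 0 := by
          have hr' : F.r i % 3 = 1 ∨ F.r i % 3 = 2 := by omega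
          clear hα' hlt hgap hbig hi
          rcases hM with h | h <;> rcases hr' with h' | h' <;> omega
        exact ⟨1, by simp, by push_cast; omega, fun w hw => (hF.vertex_mod_three hD hw).2.1 hc hr3⟩
    have hT : ((3 : ℕ) : ℤ) ∣ 8 * D * (F.tm i z + 12) + F.disc D := by
      refine hF.dvd_disc_of_vertex Nat.prime_three h32 (x := Pi.single i z) (fun j hj => ?_) ?_
      · have : j = i := by
          by_contra h
          exact hj (hr j h)
        subst this
        simpa using hzv
      · rw [val_single]; push_cast; omega
    obtain ⟨N, hN, hN1, hN2⟩ := exists_exact_disc Nat.prime_three h32 hD hT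
    have ht0 := hF.tm_nonneg i z
    have hN0 : 0 ≤ N := by omega
    lift N to ℕ using hN0
    obtain ⟨x, hx⟩ := hglob N (by
      have := hF.repAt_of_exact (p := 3) h32 hD hkl hk3.1 hk3.2 hl3.1 hl3.2 hN1 hN2
      simpa using this)
    have hxi := hz _ (hF.vertex_forced h32 hD hbad hx hN1 hi)
    have hxz : x i = z := by
      by_contra hne
      have h1 := polyVal_ge_far (hF.lev_pos i) hlt (by omega : x i ≠ 0) (by omega : x i ≠ 1)
        (by omega) (by omega)
      have h2 := tm_le_val hF x i
      have h3 : F.tm i (x i) = F.a i * polyVal (F.M i) (F.r i) (x i) := rfl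
      have h4 : F.tm i z ≤ F.a i * F.r i := by
        rcases hz01 with h | h <;> rw [h]
        · rw [tm_zero]; positivity
        · rw [tm_one]; push_cast; exact le_rfl
      have h5 : (1 : ℤ) ≤ F.a i := by exact_mod_cast hF.pos i
      have h6 : 21 + (F.r i : ℤ) ≤ polyVal (F.M i) (F.r i) (x i) := by omega
      have h7 : (N : ℤ) ≤ F.tm i z + 15 := by push_cast at hN; omega
      rw [hx, h3] at h2
      nlinarith [mul_le_mul_of_nonneg_left h6 (by positivity : (0 : ℤ) ≤ F.a i)]
    have hki := Finset.ne_of_mem_erase hk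
    have hli := Finset.ne_of_mem_erase hl
    rw [val_split_three F hki.symm hli.symm hkl, hxz] at hx
    have g : ((27 : ℕ) : ℤ) ∣ ∑ m ∈ ((Finset.univ.erase i).erase k).erase l, F.tm m (x m) :=
      Finset.dvd_sum fun m hm => dvd_tm (by
        simp only [Finset.mem_erase] at hm
        exact h27 m hm.2.2.1 hm.2.1 hm.1) _
    have f : 0 ≤ ∑ m ∈ ((Finset.univ.erase i).erase k).erase l, F.tm m (x m) :=
      Finset.sum_nonneg fun m _ => hF.tm_nonneg m _
    generalize ∑ m ∈ ((Finset.univ.erase i).erase k).erase l, F.tm m (x m) = S at *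
    have small : ∀ m, (F.a m = 3 ∨ F.a m = 2 * 3) → F.a m * F.r m ≤ 2 * 3 →
        F.tm m (x m) = 0 ∨ F.tm m (x m) = (F.a m * F.r m : ℕ) ∨ 27 < F.tm m (x m) := by
      intro m ha har
      by_cases h0 : x m = 0
      · left; rw [h0, tm_zero]
      by_cases h1 : x m = 1
      · right; left; rw [h1, tm_one]
      right; right
      have h2 := polyVal_ge (hF.lev_pos m) (hF.lev_lt m) h0 h1
      have h3 := hF.big m
      have h4 : F.r m ≤ 2 := by rcases ha with ha | ha <;> rw [ha] at har <;> omega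
      unfold tm
      rcases ha with ha | ha <;> rw [ha] <;> push_cast <;> omega
    have sk := small k (Or.inl hka) (by rw [hka, hkr]; norm_num)
    have sl := small l hla hlr
    have nk := hF.tm_nonneg k (x k)
    have nl := hF.tm_nonneg l (x l)
    have hkr3 : F.a k * F.r k = 3 := by rw [hka, hkr]
    clear hN1 hN2 hT key key0 small
    omega

end PForm

namespace PForm

variable {n : ℕ} {D : ℕ} {F : PForm n}

lemma not_dvd_val_one {i : Fin n} (hi : ¬ 3 ∣ F.a i) (hr : F.r i % 3 ≠ 0) :
    (F.a i * F.r i) % 3 ≠ 0 := fun h' => by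
  rcases (Nat.Prime.dvd_mul Nat.prime_three).1 (Nat.dvd_of_mod_eq_zero h') with h1 | h1
  · exact hi h1
  · omega

/-- The value at `1` modulo `3`, depending on the position of the vertex. -/
lemma Adm.val_one_mod_three (hF : F.Adm D) (hD : ¬ 3 ∣ D) {i : Fin n} (hr : F.r i % 3 ≠ 0) :
    (F.cc i % 3 = 0 → ((F.a i * F.r i : ℕ) - 2 * ((D : ℤ) * F.wa D i)) % 3 = 0) ∧
      (F.cc i % 3 ≠ 0 → ((F.a i * F.r i : ℕ) - (D : ℤ) * F.wa D i) % 3 = 0) := by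
  have h1 := congrArg (· % 3) (hF.wa_mul i)
  have h2 := hF.mod_three hD i
  have hcc : F.cc i = F.M i - 2 * F.r i := rfl
  have aux : ∀ a M r D w : ℕ, a < 3 → M < 3 → r < 3 → D < 3 → w < 3 → w * M % 3 = a * D % 3 →
      M ≠ 0 → D ≠ 0 → r ≠ 0 → (M % 3 = 2 * r % 3 → a * r % 3 = 2 * (D * w) % 3) ∧
        (M % 3 ≠ 2 * r % 3 → a * r % 3 = D * w % 3) := by
    intro a M r D w ha hM hr hD hw
    interval_cases a <;> interval_cases M <;> interval_cases r <;> interval_cases D <;>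
      interval_cases w <;> simp
  have h3 := aux (F.a i % 3) (F.M i % 3) (F.r i % 3) (D % 3) (F.wa D i % 3)
    (Nat.mod_lt _ (by norm_num)) (Nat.mod_lt _ (by norm_num)) (Nat.mod_lt _ (by norm_num))
    (Nat.mod_lt _ (by norm_num)) (Nat.mod_lt _ (by norm_num))
    (by simpa only [Nat.mul_mod, Nat.mod_mod] using h1) (by omega) (by omega) (by omega)
  have e1 : (F.a i % 3) * (F.r i % 3) % 3 = F.a i * F.r i % 3 := (Nat.mul_mod _ _ _).symm
  have e2 : (D % 3) * (F.wa D i % 3) % 3 = D * F.wa D i % 3 := (Nat.mul_mod _ _ _).symm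
  have e3 : ((D : ℤ) * F.wa D i) = (D * F.wa D i : ℕ) := by push_cast; ring
  rw [e3]
  generalize F.a i * F.r i = P at *
  generalize D * F.wa D i = Q at *
  generalize F.a i % 3 * (F.r i % 3) = P' at *
  generalize D % 3 * (F.wa D i % 3) = Q' at *
  clear h1 aux
  omega

/-- With two unit coefficients and a level divisible by `3` in one of these variables, the form is
exceptional. -/
lemma Adm.exceptional_of_two_units (hF : F.Adm D) (hD : ¬ 3 ∣ D)
    (hglob : ∀ N : ℕ, F.RepAt 3 N → F.RepInt N) (hbad : ¬ F.UnivAt 3)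
    {i j k : Fin n} (hij : i ≠ j) (hi : ¬ 3 ∣ F.a i) (hj : ¬ 3 ∣ F.a j)
    (hr : ∀ k, k ≠ i → k ≠ j → 3 ∣ F.a k) (hk : 3 ∣ F.a k) (hk9 : ¬ 9 ∣ F.a k)
    (hother : ∀ m, m ≠ k → 3 ∣ F.a m → 9 ∣ F.a m) (hri : F.r i % 3 = 0) : F.Exceptional := by
  classical
  have h32 : (3 : ℕ) ≠ 2 := by norm_num
  obtain ⟨h1, h2, h3, h4, h5, N, hN3, hNT⟩ := hF.of_vertex_two hD hglob hbad hi hri hk hk9 hother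
  have hβ := not_dvd_val_one hj (h5 j hij.symm hj)
  obtain ⟨v, hv0, hv3, hv⟩ := exists_class (F := F) Nat.prime_three h32 hD
  have hvN := (hv N).1 hNT
  obtain ⟨x, e, f, g⟩ := hF.exists_of_two_units (p := 3) h32 hD hglob hij hi hj hr
    (N := 3) (by norm_num) (by rw [hv]; push_cast; omega)
  have n1 := hF.tm_nonneg i (x i)
  have n2 := hF.tm_nonneg j (x j)
  have c1 := hF.tm_cases_lt i (z := x i) (by omega)
  have c2 := hF.tm_cases_lt j (z := x j) (by omega)
  rw [h1, h3] at c1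
  obtain ⟨m, hm, hma, hmr⟩ := hF.exists_eq_of_sum (q := 3) (by norm_num)
    (s := (Finset.univ.erase i).erase j) (x := x) (fun l hl => by
      simp only [Finset.mem_erase] at hl
      exact hr l hl.2.1 hl.1) (by push_cast at g c1 ⊢; omega)
  have hmk : m = k := by
    by_contra hne
    have := hother m hne (by omega)
    omega
  subst hmk
  have hcj : F.cc m = F.M m - 2 * F.r m := rfl
  have hMi := hF.modulus i
  have hMj := hF.modulus m
  have := hF.big m
  exact ⟨i, m, h2, by omega, h1, hma, h3⟩

/-- Two unit coefficients occur only in the exceptional configuration: as soon as the other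
coefficients represent `3` and `6`, two of them have exact order one, and the form is universal. -/
lemma Adm.exceptional_of_two (hF : F.Adm D) (hD : ¬ 3 ∣ D)
    (hglob : ∀ N : ℕ, F.RepAt 3 N → F.RepInt N) (hbad : ¬ F.UnivAt 3)
    {i j : Fin n} (hij : i ≠ j) (hi : ¬ 3 ∣ F.a i) (hj : ¬ 3 ∣ F.a j)
    (hr : ∀ k, k ≠ i → k ≠ j → 3 ∣ F.a k)
    (han : ∀ y z : ℤ, ((3 : ℕ) : ℤ) ∣ F.wa D i * y ^ 2 + F.wa D j * z ^ 2 →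
      ((3 : ℕ) : ℤ) ∣ y ∧ ((3 : ℕ) : ℤ) ∣ z)
    (hone : ∀ k l, k ≠ l → 3 ∣ F.a k → 3 ∣ F.a l → 3 ^ 2 ∣ F.a k ∨ 3 ^ 2 ∣ F.a l) :
    F.Exceptional := by
  classical
  have h32 : (3 : ℕ) ≠ 2 := by norm_num
  obtain ⟨v, hv0, hv3, hv⟩ := exists_class (F := F) Nat.prime_three h32 hD
  have key : ∀ N : ℤ, 0 ≤ N → N % 3 ≠ v → _ := fun N h0 hN =>
    hF.exists_of_two_units (p := 3) h32 hD hglob hij hi hj hr (N := N) h0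
      (by rw [hv]; push_cast; omega)
  have hs : ∀ l ∈ (Finset.univ.erase i).erase j, 3 ∣ F.a l := fun l hl => by
    simp only [Finset.mem_erase] at hl
    exact hr l hl.2.1 hl.1
  -- Representing both `3` and `6` by the other coefficients contradicts `hone`.
  have hfin : (∃ x : Fin n → ℤ, ∑ l ∈ (Finset.univ.erase i).erase j, F.tm l (x l) = (3 : ℕ)) →
      (∃ x : Fin n → ℤ, ∑ l ∈ (Finset.univ.erase i).erase j, F.tm l (x l) = 2 * (3 : ℕ)) →
      False := by
    rintro ⟨x, hx⟩ ⟨x', hx'⟩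
    obtain ⟨k, hk, l, hl, hkl, hka, -, hla, -⟩ := hF.exists_pair_of_sum (by norm_num) hs hx hx'
    have hk3 := exact_of_eq (by norm_num) (Or.inl hka : F.a k = 3 ∨ F.a k = 2 * 3)
    have hl3 := exact_of_eq (by norm_num) hla
    rcases hone k l hkl hk3.1 hl3.1 with h | h
    exacts [hk3.2 h, hl3.2 h]
  by_cases hno : ∀ m, 3 ∣ F.a m → 9 ∣ F.a m
  · -- the numbers up to `6` are sums of the two unit terms
    exfalso
    have key6 : ∀ N : ℤ, 0 < N → N ≤ 6 → N % 3 ≠ v → N = (F.a i * F.r i : ℕ) ∨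
        N = (F.a j * F.r j : ℕ) ∨ N = (F.a i * F.r i : ℕ) + (F.a j * F.r j : ℕ) := by
      intro N h0 h6 hN
      obtain ⟨x, e, f, g⟩ := key N h0.le hN
      have g9 : ((9 : ℕ) : ℤ) ∣ ∑ l ∈ (Finset.univ.erase i).erase j, F.tm l (x l) :=
        Finset.dvd_sum fun l hl => dvd_tm (hno l (hs l hl)) _
      have n1 := hF.tm_nonneg i (x i)
      have n2 := hF.tm_nonneg j (x j)
      have c1 := hF.tm_cases_lt i (z := x i) (by omega)
      have c2 := hF.tm_cases_lt j (z := x j) (by omega)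
      omega
    have k1 := key6 1 (by norm_num) (by norm_num)
    have k2 := key6 2 (by norm_num) (by norm_num)
    have k3 := key6 3 (by norm_num) (by norm_num)
    have k4 := key6 4 (by norm_num) (by norm_num)
    have k5 := key6 5 (by norm_num) (by norm_num)
    have k6 := key6 6 (by norm_num) (by norm_num)
    clear key key6 hv
    have hv' : v = 0 ∨ v = 1 ∨ v = 2 := by push_cast at hv3; omega
    rcases hv' with rfl | rfl | rfl
    · have k1 := k1 (by norm_num); have k2 := k2 (by norm_num)
      have k4 := k4 (by norm_num); have k5 := k5 (by norm_num)
      clear k3 k6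
      omega
    · have k2 := k2 (by norm_num); have k3 := k3 (by norm_num)
      have k5 := k5 (by norm_num); have k6 := k6 (by norm_num)
      clear k1 k4
      omega
    · have k1 := k1 (by norm_num); have k3 := k3 (by norm_num)
      have k4 := k4 (by norm_num); have k6 := k6 (by norm_num)
      clear k2 k5
      omega
  push Not at hno
  obtain ⟨k, hk, hk9⟩ := hno
  have hother : ∀ m, m ≠ k → 3 ∣ F.a m → 9 ∣ F.a m := fun m hm h3 =>
    (hone m k hm h3 hk).resolve_right (by simpa using hk9)
  by_cases hri : F.r i % 3 = 0
  · exact hF.exceptional_of_two_units hD hglob hbad hij hi hj hr hk hk9 hother hri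
  by_cases hrj : F.r j % 3 = 0
  · exact hF.exceptional_of_two_units hD hglob hbad hij.symm hj hi (fun l h1 h2 => hr l h2 h1)
      hk hk9 hother hrj
  exfalso
  -- the two unit coefficients agree modulo `3`
  have hw : ((D : ℤ) * F.wa D i - D * F.wa D j) % 3 = 0 := by
    have h1 := han 1 1
    have h2 := hF.wa_cases i
    have h3 := hF.wa_cases j
    have h4 : ((F.wa D i : ℤ) - F.wa D j) % 3 = 0 := by
      have h5 : ¬ ((3 : ℕ) : ℤ) ∣ F.wa D i + F.wa D j := fun h => by
        have := (h1 (by simpa using h)).1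
        omega
      have h6 : (F.wa D i : ℤ) % 3 ≠ 0 := by omega
      have h7 : (F.wa D j : ℤ) % 3 ≠ 0 := by omega
      clear h1 h2 h3
      have h6' : (F.wa D i : ℤ) % 3 = 1 ∨ (F.wa D i : ℤ) % 3 = 2 := by omega
      have h7' : (F.wa D j : ℤ) % 3 = 1 ∨ (F.wa D j : ℤ) % 3 = 2 := by omega
      clear h6 h7
      rcases h6' with h6 | h6 <;> rcases h7' with h7 | h7 <;> push_cast at h5 <;> omega
    rw [← mul_sub]
    exact Int.emod_eq_zero_of_dvd ((Int.dvd_of_emod_eq_zero h4).mul_left _)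
  have ri := hF.val_one_mod_three hD hri
  have rj := hF.val_one_mod_three hD hrj
  have hα := not_dvd_val_one hi hri
  have hβ := not_dvd_val_one hj hrj
  have hcMr : ∀ l, F.r l % 3 ≠ 0 → F.cc l % 3 ≠ 0 → ((F.M l : ℤ) - F.r l) % 3 = 0 := fun l h1 h2 => by
    have hM := hF.mod_three hD l
    have hcc : F.cc l = F.M l - 2 * F.r l := rfl
    have hr' : F.r l % 3 = 1 ∨ F.r l % 3 = 2 := by omega
    rcases hM with h | h <;> rcases hr' with h' | h' <;> omega
  have hgapi := hF.lev_gap i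
  have hgapj := hF.lev_gap j
  have hbigi := hF.big i
  have hbigj := hF.big j
  -- the class of the vertex
  have hvert : ∀ z w : ℤ, ((3 : ℕ) : ℤ) ∣ 2 * F.M i * z - F.cc i →
      ((3 : ℕ) : ℤ) ∣ 2 * F.M j * w - F.cc j → (F.tm i z + F.tm j w) % 3 = v := by
    intro z w hz hw
    have := hF.dvd_disc_of_vertex Nat.prime_three h32 (x := Function.update (Pi.single i z) j w)
      (v := F.tm i z + F.tm j w) (fun l hl => by
        by_cases hlj : l = j
        · subst hlj
          simpa using hw
        · have hli : l = i := by
            by_contra h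
            exact hl (hr l h hlj)
          subst hli
          simpa [hlj] using hz) (by
        rw [val_split_two F hij, Finset.sum_eq_zero]
        · simp [hij]
        · intro l hl
          simp only [Finset.mem_erase] at hl
          simp [hl.1, hl.2.1])
    have := (hv _).1 this
    push_cast at this hv3
    omega
  have hv0i : ∀ l, F.cc l % 3 = 0 → ((3 : ℕ) : ℤ) ∣ 2 * F.M l * 0 - F.cc l := fun l h => by
    push_cast; omega
  have hv1i : ∀ l, F.r l % 3 ≠ 0 → F.cc l % 3 ≠ 0 → ((3 : ℕ) : ℤ) ∣ 2 * F.M l * 1 - F.cc l :=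
    fun l h1 h2 => by
      have := hcMr l h1 h2
      have hcc : F.cc l = F.M l - 2 * F.r l := rfl
      push_cast; omega
  -- the case of different vertices
  have mixed : ∀ i' j' : Fin n, F.r i' % 3 ≠ 0 → F.cc i' % 3 ≠ 0 →
      (F.a i' * F.r i' : ℕ) % 3 ≠ 0 → (F.a i' * F.r i' : ℕ) % 3 = v →
      ((F.a i' * F.r i' : ℕ) + (F.a j' * F.r j' : ℕ)) % 3 = 0 →
      (∀ N : ℤ, 0 ≤ N → N % 3 ≠ v → ∃ x : Fin n → ℤ, F.tm i' (x i') + F.tm j' (x j') +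
        ∑ k ∈ (Finset.univ.erase i).erase j, F.tm k (x k) = N ∧
        0 ≤ ∑ k ∈ (Finset.univ.erase i).erase j, F.tm k (x k) ∧
        ((3 : ℕ) : ℤ) ∣ ∑ k ∈ (Finset.univ.erase i).erase j, F.tm k (x k)) → False := by
    intro i' j' hri' hci' hα' hvα hαβ key'
    have hMr := hcMr i' hri' hci'
    have hgapi := hF.lev_gap i'
    have hgapj := hF.lev_gap j'
    have hbigi := hF.big i'
    have hbigj := hF.big j'
    have hw3 : (v = 1 ∧ (F.a i' * F.r i' : ℕ) % 3 = 1 ∧ (F.a j' * F.r j' : ℕ) % 3 = 2) ∨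
      (v = 2 ∧ (F.a i' * F.r i' : ℕ) % 3 = 2 ∧ (F.a j' * F.r j' : ℕ) % 3 = 1) := by omega
    obtain ⟨x, e, f, g⟩ := key' (3 - v) (by push_cast at hv3; omega) (by omega)
    have n1 := hF.tm_nonneg i' (x i')
    have n2 := hF.tm_nonneg j' (x j')
    have c1 := hF.tm_cases_lt i' (z := x i') (by omega)
    have c2 := hF.tm_cases_lt j' (z := x j') (by omega)
    have hβ' : (F.a j' * F.r j' : ℕ) = 3 - v := by
      clear ri rj hα hβ hw hv0i hv1i hvert
      omega
    clear e f g n1 n2 c1 c2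
    obtain ⟨x, e, f, g⟩ := key' (6 - v) (by push_cast at hv3; omega) (by omega)
    obtain ⟨x', e', f', g'⟩ := key' (9 - v) (by push_cast at hv3; omega) (by omega)
    clear key key' ri rj hα hβ hw hv0i hv1i hvert
    refine hfin ⟨x, ?_⟩ ⟨x', ?_⟩
    · have n1 := hF.tm_nonneg i' (x i')
      have n2 := hF.tm_nonneg j' (x j')
      have c1 := hF.tm_cases_lt i' (z := x i') (by omega)
      have c2 := hF.tm_cases_lt j' (z := x j') (by omega)
      clear e' f' g'
      rcases c1 with c1 | c1 <;> rcases c2 with c2 | c2 <;> push_cast at g ⊢ <;> omega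
    · have n1 := hF.tm_nonneg i' (x' i')
      have n2 := hF.tm_nonneg j' (x' j')
      have c1 := hF.tm_cases i' (z := x' i') (by omega)
      have c2 := hF.tm_cases j' (z := x' j') (by omega)
      clear e f g
      rcases c1 with c1 | c1 | c1 <;> rcases c2 with c2 | c2 | c2 <;> push_cast at g' ⊢ <;> omega
  by_cases hci : F.cc i % 3 = 0 <;> by_cases hcj : F.cc j % 3 = 0
  · have hv00 := hvert 0 0 (hv0i i hci) (hv0i j hcj)
    rw [tm_zero, tm_zero] at hv00
    have hαβ : ((F.a i * F.r i : ℕ) - (F.a j * F.r j : ℕ) : ℤ) % 3 = 0 := by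
      have := ri.1 hci; have := rj.1 hcj; omega
    have e11 : F.a i * F.r i = 1 ∧ F.a j * F.r j = 1 := by
      obtain ⟨x, e, f, g⟩ := key 1 (by norm_num) (by omega)
      have n1 := hF.tm_nonneg i (x i)
      have n2 := hF.tm_nonneg j (x j)
      have c1 := hF.tm_cases_lt i (z := x i) (by omega)
      have c2 := hF.tm_cases_lt j (z := x j) (by omega)
      obtain ⟨x', e', f', g'⟩ := key 2 (by norm_num) (by omega)
      have n1' := hF.tm_nonneg i (x' i)
      have n2' := hF.tm_nonneg j (x' j)
      have c1' := hF.tm_cases_lt i (z := x' i) (by omega)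
      have c2' := hF.tm_cases_lt j (z := x' j) (by omega)
      clear key mixed ri rj hw hv0i hv1i hvert
      generalize ∑ k ∈ (Finset.univ.erase i).erase j, F.tm k (x k) = S at *
      generalize ∑ k ∈ (Finset.univ.erase i).erase j, F.tm k (x' k) = S' at *
      have hS : S = 0 := by push_cast at g; omega
      have hS' : S' = 0 := by push_cast at g'; omega
      clear f g f' g'
      omega
    obtain ⟨x, e, f, g⟩ := key 4 (by norm_num) (by omega)
    obtain ⟨x', e', f', g'⟩ := key 7 (by norm_num) (by omega)
    clear key mixed ri rj hw hv0i hv1i hvert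
    refine hfin ⟨x, ?_⟩ ⟨x', ?_⟩
    · have n1 := hF.tm_nonneg i (x i)
      have n2 := hF.tm_nonneg j (x j)
      have c1 := hF.tm_cases_lt i (z := x i) (by omega)
      have c2 := hF.tm_cases_lt j (z := x j) (by omega)
      clear e' f' g'
      rcases c1 with c1 | c1 <;> rcases c2 with c2 | c2 <;> push_cast at g ⊢ <;> omega
    · have n1 := hF.tm_nonneg i (x' i)
      have n2 := hF.tm_nonneg j (x' j)
      have c1 := hF.tm_cases i (z := x' i) (by omega)
      have c2 := hF.tm_cases j (z := x' j) (by omega)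
      clear e f g
      rcases c1 with c1 | c1 | c1 <;> rcases c2 with c2 | c2 | c2 <;> push_cast at g' ⊢ <;> omega
  · have hvv := hvert 0 1 (hv0i i hci) (hv1i j hrj hcj)
    rw [tm_zero, tm_one, zero_add] at hvv
    refine mixed j i hrj hcj hβ (by push_cast at hvv ⊢; omega) ?_ (fun N h0 hN => ?_)
    · have := ri.1 hci; have := rj.2 hcj; omega
    · obtain ⟨x, e, f, g⟩ := key N h0 hN
      exact ⟨x, by rw [add_comm (F.tm j (x j))]; exact e, f, g⟩
  · have hvv := hvert 1 0 (hv1i i hri hci) (hv0i j hcj)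
    rw [tm_zero, tm_one, add_zero] at hvv
    refine mixed i j hri hci hα (by push_cast at hvv ⊢; omega) ?_ key
    have := ri.2 hci; have := rj.1 hcj; omega
  · have hvv := hvert 1 1 (hv1i i hri hci) (hv1i j hrj hcj)
    rw [tm_one, tm_one] at hvv
    have hαβ : ((F.a i * F.r i : ℕ) - (F.a j * F.r j : ℕ) : ℤ) % 3 = 0 := by
      have := ri.2 hci; have := rj.2 hcj; omega
    obtain ⟨x, e, f, g⟩ := key 3 (by norm_num) (by omega)
    obtain ⟨x', e', f', g'⟩ := key 6 (by norm_num) (by omega)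
    clear key mixed ri rj hw hv0i hv1i hvert
    refine hfin ⟨x, ?_⟩ ⟨x', ?_⟩
    · have n1 := hF.tm_nonneg i (x i)
      have n2 := hF.tm_nonneg j (x j)
      have c1 := hF.tm_cases_lt i (z := x i) (by omega)
      have c2 := hF.tm_cases_lt j (z := x j) (by omega)
      clear e' f' g'
      rcases c1 with c1 | c1 <;> rcases c2 with c2 | c2 <;> push_cast at g ⊢ <;> omega
    · have n1 := hF.tm_nonneg i (x' i)
      have n2 := hF.tm_nonneg j (x' j)
      have c1 := hF.tm_cases_lt i (z := x' i) (by omega)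
      have c2 := hF.tm_cases_lt j (z := x' j) (by omega)
      clear e f g
      rcases c1 with c1 | c1 <;> rcases c2 with c2 | c2 <;> push_cast at g' ⊢ <;> omega

/-- A non-exceptional regular form that is universal away from `3` but not at `3` has just one
coefficient prime to `3`, and its diagonal form represents all multiples of `3`. -/
theorem Adm.one_unit_three (hF : F.Adm D) (hD : ¬ 3 ∣ D) (hreg : F.Regular)
    (hu : ∀ (p : ℕ) [Fact p.Prime], p ≠ 3 → F.UnivAt p) (hbad : ¬ F.UnivAt 3)
    (hexc : ¬ F.Exceptional) :
    (∃ i, ¬ 3 ∣ F.a i ∧ ∀ j, j ≠ i → 3 ∣ F.a j) ∧ F.RepMul 3 D := by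
  have hglob : ∀ N : ℕ, F.RepAt 3 N → F.RepInt N := fun N hN => hreg N fun q _ => by
    by_cases hq : q = 3
    · subst hq; exact hN
    · exact hu q hq _
  rcases hF.bad_cases (p := 3) (by norm_num) hD hbad with
    ⟨i, hi, hr⟩ | ⟨i, j, hij, hi, hj, hr, han, hone⟩
  · exact ⟨⟨i, hi, hr⟩, hF.repMul_three hD hglob hbad hexc hi hr⟩
  · exact absurd (hF.exceptional_of_two hD hglob hbad hij hi hj hr han hone) hexc

end PForm

namespace PForm

variable {n k : ℕ} {F : PForm n}

/-- Regular forms that may fail to be universal at `2` are universal at all primes `p ≥ 5`. -/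
theorem STyp.univAt_of_five_le (hn : 4 ≤ n) (hF : F.STyp k) (hreg : F.Regular) {p : ℕ}
    [Fact p.Prime] (h5 : 5 ≤ p) : F.UnivAt p := by
  obtain ⟨F', h⟩ := hF.exists_univAt_two hn hreg
  exact (h.univ_iff p (by omega)).2 (h.adm.univAt_of_five_le hn h.regular h.univ_two h5)

theorem STyp.one_unit_three (hn : 4 ≤ n) (hF : F.STyp k) (hreg : F.Regular) (h3 : ¬ 3 ∣ 2 * k)
    (hbad : ¬ F.UnivAt 3) :
    (∃ i, ¬ 3 ∣ F.a i ∧ ∀ j, j ≠ i → 3 ∣ F.a j) ∧ F.RepMul 3 (2 * k) := by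
  obtain ⟨F', h⟩ := hF.exists_univAt_two hn hreg
  have hd := h.dvd_iff 3 (by norm_num) h3
  obtain ⟨⟨i, hi, hr⟩, hT⟩ := h.adm.one_unit_three h3 h.regular (fun p hp hp3 => by
      by_cases h2 : p = 2
      · subst h2; exact h.univ_two
      · exact h.adm.univAt_of_five_le hn h.regular h.univ_two (by
          have h4 : p ≠ 4 := fun h => by subst h; exact absurd hp.out (by norm_num)
          have := hp.out.two_le
          omega))
    (fun hu => hbad ((h.univ_iff 3 (by norm_num)).2 hu)) h.not_exceptional
  exact ⟨⟨i, fun h' => hi ((hd i).2 h'), fun j hj => (hd j).1 (hr j hj)⟩,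
    h.repMul 3 (by norm_num) h3 hT⟩

end PForm

/-! ### Forms with at most one shifted variable, at the prime `2` -/

namespace TwoRep

variable {ι : Type*} {a b : ι → ℕ} {s : Finset ι} {n : ℤ}

/-- An integer vector with one term of small `2`-adic order lifts to a `2`-adic representation. -/
lemma of_vector [Fintype ι] (y : ι → ℤ) {j : ι} {e : ℕ} {m : ℤ} (hm : m % 2 = 1)
    (hj : (a j : ℤ) * y j ^ 2 = 2 ^ e * m)
    (hn : 2 ^ (e + 3) ∣ n - ∑ i, (a i : ℤ) * y i ^ 2) : TwoRep a Finset.univ n := by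
  classical
  have h1 : TwoRep a {j} (2 ^ e * m) := by
    refine (DiagRep.single (A := fun i => (a i : ℤ_[2])) j (y j : ℤ_[2])).of_eq ?_
    have := congrArg (Int.cast : ℤ → ℤ_[2]) hj
    push_cast at this ⊢
    exact this
  have h2 : TwoRep a {j} (n - ∑ i ∈ Finset.univ.erase j, (a i : ℤ) * y i ^ 2) :=
    congr e hm h1 (by
      rw [← Finset.add_sum_erase _ _ (Finset.mem_univ j), hj] at hn
      rwa [sub_sub, add_comm (∑ i ∈ Finset.univ.erase j, (a i : ℤ) * y i ^ 2)])
  have h3 : DiagRep (fun i => (a i : ℤ_[2])) (Finset.univ.erase j)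
      ((∑ i ∈ Finset.univ.erase j, (a i : ℤ) * y i ^ 2 : ℤ) : ℤ_[2]) :=
    ⟨fun i => y i, by push_cast; rfl⟩
  exact (((DiagRep.add h2 h3 (by simp)).mono (Finset.subset_univ _))).of_eq (by push_cast; ring)

lemma four_of_scale (hab : ∀ i, a i = b i ∨ a i = 4 * b i) (hu : ∀ m : ℤ, ¬ 4 ∣ m → TwoRep b s m)
    (h4 : 4 ∣ n) : TwoRep a s n := by
  obtain ⟨m, rfl⟩ := h4
  refine (DiagRep.scale (d := 4) (A := fun i => (a i : ℤ_[2])) (TwoRep.univ hu (m : ℤ_[2]))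
    fun i _ => ?_).of_eq (by push_cast; ring)
  rcases hab i with h | h
  · exact ⟨2, by rw [h]; ring⟩
  · exact ⟨1, by rw [h]; push_cast; ring⟩

end TwoRep

namespace PForm

variable {n k : ℕ} {F : PForm n}

/-- All levels equal one, with at most one exception, whose nonzero terms are large. -/
structure AlmostUnshifted (F : PForm n) : Prop where
  lev : ∀ i, F.r i = 1 ∨ 24 < F.a i * F.r i
  uniq : ∀ i j, F.r i ≠ 1 → F.r j ≠ 1 → i = j

/-- `v` is a sum of distinct coefficients with indices in `s`. -/
def SubSum (F : PForm n) (s : Finset (Fin n)) (v : ℕ) : Prop :=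
  ∃ T ⊆ s, ∑ i ∈ T, F.a i = v

lemma SubSum.exists_new {s S : Finset (Fin n)} {v : ℕ} (h : F.SubSum s v)
    (hS : ∑ i ∈ S, F.a i < v) : ∃ i ∈ s, i ∉ S ∧ F.a i ≤ v := by
  obtain ⟨T, hT, rfl⟩ := h
  by_contra hcon
  push Not at hcon
  refine absurd (Finset.sum_le_sum_of_subset (f := F.a) fun i hi => ?_) (not_le.2 hS)
  by_contra hiS
  have h1 := hcon i (hT hi) hiS
  have h2 := Finset.single_le_sum (f := F.a) (fun i _ => Nat.zero_le _) hi
  omega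

lemma SubSum.dvd {s : Finset (Fin n)} {v d : ℕ} (h : F.SubSum s v) (hd : ∀ i ∈ s, d ∣ F.a i) :
    d ∣ v := by
  obtain ⟨T, hT, rfl⟩ := h
  exact Finset.dvd_sum fun i hi => hd i (hT hi)

lemma SubSum.zero (s : Finset (Fin n)) : F.SubSum s 0 := ⟨∅, by simp, by simp⟩

lemma SubSum.single {s : Finset (Fin n)} {i : Fin n} (hi : i ∈ s) : F.SubSum s (F.a i) :=
  ⟨{i}, by simpa using hi, by simp⟩

/-- Removing one index from a set of admissible summands. -/
lemma SubSum.erase {s : Finset (Fin n)} {v : ℕ} (i : Fin n) (h : F.SubSum s v) :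
    F.SubSum (s.erase i) v ∨ F.a i ≤ v ∧ F.SubSum (s.erase i) (v - F.a i) := by
  classical
  obtain ⟨T, hT, rfl⟩ := h
  by_cases hi : i ∈ T
  · right
    rw [← Finset.add_sum_erase _ _ hi, Nat.add_sub_cancel_left]
    exact ⟨Nat.le_add_right _ _, T.erase i, Finset.erase_subset_erase _ hT, rfl⟩
  · exact Or.inl ⟨T, fun l hl => Finset.mem_erase.2 ⟨fun h => hi (h ▸ hl), hT hl⟩, rfl⟩

/-- The indices of the unshifted variables. -/
def unshifted (F : PForm n) : Finset (Fin n) := Finset.univ.filter fun i => F.r i = 1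

lemma mem_unshifted {i : Fin n} : i ∈ F.unshifted ↔ F.r i = 1 := by simp [unshifted]

/-- Numbers up to `24` are represented only by sums of distinct coefficients. -/
lemma STyp.subSum_of_repInt (hF : F.STyp k) (hA : F.AlmostUnshifted) {N : ℕ} (hN : N ≤ 24)
    (h : F.RepInt N) : F.SubSum F.unshifted N := by
  classical
  obtain ⟨x, hx⟩ := h
  have key : ∀ i, F.tm i (x i) ≤ 24 →
      F.tm i (x i) = if i ∈ F.unshifted ∧ x i = 1 then (F.a i : ℤ) else 0 := by
    intro i hi
    have hk := hF.big
    have hM := hF.M_eq i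
    have hr := hF.r_lt i
    have hpos := hF.adm.pos i
    by_cases h0 : x i = 0
    · rw [h0]; simp
    by_cases h1 : x i = 1
    · rw [h1, tm_one] at hi ⊢
      rcases hA.lev i with h | h
      · simp [mem_unshifted, h]
      · omega
    exfalso
    have h2 := polyVal_ge (hF.adm.lev_pos i) (hF.adm.lev_lt i) h0 h1
    unfold tm at hi
    rw [hM] at h2 hi
    rcases hA.lev i with h | h
    · rw [h] at h2 hi
      have : (F.a i : ℤ) * 25 ≤ F.a i * polyVal (2 * k) 1 (x i) :=
        mul_le_mul_of_nonneg_left (by push_cast at h2; omega) (by omega)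
      omega
    · have : (F.a i : ℤ) * F.r i ≤ F.a i * polyVal (2 * k) (F.r i) (x i) :=
        mul_le_mul_of_nonneg_left (by push_cast at h2; omega) (by omega)
      have h' : (24 : ℤ) < F.a i * F.r i := by exact_mod_cast h
      omega
  refine ⟨Finset.univ.filter fun i => i ∈ F.unshifted ∧ x i = 1, fun i hi => ?_, ?_⟩
  · exact (Finset.mem_filter.1 hi).2.1
  · have : ∀ i, F.tm i (x i) = if i ∈ F.unshifted ∧ x i = 1 then (F.a i : ℤ) else 0 := fun i =>
      key i (by have := tm_le_val hF.adm x i; omega)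
    rw [val_eq_sum, Finset.sum_congr rfl fun i _ => this i, ← Finset.sum_filter] at hx
    exact_mod_cast hx

/-- Representation over `ℤ_2` of numbers close to the value at an integer vector. -/
lemma STyp.repAt_of_near (hF : F.STyp k) (x : Fin n → ℤ) {j : Fin n} {e : ℕ} {m : ℤ}
    (hm : m % 2 = 1) (hj : (F.a j : ℤ) * (k * x j - F.ee k j) ^ 2 = 2 ^ e * m) {N : ℤ}
    (hN : 2 ^ (e + 3) ∣ N - F.val x) : F.RepAt 2 N := by
  refine hF.repAt_of_twoRep (TwoRep.of_vector (fun i => k * x i - F.ee k i) hm hj ?_)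
  rw [hF.complete_square_int x]
  have := hN.mul_left (k : ℤ)
  rwa [show (k : ℤ) * N + F.twoDisc k - (k * F.val x + F.twoDisc k) = k * (N - F.val x) by ring]

/-- The vector with entries `z`, `w` at `i`, `j` and otherwise the indicator vector of `T`. -/
def testVec (i j : Fin n) (z w : ℤ) (T : Finset (Fin n)) : Fin n → ℤ :=
  fun l => if l = i then z else if l = j then w else if l ∈ T then 1 else 0

lemma val_testVec {i j : Fin n} (hij : i ≠ j) (z w : ℤ) {T : Finset (Fin n)}
    (hT : T ⊆ (F.unshifted.erase i).erase j) :
    F.val (testVec i j z w T) = F.tm i z + F.tm j w + (∑ l ∈ T, F.a l : ℕ) := by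
  classical
  rw [val_split_two F hij]
  have h1 : testVec i j z w T i = z := by simp [testVec]
  have h2 : testVec i j z w T j = w := by simp [testVec, hij.symm]
  rw [h1, h2]
  congr 1
  rw [← Finset.sum_subset (s₁ := T)]
  · push_cast
    refine Finset.sum_congr rfl fun l hl => ?_
    have := hT hl
    simp only [Finset.mem_erase, mem_unshifted] at this
    have h3 : testVec i j z w T l = 1 := by simp [testVec, this.1, this.2.1, hl]
    rw [h3, tm_one, this.2.2, mul_one]
  · intro l hl
    have := hT hl
    simp only [Finset.mem_erase] at this ⊢
    exact ⟨this.1, this.2.1, Finset.mem_univ _⟩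
  · intro l hl hlT
    simp only [Finset.mem_erase] at hl
    have h3 : testVec i j z w T l = 0 := by simp [testVec, hl.1, hl.2.1, hlT]
    rw [h3, tm_zero]

lemma val_testVec_self {i : Fin n} (z : ℤ) {T : Finset (Fin n)} (hT : T ⊆ F.unshifted.erase i) :
    F.val (testVec i i z z T) = F.tm i z + (∑ l ∈ T, F.a l : ℕ) := by
  classical
  rw [val_split_one F i]
  have h1 : testVec i i z z T i = z := by simp [testVec]
  rw [h1]
  congr 1
  rw [← Finset.sum_subset (s₁ := T)]
  · push_cast
    refine Finset.sum_congr rfl fun l hl => ?_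
    have := hT hl
    simp only [Finset.mem_erase, mem_unshifted] at this
    have h3 : testVec i i z z T l = 1 := by simp [testVec, this.1, hl]
    rw [h3, tm_one, this.2, mul_one]
  · intro l hl
    have := hT hl
    simp only [Finset.mem_erase] at this ⊢
    exact ⟨this.1, Finset.mem_univ _⟩
  · intro l hl hlT
    simp only [Finset.mem_erase] at hl
    have h3 : testVec i i z z T l = 0 := by simp [testVec, hl.1, hlT]
    rw [h3, tm_zero]

lemma STyp.repAt_of_pair (hF : F.STyp k) {i j : Fin n} (hij : i ≠ j) (z w : ℤ) {v : ℕ}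
    (hv : F.SubSum ((F.unshifted.erase i).erase j) v) {e : ℕ} {m : ℤ}
    (hm : m % 2 = 1) (hp : (F.a i : ℤ) * (k * z - F.ee k i) ^ 2 = 2 ^ e * m) {N : ℤ}
    (hN : 2 ^ (e + 3) ∣ N - (F.tm i z + F.tm j w + v)) : F.RepAt 2 N := by
  obtain ⟨T, hT, rfl⟩ := hv
  refine hF.repAt_of_near (testVec i j z w T) (j := i) hm (by simpa [testVec] using hp) ?_
  rw [val_testVec hij z w hT]
  exact hN

lemma STyp.repAt_of_single (hF : F.STyp k) {i : Fin n} (z : ℤ) {v : ℕ}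
    (hv : F.SubSum (F.unshifted.erase i) v) {e : ℕ} {m : ℤ}
    (hm : m % 2 = 1) (hp : (F.a i : ℤ) * (k * z - F.ee k i) ^ 2 = 2 ^ e * m) {N : ℤ}
    (hN : 2 ^ (e + 3) ∣ N - (F.tm i z + v)) : F.RepAt 2 N := by
  obtain ⟨T, hT, rfl⟩ := hv
  refine hF.repAt_of_near (testVec i i z z T) (j := i) hm (by simpa [testVec] using hp) ?_
  rw [val_testVec_self z hT]
  exact hN

lemma odd_mul_sq {a : ℕ} {y : ℤ} (ha : a % 2 = 1) (hy : y % 2 = 1) : ((a : ℤ) * y ^ 2) % 2 = 1 := by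
  have : (a : ℤ) % 2 = 1 := by omega
  rw [Int.mul_emod, this, pow_two, Int.mul_emod y, hy]
  norm_num

/-- The case of an odd coefficient and an odd argument of the square. -/
lemma STyp.repAt_of_pair_odd (hF : F.STyp k) {i j : Fin n} (hij : i ≠ j) (z w : ℤ) {v : ℕ}
    (hv : F.SubSum ((F.unshifted.erase i).erase j) v) (hi : F.a i % 2 = 1)
    (hz : (k * z - F.ee k i) % 2 = 1) {N : ℤ}
    (hN : N % 8 = (F.tm i z + F.tm j w + v) % 8) : F.RepAt 2 N :=
  hF.repAt_of_pair hij z w hv (e := 0) (odd_mul_sq hi hz) (by ring) (by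
    norm_num; omega)

lemma STyp.repAt_of_single_odd (hF : F.STyp k) {i : Fin n} (z : ℤ) {v : ℕ}
    (hv : F.SubSum (F.unshifted.erase i) v) (hi : F.a i % 2 = 1)
    (hz : (k * z - F.ee k i) % 2 = 1) {N : ℤ}
    (hN : N % 8 = (F.tm i z + v) % 8) : F.RepAt 2 N :=
  hF.repAt_of_single z hv (e := 0) (odd_mul_sq hi hz) (by ring) (by norm_num; omega)

/-- The target of a number congruent modulo `4` to the value at a vector all of whose odd
coefficients carry even squares. -/
lemma STyp.four_dvd_target (hF : F.STyp k) (x : Fin n → ℤ)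
    (h : ∀ l, 4 ∣ F.a l ∨ (k * x l - F.ee k l) % 2 = 0) {N : ℤ} (hN : (N - F.val x) % 4 = 0) :
    4 ∣ k * N + F.twoDisc k := by
  have h1 := hF.complete_square_int x
  have h2 : (4 : ℤ) ∣ ∑ l, (F.a l : ℤ) * (k * x l - F.ee k l) ^ 2 := by
    refine Finset.dvd_sum fun l _ => ?_
    rcases h l with h | h
    · exact Dvd.dvd.mul_right (by omega) _
    · refine Dvd.dvd.mul_left ?_ _
      obtain ⟨c, hc⟩ := Int.dvd_of_emod_eq_zero h
      exact ⟨c ^ 2, by rw [hc]; ring⟩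
  have h3 : (4 : ℤ) ∣ k * (N - F.val x) := (Int.dvd_of_emod_eq_zero hN).mul_left _
  rw [h1] at h2
  have := dvd_add h2 h3
  rwa [show (k : ℤ) * F.val x + F.twoDisc k + k * (N - F.val x) = k * N + F.twoDisc k by ring] at this

/-- The diagonal coefficients after removing a factor `4` from those divisible by `4`. -/
def quart (F : PForm n) (i : Fin n) : ℕ := if F.a i % 4 = 0 then F.a i / 4 else F.a i

lemma quart_cases (F : PForm n) (i : Fin n) : F.a i = F.quart i ∨ F.a i = 4 * F.quart i := by
  unfold quart
  split_ifs with h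
  · right; omega
  · left; rfl

lemma quart_of_odd {i : Fin n} (h : F.a i % 2 = 1) : F.quart i = F.a i := by
  unfold quart
  rw [if_neg (by omega)]

lemma quart_of_dvd {i : Fin n} (h : F.a i % 4 = 0) : F.a i = 4 * F.quart i := by
  unfold quart
  rw [if_pos h]
  omega

lemma tm_of_unit {i : Fin n} (h : F.r i = 1) : F.tm i 1 = F.a i := by
  rw [tm_one, h, mul_one]

lemma STyp.tm_two (hF : F.STyp k) {i : Fin n} (h : F.r i = 1) (ha : F.a i % 2 = 1)
    (hk : k % 4 = 1) : F.tm i 2 % 8 = 4 := by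
  unfold tm
  rw [polyVal_two, hF.M_eq, h]
  obtain ⟨q, rfl⟩ : ∃ q, k = 4 * q + 1 := ⟨k / 4, by omega⟩
  obtain ⟨b, hb⟩ : ∃ b, F.a i = 2 * b + 1 := ⟨F.a i / 2, by omega⟩
  rw [hb]
  push_cast
  rw [show (2 * (b : ℤ) + 1) * (2 * (4 * q + 1) + 2) = 4 + 8 * (2 * b * q + q + b) by ring]
  omega

lemma STyp.tm_neg_one (hF : F.STyp k) {i : Fin n} (h : F.r i = 1) (ha : F.a i % 2 = 1)
    (hk : k % 4 = 3) : F.tm i (-1) % 8 = (F.a i + 4) % 8 := by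
  unfold tm
  rw [polyVal_neg_one, hF.M_eq, h]
  obtain ⟨q, rfl⟩ : ∃ q, k = 4 * q + 3 := ⟨k / 4, by omega⟩
  obtain ⟨b, hb⟩ : ∃ b, F.a i = 2 * b + 1 := ⟨F.a i / 2, by omega⟩
  rw [hb]
  push_cast
  rw [show (2 * (b : ℤ) + 1) * (2 * (4 * q + 3) - 1) = (2 * b + 1 + 4) + 8 * (2 * b * q + q + b) by ring]
  omega

end PForm

namespace TwoRep

variable {ι : Type*} [DecidableEq ι] {a : ι → ℕ} {n : ℤ} {i p q x : ι}

/-- With one odd coefficient and three suitable small even ones all integers congruent to `2`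
modulo `4` are represented: subtracting small squares leaves a number `2` or `6` modulo `16`, which
is a square times the remaining coefficient. -/
lemma of_two_mod_four (hip : i ≠ p) (hiq : i ≠ q) (hpq : p ≠ q) (hix : i ≠ x) (hpx : p ≠ x)
    (hqx : q ≠ x) (hi : a i % 2 = 1) (hp : a p = 2) (hq : a q = 2 ∨ a q = 4)
    (hx : a x = 2 ∨ a x = 4 ∨ a x = 6 ∨ a x = 8) (hn : n % 4 = 2) : TwoRep a {x, q, i, p} n := by
  have hxs : x ∉ ({q, i, p} : Finset ι) := by simp [hix.symm, hpx.symm, hqx.symm]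
  have hqs : q ∉ ({i, p} : Finset ι) := by simp [hiq.symm, hpq.symm]
  have his : i ∉ ({p} : Finset ι) := by simpa using hip
  have main : ∀ u v w : ℤ, (n - a x * u ^ 2 - a q * v ^ 2 - a i * w ^ 2) % 16 = 2 →
      TwoRep a {x, q, i, p} n := fun u v w h =>
    cons hxs u (cons hqs v (cons his w (single_two (by omega) (by rw [h, hp]; norm_num))))
  rcases hq with hq | hq
  · have : (n - a x * 0 ^ 2 - a q * 0 ^ 2 - a i * 0 ^ 2) % 16 = 2 ∨
        (n - a x * 0 ^ 2 - a q * 2 ^ 2 - a i * 0 ^ 2) % 16 = 2 ∨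
        (n - a x * 0 ^ 2 - a q * 0 ^ 2 - a i * 2 ^ 2) % 16 = 2 ∨
        (n - a x * 0 ^ 2 - a q * 2 ^ 2 - a i * 2 ^ 2) % 16 = 2 := by
      rw [hq]; push_cast; omega
    rcases this with h | h | h | h
    exacts [main _ _ _ h, main _ _ _ h, main _ _ _ h, main _ _ _ h]
  rcases hx with hx | hx | hx | hx
  · have : (n - a x * 0 ^ 2 - a q * 0 ^ 2 - a i * 0 ^ 2) % 16 = 2 ∨
        (n - a x * 2 ^ 2 - a q * 0 ^ 2 - a i * 0 ^ 2) % 16 = 2 ∨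
        (n - a x * 0 ^ 2 - a q * 0 ^ 2 - a i * 2 ^ 2) % 16 = 2 ∨
        (n - a x * 2 ^ 2 - a q * 0 ^ 2 - a i * 2 ^ 2) % 16 = 2 := by
      rw [hq, hx]; push_cast; omega
    rcases this with h | h | h | h
    exacts [main _ _ _ h, main _ _ _ h, main _ _ _ h, main _ _ _ h]
  · have : (n - a x * 0 ^ 2 - a q * 0 ^ 2 - a i * 0 ^ 2) % 16 = 2 ∨
        (n - a x * 0 ^ 2 - a q * 1 ^ 2 - a i * 0 ^ 2) % 16 = 2 ∨
        (n - a x * 1 ^ 2 - a q * 1 ^ 2 - a i * 0 ^ 2) % 16 = 2 ∨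
        (n - a x * 0 ^ 2 - a q * 0 ^ 2 - a i * 2 ^ 2) % 16 = 2 ∨
        (n - a x * 1 ^ 2 - a q * 1 ^ 2 - a i * 2 ^ 2) % 16 = 2 := by
      rw [hq, hx]; push_cast; omega
    rcases this with h | h | h | h | h
    exacts [main _ _ _ h, main _ _ _ h, main _ _ _ h, main _ _ _ h, main _ _ _ h]
  · have hps : p ∉ ({q, i, x} : Finset ι) := by simp [hip.symm, hpx, hpq]
    have hqs' : q ∉ ({i, x} : Finset ι) := by simp [hiq.symm, hqx]
    have his' : i ∉ ({x} : Finset ι) := by simpa using hix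
    have hset : ({p, q, i, x} : Finset ι) = {x, q, i, p} := by
      ext y; simp only [Finset.mem_insert, Finset.mem_singleton]; tauto
    have main' : ∀ v w : ℤ, (n - a p * 0 ^ 2 - a q * v ^ 2 - a i * w ^ 2) % 16 = 6 →
        TwoRep a {x, q, i, p} n := fun v w h => by
      rw [← hset]
      exact cons hps 0 (cons hqs' v (cons his' w (single_two (by omega) (by rw [h, hx]; norm_num))))
    have : (n - a x * 0 ^ 2 - a q * 0 ^ 2 - a i * 0 ^ 2) % 16 = 2 ∨
        (n - a x * 0 ^ 2 - a q * 1 ^ 2 - a i * 0 ^ 2) % 16 = 2 ∨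
        (n - a p * 0 ^ 2 - a q * 1 ^ 2 - a i * 0 ^ 2) % 16 = 6 ∨
        (n - a x * 0 ^ 2 - a q * 0 ^ 2 - a i * 2 ^ 2) % 16 = 2 ∨
        (n - a p * 0 ^ 2 - a q * 1 ^ 2 - a i * 2 ^ 2) % 16 = 6 := by
      rw [hq, hx, hp]; push_cast; omega
    rcases this with h | h | h | h | h
    exacts [main _ _ _ h, main _ _ _ h, main' _ _ h, main _ _ _ h, main' _ _ h]
  · have : (n - a x * 0 ^ 2 - a q * 0 ^ 2 - a i * 0 ^ 2) % 16 = 2 ∨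
        (n - a x * 0 ^ 2 - a q * 1 ^ 2 - a i * 0 ^ 2) % 16 = 2 ∨
        (n - a x * 1 ^ 2 - a q * 0 ^ 2 - a i * 0 ^ 2) % 16 = 2 ∨
        (n - a x * 1 ^ 2 - a q * 1 ^ 2 - a i * 0 ^ 2) % 16 = 2 := by
      rw [hq, hx]; push_cast; omega
    rcases this with h | h | h | h
    exacts [main _ _ _ h, main _ _ _ h, main _ _ _ h, main _ _ _ h]

/-- Of three integers in arithmetic progression with difference `2 k`, `k` odd, one is represented:
the classes modulo `16` missed by the form with coefficients `a i`, `2`, and `2` or `4` contain at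
most two of them. -/
lemma of_progression (hip : i ≠ p) (hiq : i ≠ q) (hpq : p ≠ q) (hi : a i % 2 = 1) (hp : a p = 2)
    (hq : a q = 2 ∨ a q = 4) {k : ℤ} (hk : k % 2 = 1) :
    TwoRep a {p, q, i} n ∨ TwoRep a {p, q, i} (n + 2 * k) ∨ TwoRep a {p, q, i} (n + 4 * k) := by
  by_cases h2 : n % 2 = 1
  · have hps : p ∉ ({q, i} : Finset ι) := by simp [hip.symm, hpq]
    have hqs : q ∉ ({i} : Finset ι) := by simpa using hiq.symm
    have main : ∀ m u v : ℤ, (m - a p * u ^ 2 - a q * v ^ 2) % 8 = a i % 8 →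
        TwoRep a {p, q, i} m := fun m u v h => cons hps u (cons hqs v (single_odd hi h))
    have e : ∀ m : ℤ, m % 8 = a i % 8 ∨ (m - 2) % 8 = a i % 8 ∨ (m - 4) % 8 = a i % 8 →
        TwoRep a {p, q, i} m := by
      intro m h
      rcases h with h | h | h
      · exact main m 0 0 (by simpa using h)
      · exact main m 1 0 (by rw [hp]; simpa using h)
      · rcases hq with hq | hq
        · exact main m 1 1 (by rw [hp, hq, ← h]; push_cast; congr 1; ring)
        · exact main m 0 1 (by rw [hq]; simpa using h)
    have : (n % 8 = a i % 8 ∨ (n - 2) % 8 = a i % 8 ∨ (n - 4) % 8 = a i % 8) ∨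
        ((n + 2 * k) % 8 = a i % 8 ∨ (n + 2 * k - 2) % 8 = a i % 8 ∨
          (n + 2 * k - 4) % 8 = a i % 8) := by
      clear main e
      omega
    rcases this with h | h
    exacts [Or.inl (e _ h), Or.inr (Or.inl (e _ h))]
  have hqs : q ∉ ({i, p} : Finset ι) := by simp [hiq.symm, hpq.symm]
  have his : i ∉ ({p} : Finset ι) := by simpa using hip
  have hset : ({q, i, p} : Finset ι) = {p, q, i} := by
    ext y; simp only [Finset.mem_insert, Finset.mem_singleton]; tauto
  have main : ∀ m v w : ℤ, (m - a q * v ^ 2 - a i * w ^ 2) % 16 = 2 →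
      TwoRep a {p, q, i} m := fun m v w h => by
    rw [← hset]
    exact cons hqs v (cons his w (single_two (by omega) (by rw [h, hp]; norm_num)))
  rcases hq with hq | hq
  · have e : ∀ m : ℤ, m % 4 = 2 → TwoRep a {p, q, i} m := fun m hm => by
      have : (m - a q * 0 ^ 2 - a i * 0 ^ 2) % 16 = 2 ∨ (m - a q * 2 ^ 2 - a i * 0 ^ 2) % 16 = 2 ∨
          (m - a q * 0 ^ 2 - a i * 2 ^ 2) % 16 = 2 ∨ (m - a q * 2 ^ 2 - a i * 2 ^ 2) % 16 = 2 := by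
        rw [hq]; push_cast; omega
      rcases this with h | h | h | h
      exacts [main _ _ _ h, main _ _ _ h, main _ _ _ h, main _ _ _ h]
    have : n % 4 = 2 ∨ (n + 2 * k) % 4 = 2 := by omega
    exact this.imp (e _) fun h => Or.inl (e _ h)
  by_cases h4 : n % 4 = 0
  · have hps : p ∉ ({i, q} : Finset ι) := by simp [hip.symm, hpq]
    have his' : i ∉ ({q} : Finset ι) := by simpa using hiq
    have hset' : ({p, i, q} : Finset ι) = {p, q, i} := by
      ext y; simp only [Finset.mem_insert, Finset.mem_singleton]; tauto
    have e : ∀ m : ℤ, m % 8 = 4 → TwoRep a {p, q, i} m := fun m hm => by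
      have main4 : ∀ v w : ℤ, (m - a p * v ^ 2 - a i * w ^ 2) % 32 = 4 → TwoRep a {p, q, i} m := by
        intro v w h
        rw [← hset']
        refine cons hps v (cons his' w (congr (m := 1) 2 rfl ?_ (by norm_num; omega)))
        have := self (a := a) q
        rw [hq] at this
        exact this
      have : (m - a p * 0 ^ 2 - a i * 0 ^ 2) % 32 = 4 ∨ (m - a p * 2 ^ 2 - a i * 0 ^ 2) % 32 = 4 ∨
          (m - a p * 0 ^ 2 - a i * 4 ^ 2) % 32 = 4 ∨ (m - a p * 2 ^ 2 - a i * 4 ^ 2) % 32 = 4 := by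
        rw [hp]; push_cast; clear main4; omega
      rcases this with h | h | h | h
      exacts [main4 _ _ h, main4 _ _ h, main4 _ _ h, main4 _ _ h]
    have : n % 8 = 4 ∨ (n + 4 * k) % 8 = 4 := by omega
    exact this.imp (e _) fun h => Or.inr (e _ h)
  · have e : ∀ m : ℤ, m % 4 = 2 → m % 16 ≠ 16 - 2 * ((a i : ℤ) % 4) → TwoRep a {p, q, i} m :=
        fun m hm hm' => by
      have : (m - a q * 0 ^ 2 - a i * 0 ^ 2) % 16 = 2 ∨ (m - a q * 1 ^ 2 - a i * 0 ^ 2) % 16 = 2 ∨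
          (m - a q * 0 ^ 2 - a i * 2 ^ 2) % 16 = 2 ∨ (m - a q * 1 ^ 2 - a i * 2 ^ 2) % 16 = 2 := by
        rw [hq]; push_cast; omega
      rcases this with h | h | h | h
      exacts [main _ _ _ h, main _ _ _ h, main _ _ _ h, main _ _ _ h]
    by_cases h : n % 16 = 16 - 2 * ((a i : ℤ) % 4)
    · exact Or.inr (Or.inr (e _ (by omega) (by omega)))
    · exact Or.inl (e _ (by omega) h)

end TwoRep

namespace PForm

variable {n k : ℕ} {F : PForm n}

/-- A form with one odd coefficient is universal at `2` if all even numbers up to `16` are sums of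
distinct other unshifted coefficients: three of these are then small. -/
lemma STyp.univAt_of_sums (hF : F.STyp k) {i : Fin n} (hi : F.a i % 2 = 1)
    (heven : ∀ l, l ≠ i → F.a l % 2 = 0)
    (hE : ∀ v, v ≤ 16 → v % 2 = 0 → F.SubSum (F.unshifted.erase i) v) : F.UnivAt 2 := by
  classical
  obtain ⟨p, hps, -, hp⟩ := (hE 2 (by norm_num) rfl).exists_new (S := ∅) (by simp)
  have hpi := Finset.ne_of_mem_erase hps
  have hp2 : F.a p = 2 := by have := heven p hpi; have := hF.adm.pos p; omega
  obtain ⟨q, hqs, hqp, hq⟩ := (hE 4 (by norm_num) rfl).exists_new (S := {p}) (by simp [hp2])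
  have hqi := Finset.ne_of_mem_erase hqs
  rw [Finset.mem_singleton] at hqp
  have hq4 : F.a q = 2 ∨ F.a q = 4 := by have := heven q hqi; have := hF.adm.pos q; omega
  obtain ⟨x, hxs, hxpq, hx⟩ := (hE 8 (by norm_num) rfl).exists_new (S := {p, q}) (by
    rw [Finset.sum_pair (Ne.symm hqp)]; omega)
  have hxi := Finset.ne_of_mem_erase hxs
  simp only [Finset.mem_insert, Finset.mem_singleton, not_or] at hxpq
  have hx8 : F.a x = 2 ∨ F.a x = 4 ∨ F.a x = 6 ∨ F.a x = 8 := by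
    have := heven x hxi; have := hF.adm.pos x; omega
  have hodd : ∀ m : ℤ, m % 2 = 1 → TwoRep F.a Finset.univ m := by
    intro m hm
    obtain ⟨T, hT, hTv⟩ := hE ((m - F.a i) % 8).toNat (by omega) (by omega)
    refine TwoRep.of_vector (j := i) (fun l => if l = i ∨ l ∈ T then 1 else 0) (e := 0)
      (m := F.a i) (by omega) (by simp) ?_
    have hiT : i ∉ T := fun h => Finset.ne_of_mem_erase (hT h) rfl
    have hsum : ∑ l, (F.a l : ℤ) * (if l = i ∨ l ∈ T then (1 : ℤ) else 0) ^ 2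
        = F.a i + ((∑ l ∈ T, F.a l : ℕ) : ℤ) := by
      have : ∀ l, (F.a l : ℤ) * (if l = i ∨ l ∈ T then (1 : ℤ) else 0) ^ 2
          = if l ∈ insert i T then (F.a l : ℤ) else 0 := fun l => by
        simp only [Finset.mem_insert]
        split_ifs <;> simp
      rw [Finset.sum_congr rfl fun l _ => this l, ← Finset.sum_filter, Finset.filter_mem_eq_inter,
        Finset.univ_inter, Finset.sum_insert hiT]
      push_cast
      rfl
    rw [hsum, hTv]
    norm_num
    omega
  refine hF.univAt_of_twoRep (s := Finset.univ) fun m hm => ?_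
  by_cases h : m % 2 = 1
  · exact hodd m h
  · exact (TwoRep.of_two_mod_four hpi.symm hqi.symm (Ne.symm hqp) hxi.symm (Ne.symm hxpq.1)
      (Ne.symm hxpq.2) hi hp2 hq4 hx8 (by omega)).mono (Finset.subset_univ _)

/-- The coefficients of a diagonal form with one odd coefficient and enough small ones, after
removing a factor `4` from the even ones. -/
lemma STyp.quart_univ (hF : F.STyp k) {i p q x : Fin n} (hi : F.a i % 2 = 1) (hpi : p ≠ i)
    (hqi : q ≠ i) (hqp : q ≠ p) (hxi : x ≠ i) (hxp : x ≠ p) (hxq : x ≠ q) (hp : F.a p = 4)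
    (hq : F.a q = 4 ∨ F.a q = 8) (hx4 : F.a x % 4 = 0) (hx : F.a x ≤ 16) {t : ℤ}
    (ht : ¬ 4 ∣ t) : TwoRep F.quart Finset.univ t := by
  have e1 := quart_of_odd hi
  have e2 := quart_of_dvd (F := F) (i := p) (by omega)
  have e3 := quart_of_dvd (F := F) (i := q) (by omega)
  have e4 := quart_of_dvd hx4
  have hx0 := hF.adm.pos x
  rcases hq with hq | hq
  · exact (TwoRep.quadruple hpi.symm hqi.symm hqp.symm hxi.symm hxp.symm hxq.symm (by omega)
      (by omega) (by omega) (by omega) ht).mono (Finset.subset_univ _)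
  by_cases h : F.quart x % 2 = 1
  · exact (TwoRep.quadruple hpi.symm hxi.symm hxp.symm hqi.symm hqp.symm hxq (by omega)
      (by omega) h (by omega) ht).mono (Finset.subset_univ _)
  · exact (TwoRep.quadruple_two hpi.symm hqi.symm hqp.symm hxi.symm hxp.symm hxq.symm (by omega)
      (by omega) (by omega) (by omega) (by omega) ht).mono (Finset.subset_univ _)

end PForm

namespace PForm

variable {n k : ℕ} {F : PForm n}

/-- Numbers up to `24` represented over `ℤ_2` are sums of distinct unshifted coefficients. -/
lemma STyp.subSum_of_repAt (hF : F.STyp k) (hA : F.AlmostUnshifted)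
    (hglob : ∀ N : ℕ, F.RepAt 2 N → F.RepInt N) {N : ℕ} (hN : N ≤ 24)
    (h : F.RepAt 2 ((N : ℤ) : ℤ_[2])) : F.SubSum F.unshifted N :=
  hF.subSum_of_repInt hA hN (hglob N (by simpa using h))

lemma erase_unshifted {i : Fin n} (h : F.r i ≠ 1) : F.unshifted.erase i = F.unshifted :=
  Finset.erase_eq_of_notMem fun h' => h (mem_unshifted.1 h')

/-- If only one coefficient is odd, its variable is unshifted: otherwise all sums of unshifted
coefficients are even, while some odd number up to `24` is represented over `ℤ_2`. -/
lemma STyp.level_of_one_odd (hF : F.STyp k) (hA : F.AlmostUnshifted)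
    (hglob : ∀ N : ℕ, F.RepAt 2 N → F.RepInt N) {i : Fin n} (hi : F.a i % 2 = 1)
    (heven : ∀ l, l ≠ i → F.a l % 2 = 0) : F.r i = 1 := by
  by_contra hri
  have hs : ∀ v, F.SubSum F.unshifted v → v % 2 = 0 := fun v hv =>
    Nat.mod_eq_zero_of_dvd (hv.dvd fun l hl => Nat.dvd_of_mod_eq_zero
      (heven l fun h => hri (mem_unshifted.1 (h ▸ hl))))
  have hrep := fun N (hN : N ≤ 24) h => hF.subSum_of_repAt hA hglob (N := N) hN h
  have hα := hF.odd_mul_r hi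
  have hk := hF.odd
  by_cases h1 : (k * (1 : ℤ) - F.ee k i) % 2 = 1
  · have h2 := hs _ (hrep ((F.a i * F.r i) % 8) (by omega)
      (hF.repAt_of_single_odd 1 (SubSum.zero _) hi h1 (by rw [tm_one]; push_cast; omega)))
    omega
  · have hz : ∃ z : ℤ, (k * z - F.ee k i) % 4 = 2 ∧ F.tm i z % 2 = 1 := by
      have h4 : (k * (1 : ℤ) - F.ee k i) % 4 = 2 ∨ (k * (-1 : ℤ) - F.ee k i) % 4 = 2 := by omega
      rcases h4 with h | h
      · exact ⟨1, h, by rw [tm_one]; omega⟩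
      · refine ⟨-1, h, ?_⟩
        unfold tm
        rw [polyVal_neg_one, hF.M_eq]
        have e1 : (F.a i : ℤ) % 2 = 1 := by omega
        have e2 : (((2 * k : ℕ) : ℤ) - F.r i) % 2 = 1 := by have := hF.r_odd i; omega
        rw [Int.mul_emod, e1, e2]
        norm_num
    obtain ⟨z, hz4, hzo⟩ := hz
    have h8 : ∀ v, v % 8 = 0 → v ≤ 24 → F.SubSum (F.unshifted.erase i) v := fun v hv h24 => by
      rw [erase_unshifted hri]
      exact hrep v h24 (hF.repAt_of_single_odd (i := i) 0 (SubSum.zero _) hi (by omega)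
        (by rw [tm_zero]; push_cast; omega))
    have hsq : ∃ m : ℤ, m % 2 = 1 ∧ (F.a i : ℤ) * (k * z - F.ee k i) ^ 2 = 2 ^ 2 * m := by
      obtain ⟨q, hq⟩ : ∃ q, k * z - F.ee k i = 2 * (2 * q + 1) :=
        ⟨(k * z - F.ee k i) / 4, by omega⟩
      exact ⟨F.a i * (2 * q + 1) ^ 2, odd_mul_sq hi (by omega), by rw [hq]; ring⟩
    obtain ⟨m, hm, hsq⟩ := hsq
    have hN := hrep (F.tm i z % 8).toNat (by omega) (hF.repAt_of_single (i := i) z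
      (h8 ((F.tm i z % 8 - F.tm i z) % 32).toNat (by omega) (by omega)) hm hsq (by
        norm_num; omega))
    have := hs _ hN
    omega

/-- Next to one odd coefficient `a i`, the sums of the other unshifted coefficients are even, every
number up to `24` represented over `ℤ_2` is such a sum, possibly increased by `a i`, and the set of
these sums is periodic modulo `8` in the range up to `17`. -/
lemma STyp.closed_of_one_odd (hF : F.STyp k) (hA : F.AlmostUnshifted)
    (hglob : ∀ N : ℕ, F.RepAt 2 N → F.RepInt N) {i : Fin n} (hi : F.a i % 2 = 1)
    (heven : ∀ l, l ≠ i → F.a l % 2 = 0) :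
    (∀ v, F.SubSum (F.unshifted.erase i) v → v % 2 = 0) ∧
    (∀ N : ℕ, N ≤ 24 → F.RepAt 2 ((N : ℤ) : ℤ_[2]) → F.SubSum (F.unshifted.erase i) N ∨
      F.a i ≤ N ∧ F.SubSum (F.unshifted.erase i) (N - F.a i)) ∧
    (∀ e N : ℕ, F.SubSum (F.unshifted.erase i) e → N ≤ 17 → N % 8 = e % 8 →
      F.SubSum (F.unshifted.erase i) N) := by
  have hri := hF.level_of_one_odd hA hglob hi heven
  have hs : ∀ v, F.SubSum (F.unshifted.erase i) v → v % 2 = 0 := fun v hv =>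
    Nat.mod_eq_zero_of_dvd (hv.dvd fun l hl => Nat.dvd_of_mod_eq_zero
      (heven l (Finset.ne_of_mem_erase hl)))
  have hrep : ∀ N : ℕ, N ≤ 24 → F.RepAt 2 ((N : ℤ) : ℤ_[2]) → F.SubSum (F.unshifted.erase i) N ∨
      F.a i ≤ N ∧ F.SubSum (F.unshifted.erase i) (N - F.a i) := fun N hN h =>
    (hF.subSum_of_repAt hA hglob hN h).erase i
  refine ⟨hs, hrep, fun e N he hN hNe => ?_⟩
  have hee := hF.two_mul_ee i
  have hk := hF.odd
  rw [hri] at hee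
  have hse := hs e he
  by_cases hk4 : k % 4 = 1
  · have key : ∀ e' N' : ℕ, F.SubSum (F.unshifted.erase i) e' → N' ≤ 24 → N' % 8 = (F.a i + e') % 8 →
        F.a i ≤ N' ∧ F.SubSum (F.unshifted.erase i) (N' - F.a i) := fun e' N' h1 h2 h3 => by
      rcases hrep N' h2 (hF.repAt_of_single_odd (i := i) 1 h1 hi (by omega)
        (by rw [tm_of_unit hri]; omega)) with h | h
      · have := hs _ h; have := hs _ h1; omega
      · exact h
    have h7 := (key 0 (F.a i % 8) (SubSum.zero _) (by omega) (by omega)).1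
    have := (key e (N + F.a i) he (by omega) (by omega)).2
    rwa [Nat.add_sub_cancel] at this
  · rcases hrep N (by omega) (hF.repAt_of_single_odd (i := i) 0 he hi (by omega)
      (by rw [tm_zero]; omega)) with h | ⟨h, h'⟩
    · exact h
    · have := hs _ h'; omega

/-- With one odd coefficient the other unshifted coefficients are divisible by `4`: a coefficient
congruent to `2` modulo `4` makes all even residues modulo `8` sums, and `STyp.univAt_of_sums`
applies. -/
lemma STyp.no_two_mod_four (hF : F.STyp k) (hA : F.AlmostUnshifted)
    (hglob : ∀ N : ℕ, F.RepAt 2 N → F.RepInt N) (hbad : ¬ F.UnivAt 2) {i : Fin n}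
    (hi : F.a i % 2 = 1) (heven : ∀ l, l ≠ i → F.a l % 2 = 0) {j : Fin n} (hji : j ≠ i)
    (hrj : F.r j = 1) : F.a j % 4 = 0 := by
  classical
  have hri := hF.level_of_one_odd hA hglob hi heven
  obtain ⟨hs, hrep, hcl⟩ := hF.closed_of_one_odd hA hglob hi heven
  by_contra hj4
  have hj : F.a j % 4 = 2 := by have := heven j hji; omega
  apply hbad
  have hk := hF.odd
  have hei := hF.two_mul_ee i
  have hej := hF.two_mul_ee j
  rw [hri] at hei
  rw [hrj] at hej
  have hjs : j ∈ F.unshifted.erase i := Finset.mem_erase.2 ⟨hji, mem_unshifted.2 hrj⟩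
  have hsub : ∀ e, F.SubSum ((F.unshifted.erase i).erase j) e → F.SubSum (F.unshifted.erase i) e :=
    fun e ⟨T, hT, h⟩ => ⟨T, hT.trans (Finset.erase_subset _ _), h⟩
  have hsubj : ∀ e, F.SubSum ((F.unshifted.erase i).erase j) e →
      F.SubSum (F.unshifted.erase i) (F.a j + e) := by
    rintro e ⟨T, hT, rfl⟩
    refine ⟨insert j T, fun l hl => ?_, Finset.sum_insert fun h => Finset.ne_of_mem_erase (hT h) rfl⟩
    rcases Finset.mem_insert.1 hl with rfl | hl
    exacts [hjs, Finset.mem_of_mem_erase (hT hl)]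
  obtain ⟨c, hc⟩ : ∃ c : ℤ, (F.a j : ℤ) = 2 * (2 * c + 1) := ⟨F.a j / 4, by omega⟩
  have hpiv : ∀ z : ℤ, (k * z - F.ee k j) % 2 = 1 → ∃ m : ℤ, m % 2 = 1 ∧
      (F.a j : ℤ) * (k * z - F.ee k j) ^ 2 = 2 ^ 1 * m := fun z hz => by
    obtain ⟨q, hq⟩ : ∃ q, k * z - F.ee k j = 2 * q + 1 := ⟨(k * z - F.ee k j) / 2, by omega⟩
    refine ⟨(2 * c + 1) * (2 * q + 1) ^ 2, ?_, by rw [hq, hc]; ring⟩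
    rw [show (2 * c + 1) * (2 * q + 1) ^ 2 = 2 * ((2 * c + 1) * (2 * q ^ 2 + 2 * q) + c) + 1 by ring]
    omega
  -- shifting by `4` modulo `8`
  have hstep : ∀ e N : ℕ, F.SubSum ((F.unshifted.erase i).erase j) e → N ≤ 17 →
      N % 8 = ((if k % 4 = 1 then F.a j else 0) + e + 4) % 8 →
      F.SubSum (F.unshifted.erase i) N := by
    intro e N he hN hNe
    have he' : F.SubSum ((F.unshifted.erase j).erase i) e := by rwa [Finset.erase_right_comm]
    have hse := hs e (hsub e he)
    by_cases hk4 : k % 4 = 1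
    · rw [if_pos hk4] at hNe
      obtain ⟨m, hm, hp⟩ := hpiv 1 (by omega)
      have h2 := hF.tm_two hri hi hk4
      rcases hrep ((F.tm j 1 + F.tm i 2 + e) % 16).toNat (by omega)
        (hF.repAt_of_pair hji 1 2 he' hm hp (by norm_num; omega)) with h | ⟨h, h'⟩
      · refine hcl _ N h hN ?_
        rw [tm_of_unit hrj]
        omega
      · have := hs _ h'
        rw [tm_of_unit hrj] at this h
        omega
    · rw [if_neg hk4] at hNe
      obtain ⟨m, hm, hp⟩ := hpiv 0 (by omega)
      have h2 := hF.tm_neg_one hri hi (by omega)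
      rcases hrep ((F.tm j 0 + F.tm i (-1) + e) % 16).toNat (by omega)
        (hF.repAt_of_pair hji 0 (-1) he' hm hp (by norm_num; omega)) with h | ⟨h, h'⟩
      · have := hs _ h
        rw [tm_zero] at this
        omega
      · refine hcl _ N h' hN ?_
        rw [tm_zero] at h ⊢
        omega
  have hsj := hcl _ (F.a j % 8) (SubSum.single hjs) (by omega) (by omega)
  -- the residues `2`, `4` and `6` all occur
  have h246 : ∀ v, v % 2 = 0 → v < 8 → F.SubSum (F.unshifted.erase i) v := by
    by_cases hk4 : k % 4 = 1
    · simp only [hk4, if_true] at hstep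
      have h26 : ∀ v, v % 4 = 2 → v < 8 → F.SubSum (F.unshifted.erase i) v := fun v hv h8 => by
        by_cases h : v = F.a j % 8
        · rwa [h]
        · exact hstep 0 v (SubSum.zero _) (by omega) (by omega)
      have h4 : F.SubSum (F.unshifted.erase i) 4 := by
        have haux : ∀ e, F.SubSum ((F.unshifted.erase i).erase j) e → e % 4 = 2 →
            F.SubSum (F.unshifted.erase i) 4 := fun e he he2 => by
          by_cases h : (F.a j + e) % 8 = 4
          · exact hcl _ 4 (hsubj e he) (by norm_num) (by omega)
          · exact hstep e 4 he (by norm_num) (by omega)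
        rcases (h26 2 rfl (by norm_num)).erase j with h | ⟨h, -⟩
        · exact haux 2 h rfl
        rcases (h26 6 rfl (by norm_num)).erase j with h' | ⟨h', h''⟩
        · exact haux 6 h' rfl
        · have : F.a j = 2 := by omega
          rw [this] at h''
          exact hsub _ h''
      intro v hv h8
      have : v = 0 ∨ v % 4 = 2 ∨ v = 4 := by omega
      rcases this with rfl | h | rfl
      exacts [SubSum.zero _, h26 v h h8, h4]
    · simp only [hk4, if_false] at hstep
      have h4 := hstep 0 4 (SubSum.zero _) (by norm_num) (by norm_num)
      have hj4 : ∀ v, v % 8 = (F.a j + 4) % 8 → v < 8 → F.SubSum (F.unshifted.erase i) v := by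
        intro v hv h8
        rcases h4.erase j with h | ⟨h, h'⟩
        · exact hcl _ v (hsubj 4 h) (by omega) (by omega)
        · exact hstep _ v h' (by omega) (by omega)
      intro v hv h8
      have : v = 0 ∨ v = 4 ∨ v = F.a j % 8 ∨ v % 8 = (F.a j + 4) % 8 := by omega
      rcases this with rfl | rfl | h | h
      exacts [SubSum.zero _, h4, h ▸ hsj, hj4 v h h8]
  exact hF.univAt_of_sums hi heven fun v hv h2 =>
    hcl (v % 8) v (h246 _ (by omega) (by omega)) (by omega) (by omega)

/-- If a form with one odd coefficient is not universal at `2`, then this coefficient is `1` or `3`,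
its variable is unshifted, and the other coefficients are divisible by `4`. -/
theorem STyp.of_one_odd (hF : F.STyp k) (hA : F.AlmostUnshifted)
    (hglob : ∀ N : ℕ, F.RepAt 2 N → F.RepInt N) (hbad : ¬ F.UnivAt 2) {i : Fin n}
    (hi : F.a i % 2 = 1) (heven : ∀ l, l ≠ i → F.a l % 2 = 0) :
    F.r i = 1 ∧ (F.a i = 1 ∨ F.a i = 3) ∧ (∀ l, l ≠ i → F.a l % 4 = 0) ∧
      ∀ t : ℤ, t % 4 = 0 ∨ t % 4 = F.a i % 4 → TwoRep F.a Finset.univ t := by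
  classical
  have hri := hF.level_of_one_odd hA hglob hi heven
  obtain ⟨hs, hrep, hcl⟩ := hF.closed_of_one_odd hA hglob hi heven
  have hk := hF.odd
  have hei := hF.two_mul_ee i
  rw [hri] at hei
  have hk4 : k % 4 = 1 ∨ k % 4 = 3 := by omega
  have hreal : ∀ l, l ≠ i → F.r l = 1 → F.a l % 4 = 0 := fun l hl hr =>
    hF.no_two_mod_four hA hglob hbad hi heven hl hr
  have hs4 : ∀ v, F.SubSum (F.unshifted.erase i) v → v % 4 = 0 := fun v hv =>
    Nat.mod_eq_zero_of_dvd (hv.dvd fun l hl => Nat.dvd_of_mod_eq_zero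
      (hreal l (Finset.ne_of_mem_erase hl) (mem_unshifted.1 (Finset.mem_of_mem_erase hl))))
  -- Giving the variable `l` the value `1` represents a class modulo `8` over `ℤ_2`. This class has to
  -- contain a small sum of unshifted coefficients, which restricts `a l` even if `l` is shifted.
  have hghost : ∀ l, l ≠ i → ∃ N : ℕ, N < 8 ∧
      (N % 8 : ℤ) = ((if k % 4 = 1 then F.a i else 0 : ℕ) + (F.a l * F.r l : ℕ)) % 8 ∧
      (F.SubSum (F.unshifted.erase i) N ∨
        F.a i ≤ N ∧ F.SubSum (F.unshifted.erase i) (N - F.a i)) := by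
    intro l hl
    refine ⟨((if k % 4 = 1 then F.a i else 0) + F.a l * F.r l) % 8, Nat.mod_lt _ (by norm_num),
      by push_cast; omega, hrep _ (by omega) ?_⟩
    rcases hk4 with h | h
    · refine hF.repAt_of_pair_odd hl.symm 1 1 (SubSum.zero _) hi (by omega) ?_
      rw [tm_of_unit hri, tm_one, if_pos h]
      push_cast
      omega
    · refine hF.repAt_of_pair_odd hl.symm 0 1 (SubSum.zero _) hi (by omega) ?_
      rw [tm_zero, tm_one, if_neg (by omega)]
      push_cast
      omega
  have h4 : ∀ l, l ≠ i → F.a l % 4 = 0 := by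
    intro l hl
    by_cases hr : F.r l = 1
    · exact hreal l hl hr
    by_contra h
    obtain ⟨N, hN8, hN, hN'⟩ := hghost l hl
    have h2 : (F.a l * F.r l) % 4 = 2 := by
      have h1 := heven l hl
      have h3 := hF.r_odd l
      have : F.a l % 4 = 2 := by omega
      have h5 : F.r l % 4 = 1 ∨ F.r l % 4 = 3 := by omega
      rcases h5 with h5 | h5 <;> rw [Nat.mul_mod, this, h5]
    have hN4 : N % 4 = 0 ∨ N % 4 = F.a i % 4 ∧ N % 2 = 1 := by
      rcases hN' with h | ⟨h, h'⟩
      · exact Or.inl (hs4 _ h)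
      · have := hs4 _ h'; omega
    generalize F.a l * F.r l = α at *
    clear hghost hs hrep hcl hreal hs4 hN'
    split_ifs at hN <;> omega
  have h8 : ∀ v, v % 8 = 0 → v ≤ 17 → F.SubSum (F.unshifted.erase i) v := fun v hv h17 =>
    hcl 0 v (SubSum.zero _) h17 (by omega)
  -- A coefficient exactly divisible by `4` makes all multiples of `4` up to `17` sums. If there is none,
  -- the even coefficients are all divisible by `8`, and `TwoRep.of_progression` finds a number in a class
  -- modulo `8` without sums that is represented over `ℤ_2`.
  by_cases hodd : ∃ l ∈ F.unshifted.erase i, F.a l % 8 = 4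
  · obtain ⟨l, hl, hl8⟩ := hodd
    have h4' : ∀ v, v % 4 = 0 → v ≤ 17 → F.SubSum (F.unshifted.erase i) v := fun v hv h17 => by
      by_cases h : v % 8 = 0
      · exact h8 v h h17
      · exact hcl _ v (SubSum.single hl) h17 (by omega)
    obtain ⟨p, hps, -, hp⟩ := (h4' 4 (by norm_num) (by norm_num)).exists_new (S := ∅) (by simp)
    have hpi := Finset.ne_of_mem_erase hps
    have hp4 : F.a p = 4 := by have := h4 p hpi; have := hF.adm.pos p; omega
    obtain ⟨q, hqs, hqp, hq⟩ := (h4' 8 (by norm_num) (by norm_num)).exists_new (S := {p})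
      (by simp [hp4])
    have hqi := Finset.ne_of_mem_erase hqs
    rw [Finset.mem_singleton] at hqp
    have hq4 : F.a q = 4 ∨ F.a q = 8 := by have := h4 q hqi; have := hF.adm.pos q; omega
    obtain ⟨x, hxs, hxpq, hx⟩ := (h4' 16 (by norm_num) (by norm_num)).exists_new (S := {p, q}) (by
      rw [Finset.sum_pair (Ne.symm hqp)]; omega)
    have hxi := Finset.ne_of_mem_erase hxs
    simp only [Finset.mem_insert, Finset.mem_singleton, not_or] at hxpq
    have hT : ∀ t : ℤ, t % 4 = 0 ∨ t % 4 = F.a i % 4 → TwoRep F.a Finset.univ t := by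
      intro t ht
      by_cases h0 : t % 4 = 0
      · exact TwoRep.four_of_scale F.quart_cases (fun m hm => hF.quart_univ hi hpi hqi hqp hxi
          hxpq.1 hxpq.2 hp4 hq4 (h4 x hxi) hx hm) (Int.dvd_of_emod_eq_zero h0)
      · have h1 : t % 8 = F.a i % 8 ∨ (t - F.a p) % 8 = F.a i % 8 := by rw [hp4]; omega
        rcases h1 with h1 | h1
        · exact (TwoRep.single_odd hi h1).mono (Finset.subset_univ _)
        · exact (TwoRep.cons_one (by simpa using hpi) (TwoRep.single_odd hi h1)).mono
            (Finset.subset_univ _)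
    refine ⟨hri, ?_, h4, hT⟩
    -- The residue of `a i` is represented, which bounds `a i`.
    have hN : F.RepAt 2 (((F.a i % 4 : ℕ) : ℤ) : ℤ_[2]) := by
      refine hF.repAt_of_twoRep (hT _ ?_)
      rcases hk4 with h | h
      · right
        have := hF.four_dvd_target (fun _ => 0) (fun l => by
          by_cases hl : l = i
          · subst hl; right; omega
          · left; exact Nat.dvd_of_mod_eq_zero (h4 l hl)) (N := 0) (by
          rw [val_eq_sum, Finset.sum_eq_zero fun l _ => tm_zero F l]; rfl)
        have hk' : ((k : ℤ) * (F.a i % 4 : ℕ)) % 4 = F.a i % 4 := by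
          rw [Int.mul_emod, show (k : ℤ) % 4 = 1 by omega]; omega
        generalize (k : ℤ) * (F.a i % 4 : ℕ) = u at *
        clear hghost hs hrep hcl hreal hs4
        omega
      · left
        refine Int.emod_eq_zero_of_dvd (hF.four_dvd_target (Pi.single i 1) (fun l => ?_) ?_)
        · by_cases hl : l = i
          · subst hl; right; rw [Pi.single_eq_same]; omega
          · left; exact Nat.dvd_of_mod_eq_zero (h4 l hl)
        · rw [val_single, tm_of_unit hri]
          push_cast
          omega
    rcases hrep _ (by omega) hN with h | ⟨h, -⟩
    · have := hs4 _ h; omega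
    · omega
  · exfalso
    push Not at hodd
    have hall8 : ∀ l, l ≠ i → F.a l % 8 = 0 := by
      intro l hl
      have hl4 := h4 l hl
      by_contra hl8
      by_cases hr : F.r l = 1
      · exact hodd l (Finset.mem_erase.2 ⟨hl, mem_unshifted.2 hr⟩) (by omega)
      obtain ⟨N, hN8, hN, hN'⟩ := hghost l hl
      have h2 : (F.a l * F.r l) % 8 = 4 := by
        have h3 := hF.r_odd l
        have : F.a l % 8 = 4 := by omega
        have h5 : F.r l % 8 = 1 ∨ F.r l % 8 = 3 ∨ F.r l % 8 = 5 ∨ F.r l % 8 = 7 := by omega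
        rcases h5 with h5 | h5 | h5 | h5 <;> rw [Nat.mul_mod, this, h5]
      have hs8 : ∀ v, F.SubSum (F.unshifted.erase i) v → v % 8 = 0 := fun v hv =>
        Nat.mod_eq_zero_of_dvd (hv.dvd fun l hl => Nat.dvd_of_mod_eq_zero (by
          have := hodd l hl
          have := h4 l (Finset.ne_of_mem_erase hl)
          omega))
      have hN4 : N % 8 = 0 ∨ N % 8 = F.a i % 8 := by
        rcases hN' with h | ⟨h, h'⟩
        · exact Or.inl (hs8 _ h)
        · have := hs8 _ h'; omega
      generalize F.a l * F.r l = α at *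
      clear hghost hs hrep hcl hreal hs4 hN' hs8
      split_ifs at hN <;> omega
    have hs8 : ∀ v, F.SubSum (F.unshifted.erase i) v → v % 8 = 0 := fun v hv =>
      Nat.mod_eq_zero_of_dvd (hv.dvd fun l hl => Nat.dvd_of_mod_eq_zero
        (hall8 l (Finset.ne_of_mem_erase hl)))
    obtain ⟨p, hps, -, hp⟩ := (h8 8 (by norm_num) (by norm_num)).exists_new (S := ∅) (by simp)
    have hpi := Finset.ne_of_mem_erase hps
    have hp8 : F.a p = 8 := by have := hall8 p hpi; have := hF.adm.pos p; omega
    obtain ⟨q, hqs, hqp, hq⟩ := (h8 16 (by norm_num) (by norm_num)).exists_new (S := {p})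
      (by simp [hp8])
    have hqi := Finset.ne_of_mem_erase hqs
    rw [Finset.mem_singleton] at hqp
    have hq8 : F.a q = 8 ∨ F.a q = 16 := by have := hall8 q hqi; have := hF.adm.pos q; omega
    have e1 := quart_of_odd hi
    have e2 := quart_of_dvd (F := F) (i := p) (by omega)
    have e3 := quart_of_dvd (F := F) (i := q) (by omega)
    -- three numbers in the missing class modulo `8`, one of which is represented
    obtain ⟨v, hv8, hv, x, hx, hvx⟩ : ∃ v : ℕ, v < 8 ∧
        (v % 8 = 4 ∨ v % 8 = (F.a i + 4) % 8 ∧ v % 8 ≠ F.a i % 8) ∧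
        ∃ x : Fin n → ℤ, (∀ l, 4 ∣ F.a l ∨ (k * x l - F.ee k l) % 2 = 0) ∧
          ((v : ℤ) - F.val x) % 4 = 0 := by
      rcases hk4 with h | h
      · refine ⟨4, by norm_num, Or.inl rfl, fun _ => 0, fun l => ?_, ?_⟩
        · by_cases hl : l = i
          · subst hl; right; rw [mul_zero]; omega
          · left; exact Nat.dvd_of_mod_eq_zero (h4 l hl)
        · rw [val_eq_sum, Finset.sum_eq_zero fun l _ => tm_zero F l]; rfl
      · refine ⟨(F.a i + 4) % 8, by omega, Or.inr (by omega), Pi.single i 1, fun l => ?_, ?_⟩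
        · by_cases hl : l = i
          · subst hl; right; rw [Pi.single_eq_same]; omega
          · left; exact Nat.dvd_of_mod_eq_zero (h4 l hl)
        · rw [val_single, tm_of_unit hri]
          push_cast
          omega
    obtain ⟨τ, hτ⟩ := hF.four_dvd_target x hx hvx
    have hno : ∀ u : ℕ, u ≤ 2 → ¬ TwoRep F.quart Finset.univ (τ + 2 * u * k) := by
      intro u hu h
      have h1 : TwoRep F.a Finset.univ (4 * (τ + 2 * u * k)) := by
        refine (DiagRep.scale (d := 4) (A := fun i => (F.a i : ℤ_[2])) h fun l _ => ?_).of_eq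
          (by push_cast; ring)
        rcases F.quart_cases l with h | h
        · exact ⟨2, by rw [← h]; ring⟩
        · exact ⟨1, by rw [h]; push_cast; ring⟩
      have h2 : F.RepAt 2 (((v + 8 * u : ℕ) : ℤ) : ℤ_[2]) := by
        refine hF.repAt_of_twoRep (s := Finset.univ) ?_
        rwa [show (k : ℤ) * (v + 8 * u : ℕ) + F.twoDisc k = 4 * (τ + 2 * u * k) by
          push_cast; linear_combination hτ]
      rcases hrep _ (by omega) h2 with h | ⟨h, h'⟩
      · have := hs8 _ h; omega
      · have := hs8 _ h'
        omega
    rcases TwoRep.of_progression (a := F.quart) (n := τ) hpi.symm hqi.symm (Ne.symm hqp)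
      (by omega) (by omega) (by omega) (k := k) (by omega) with h | h | h
    · exact hno 0 (by norm_num) (DiagRep.of_eq (h.mono (Finset.subset_univ _)) (by push_cast; ring))
    · exact hno 1 (by norm_num) (DiagRep.of_eq (h.mono (Finset.subset_univ _)) (by push_cast; ring))
    · exact hno 2 (by norm_num) (DiagRep.of_eq (h.mono (Finset.subset_univ _)) (by push_cast; ring))

end PForm

namespace PForm

variable {n k : ℕ} {F : PForm n}

/-- The sums of the coefficients divisible by `4` next to two odd coefficients, and the numbers up
to `24` in terms of them. -/
lemma STyp.sums_of_two_odd (hF : F.STyp k) (hA : F.AlmostUnshifted)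
    (hglob : ∀ N : ℕ, F.RepAt 2 N → F.RepInt N) {i j : Fin n}
    (h4 : ∀ l, l ≠ i → l ≠ j → F.a l % 4 = 0) :
    (∀ v, F.SubSum ((F.unshifted.erase i).erase j) v → v % 4 = 0) ∧
    (∀ N : ℕ, N ≤ 24 → F.RepAt 2 ((N : ℤ) : ℤ_[2]) →
      (F.SubSum ((F.unshifted.erase i).erase j) N ∨
        F.a j ≤ N ∧ F.SubSum ((F.unshifted.erase i).erase j) (N - F.a j)) ∨
      (F.r i = 1 ∧ F.a i ≤ N ∧ (F.SubSum ((F.unshifted.erase i).erase j) (N - F.a i) ∨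
        F.a j ≤ N - F.a i ∧ F.SubSum ((F.unshifted.erase i).erase j) (N - F.a i - F.a j)))) := by
  refine ⟨fun v hv => Nat.mod_eq_zero_of_dvd (hv.dvd fun l hl => Nat.dvd_of_mod_eq_zero
    (h4 l (Finset.ne_of_mem_erase (Finset.mem_of_mem_erase hl)) (Finset.ne_of_mem_erase hl))),
    fun N hN h => ?_⟩
  have h0 := hF.subSum_of_repAt hA hglob hN h
  by_cases hr : F.r i = 1
  · rcases h0.erase i with h | ⟨h, h'⟩
    · exact Or.inl (h.erase j)
    · exact Or.inr ⟨hr, h, h'.erase j⟩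
  · rw [erase_unshifted hr]
    exact Or.inl (h0.erase j)

/-- The analogue of `STyp.quart_univ` for two odd coefficients. -/
lemma STyp.quart_univ_two (hF : F.STyp k) {i j p q : Fin n} (hi : F.a i % 2 = 1)
    (hj : F.a j % 2 = 1) (hij : i ≠ j) (hpi : p ≠ i) (hpj : p ≠ j)
    (hqi : q ≠ i) (hqj : q ≠ j) (hqp : q ≠ p) (hp : F.a p % 8 = 4) (hq4 : F.a q % 4 = 0)
    (hq : F.a q ≤ 16) {t : ℤ} (ht : ¬ 4 ∣ t) : TwoRep F.quart Finset.univ t := by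
  have e1 := quart_of_odd hi
  have e2 := quart_of_odd hj
  have e3 := quart_of_dvd (F := F) (i := p) (by omega)
  have e4 := quart_of_dvd hq4
  have := hF.adm.pos q
  exact (TwoRep.quadruple hij hpi.symm hpj.symm hqi.symm hqj.symm hqp.symm (by omega)
    (by omega) (by omega) (by omega) ht).mono (Finset.subset_univ _)

/-- If the diagonal form represents all multiples of `4`, then over `ℤ_2` the form represents all
numbers congruent modulo `4` to its value at a vector with even arguments of the squares. -/
lemma STyp.repAt_of_quart (hF : F.STyp k) (hu : ∀ t : ℤ, ¬ 4 ∣ t → TwoRep F.quart Finset.univ t)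
    (x : Fin n → ℤ) (h : ∀ l, 4 ∣ F.a l ∨ (k * x l - F.ee k l) % 2 = 0) {N : ℤ}
    (hN : (N - F.val x) % 4 = 0) : F.RepAt 2 N :=
  hF.repAt_of_twoRep (TwoRep.four_of_scale F.quart_cases hu (hF.four_dvd_target x h hN))

/-- If two coefficients are odd, their variables are unshifted: otherwise the sums of unshifted
coefficients are `0` or `a j` modulo `4`, while a further class is represented over `ℤ_2`. -/
lemma STyp.level_of_two_odd (hF : F.STyp k) (hA : F.AlmostUnshifted)
    (hglob : ∀ N : ℕ, F.RepAt 2 N → F.RepInt N) {i j : Fin n} (hij : i ≠ j) (hi : F.a i % 2 = 1)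
    (hj : F.a j % 2 = 1) (h4 : ∀ l, l ≠ i → l ≠ j → F.a l % 4 = 0) : F.r i = 1 := by
  classical
  by_contra hri
  have hrj : F.r j = 1 := by
    by_contra h
    exact hij (hA.uniq i j hri h)
  obtain ⟨hs, hrep'⟩ := hF.sums_of_two_odd hA hglob h4
  have hrep : ∀ N : ℕ, N ≤ 24 → F.RepAt 2 ((N : ℤ) : ℤ_[2]) →
      (F.SubSum ((F.unshifted.erase i).erase j) N ∨
        F.a j ≤ N ∧ F.SubSum ((F.unshifted.erase i).erase j) (N - F.a j)) := fun N hN h =>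
    (hrep' N hN h).resolve_right fun h => hri h.1
  have hrep4 : ∀ N : ℕ, N ≤ 24 → F.RepAt 2 ((N : ℤ) : ℤ_[2]) → N % 4 = 0 ∨ N % 4 = F.a j % 4 :=
    fun N hN h => by
      rcases hrep N hN h with h | ⟨h, h'⟩
      · exact Or.inl (hs _ h)
      · have := hs _ h'; omega
  have hα := hF.odd_mul_r hi
  have hk := hF.odd
  have hej := hF.two_mul_ee j
  rw [hrj] at hej
  by_cases h1 : (k * (1 : ℤ) - F.ee k i) % 2 = 1
  · have h2 := hrep4 ((F.a i * F.r i) % 8) (by omega)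
      (hF.repAt_of_pair_odd hij 1 0 (SubSum.zero _) hi h1 (by rw [tm_one, tm_zero]; push_cast; omega))
    have h3 := hrep4 ((F.a i * F.r i + F.a j) % 8) (by omega)
      (hF.repAt_of_pair_odd hij 1 1 (SubSum.zero _) hi h1
        (by rw [tm_one, tm_of_unit hrj]; push_cast; omega))
    omega
  have hsw : ∀ v, F.SubSum ((F.unshifted.erase i).erase j) v →
      F.SubSum ((F.unshifted.erase j).erase i) v := fun v hv => by rwa [Finset.erase_right_comm]
  have h0 : (k * (0 : ℤ) - F.ee k i) % 2 = 1 := by omega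
  have h8 : ∀ v, v % 8 = 0 → v ≤ 24 → F.SubSum ((F.unshifted.erase i).erase j) v := by
    intro v hv h24
    rcases hrep v h24 (hF.repAt_of_pair_odd hij 0 0 (SubSum.zero _) hi h0
      (by rw [tm_zero, tm_zero]; push_cast; omega)) with h | ⟨h, h'⟩
    · exact h
    · have := hs _ h'; omega
  have hE4 : F.SubSum ((F.unshifted.erase i).erase j) 4 := by
    by_cases hk4 : k % 4 = 1
    · have h2 := hF.tm_two hrj hj hk4
      rcases hrep 4 (by norm_num) (hF.repAt_of_pair_odd hij 0 2 (SubSum.zero _) hi h0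
        (by rw [tm_zero]; push_cast; omega)) with h | ⟨h, h'⟩
      · exact h
      · have := hs _ h'; omega
    · have h2 := hF.tm_neg_one hrj hj (by omega)
      rcases hrep ((F.a j + 4) % 8) (by omega) (hF.repAt_of_pair_odd hij 0 (-1) (SubSum.zero _) hi h0
        (by rw [tm_zero]; push_cast; omega)) with h | ⟨h, h'⟩
      · have := hs _ h; omega
      · have : (F.a j + 4) % 8 - F.a j = 4 := by have := hs _ h'; omega
        rwa [this] at h'
  obtain ⟨p, hps, -, hp⟩ := hE4.exists_new (S := ∅) (by simp)
  have hpj := Finset.ne_of_mem_erase hps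
  have hpi := Finset.ne_of_mem_erase (Finset.mem_of_mem_erase hps)
  have hp4 : F.a p = 4 := by have := h4 p hpi hpj; have := hF.adm.pos p; omega
  obtain ⟨q, hqs, hqp, hq⟩ := (h8 8 rfl (by norm_num)).exists_new (S := {p}) (by simp [hp4])
  have hqj := Finset.ne_of_mem_erase hqs
  have hqi := Finset.ne_of_mem_erase (Finset.mem_of_mem_erase hqs)
  rw [Finset.mem_singleton] at hqp
  have hu : ∀ t : ℤ, ¬ 4 ∣ t → TwoRep F.quart Finset.univ t := fun t ht =>
    hF.quart_univ_two hi hj hij hpi hpj hqi hqj hqp (by omega) (h4 q hqi hqj) (by omega) ht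
  have hfour : ∀ l, l ≠ i → l ≠ j → 4 ∣ F.a l := fun l h h' => Nat.dvd_of_mod_eq_zero (h4 l h h')
  by_cases hk4 : k % 4 = 1
  · have h2 := hrep4 ((F.a i * F.r i + F.a j) % 8) (by omega)
      (hF.repAt_of_pair_odd hij.symm 1 1 (SubSum.zero _) hj (by omega)
        (by rw [tm_of_unit hrj, tm_one]; push_cast; omega))
    have h3 := hrep4 ((F.a i * F.r i) % 4) (by omega)
      (hF.repAt_of_quart hu (testVec i j 1 0 ∅) (fun l => by
        by_cases hli : l = i
        · right; subst hli; simp only [testVec, if_true]; omega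
        by_cases hlj : l = j
        · right; subst hlj; simp only [testVec, hij.symm, if_true, if_false, mul_zero]; omega
        · exact Or.inl (hfour l hli hlj)) (by
        rw [val_testVec hij 1 0 (by simp), tm_one, tm_zero, Finset.sum_empty]; push_cast; omega))
    omega
  · have h2 := hrep4 ((F.a i * F.r i) % 8) (by omega)
      (hF.repAt_of_pair_odd hij.symm 0 1 (SubSum.zero _) hj (by omega)
        (by rw [tm_zero, tm_one]; push_cast; omega))
    have h3 := hrep4 ((F.a i * F.r i + F.a j) % 4) (by omega)
      (hF.repAt_of_quart hu (testVec i j 1 1 ∅) (fun l => by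
        by_cases hli : l = i
        · right; subst hli; simp only [testVec, if_true]; omega
        by_cases hlj : l = j
        · right; subst hlj; simp only [testVec, hij.symm, if_true, if_false]; omega
        · exact Or.inl (hfour l hli hlj)) (by
        rw [val_testVec hij 1 1 (by simp), tm_one, tm_of_unit hrj, Finset.sum_empty]; push_cast; omega))
    omega

/-- Two odd coefficients congruent modulo `4`, the first one less than `4`, are both `1`. The small
numbers in the class of the odd coefficients force small coefficients divisible by `4`, after which `2`
or `4` would be represented over `ℤ_2` but not over `ℤ` in all other cases. -/
lemma STyp.of_two_odd_congr (hF : F.STyp k) (hA : F.AlmostUnshifted)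
    (hglob : ∀ N : ℕ, F.RepAt 2 N → F.RepInt N) {i j : Fin n} (hij : i ≠ j)
    (hri : F.r i = 1) (hrj : F.r j = 1) (hi : F.a i % 2 = 1) (hi4 : F.a i < 4)
    (hji : F.a j % 4 = F.a i % 4) (h4 : ∀ l, l ≠ i → l ≠ j → F.a l % 4 = 0)
    (hcl : ∀ N : ℕ, N % 4 = F.a i % 4 → F.RepAt 2 ((N : ℤ) : ℤ_[2])) :
    F.a i = 1 ∧ F.a j = 1 ∧ ∀ t : ℤ, t % 4 ≠ 3 → TwoRep F.a Finset.univ t := by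
  classical
  obtain ⟨hs, hrep⟩ := hF.sums_of_two_odd hA hglob h4
  have hj : F.a j % 2 = 1 := by omega
  have hk := hF.odd
  have hei := hF.two_mul_ee i
  have hej := hF.two_mul_ee j
  rw [hri] at hei
  rw [hrj] at hej
  have hfour : ∀ l, l ≠ i → l ≠ j → 4 ∣ F.a l := fun l h h' => Nat.dvd_of_mod_eq_zero (h4 l h h')
  -- numbers in the class of the odd coefficients
  have hu5 : ∀ u, u ≤ 5 → F.SubSum ((F.unshifted.erase i).erase j) (4 * u) ∨
      F.a j ≤ 4 * u + F.a i ∧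
        F.SubSum ((F.unshifted.erase i).erase j) (4 * u + F.a i - F.a j) := by
    intro u hu
    rcases hrep (4 * u + F.a i) (by omega) (hcl _ (by omega)) with (h | ⟨h, h'⟩) | ⟨-, h, h' | ⟨h', h''⟩⟩
    · have := hs _ h; omega
    · exact Or.inr ⟨h, h'⟩
    · left; rwa [Nat.add_sub_cancel] at h'
    · have := hs _ h''; omega
  have heven : ∀ N : ℕ, N ≤ 24 → N % 4 = 2 → F.RepAt 2 ((N : ℤ) : ℤ_[2]) →
      F.a i + F.a j ≤ N ∧ F.SubSum ((F.unshifted.erase i).erase j) (N - F.a i - F.a j) := by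
    intro N hN h2 h
    rcases hrep N hN h with (h | ⟨h, h'⟩) | ⟨-, h, h' | ⟨h', h''⟩⟩
    · have := hs _ h; omega
    · have := hs _ h'; omega
    · have := hs _ h'; omega
    · exact ⟨by omega, h''⟩
  have hdiv : ∀ N : ℕ, N ≤ 24 → N % 4 = 0 → F.RepAt 2 ((N : ℤ) : ℤ_[2]) →
      F.SubSum ((F.unshifted.erase i).erase j) N := by
    intro N hN h2 h
    rcases hrep N hN h with (h | ⟨h, h'⟩) | ⟨-, h, h' | ⟨h', h''⟩⟩
    · exact h
    · have := hs _ h'; omega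
    · have := hs _ h'; omega
    · have := hs _ h''; omega
  have main : F.a i = 1 ∧ F.a j = 1 := by
    by_cases hk4 : k % 4 = 1
    · have hsum : ∀ e N : ℕ, F.SubSum ((F.unshifted.erase i).erase j) e →
          N % 8 = (F.a i + F.a j + e) % 8 → F.RepAt 2 ((N : ℤ) : ℤ_[2]) := fun e N he hN =>
        hF.repAt_of_pair_odd hij 1 1 he hi (by omega)
          (by rw [tm_of_unit hri, tm_of_unit hrj]; omega)
      have h6 := (heven ((F.a i + F.a j) % 8) (by omega) (by omega)
        (hsum 0 _ (SubSum.zero _) (by omega))).1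
      by_contra hne
      -- As `a i + a j` is less than `8`, the pairs `(3, 3)` and `(1, 5)` remain. For these no sum of the
      -- other coefficients is `4` modulo `8`, as otherwise `2` would be represented.
      have hno : ∀ e, F.SubSum ((F.unshifted.erase i).erase j) e → e % 8 = 4 → False := by
        intro e he he8
        have := (heven 2 (by norm_num) (by norm_num) (hsum e 2 he (by omega))).1
        omega
      have h15 : F.a i = 1 ∧ F.a j = 5 := by
        by_contra h
        have h33 : F.a i = 3 ∧ F.a j = 3 := by omega
        rcases hu5 1 (by norm_num) with h | ⟨-, h⟩
        · exact hno 4 (by simpa using h) rfl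
        · exact hno 4 (by simpa [h33] using h) rfl
      have e8 : F.SubSum ((F.unshifted.erase i).erase j) 8 := by
        rcases hu5 2 (by norm_num) with h | ⟨-, h⟩
        · exact h
        · exact (hno 4 (by simpa [h15] using h) rfl).elim
      have e16 : F.SubSum ((F.unshifted.erase i).erase j) 16 := by
        rcases hu5 4 (by norm_num) with h | ⟨-, h⟩
        · exact h
        · exact (hno 12 (by simpa [h15] using h) rfl).elim
      have hall8 : ∀ l ∈ (F.unshifted.erase i).erase j, F.a l % 8 = 0 := fun l hl => by
        by_contra h
        have := h4 l (Finset.ne_of_mem_erase (Finset.mem_of_mem_erase hl)) (Finset.ne_of_mem_erase hl)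
        exact hno _ (SubSum.single hl) (by omega)
      obtain ⟨p, hps, -, hp⟩ := e8.exists_new (S := ∅) (by simp)
      have hpj := Finset.ne_of_mem_erase hps
      have hpi := Finset.ne_of_mem_erase (Finset.mem_of_mem_erase hps)
      have hp8 : F.a p = 8 := by have := hall8 p hps; have := hF.adm.pos p; omega
      obtain ⟨q, hqs, hqp, hq⟩ := e16.exists_new (S := {p}) (by simp [hp8])
      have hqj := Finset.ne_of_mem_erase hqs
      have hqi := Finset.ne_of_mem_erase (Finset.mem_of_mem_erase hqs)
      rw [Finset.mem_singleton] at hqp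
      have hq8 : F.a q = 8 ∨ F.a q = 16 := by
        have := hall8 q hqs; have := hF.adm.pos q; omega
      have e1 := quart_of_odd hi
      have e2 := quart_of_odd hj
      have e3 := quart_of_dvd (F := F) (i := p) (by omega)
      have e4 := quart_of_dvd (F := F) (i := q) (by omega)
      have hu : ∀ t : ℤ, ¬ 4 ∣ t → TwoRep F.quart Finset.univ t := fun t ht =>
        (TwoRep.quadruple_two hij hpi.symm hpj.symm hqi.symm hqj.symm (Ne.symm hqp) (by omega)
          (by omega) (by omega) (by omega) (by omega) ht).mono (Finset.subset_univ _)
      refine hno 4 (hdiv 4 (by norm_num) rfl (hF.repAt_of_quart hu (fun _ => 0) (fun l => ?_) ?_)) rfl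
      · by_cases hli : l = i
        · right; subst hli; rw [mul_zero]; omega
        by_cases hlj : l = j
        · right; subst hlj; rw [mul_zero]; omega
        · exact Or.inl (hfour l hli hlj)
      · rw [val_eq_sum, Finset.sum_eq_zero fun l _ => tm_zero F l]; rfl
    · have h8 : ∀ v, v % 8 = 0 → v ≤ 24 → F.SubSum ((F.unshifted.erase i).erase j) v :=
        fun v hv h24 => hdiv v h24 (by omega) (hF.repAt_of_pair_odd hij 0 0 (SubSum.zero _) hi
          (by omega) (by rw [tm_zero, tm_zero]; push_cast; omega))
      obtain ⟨p, hps, -, hp⟩ := (h8 8 rfl (by norm_num)).exists_new (S := ∅) (by simp)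
      have hpj := Finset.ne_of_mem_erase hps
      have hpi := Finset.ne_of_mem_erase (Finset.mem_of_mem_erase hps)
      have hp4 := h4 p hpi hpj
      have hp0 := hF.adm.pos p
      obtain ⟨q, hqs, hqp, hq⟩ := (h8 16 rfl (by norm_num)).exists_new (S := {p})
        (by rw [Finset.sum_singleton]; omega)
      have hqj := Finset.ne_of_mem_erase hqs
      have hqi := Finset.ne_of_mem_erase (Finset.mem_of_mem_erase hqs)
      have hq4 := h4 q hqi hqj
      have hq0 := hF.adm.pos q
      rw [Finset.mem_singleton] at hqp
      have hu : ∀ t : ℤ, ¬ 4 ∣ t → TwoRep F.quart Finset.univ t := by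
        intro t ht
        by_cases hp8 : F.a p = 4
        · exact hF.quart_univ_two hi hj hij hpi hpj hqi hqj hqp (by omega) hq4 hq ht
        by_cases hq8 : F.a q % 8 = 4
        · exact hF.quart_univ_two hi hj hij hqi hqj hpi hpj (Ne.symm hqp) hq8 hp4 (by omega) ht
        have e1 := quart_of_odd hi
        have e2 := quart_of_odd hj
        have e3 := quart_of_dvd hp4
        have e4 := quart_of_dvd hq4
        exact (TwoRep.quadruple_two hij hpi.symm hpj.symm hqi.symm hqj.symm (Ne.symm hqp) (by omega)
          (by omega) (by omega) (by omega) (by omega) ht).mono (Finset.subset_univ _)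
      have := (heven 2 (by norm_num) (by norm_num) (hF.repAt_of_quart hu (testVec i j 1 1 ∅)
        (fun l => by
          by_cases hli : l = i
          · right; subst hli; simp only [testVec, if_true]; omega
          by_cases hlj : l = j
          · right; subst hlj; simp only [testVec, hij.symm, if_true, if_false]; omega
          · exact Or.inl (hfour l hli hlj)) (by
          rw [val_testVec hij 1 1 (by simp), tm_of_unit hri, tm_of_unit hrj, Finset.sum_empty]
          push_cast; omega))).1
      omega
  obtain ⟨m1, m2⟩ := main
  have hE : ∀ u, u ≤ 5 → F.SubSum ((F.unshifted.erase i).erase j) (4 * u) := fun u hu => by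
    rcases hu5 u hu with h | ⟨-, h⟩
    · exact h
    · rwa [m1, m2, Nat.add_sub_cancel] at h
  obtain ⟨p, hps, -, hp⟩ := (hE 1 (by norm_num)).exists_new (S := ∅) (by simp)
  have hpj := Finset.ne_of_mem_erase hps
  have hpi := Finset.ne_of_mem_erase (Finset.mem_of_mem_erase hps)
  have hp4 : F.a p = 4 := by have := h4 p hpi hpj; have := hF.adm.pos p; omega
  obtain ⟨q, hqs, hqp, hq⟩ := (hE 2 (by norm_num)).exists_new (S := {p}) (by simp [hp4])
  have hqj := Finset.ne_of_mem_erase hqs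
  have hqi := Finset.ne_of_mem_erase (Finset.mem_of_mem_erase hqs)
  rw [Finset.mem_singleton] at hqp
  refine ⟨m1, m2, fun t ht => ?_⟩
  by_cases t0 : t % 4 = 0
  · exact TwoRep.four_of_scale F.quart_cases (fun m hm => hF.quart_univ_two hi hj hij hpi hpj hqi hqj
      hqp (by omega) (h4 q hqi hqj) (by omega) hm) (Int.dvd_of_emod_eq_zero t0)
  by_cases t1 : t % 4 = 1
  · exact (TwoRep.pair_odd hij hi hj (by omega)).mono (Finset.subset_univ _)
  by_cases t2 : t % 8 = 2
  · exact (TwoRep.pair_sum hij hi (by rw [m1, m2]; omega)).mono (Finset.subset_univ _)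
  · exact (TwoRep.cons_one (i := p) (by simp [hpi, hpj]) (TwoRep.pair_sum hij hi
      (by rw [m1, m2, hp4]; push_cast; omega))).mono (Finset.subset_univ _)

/-- Two odd coefficients next to multiples of `4` are `1, 3` or `1, 1`. If they add up to a multiple of
`4`, all odd numbers are represented over `ℤ_2`, and `1` and `3` must be coefficients. If not, they are
congruent modulo `4`. -/
theorem STyp.of_two_odd (hF : F.STyp k) (hA : F.AlmostUnshifted)
    (hglob : ∀ N : ℕ, F.RepAt 2 N → F.RepInt N) {i j : Fin n} (hij : i ≠ j) (hi : F.a i % 2 = 1)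
    (hj : F.a j % 2 = 1) (h4 : ∀ l, l ≠ i → l ≠ j → F.a l % 4 = 0) :
    F.r i = 1 ∧ F.r j = 1 ∧
    ((F.a i = 1 ∧ F.a j = 3 ∨ F.a i = 3 ∧ F.a j = 1) ∧
        (∀ t : ℤ, t % 4 ≠ 2 → TwoRep F.a Finset.univ t) ∨
      (F.a i = 1 ∧ F.a j = 1) ∧ ∀ t : ℤ, t % 4 ≠ 3 → TwoRep F.a Finset.univ t) := by
  classical
  have h4' : ∀ l, l ≠ j → l ≠ i → F.a l % 4 = 0 := fun l h h' => h4 l h' h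
  have hri := hF.level_of_two_odd hA hglob hij hi hj h4
  have hrj := hF.level_of_two_odd hA hglob hij.symm hj hi h4'
  refine ⟨hri, hrj, ?_⟩
  obtain ⟨hs, hrep⟩ := hF.sums_of_two_odd hA hglob h4
  have hk := hF.odd
  have hei := hF.two_mul_ee i
  have hej := hF.two_mul_ee j
  rw [hri] at hei
  rw [hrj] at hej
  -- Over `ℤ_2` the form represents the full classes modulo `4` of both odd coefficients.
  have hcl : ∀ i j : Fin n, i ≠ j → F.a i % 2 = 1 → F.a j % 2 = 1 → F.r i = 1 → F.r j = 1 →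
      ∀ N : ℕ, N % 4 = F.a i % 4 → F.RepAt 2 ((N : ℤ) : ℤ_[2]) := by
    intro i j hij hi hj hri hrj N hN
    have hei := hF.two_mul_ee i
    have hej := hF.two_mul_ee j
    rw [hri] at hei
    rw [hrj] at hej
    by_cases hk4 : k % 4 = 1
    · have h2 := hF.tm_two hrj hj hk4
      by_cases h8 : N % 8 = F.a i % 8
      · exact hF.repAt_of_pair_odd hij 1 0 (SubSum.zero _) hi (by omega)
          (by rw [tm_of_unit hri, tm_zero]; push_cast; omega)
      · exact hF.repAt_of_pair_odd hij 1 2 (SubSum.zero _) hi (by omega)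
          (by rw [tm_of_unit hri]; push_cast; omega)
    · have h2 := hF.tm_neg_one hri hi (by omega)
      by_cases h8 : N % 8 = F.a i % 8
      · exact hF.repAt_of_pair_odd hij.symm 0 1 (SubSum.zero _) hj (by omega)
          (by rw [tm_of_unit hri, tm_zero]; push_cast; omega)
      · exact hF.repAt_of_pair_odd hij.symm 0 (-1) (SubSum.zero _) hj (by omega)
          (by rw [tm_zero]; push_cast; omega)
  have hci := hcl i j hij hi hj hri hrj
  have hcj := hcl j i hij.symm hj hi hrj hri
  have hodd : ∀ N : ℕ, N ≤ 24 → N % 2 = 1 → (N % 4 = F.a i % 4 ∨ N % 4 = F.a j % 4) →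
      F.a i ≤ N ∧ N % 4 = F.a i % 4 ∧ F.SubSum ((F.unshifted.erase i).erase j) (N - F.a i) ∨
      F.a j ≤ N ∧ N % 4 = F.a j % 4 ∧ F.SubSum ((F.unshifted.erase i).erase j) (N - F.a j) := by
    intro N hN h2 h
    rcases hrep N hN (h.elim (hci N) (hcj N)) with (h | ⟨h, h'⟩) | ⟨-, h, h' | ⟨h', h''⟩⟩
    · have := hs _ h; omega
    · have := hs _ h'; exact Or.inr ⟨h, by omega, h'⟩
    · have := hs _ h'; exact Or.inl ⟨h, by omega, h'⟩
    · have := hs _ h''; omega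
  by_cases hsum : (F.a i + F.a j) % 4 = 0
  · left
    have o1 := hodd 1 (by norm_num) (by norm_num) (by omega)
    have o3 := hodd 3 (by norm_num) (by norm_num) (by omega)
    have h13 : F.a i = 1 ∧ F.a j = 3 ∨ F.a i = 3 ∧ F.a j = 1 := by omega
    have hE4 : F.SubSum ((F.unshifted.erase i).erase j) 4 := by
      rcases hodd 5 (by norm_num) (by norm_num) (by omega) with ⟨-, h, h'⟩ | ⟨-, h, h'⟩
      · rwa [show F.a i = 1 by omega] at h'
      · rwa [show F.a j = 1 by omega] at h'
    refine ⟨h13, fun t ht => ?_⟩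
    obtain ⟨p, hps, -, hp⟩ := hE4.exists_new (S := ∅) (by simp)
    have hpj := Finset.ne_of_mem_erase hps
    have hpi := Finset.ne_of_mem_erase (Finset.mem_of_mem_erase hps)
    have hp4 : F.a p = 4 := by have := h4 p hpi hpj; have := hF.adm.pos p; omega
    by_cases t1 : t % 2 = 1
    · exact (TwoRep.pair_odd_all hij hi (by omega) t1).mono (Finset.subset_univ _)
    by_cases t2 : t % 8 = 4
    · exact (TwoRep.pair_sum hij hi (by omega)).mono (Finset.subset_univ _)
    · exact (TwoRep.cons_one (i := p) (by simp [hpi, hpj]) (TwoRep.pair_sum hij hi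
        (by omega))).mono (Finset.subset_univ _)
  · right
    have hg := hodd (F.a i % 4) (by omega) (by omega) (by omega)
    by_cases hi4 : F.a i < 4
    · obtain ⟨h1, h2, h3⟩ := hF.of_two_odd_congr hA hglob hij hri hrj hi hi4 (by omega) h4 hci
      exact ⟨⟨h1, h2⟩, h3⟩
    · obtain ⟨h1, h2, h3⟩ := hF.of_two_odd_congr hA hglob hij.symm hrj hri hj (by omega) (by omega)
        h4' hcj
      exact ⟨⟨h2, h1⟩, h3⟩

end PForm

/-! ### The types of forms that are not universal -/

namespace PForm

variable {n k D : ℕ} {F : PForm n}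

lemma five_le_of_prime {p : ℕ} (hp : p.Prime) (h2 : p ≠ 2) (h3 : p ≠ 3) : 5 ≤ p := by
  have h4 : p ≠ 4 := fun h => by subst h; exact absurd hp (by norm_num)
  have := hp.two_le
  omega

lemma almostUnshifted_of_unit (hr : ∀ i, F.r i = 1) : F.AlmostUnshifted :=
  ⟨fun i => Or.inl (hr i), fun i _ h _ => absurd (hr i) h⟩

/-- The three ways in which a form fails to be universal at `2`: the odd coefficients are one of
`1`, `3`, or `1, 3`, or `1, 1`, the others are divisible by `4`, and the diagonal form represents
all residues modulo `4` that it can. -/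
def TwoShape (F : PForm n) : Prop :=
  (∃ i, F.r i = 1 ∧ (F.a i = 1 ∨ F.a i = 3) ∧ (∀ l, l ≠ i → F.a l % 4 = 0) ∧
    ∀ t : ℤ, t % 4 = 0 ∨ t % 4 = F.a i % 4 → TwoRep F.a Finset.univ t) ∨
  (∃ i j, i ≠ j ∧ F.r i = 1 ∧ F.r j = 1 ∧ F.a i = 1 ∧ F.a j = 3 ∧
    (∀ l, l ≠ i → l ≠ j → F.a l % 4 = 0) ∧ ∀ t : ℤ, t % 4 ≠ 2 → TwoRep F.a Finset.univ t) ∨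
  (∃ i j, i ≠ j ∧ F.r i = 1 ∧ F.r j = 1 ∧ F.a i = 1 ∧ F.a j = 1 ∧
    (∀ l, l ≠ i → l ≠ j → F.a l % 4 = 0) ∧ ∀ t : ℤ, t % 4 ≠ 3 → TwoRep F.a Finset.univ t)

/-- With universality at all other primes known, the small numbers represented over `ℤ_2` determine
the shape. -/
theorem STyp.twoShape (hn : 4 ≤ n) (hF : F.STyp k) (hA : F.AlmostUnshifted) (hreg : F.Regular)
    (h3 : F.UnivAt 3) (hbad : ¬ F.UnivAt 2) : F.TwoShape := by
  have hglob : ∀ N : ℕ, F.RepAt 2 N → F.RepInt N := fun N hN => hreg N fun p hp => by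
    by_cases h2 : p = 2
    · subst h2; exact hN
    by_cases hp3 : p = 3
    · subst hp3; exact h3 _
    · exact hF.univAt_of_five_le hn hreg (five_le_of_prime hp.out h2 hp3) _
  rcases hF.odd_coeffs hn hreg hbad with ⟨i, hi, hr⟩ | ⟨i, j, hij, hi, hj, hr⟩
  · obtain ⟨h1, h2, h3, h4⟩ := hF.of_one_odd hA hglob hbad hi hr
    exact Or.inl ⟨i, h1, h2, h3, h4⟩
  · obtain ⟨h1, h2, ⟨⟨h5, h6⟩ | ⟨h5, h6⟩, h4⟩ | ⟨⟨h5, h6⟩, h4⟩⟩ :=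
      hF.of_two_odd hA hglob hij hi hj hr
    · exact Or.inr (Or.inl ⟨i, j, hij, h1, h2, h5, h6, hr, h4⟩)
    · exact Or.inr (Or.inl ⟨j, i, hij.symm, h2, h1, h6, h5, fun l h h' => hr l h' h, h4⟩)
    · exact Or.inr (Or.inr ⟨i, j, hij, h1, h2, h5, h6, hr, h4⟩)

/-- The target of `N` modulo `4` for an unshifted form. -/
lemma STyp.target_mod_four (hF : F.STyp k) (hr : ∀ i, F.r i = 1) (N : ℤ) :
    (k % 4 = 1 → (k * N + F.twoDisc k) % 4 = N % 4) ∧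
      (k % 4 = 3 → (k * N + F.twoDisc k) % 4 = ((∑ l, F.a l : ℕ) - N) % 4) := by
  constructor
  · intro h
    have h1 : (4 : ℤ) ∣ F.twoDisc k := Finset.dvd_sum fun l _ => by
      have := hF.two_mul_ee l
      rw [hr] at this
      obtain ⟨q, hq⟩ : ∃ q, F.ee k l = 2 * q := ⟨F.ee k l / 2, by omega⟩
      exact ⟨F.a l * q ^ 2, by rw [hq]; ring⟩
    have h2 : (4 : ℤ) ∣ (k - 1) * N := Dvd.dvd.mul_right (by omega) _
    have h3 : (k : ℤ) * N = (k - 1) * N + N := by ring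
    omega
  · intro h
    have h1 : (4 : ℤ) ∣ F.twoDisc k - (∑ l, F.a l : ℕ) := by
      unfold twoDisc
      push_cast
      rw [← Finset.sum_sub_distrib]
      refine Finset.dvd_sum fun l _ => ?_
      have := hF.two_mul_ee l
      rw [hr] at this
      obtain ⟨q, hq⟩ : ∃ q, F.ee k l = 2 * q + 1 := ⟨F.ee k l / 2, by omega⟩
      exact ⟨F.a l * (q ^ 2 + q), by rw [hq]; ring⟩
    have h2 : (4 : ℤ) ∣ (k + 1) * N := Dvd.dvd.mul_right (by omega) _
    have h3 : (k : ℤ) * N = (k + 1) * N - N := by ring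
    omega

/-- The terms of an unshifted form modulo `4`. -/
lemma STyp.tm_mod_four (hF : F.STyp k) {i : Fin n} (hr : F.r i = 1) (z : ℤ) :
    F.tm i z % 4 = 0 ∨ F.tm i z % 4 = F.a i % 4 := by
  have h1 := polyDbl_eq_two_mul (F.M i) (F.r i) z
  have hk := hF.odd
  have hP : polyVal (F.M i) (F.r i) z % 4 = 0 ∨ polyVal (F.M i) (F.r i) z % 4 = 1 := by
    rw [hF.M_eq, hr] at h1 ⊢
    unfold polyDbl at h1
    obtain ⟨q, hq⟩ : ∃ q : ℤ, (k : ℤ) = 2 * q + 1 := ⟨k / 2, by omega⟩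
    obtain ⟨w, hw⟩ : ∃ w : ℤ, z = 4 * w ∨ z = 4 * w + 1 ∨ z = 4 * w + 2 ∨ z = 4 * w + 3 :=
      ⟨z / 4, by omega⟩
    generalize polyVal (2 * k) 1 z = P at *
    push_cast at h1
    rw [hq] at h1
    have h2 : P = (2 * q + 1) * (z * (z - 1)) + z := by linarith
    rcases hw with rfl | rfl | rfl | rfl
    · left; rw [h2, show (2 * q + 1) * (4 * w * (4 * w - 1)) + 4 * w
        = 4 * ((2 * q + 1) * (w * (4 * w - 1)) + w) by ring]; omega
    · right; rw [h2, show (2 * q + 1) * ((4 * w + 1) * (4 * w + 1 - 1)) + (4 * w + 1)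
        = 4 * ((2 * q + 1) * ((4 * w + 1) * w) + w) + 1 by ring]; omega
    · left; rw [h2, show (2 * q + 1) * ((4 * w + 2) * (4 * w + 2 - 1)) + (4 * w + 2)
        = 4 * ((2 * q + 1) * (4 * w * w + 3 * w) + q + 1 + w) by ring]; omega
    · right; rw [h2, show (2 * q + 1) * ((4 * w + 3) * (4 * w + 3 - 1)) + (4 * w + 3)
        = 4 * ((2 * q + 1) * (4 * w * w + 5 * w) + 3 * q + w + 2) + 1 by ring]; omega
  unfold tm
  rcases hP with h | h
  · left; rw [Int.mul_emod, h]; norm_num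
  · right; rw [Int.mul_emod, h]; norm_num

/-- The terms of an unshifted form modulo `3`. -/
lemma Adm.tm_mod_three (hF : F.Adm D) (hD : ¬ 3 ∣ D) {i : Fin n} (hr : F.r i = 1) (z : ℤ) :
    F.tm i z % 3 = 0 ∨ F.tm i z % 3 = F.a i % 3 := by
  have h1 := polyDbl_eq_two_mul (F.M i) (F.r i) z
  have hM := hF.mod_three hD i
  have hP : polyVal (F.M i) (F.r i) z % 3 = 0 ∨ polyVal (F.M i) (F.r i) z % 3 = 1 := by
    rw [hr] at h1 ⊢
    unfold polyDbl at h1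
    obtain ⟨w, hw⟩ : ∃ w : ℤ, z = 3 * w ∨ z = 3 * w + 1 ∨ z = 3 * w + 2 := ⟨z / 3, by omega⟩
    generalize polyVal (F.M i) 1 z = P at *
    generalize F.M i = M at *
    rcases hw with rfl | rfl | rfl
    · left
      rw [show (M : ℤ) * (3 * w * (3 * w - 1)) + 2 * (1 : ℕ) * (3 * w)
        = 3 * (M * (w * (3 * w - 1)) + 2 * w) by push_cast; ring] at h1
      omega
    · right
      rw [show (M : ℤ) * ((3 * w + 1) * (3 * w + 1 - 1)) + 2 * (1 : ℕ) * (3 * w + 1)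
        = 3 * (M * ((3 * w + 1) * w) + 2 * w) + 2 by push_cast; ring] at h1
      omega
    · rw [show (M : ℤ) * ((3 * w + 2) * (3 * w + 2 - 1)) + 2 * (1 : ℕ) * (3 * w + 2)
        = 3 * (M * (3 * w * w + 3 * w) + 2 * w + 1) + 2 * M + 1 by push_cast; ring] at h1
      generalize (M : ℤ) * (3 * w * w + 3 * w) = Q at *
      omega
  unfold tm
  rcases hP with h | h
  · left; rw [Int.mul_emod, h]; norm_num
  · right; rw [Int.mul_emod, h]; norm_num

/-- Local representation at `3`. -/
lemma Adm.repAt_three (hF : F.Adm D) (hD : ¬ 3 ∣ D) (hT : F.RepMul 3 D) {i : Fin n}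
    (hi : ¬ 3 ∣ F.a i) (hrest : ∀ l, l ≠ i → 3 ∣ F.a l) (hr : F.r i = 1) {N : ℕ}
    (hN : N % 3 = 0 ∨ N % 3 = F.a i % 3) : F.RepAt 3 N := by
  classical
  have h32 : (3 : ℕ) ≠ 2 := by norm_num
  obtain ⟨z, hz⟩ : ∃ z : ℤ, ((3 : ℕ) : ℤ) ∣ (N : ℤ) - F.val (Pi.single i z) := by
    rcases hN with h | h
    · exact ⟨0, by rw [val_single, tm_zero]; push_cast; omega⟩
    · exact ⟨1, by rw [val_single, tm_of_unit hr]; push_cast; omega⟩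
  by_cases hv : ((3 : ℕ) : ℤ) ∣ 2 * F.M i * z - F.cc i
  · obtain ⟨c, hc⟩ := hF.dvd_disc_of_vertex Nat.prime_three h32 (x := Pi.single i z) (fun l hl => by
      have hli : l = i := by
        by_contra h
        exact hl (hrest l h)
      subst hli
      simpa using hv) hz
    refine hF.repAt_of_diagRep h32 hD ((hT c).of_eq ?_)
    have := congrArg (Int.cast : ℤ → ℤ_[3]) hc
    push_cast at this ⊢
    rw [this]
  · have := hF.repAt_of_congr h32 hD hi (x := Pi.single i z) (N := N) hz (by simpa using hv)
    simpa using this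

/-- Representation by a form with one coefficient prime to `d`. -/
lemma Adm.exists_tm_of_repInt (hF : F.Adm D) {d : ℕ} {i : Fin n} (hrest : ∀ l, l ≠ i → d ∣ F.a l)
    {N : ℕ} (h : F.RepInt N) : ∃ z, (N : ℤ) % d = F.tm i z % d ∧ (z ≠ 0 → F.a i ≤ N) := by
  classical
  obtain ⟨x, hx⟩ := h
  refine ⟨x i, ?_, fun hz => ?_⟩
  · rw [← hx, val_split_one F i]
    have : (d : ℤ) ∣ ∑ l ∈ Finset.univ.erase i, F.tm l (x l) :=
      Finset.dvd_sum fun l hl => dvd_tm (hrest l (Finset.ne_of_mem_erase hl)) _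
    obtain ⟨c, hc⟩ := this
    rw [hc]
    simp
  · have h1 := tm_le_val hF x i
    have hP : 1 ≤ polyVal (F.M i) (F.r i) (x i) := by
      by_cases h : x i = 1
      · rw [h, polyVal_one]; have := hF.lev_pos i; omega
      · have := polyVal_ge (hF.lev_pos i) (hF.lev_lt i) hz h
        have := hF.lev_lt i
        omega
    rw [hx] at h1
    have h2 : (F.a i : ℤ) ≤ F.tm i (x i) := by
      unfold tm
      have := hF.pos i
      nlinarith
    omega

/-- Unshifted forms universal except at `3`. -/
theorem Adm.three_type (hF : F.Adm D) (hD : ¬ 3 ∣ D) (hr : ∀ i, F.r i = 1)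
    (hglob : ∀ N : ℕ, F.RepAt 3 N → F.RepInt N)
    (h : (∃ i, ¬ 3 ∣ F.a i ∧ ∀ j, j ≠ i → 3 ∣ F.a j) ∧ F.RepMul 3 D) :
    ∃ i, (F.a i = 1 ∨ F.a i = 2) ∧ (∀ j, j ≠ i → 3 ∣ F.a j) ∧
      ∀ N, F.RepInt N ↔ N % 3 = F.a i ∨ N % 3 = 0 := by
  obtain ⟨⟨i, hi, hrest⟩, hT⟩ := h
  have hrep : ∀ N : ℕ, N % 3 = 0 ∨ N % 3 = F.a i % 3 → F.RepInt N := fun N hN =>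
    hglob N (hF.repAt_three hD hT hi hrest (hr i) hN)
  have hai : F.a i = 1 ∨ F.a i = 2 := by
    obtain ⟨z, hz, hz'⟩ := hF.exists_tm_of_repInt hrest (hrep (F.a i % 3) (by omega))
    have : z ≠ 0 := fun h => by
      rw [h, tm_zero] at hz
      push_cast at hz
      omega
    have := hz' this
    omega
  refine ⟨i, hai, hrest, fun N => ⟨fun hN => ?_, fun hN => hrep N (by omega)⟩⟩
  obtain ⟨z, hz, -⟩ := hF.exists_tm_of_repInt hrest hN
  have := hF.tm_mod_three hD (hr i) z
  push_cast at hz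
  omega

/-- Representation modulo `4` by a form with two odd coefficients. -/
lemma exists_tm_pair_of_repInt {d : ℕ} {i j : Fin n} (hij : i ≠ j)
    (hrest : ∀ l, l ≠ i → l ≠ j → d ∣ F.a l) {N : ℕ} (h : F.RepInt N) :
    ∃ z w, (N : ℤ) % d = (F.tm i z + F.tm j w) % d := by
  classical
  obtain ⟨x, hx⟩ := h
  refine ⟨x i, x j, ?_⟩
  rw [← hx, val_split_two F hij]
  have : (d : ℤ) ∣ ∑ l ∈ (Finset.univ.erase i).erase j, F.tm l (x l) :=
    Finset.dvd_sum fun l hl => dvd_tm (hrest l (Finset.ne_of_mem_erase (Finset.mem_of_mem_erase hl))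
      (Finset.ne_of_mem_erase hl)) _
  obtain ⟨c, hc⟩ := this
  rw [hc]
  simp

/-- The residues modulo `4` represented at `2` by an unshifted form with one odd coefficient. -/
lemma STyp.repAt_two_of_one (hF : F.STyp k) (hr : ∀ i, F.r i = 1) {i : Fin n}
    (hi : F.a i % 2 = 1) (h4 : ∀ l, l ≠ i → F.a l % 4 = 0)
    (hT : ∀ t : ℤ, t % 4 = 0 ∨ t % 4 = F.a i % 4 → TwoRep F.a Finset.univ t) {N : ℕ}
    (hN : N % 4 = 0 ∨ N % 4 = F.a i % 4) : F.RepAt 2 N := by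
  classical
  have h1 := hF.target_mod_four hr N
  have h2 : (∑ l, F.a l) % 4 = F.a i % 4 := by
    rw [← Finset.add_sum_erase _ _ (Finset.mem_univ i)]
    have : 4 ∣ ∑ l ∈ Finset.univ.erase i, F.a l := Finset.dvd_sum fun l hl =>
      Nat.dvd_of_mod_eq_zero (h4 l (Finset.ne_of_mem_erase hl))
    omega
  have hk := hF.odd
  have := hF.repAt_of_twoRep (N := N) (hT _ (by
    generalize (k : ℤ) * (N : ℤ) + F.twoDisc k = t at *
    generalize ∑ l, F.a l = A at *
    have : k % 4 = 1 ∨ k % 4 = 3 := by omega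
    rcases this with h | h
    · have := h1.1 h; omega
    · have := h1.2 h; omega))
  simpa using this

/-- The analogue of `STyp.repAt_two_of_one` for two odd coefficients; `e` is the residue that is not
represented. -/
lemma STyp.repAt_two_of_two (hF : F.STyp k) (hr : ∀ i, F.r i = 1) {i j : Fin n} (hij : i ≠ j)
    (hi : F.a i % 2 = 1) (hj : F.a j % 2 = 1)
    (h4 : ∀ l, l ≠ i → l ≠ j → F.a l % 4 = 0) {e : ℤ}
    (he : (2 * e) % 4 = (F.a i + F.a j : ℤ) % 4)
    (hT : ∀ t : ℤ, t % 4 ≠ e % 4 → TwoRep F.a Finset.univ t) {N : ℕ}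
    (hN : (N : ℤ) % 4 ≠ e % 4) : F.RepAt 2 N := by
  classical
  have h1 := hF.target_mod_four hr N
  have h2 : (∑ l, F.a l) % 4 = (F.a i + F.a j) % 4 := by
    rw [← Finset.add_sum_erase _ _ (Finset.mem_univ i),
      ← Finset.add_sum_erase _ _ (Finset.mem_erase.2 ⟨hij.symm, Finset.mem_univ j⟩)]
    have : 4 ∣ ∑ l ∈ (Finset.univ.erase i).erase j, F.a l := Finset.dvd_sum fun l hl =>
      Nat.dvd_of_mod_eq_zero (h4 l (Finset.ne_of_mem_erase (Finset.mem_of_mem_erase hl))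
        (Finset.ne_of_mem_erase hl))
    omega
  have hk := hF.odd
  have := hF.repAt_of_twoRep (N := N) (hT _ (by
    generalize (k : ℤ) * (N : ℤ) + F.twoDisc k = t at *
    generalize ∑ l, F.a l = A at *
    have : k % 4 = 1 ∨ k % 4 = 3 := by omega
    rcases this with h | h
    · have := h1.1 h; omega
    · have := h1.2 h; omega))
  simpa using this

/-- Unshifted forms universal except at `2`. -/
theorem STyp.two_type (hF : F.STyp k) (hr : ∀ i, F.r i = 1)
    (hglob : ∀ N : ℕ, F.RepAt 2 N → F.RepInt N) (h : F.TwoShape) :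
    (∃ i, (F.a i = 1 ∨ F.a i = 3) ∧ (∀ l, l ≠ i → 4 ∣ F.a l) ∧
      ∀ N, F.RepInt N ↔ N % 4 = F.a i ∨ N % 4 = 0) ∨
    (∃ i j, i ≠ j ∧ F.a i = 1 ∧ F.a j = 3 ∧ (∀ l, l ≠ i → l ≠ j → 4 ∣ F.a l) ∧
      ∀ N, F.RepInt N ↔ N % 4 ≠ 2) ∨
    (∃ i j, i ≠ j ∧ F.a i = 1 ∧ F.a j = 1 ∧ (∀ l, l ≠ i → l ≠ j → 4 ∣ F.a l) ∧
      ∀ N, F.RepInt N ↔ N % 4 ≠ 3) := by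
  rcases h with ⟨i, -, hi, h4, hT⟩ | ⟨i, j, hij, -, -, hi, hj, h4, hT⟩ |
    ⟨i, j, hij, -, -, hi, hj, h4, hT⟩
  · have h4' : ∀ l, l ≠ i → 4 ∣ F.a l := fun l hl => Nat.dvd_of_mod_eq_zero (h4 l hl)
    refine Or.inl ⟨i, hi, h4', fun N => ⟨fun hN => ?_, fun hN => hglob N
      (hF.repAt_two_of_one hr (by omega) h4 hT (by omega))⟩⟩
    obtain ⟨z, hz, -⟩ := hF.adm.exists_tm_of_repInt h4' hN
    have := hF.tm_mod_four (hr i) z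
    push_cast at hz
    omega
  · have h4' : ∀ l, l ≠ i → l ≠ j → 4 ∣ F.a l := fun l hl hl' => Nat.dvd_of_mod_eq_zero (h4 l hl hl')
    refine Or.inr (Or.inl ⟨i, j, hij, hi, hj, h4', fun N => ⟨fun hN => ?_, fun hN => hglob N
      (hF.repAt_two_of_two hr hij (by omega) (by omega) h4 (e := 2) (by rw [hi, hj]; norm_num)
        (by simpa using hT) (by omega))⟩⟩)
    obtain ⟨z, w, hz⟩ := exists_tm_pair_of_repInt hij h4' hN
    have h1 := hF.tm_mod_four (hr i) z
    have h2 := hF.tm_mod_four (hr j) w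
    push_cast at hz
    omega
  · have h4' : ∀ l, l ≠ i → l ≠ j → 4 ∣ F.a l := fun l hl hl' => Nat.dvd_of_mod_eq_zero (h4 l hl hl')
    refine Or.inr (Or.inr ⟨i, j, hij, hi, hj, h4', fun N => ⟨fun hN => ?_, fun hN => hglob N
      (hF.repAt_two_of_two hr hij (by omega) (by omega) h4 (e := 3) (by rw [hi, hj]; norm_num)
        (by simpa using hT) (by omega))⟩⟩)
    obtain ⟨z, w, hz⟩ := exists_tm_pair_of_repInt hij h4' hN
    have h1 := hF.tm_mod_four (hr i) z
    have h2 := hF.tm_mod_four (hr j) w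
    push_cast at hz
    omega

end PForm

/-! ### Forms that fail to be universal at both `2` and `3` -/

namespace PForm

variable {n k : ℕ} {F : PForm n}

lemma STyp.wa_eq (hF : F.STyp k) (i : Fin n) : F.wa (2 * k) i = F.a i := by
  have := hF.big
  unfold wa
  rw [hF.M_eq, Nat.div_self (by omega), mul_one]

/-- In a representation of a multiple of `3`, the variable with coefficient prime to `3` is a
multiple of `3`. -/
lemma exists_three_mul {a : Fin n → ℕ} {i : Fin n} (hi : ¬ 3 ∣ a i) (hrest : ∀ l, l ≠ i → 3 ∣ a l)
    {t : ℤ_[3]} {y : Fin n → ℤ_[3]} (hy : ∑ l, (a l : ℤ_[3]) * y l ^ 2 = 3 * t) :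
    ∃ w, y i = 3 * w ∧
      (a i : ℤ_[3]) * (3 * w) ^ 2 + ∑ l ∈ Finset.univ.erase i, (a l : ℤ_[3]) * y l ^ 2 = 3 * t := by
  rw [← Finset.add_sum_erase _ _ (Finset.mem_univ i)] at hy
  have h1 : (3 : ℤ_[3]) ∣ ∑ l ∈ Finset.univ.erase i, (a l : ℤ_[3]) * y l ^ 2 :=
    Finset.dvd_sum fun l hl => Dvd.dvd.mul_right (by
      have := (padicInt_dvd_natCast (p := 3) _).2 (hrest l (Finset.ne_of_mem_erase hl))
      exact_mod_cast this) _
  have h2 : ((3 : ℕ) : ℤ_[3]) ∣ (a i : ℤ_[3]) * y i ^ 2 := by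
    push_cast
    exact (dvd_add_left h1).1 (hy ▸ dvd_mul_right _ _)
  rcases padicInt_dvd_mul.1 h2 with h | h
  · exact absurd ((padicInt_dvd_natCast _).1 h) hi
  · obtain ⟨w, hw⟩ := PadicInt.prime_p.dvd_of_dvd_pow h
    have hw' : y i = 3 * w := by rw [hw]; push_cast; ring
    exact ⟨w, hw', by rw [← hw']; exact hy⟩

/-- The descent at `3` of an unshifted form with a single coefficient prime to `3` multiplies this
coefficient by `3`, shifts its variable, and divides all other coefficients by `3`; it arrives at a
form universal at `3`. -/
lemma STyp.exists_descent_three (hF : F.STyp k) (hr : ∀ i, F.r i = 1) (h3 : ¬ 3 ∣ 2 * k)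
    (hbad : ¬ F.UnivAt 3) {i : Fin n} (hi : ¬ 3 ∣ F.a i) (hrest : ∀ l, l ≠ i → 3 ∣ F.a l)
    (hT : F.RepMul 3 (2 * k)) :
    ∃ (F' : PForm n) (_ : Descent 3 F F'), F'.STyp k ∧ F'.AlmostUnshifted ∧ F'.UnivAt 3 ∧
      F'.r i ≠ 1 ∧ F'.a i = 3 * F.a i ∧ ∀ l, l ≠ i → F.a l = 3 * F'.a l := by
  classical
  have h32 : (3 : ℕ) ≠ 2 := by norm_num
  have h30 : (3 : ℤ_[3]) ≠ 0 := by norm_num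
  obtain ⟨F', δ, hF', hM, hd, h1, h2⟩ := hF.adm.exists_descent Nat.prime_three h32 h3
    (hF.adm.vertex_of_bad h32 h3 hbad)
  have hT' : ∀ t : ℤ_[3], ∃ y : Fin n → ℤ_[3], ∑ l, (F.a l : ℤ_[3]) * y l ^ 2 = 3 * t := fun t => by
    obtain ⟨y, hy⟩ := hT t
    simp only [hF.wa_eq] at hy
    exact ⟨y, by exact_mod_cast hy⟩
  have hd3 : δ.d = 3 := by
    by_contra hne
    rw [hd] at hne
    split_ifs at hne with h9
    · obtain ⟨y, hy⟩ := hT' 1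
      obtain ⟨w, -, hw⟩ := exists_three_mul hi hrest hy
      have h : (9 : ℤ_[3]) ∣ ∑ l ∈ Finset.univ.erase i, (F.a l : ℤ_[3]) * y l ^ 2 :=
        Finset.dvd_sum fun l hl => Dvd.dvd.mul_right (by
          obtain ⟨c, hc⟩ := h9 l (hrest l (Finset.ne_of_mem_erase hl))
          exact ⟨c, by rw [hc]; push_cast; norm_num⟩) _
      obtain ⟨c, hc⟩ := h
      rw [hc] at hw
      have h5 : ((1 : ℕ) : ℤ_[3]) = (3 : ℕ) * (F.a i * w ^ 2 + c) := by
        apply mul_left_cancel₀ h30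
        push_cast
        linear_combination -hw
      have := (padicInt_dvd_natCast (p := 3) 1).1 ⟨_, h5⟩
      omega
    · exact hne rfl
  obtain ⟨h4, h5, h6⟩ := h2 i hi
  have hai : F'.a i = 3 * F.a i := by rw [hd3] at h4; omega
  have hrest' : ∀ l, l ≠ i → F.a l = 3 * F'.a l ∧ F'.r l = 1 := fun l hl => by
    obtain ⟨h7, h8⟩ := h1 l (hrest l hl)
    rw [hd3] at h7
    exact ⟨h7.symm, h8.trans (hr l)⟩
  have hS : F'.STyp k := ⟨hF', fun l => by rw [hM]; exact hF.M_eq l, hF.odd, hF.big⟩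
  -- The new level is `(2 k j ± 1) / 3` with `j > 0`, which is at least `9`.
  have hri : 9 ≤ F'.r i := by
    by_contra hlt
    have hpos := hF'.lev_pos i
    rw [hF.M_eq, hr] at h6
    have hk := hF.big
    obtain ⟨j, hj⟩ : ∃ j : ℤ, 2 * (k * j) = 3 * F'.r i - 1 ∨ 2 * (k * j) = 3 * F'.r i + 1 := by
      rcases h5 with h | h
      · refine ⟨δ.s i + 1, Or.inl ?_⟩
        rw [h] at h6; push_cast at h6; linarith
      · refine ⟨2 - δ.s i, Or.inr ?_⟩
        rw [h] at h6; push_cast at h6; linarith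
    rcases le_or_gt j 0 with h | h
    · have : (k : ℤ) * j ≤ 0 := mul_nonpos_of_nonneg_of_nonpos (by positivity) h
      omega
    · have : (k : ℤ) ≤ k * j := le_mul_of_one_le_right (by positivity) h
      omega
  refine ⟨F', δ, hS, ⟨fun l => ?_, fun l j hl hj => ?_⟩, ?_, by omega, hai,
    fun l hl => (hrest' l hl).1⟩
  · by_cases hl : l = i
    · subst hl
      right
      have := hF.adm.pos l
      rw [hai]
      nlinarith
    · exact Or.inl (hrest' l hl).2
  · have h7 : l = i := by_contra fun h => hl (hrest' l h).2
    have h8 : j = i := by_contra fun h => hj (hrest' j h).2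
    rw [h7, h8]
  · refine hF'.univAt_of_diagRep h32 h3 (s := Finset.univ) fun t => ?_
    simp only [hS.wa_eq]
    obtain ⟨y, hy⟩ := hT' t
    obtain ⟨w, -, hw⟩ := exists_three_mul hi hrest hy
    refine ⟨fun l => if l = i then w else y l, ?_⟩
    rw [← Finset.add_sum_erase _ _ (Finset.mem_univ i)]
    apply mul_left_cancel₀ h30
    rw [← hw, mul_add, Finset.mul_sum]
    congr 1
    · simp only [if_true, hai]; push_cast; ring
    · refine Finset.sum_congr rfl fun l hl => ?_
      have hl := Finset.ne_of_mem_erase hl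
      simp only [hl, if_false, (hrest' l hl).1]
      push_cast; ring

/-- Transfer of representations over `ℤ_2` along the descent at `3`. -/
lemma _root_.TwoRep.of_three_mul {a b : Fin n → ℕ} {i : Fin n} (hi : b i = 3 * a i)
    (hrest : ∀ l, l ≠ i → a l = 3 * b l) {t : ℤ} (h : TwoRep b Finset.univ (3 * t)) :
    TwoRep a Finset.univ t := by
  obtain ⟨c, hc⟩ := ((padicInt_isUnit_natCast (p := 2) 3).2 (by norm_num)).exists_right_inv
  have h1 : DiagRep (fun l => (a l : ℤ_[2])) Finset.univ (3 * ((3 * t : ℤ) : ℤ_[2])) :=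
    DiagRep.scale h fun l _ => by
      by_cases hl : l = i
      · subst hl
        exact ⟨3, by rw [hi]; push_cast; ring⟩
      · exact ⟨1, by rw [hrest l hl]; push_cast; ring⟩
  refine (h1.sq_mul c).of_eq ?_
  push_cast at hc ⊢
  linear_combination (3 * c + 1) * (t : ℤ_[2]) * hc

/-- Unshifted forms universal neither at `2` nor at `3`. The descent at `3` leads to a form with one
shifted variable, universal except at `2`, so that `STyp.twoShape` applies; since the shifted variable
has coefficient divisible by `4`, each shape determines the classes modulo `12` represented by the
original form, and the smallest such numbers give the coefficients or a contradiction. -/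
theorem STyp.two_three_type (hn : 4 ≤ n) (hF : F.STyp k) (hr : ∀ i, F.r i = 1)
    (hreg : F.Regular) (h3 : ¬ 3 ∣ 2 * k) (hbad2 : ¬ F.UnivAt 2) (hbad3 : ¬ F.UnivAt 3) :
    (∃ i j, j ≠ i ∧ F.a j = 3 ∧ (∀ l, l ≠ i → l ≠ j → 12 ∣ F.a l) ∧
      ((F.a i = 4 ∧ ∀ N, F.RepInt N ↔ N % 12 ∈ ({0, 3, 4, 7} : Set ℕ)) ∨
       (F.a i = 8 ∧ ∀ N, F.RepInt N ↔ N % 12 ∈ ({0, 3, 8, 11} : Set ℕ)))) ∨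
    (∃ i j j', j ≠ i ∧ j' ≠ i ∧ j ≠ j' ∧ F.a i = 4 ∧ F.a j = 3 ∧ F.a j' = 3 ∧
      (∀ l, l ≠ i → l ≠ j → l ≠ j' → 12 ∣ F.a l) ∧
      ∀ N, F.RepInt N ↔ N % 12 ∈ ({0, 3, 4, 6, 7, 10} : Set ℕ)) := by
  obtain ⟨⟨i, hi, hrest⟩, hT⟩ := hF.one_unit_three hn hreg h3 hbad3
  obtain ⟨F', δ, hF', hA, hu3, hri, hai, hal⟩ :=
    hF.exists_descent_three hr h3 hbad3 hi hrest hT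
  have hshape := hF'.twoShape hn hA (δ.regular Nat.prime_three hreg) hu3
    fun h => hbad2 ((δ.univAt_iff Nat.prime_three (by norm_num)).2 h)
  have hne : ∀ {j}, F'.r j = 1 → j ≠ i := fun h h' => hri (h' ▸ h)
  have hrep : ∀ N : ℕ, (N % 3 = 0 ∨ N % 3 = F.a i % 3) → F.RepAt 2 N → F.RepInt N := by
    intro N hN hN2
    refine hreg N fun p hp => ?_
    by_cases hp2 : p = 2
    · subst hp2; exact hN2
    by_cases hp3 : p = 3
    · subst hp3; exact hF.adm.repAt_three h3 hT hi hrest (hr i) hN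
    · exact hF.univAt_of_five_le hn hreg (five_le_of_prime hp.out hp2 hp3) _
  have hmod3 : ∀ N : ℕ, F.RepInt N → N % 3 = 0 ∨ N % 3 = F.a i % 3 := fun N hN => by
    obtain ⟨z, hz, -⟩ := hF.adm.exists_tm_of_repInt hrest hN
    have := hF.adm.tm_mod_three h3 (hr i) z
    push_cast at hz
    omega
  -- The coefficient prime to `3` is at most every represented number congruent to it.
  have hle : ∀ N : ℕ, N % 3 = F.a i % 3 → F.RepInt N → F.a i ≤ N := fun N hN h => by
    obtain ⟨z, hz, hz'⟩ := hF.adm.exists_tm_of_repInt hrest h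
    refine hz' fun h0 => ?_
    rw [h0, tm_zero] at hz
    push_cast at hz
    omega
  have hpos := hF.adm.pos i
  have h12 : ∀ l, l ≠ i → F'.a l % 4 = 0 → 12 ∣ F.a l := fun l hl h => by
    have := hal l hl
    omega
  have hi4 : F'.a i % 4 = 0 → F.a i % 4 = 0 := fun h => by omega
  rcases hshape with ⟨j, hj, hja, h4, hS⟩ | ⟨j, j', hjj, hj, hj', hja, hja', h4, hS⟩ |
    ⟨j, j', hjj, hj, hj', hja, hja', h4, hS⟩
  · have hji := hne hj
    have haj := hal j hji
    have hc4 := hi4 (h4 i hji.symm)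
    have h4' : ∀ l, l ≠ j → F.a l % 4 = 0 := fun l hl => by
      by_cases hli : l = i
      · rw [hli]; exact hc4
      · have := h4 l hl; have := hal l hli; omega
    have h2 : ∀ N : ℕ, (N % 4 = 0 ∨ N % 4 = F.a j % 4) → F.RepAt 2 N := fun N hN =>
      hF.repAt_two_of_one hr (by omega) h4' (fun t ht => .of_three_mul hai hal (hS _ (by omega))) hN
    have hmod4 : ∀ N : ℕ, F.RepInt N → N % 4 = 0 ∨ N % 4 = F.a j % 4 := fun N hN => by
      obtain ⟨z, hz, -⟩ := hF.adm.exists_tm_of_repInt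
        (fun l hl => Nat.dvd_of_mod_eq_zero (h4' l hl)) hN
      have := hF.tm_mod_four (hr j) z
      push_cast at hz
      omega
    have hc : F.a i = 4 ∨ F.a i = 8 := by
      have : F.a i % 3 = 1 ∨ F.a i % 3 = 2 := by omega
      rcases this with h | h
      · have := hle 4 (by omega) (hrep 4 (by omega) (h2 4 (by omega)))
        omega
      · have := hle 8 (by omega) (hrep 8 (by omega) (h2 8 (by omega)))
        omega
    have hj3 : F.a j = 3 := by
      rcases hja with h | h
      · omega
      · exfalso
        rcases hc with h' | h'
        · have := hle 1 (by omega) (hrep 1 (by omega) (h2 1 (by omega)))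
          omega
        · have := hle 5 (by omega) (hrep 5 (by omega) (h2 5 (by omega)))
          omega
    refine Or.inl ⟨i, j, hji, hj3, fun l hl hl' => h12 l hl (h4 l hl'), ?_⟩
    simp only [Set.mem_insert_iff, Set.mem_singleton_iff]
    rcases hc with h | h
    · refine Or.inl ⟨h, fun N => ⟨fun hN => ?_, fun hN => hrep N (by omega) (h2 N (by omega))⟩⟩
      have := hmod3 N hN
      have := hmod4 N hN
      omega
    · refine Or.inr ⟨h, fun N => ⟨fun hN => ?_, fun hN => hrep N (by omega) (h2 N (by omega))⟩⟩
      have := hmod3 N hN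
      have := hmod4 N hN
      omega
  · exfalso
    have hji := hne hj
    have hji' := hne hj'
    have haj := hal j hji
    have haj' := hal j' hji'
    have hc4 := hi4 (h4 i hji.symm hji'.symm)
    have h4' : ∀ l, l ≠ j → l ≠ j' → F.a l % 4 = 0 := fun l hl hl' => by
      by_cases hli : l = i
      · rw [hli]; exact hc4
      · have := h4 l hl hl'; have := hal l hli; omega
    have h2 : ∀ N : ℕ, N % 4 ≠ 2 → F.RepAt 2 N := fun N hN =>
      hF.repAt_two_of_two hr hjj (by omega) (by omega) h4' (e := 2)
        (by rw [haj, haj', hja, hja']; norm_num)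
        (fun t ht => .of_three_mul hai hal (hS _ (by omega))) (by omega)
    have : F.a i % 3 = 1 ∨ F.a i % 3 = 2 := by omega
    rcases this with h | h
    · have := hle 1 (by omega) (hrep 1 (by omega) (h2 1 (by omega)))
      omega
    · have := hle 5 (by omega) (hrep 5 (by omega) (h2 5 (by omega)))
      have := hle 8 (by omega) (hrep 8 (by omega) (h2 8 (by omega)))
      omega
  · have hji := hne hj
    have hji' := hne hj'
    have haj := hal j hji
    have haj' := hal j' hji'
    have hc4 := hi4 (h4 i hji.symm hji'.symm)
    have h4' : ∀ l, l ≠ j → l ≠ j' → F.a l % 4 = 0 := fun l hl hl' => by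
      by_cases hli : l = i
      · rw [hli]; exact hc4
      · have := h4 l hl hl'; have := hal l hli; omega
    have h2 : ∀ N : ℕ, N % 4 ≠ 1 → F.RepAt 2 N := fun N hN =>
      hF.repAt_two_of_two hr hjj (by omega) (by omega) h4' (e := 1)
        (by rw [haj, haj', hja, hja']; norm_num)
        (fun t ht => .of_three_mul hai hal (hS _ (by omega))) (by omega)
    have hmod4 : ∀ N : ℕ, F.RepInt N → N % 4 ≠ 1 := fun N hN => by
      obtain ⟨z, w, hz⟩ := exists_tm_pair_of_repInt hjj
        (fun l hl hl' => Nat.dvd_of_mod_eq_zero (h4' l hl hl')) hN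
      have h1 := hF.tm_mod_four (hr j) z
      have h2 := hF.tm_mod_four (hr j') w
      push_cast at hz
      omega
    have hc : F.a i = 4 := by
      have : F.a i % 3 = 1 ∨ F.a i % 3 = 2 := by omega
      rcases this with h | h
      · have := hle 4 (by omega) (hrep 4 (by omega) (h2 4 (by omega)))
        omega
      · have := hle 2 (by omega) (hrep 2 (by omega) (h2 2 (by omega)))
        omega
    refine Or.inr ⟨i, j, j', hji, hji', hjj, hc, by omega, by omega,
      fun l hl hl' hl'' => h12 l hl (h4 l hl' hl''), fun N => ?_⟩
    simp only [Set.mem_insert_iff, Set.mem_singleton_iff]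
    refine ⟨fun hN => ?_, fun hN => hrep N (by omega) (h2 N (by omega))⟩
    have := hmod3 N hN
    have := hmod4 N hN
    omega

end PForm

/-! ### Generalized polygonal forms -/

section Polygonal

variable {n m : ℕ} {a r : Fin n → ℕ}

/-- The polygonal form with normalised levels: a level `r` above `(m - 2) / 2` is replaced by
`m - 2 - r`, which amounts to `x ↦ -x`. -/
def toForm (m : ℕ) (a r : Fin n → ℕ) : PForm n :=
  ⟨a, fun _ => m - 2, fun i => if 2 * r i < m - 2 then r i else m - 2 - r i⟩

lemma two_mul_shiftedPolygonal {K : Type*} [Field K] [CharZero K] (hm : 2 ≤ m) (r : ℕ) (x : K) :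
    2 * shiftedPolygonal m r x = polyDbl (m - 2) r x := by
  have h : ((m - 2 : ℕ) : K) = m - 2 := by push_cast [Nat.cast_sub hm]; ring
  unfold shiftedPolygonal polyDbl
  rw [h]
  field_simp
  ring

lemma map_polyDbl {R S : Type*} [CommRing R] [CommRing S] (φ : R →+* S) (M r : ℕ) (x : R) :
    φ (polyDbl M r x) = polyDbl M r (φ x) := by
  simp [polyDbl, map_ofNat φ 2]

lemma polyDbl_neg {R : Type*} [CommRing R] {M r : ℕ} (h : r ≤ M) (x : R) :
    polyDbl M (M - r) (-x) = polyDbl M r x := by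
  unfold polyDbl
  push_cast [Nat.cast_sub h]
  ring

/-- Reflection of the variables whose levels are changed in `toForm`. -/
def reflect {R : Type*} [CommRing R] (m : ℕ) (r : Fin n → ℕ) (x : Fin n → R) (i : Fin n) : R :=
  if 2 * r i < m - 2 then x i else -x i

lemma reflect_reflect {R : Type*} [CommRing R] (m : ℕ) (r : Fin n → ℕ) (x : Fin n → R) :
    reflect m r (reflect m r x) = x := by
  funext i
  unfold reflect
  split_ifs <;> simp

lemma toForm_dbl_reflect {R : Type*} [CommRing R] (hr : ∀ i, r i ≤ m - 2) (x : Fin n → R) :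
    (toForm m a r).dbl (reflect m r x) = ∑ i, (a i : R) * polyDbl (m - 2) (r i) (x i) := by
  unfold PForm.dbl toForm reflect
  refine Finset.sum_congr rfl fun i _ => ?_
  dsimp only
  split_ifs
  · rfl
  · rw [polyDbl_neg (hr i)]

lemma sum_shiftedPolygonal_eq_iff {R K : Type*} [CommRing R] [Field K] [CharZero K] (φ : R →+* K)
    (hφ : Function.Injective φ) (hm : 2 ≤ m) (hr : ∀ i, r i ≤ m - 2) (x : Fin n → R) (N : ℕ) :
    ∑ i, (a i : K) * shiftedPolygonal m (r i) (φ (x i)) = N ↔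
      (toForm m a r).dbl (reflect m r x) = 2 * N := by
  rw [toForm_dbl_reflect hr, ← hφ.eq_iff, ← mul_right_inj' (two_ne_zero (α := K)), Finset.mul_sum]
  simp only [map_sum, map_mul, map_natCast, map_ofNat, map_polyDbl, ← two_mul_shiftedPolygonal hm]
  rw [Finset.sum_congr rfl fun i _ => mul_left_comm _ _ _]

lemma represents_iff (hm : 2 ≤ m) (hr : ∀ i, r i ≤ m - 2) (N : ℕ) :
    Represents m a r N ↔ (toForm m a r).RepInt N := by
  have key : ∀ x : Fin n → ℤ, (toForm m a r).val (reflect m r x) = N ↔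
      ∑ i, (a i : ℚ) * shiftedPolygonal m (r i) (x i : ℚ) = N := fun x => by
    rw [← mul_right_inj' (two_ne_zero (α := ℤ)), ← PForm.dbl_eq_two_mul]
    exact (sum_shiftedPolygonal_eq_iff (Int.castRingHom ℚ) Int.cast_injective hm hr x N).symm
  constructor
  · rintro ⟨x, hx⟩
    exact ⟨_, (key x).2 hx⟩
  · rintro ⟨y, hy⟩
    exact ⟨reflect m r y, (key _).1 (by rwa [reflect_reflect])⟩

lemma representsOver_iff (hm : 2 ≤ m) (hr : ∀ i, r i ≤ m - 2) (p : ℕ) [Fact p.Prime] (N : ℕ) :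
    RepresentsOver p m a r N ↔ (toForm m a r).RepAt p N := by
  have key : ∀ x : Fin n → ℤ_[p], _ := fun x =>
    sum_shiftedPolygonal_eq_iff (a := a) (PadicInt.Coe.ringHom (p := p)) Subtype.val_injective
      hm hr x N
  constructor
  · rintro ⟨x, hx⟩
    exact ⟨_, (key x).1 hx⟩
  · rintro ⟨y, hy⟩
    exact ⟨reflect m r y, (key _).2 (by rwa [reflect_reflect])⟩

lemma IsRegularForm.regular (h : IsRegularForm m a r) (hm : 2 ≤ m) (hr : ∀ i, r i ≤ m - 2) :
    (toForm m a r).Regular := fun N hN => (represents_iff hm hr N).1 <| h N fun p _ =>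
  (representsOver_iff hm hr p N).2 (hN p)

lemma isUniversalForm_of_univAt (h : IsRegularForm m a r) (hm : 2 ≤ m) (hr : ∀ i, r i ≤ m - 2)
    (hu : ∀ (p : ℕ) [Fact p.Prime], (toForm m a r).UnivAt p) : IsUniversalForm m a r := fun N =>
  (represents_iff hm hr N).2 (h.regular hm hr N fun p _ => hu p _)

lemma IsLevel.le {r : ℕ} (h : IsLevel m r) : r ≤ m - 2 := by
  have := h.1
  omega

lemma toForm_adm (hm : 14 ≤ m) (hr : ∀ i, IsLevel m (r i)) (ha : IsPrimitiveCoeff a) :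
    (toForm m a r).Adm (m - 2) where
  pos := ha.1
  lev_pos i := by
    have h0 : r i ≠ 0 := fun h => by
      have := (hr i).2
      rw [h, Nat.coprime_zero_left] at this
      omega
    have h1 : r i ≠ m - 2 := fun h => by
      have := (hr i).2
      rw [h, Nat.coprime_self] at this
      omega
    have := (hr i).le
    simp only [toForm]
    split_ifs <;> omega
  lev_lt i := by
    have h1 : 2 * r i ≠ m - 2 := fun h => by
      have := (hr i).2
      rw [← h] at this
      have := this.eq_one_of_dvd (dvd_mul_left _ _)
      omega
    have := (hr i).le
    simp only [toForm]
    split_ifs <;> omega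
  cop i := by
    simp only [toForm]
    split_ifs
    · exact (hr i).2
    · exact (Nat.coprime_self_sub_left (hr i).le).2 (hr i).2
  big i := by simp only [toForm]; omega
  modulus i := Or.inl rfl
  prim ℓ hℓ := by
    by_contra! h
    have : ℓ ∣ Finset.univ.gcd a := Finset.dvd_gcd fun i _ => h i
    rw [ha.2] at this
    exact hℓ.one_lt.ne' (Nat.dvd_one.1 this)

lemma isLevel_one (hm : 3 ≤ m) : IsLevel m 1 := ⟨by omega, Nat.coprime_one_left _⟩

lemma toForm_unitLevel_r (hm : 5 ≤ m) (i : Fin n) : (toForm m a (unitLevel n)).r i = 1 := by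
  show (if 2 * 1 < m - 2 then 1 else m - 2 - 1) = 1
  rw [if_pos (by omega)]

/-- If the coefficients outside a list of distinct indices are divisible by `d`, then the form has
the shape given by the listed coefficients. -/
lemma hasShape_of_dvd {d : ℕ} (hd : 0 < d) (ha : ∀ i, 0 < a i) {L : List (Fin n)} (hL : L.Nodup)
    (h : ∀ l, l ∉ L → d ∣ a l) : HasShape (L.map a) d a := by
  classical
  have hle : (L : Multiset (Fin n)) ≤ (Finset.univ : Finset (Fin n)).val :=
    (Multiset.le_iff_subset (Multiset.coe_nodup.2 hL)).2 fun i _ => Finset.mem_univ i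
  have hmem : ∀ l ∈ (Finset.univ : Finset (Fin n)).val - L, d ∣ a l := fun l hl =>
    h l fun h' => by
      have := (Multiset.mem_sub_of_nodup Finset.univ.nodup).1 hl
      exact this.2 (by simpa using h')
  refine ⟨((Finset.univ : Finset (Fin n)).val - L).map (fun l => a l / d), fun x hx => ?_, ?_⟩
  · obtain ⟨l, hl, rfl⟩ := Multiset.mem_map.1 hx
    exact Nat.div_pos (Nat.le_of_dvd (ha l) (hmem l hl)) hd
  · conv_lhs => rw [← add_tsub_cancel_of_le hle]
    rw [Multiset.map_add, Multiset.map_map, Multiset.map_coe]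
    congr 1
    exact Multiset.map_congr rfl fun l hl => (Nat.mul_div_cancel' (hmem l hl)).symm

end Polygonal

section Types

open PForm

variable {n m : ℕ} {a : Fin n → ℕ}

lemma isOfType_of_repInt {h : List ℕ} {d : ℕ} {S : Set ℕ} (hm : 5 ≤ m) (hs : HasShape h d a)
    (hS : ∀ N, (toForm m a (unitLevel n)).RepInt N ↔ N ∈ S) : IsOfType m a h d S :=
  ⟨hs, Set.ext fun N => (represents_iff (by omega) (fun _ => (isLevel_one (by omega)).le) N).trans
    (hS N)⟩

lemma isOfType_of_three_type (hm : 5 ≤ m) (ha : ∀ i, 0 < a i)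
    (h : ∃ i, (a i = 1 ∨ a i = 2) ∧ (∀ j, j ≠ i → 3 ∣ a j) ∧
      ∀ N, (toForm m a (unitLevel n)).RepInt N ↔ N % 3 = a i ∨ N % 3 = 0) :
    ∃ a₁ ∈ ({1, 2} : Set ℕ), IsOfType m a [a₁] 3 {N | N % 3 = a₁ ∨ N % 3 = 0} := by
  obtain ⟨i, hi, hr, hN⟩ := h
  exact ⟨a i, hi, isOfType_of_repInt hm (hasShape_of_dvd (L := [i]) (by norm_num) ha (by simp)
    (by simpa using hr)) hN⟩

lemma isOfType_of_two_type (hm : 5 ≤ m) (ha : ∀ i, 0 < a i)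
    (h : (∃ i, (a i = 1 ∨ a i = 3) ∧ (∀ l, l ≠ i → 4 ∣ a l) ∧
        ∀ N, (toForm m a (unitLevel n)).RepInt N ↔ N % 4 = a i ∨ N % 4 = 0) ∨
      (∃ i j, i ≠ j ∧ a i = 1 ∧ a j = 3 ∧ (∀ l, l ≠ i → l ≠ j → 4 ∣ a l) ∧
        ∀ N, (toForm m a (unitLevel n)).RepInt N ↔ N % 4 ≠ 2) ∨
      (∃ i j, i ≠ j ∧ a i = 1 ∧ a j = 1 ∧ (∀ l, l ≠ i → l ≠ j → 4 ∣ a l) ∧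
        ∀ N, (toForm m a (unitLevel n)).RepInt N ↔ N % 4 ≠ 3)) :
    (∃ a₁ ∈ ({1, 3} : Set ℕ), IsOfType m a [a₁] 4 {N | N % 4 = a₁ ∨ N % 4 = 0}) ∨
      IsOfType m a [1, 3] 4 {N | N % 4 ≠ 2} ∨ IsOfType m a [1, 1] 4 {N | N % 4 ≠ 3} := by
  have hpair : ∀ {i j : Fin n}, i ≠ j → (∀ l, l ≠ i → l ≠ j → 4 ∣ a l) →
      HasShape [a i, a j] 4 a := fun {i j} hij hr =>
    hasShape_of_dvd (L := [i, j]) (by norm_num) ha (by simpa using hij)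
      fun l hl => by
        simp only [List.mem_cons, List.not_mem_nil, or_false, not_or] at hl
        exact hr l hl.1 hl.2
  rcases h with ⟨i, hi, hr, hN⟩ | ⟨i, j, hij, hi, hj, hr, hN⟩ | ⟨i, j, hij, hi, hj, hr, hN⟩
  · exact Or.inl ⟨a i, hi, isOfType_of_repInt hm (hasShape_of_dvd (L := [i]) (by norm_num) ha
      (by simp) (by simpa using hr)) hN⟩
  · have := hpair hij hr
    rw [hi, hj] at this
    exact Or.inr (Or.inl (isOfType_of_repInt hm this hN))
  · have := hpair hij hr
    rw [hi, hj] at this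
    exact Or.inr (Or.inr (isOfType_of_repInt hm this hN))

lemma isOfType_of_two_three_type (hm : 5 ≤ m) (ha : ∀ i, 0 < a i)
    (h : (∃ i j, j ≠ i ∧ a j = 3 ∧ (∀ l, l ≠ i → l ≠ j → 12 ∣ a l) ∧
        ((a i = 4 ∧ ∀ N, (toForm m a (unitLevel n)).RepInt N ↔
            N % 12 ∈ ({0, 3, 4, 7} : Set ℕ)) ∨
         (a i = 8 ∧ ∀ N, (toForm m a (unitLevel n)).RepInt N ↔
            N % 12 ∈ ({0, 3, 8, 11} : Set ℕ)))) ∨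
      (∃ i j j', j ≠ i ∧ j' ≠ i ∧ j ≠ j' ∧ a i = 4 ∧ a j = 3 ∧ a j' = 3 ∧
        (∀ l, l ≠ i → l ≠ j → l ≠ j' → 12 ∣ a l) ∧
        ∀ N, (toForm m a (unitLevel n)).RepInt N ↔
          N % 12 ∈ ({0, 3, 4, 6, 7, 10} : Set ℕ))) :
    IsOfType m a [3, 4] 12 {N | N % 12 ∈ ({0, 3, 4, 7} : Set ℕ)} ∨
      IsOfType m a [3, 8] 12 {N | N % 12 ∈ ({0, 3, 8, 11} : Set ℕ)} ∨
      IsOfType m a [3, 3, 4] 12 {N | N % 12 ∈ ({0, 3, 4, 6, 7, 10} : Set ℕ)} := by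
  rcases h with ⟨i, j, hij, hj, hr, h⟩ | ⟨i, j, j', hij, hij', hjj, hi, hj, hj', hr, hN⟩
  · have hs : HasShape [a j, a i] 12 a := hasShape_of_dvd (L := [j, i]) (by norm_num) ha
      (by simpa using hij) fun l hl => by
        simp only [List.mem_cons, List.not_mem_nil, or_false, not_or] at hl
        exact hr l hl.2 hl.1
    rw [hj] at hs
    rcases h with ⟨hi, hN⟩ | ⟨hi, hN⟩
    · rw [hi] at hs
      exact Or.inl (isOfType_of_repInt hm hs hN)
    · rw [hi] at hs
      exact Or.inr (Or.inl (isOfType_of_repInt hm hs hN))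
  · have hs : HasShape [a j, a j', a i] 12 a := hasShape_of_dvd (L := [j, j', i]) (by norm_num) ha
      (by simp [hij, hij', hjj]) fun l hl => by
        simp only [List.mem_cons, List.not_mem_nil, or_false, not_or] at hl
        exact hr l hl.2.2 hl.1 hl.2.1
    rw [hi, hj, hj'] at hs
    exact Or.inr (Or.inr (isOfType_of_repInt hm hs hN))

/-- For `m` not divisible by `4`, regular forms are universal at every prime other than `3`. -/
lemma univAt_of_not_four_dvd {r : Fin n → ℕ} (hm : 14 ≤ m) (h4 : ¬ 4 ∣ m) (hn : 4 ≤ n)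
    (hF : (toForm m a r).Adm (m - 2)) (hreg : (toForm m a r).Regular) {p : ℕ} [hp : Fact p.Prime]
    (hp3 : p ≠ 3) : (toForm m a r).UnivAt p := by
  have h2 : (toForm m a r).UnivAt 2 := by
    obtain ⟨i, hi⟩ := hF.prim 2 Nat.prime_two
    exact univAt_two_of_odd hi (hF.cop i) (by simp only [toForm]; omega)
  by_cases hp2 : p = 2
  · subst hp2; exact h2
  · exact hF.univAt_of_five_le hn hreg h2 (five_le_of_prime hp.out hp2 hp3)

lemma toForm_sTyp {k : ℕ} {r : Fin n → ℕ} (hk : m - 2 = 2 * k) (hk1 : k % 2 = 1) (hk13 : 13 ≤ k)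
    (hF : (toForm m a r).Adm (m - 2)) : (toForm m a r).STyp k :=
  ⟨hk ▸ hF, fun _ => hk, hk1, hk13⟩

/-- A form universal at every prime other than `q` represents what it represents over `ℤ_q`. -/
lemma PForm.Regular.repInt {F : PForm n} (hreg : F.Regular) (q : ℕ) [Fact q.Prime]
    (hu : ∀ (p : ℕ) [Fact p.Prime], p ≠ q → F.UnivAt p) (N : ℕ) (hN : F.RepAt q N) :
    F.RepInt N := hreg N fun p _ => by
  by_cases h : p = q
  · subst h; exact hN
  · exact hu p h _

end Types

theorem theorem1p1 :
    (∀ (m n : ℕ) (a r : Fin n → ℕ), 14 ≤ m → ¬ 4 ∣ m → 3 ∣ m - 2 → 4 ≤ n →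
      (∀ i, IsLevel m (r i)) → IsPrimitiveCoeff a → IsRegularForm m a r →
      IsUniversalForm m a r) ∧
    (∀ (m n : ℕ) (a : Fin n → ℕ), 14 ≤ m → ¬ 4 ∣ m → ¬ 3 ∣ m - 2 → 4 ≤ n →
      IsPrimitiveCoeff a → IsRegularForm m a (unitLevel n) →
      IsUniversalForm m a (unitLevel n) ∨
      (∃ a₁ ∈ ({1, 2} : Set ℕ),
        IsOfType m a [a₁] 3 {N | N % 3 = a₁ ∨ N % 3 = 0})) ∧
    (∀ (m n : ℕ) (a : Fin n → ℕ), 28 ≤ m → 4 ∣ m → m % 3 = 2 → 4 ≤ n →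
      IsPrimitiveCoeff a → IsRegularForm m a (unitLevel n) →
      IsUniversalForm m a (unitLevel n) ∨
      (∃ a₁ ∈ ({1, 3} : Set ℕ),
        IsOfType m a [a₁] 4 {N | N % 4 = a₁ ∨ N % 4 = 0}) ∨
      IsOfType m a [1, 3] 4 {N | N % 4 ≠ 2} ∨
      IsOfType m a [1, 1] 4 {N | N % 4 ≠ 3}) ∧
    (∀ (m n : ℕ) (a : Fin n → ℕ), 28 ≤ m → 4 ∣ m → m % 3 ≠ 2 → 4 ≤ n →
      IsPrimitiveCoeff a → IsRegularForm m a (unitLevel n) →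
      IsUniversalForm m a (unitLevel n) ∨
      (∃ a₁ ∈ ({1, 2} : Set ℕ),
        IsOfType m a [a₁] 3 {N | N % 3 = a₁ ∨ N % 3 = 0}) ∨
      (∃ a₁ ∈ ({1, 3} : Set ℕ),
        IsOfType m a [a₁] 4 {N | N % 4 = a₁ ∨ N % 4 = 0}) ∨
      IsOfType m a [1, 3] 4 {N | N % 4 ≠ 2} ∨
      IsOfType m a [1, 1] 4 {N | N % 4 ≠ 3} ∨
      IsOfType m a [3, 4] 12 {N | N % 12 ∈ ({0, 3, 4, 7} : Set ℕ)} ∨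
      IsOfType m a [3, 8] 12 {N | N % 12 ∈ ({0, 3, 8, 11} : Set ℕ)} ∨
      IsOfType m a [3, 3, 4] 12 {N | N % 12 ∈ ({0, 3, 4, 6, 7, 10} : Set ℕ)}) := by
  refine ⟨fun m n a r hm h4 h3 hn hr ha hreg => ?_, fun m n a hm h4 h3 hn ha hreg => ?_,
    fun m n a hm h4 h3 hn ha hreg => ?_, fun m n a hm h4 h3 hn ha hreg => ?_⟩
  · have hF := toForm_adm hm hr ha
    have hle := fun i => (hr i).le
    refine isUniversalForm_of_univAt hreg (by omega) hle fun p _ => ?_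
    by_cases hp : p = 3
    · subst hp
      exact hF.univAt_of_dvd (by norm_num) h3
    · exact univAt_of_not_four_dvd hm h4 hn hF (hreg.regular (by omega) hle) hp
  all_goals
    have hlev : ∀ i, IsLevel m (unitLevel n i) := fun i => isLevel_one (by omega)
    have hle := fun i => (hlev i).le
    have hF := toForm_adm (by omega) hlev ha
    have hG := hreg.regular (by omega) hle
    have hr : ∀ i, (toForm m a (unitLevel n)).r i = 1 := toForm_unitLevel_r (by omega)
  · have hu : ∀ (p : ℕ) [Fact p.Prime], p ≠ 3 → (toForm m a (unitLevel n)).UnivAt p :=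
      fun p _ hp => univAt_of_not_four_dvd hm h4 hn hF hG hp
    by_cases hu3 : (toForm m a (unitLevel n)).UnivAt 3
    · refine Or.inl (isUniversalForm_of_univAt hreg (by omega) hle fun p _ => ?_)
      by_cases hp : p = 3
      · subst hp; exact hu3
      · exact hu p hp
    · have h := hF.one_unit_three h3 hG hu hu3 fun ⟨i, _, _, _, _, _, h6⟩ => by
        rw [hr] at h6
        omega
      exact Or.inr (isOfType_of_three_type (by omega) ha.1
        (hF.three_type h3 hr (hG.repInt 3 hu) h))
  all_goals
    obtain ⟨k, hk⟩ : ∃ k, m - 2 = 2 * k := ⟨(m - 2) / 2, by omega⟩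
    have hS := toForm_sTyp hk (by omega) (by omega) hF
    have h5 : ∀ (p : ℕ) [Fact p.Prime], p ≠ 2 → p ≠ 3 → (toForm m a (unitLevel n)).UnivAt p :=
      fun p hp hp2 hp3 => hS.univAt_of_five_le hn hG (PForm.five_le_of_prime hp.out hp2 hp3)
    have huniv : (toForm m a (unitLevel n)).UnivAt 2 → (toForm m a (unitLevel n)).UnivAt 3 →
        IsUniversalForm m a (unitLevel n) := fun h2 h3 =>
      isUniversalForm_of_univAt hreg (by omega) hle fun p _ => by
        by_cases hp2 : p = 2
        · subst hp2; exact h2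
        by_cases hp3 : p = 3
        · subst hp3; exact h3
        · exact h5 p hp2 hp3
    have htwo : ¬ (toForm m a (unitLevel n)).UnivAt 2 → (toForm m a (unitLevel n)).UnivAt 3 →
        (∃ a₁ ∈ ({1, 3} : Set ℕ), IsOfType m a [a₁] 4 {N | N % 4 = a₁ ∨ N % 4 = 0}) ∨
          IsOfType m a [1, 3] 4 {N | N % 4 ≠ 2} ∨ IsOfType m a [1, 1] 4 {N | N % 4 ≠ 3} :=
      fun h2 h3 => isOfType_of_two_type (by omega) ha.1 (hS.two_type hr
        (hG.repInt 2 fun p _ hp2 => by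
          by_cases hp3 : p = 3
          · subst hp3; exact h3
          · exact h5 p hp2 hp3)
        (hS.twoShape hn (PForm.almostUnshifted_of_unit hr) hG h3 h2))
  · have hu3 : (toForm m a (unitLevel n)).UnivAt 3 :=
      hF.univAt_of_dvd (by norm_num) (by omega)
    by_cases hu2 : (toForm m a (unitLevel n)).UnivAt 2
    · exact Or.inl (huniv hu2 hu3)
    · exact Or.inr (htwo hu2 hu3)
  · have hk3 : ¬ 3 ∣ 2 * k := by omega
    by_cases hu3 : (toForm m a (unitLevel n)).UnivAt 3
    · by_cases hu2 : (toForm m a (unitLevel n)).UnivAt 2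
      · exact Or.inl (huniv hu2 hu3)
      · rcases htwo hu2 hu3 with h | h | h
        · exact Or.inr (Or.inr (Or.inl h))
        · exact Or.inr (Or.inr (Or.inr (Or.inl h)))
        · exact Or.inr (Or.inr (Or.inr (Or.inr (Or.inl h))))
    · by_cases hu2 : (toForm m a (unitLevel n)).UnivAt 2
      · refine Or.inr (Or.inl (isOfType_of_three_type (by omega) ha.1
          (hS.adm.three_type hk3 hr (hG.repInt 3 fun p _ hp3 => ?_)
            (hS.one_unit_three hn hG hk3 hu3))))
        by_cases hp2 : p = 2
        · subst hp2; exact hu2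
        · exact h5 p hp2 hp3
      · exact Or.inr (Or.inr (Or.inr (Or.inr (Or.inr (isOfType_of_two_three_type (by omega) ha.1
          (hS.two_three_type hn hr hG hk3 hu2 hu3))))))
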